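/- **Setting.** Let $d\ge 1$ and let $(\rho_i)_{i\ge -1}$ be a dyadic partition of unity of $\mathbb R^d$: smooth, compactly supported, radial functions $\rho_i:\mathbb R^d\to[0,1]$ with $\operatorname{supp}\rho_{-1}\subset\{|x|<4/3\}$, $\operatorname{supp}\rho_0\subset\{3/4<|x|<8/3\}$, $\rho_i=\rho_0(2^{-i}\cdot)$ for $i\ge0$, and $\sum_{i\ge-1}\rho_i=1$. Put $\Delta_iu=\mathcal F^{-1}(\rho_i\mathcal Fu)$ for real tempered distributions $u$, $\|u\|_{\mathcal C^\alpha}=\sup_{i\ge-1}2^{\alpha i}\|\Delta_iu\|_{L^\infty}$, $\mathcal C^\alpha=\{u\in\mathcal S':\|u\|_{\mathcal C^\alpha}<\infty\}$ ($\alpha\in\mathbb R$), and $\mathsf P_fu=\sum_{-1\le i\le j-2}\Delta_if\,\Delta_ju$ (paraproduct). A *concrete regularity structure* $\mathscr T=((T^+,\Delta^+),(T,\Delta))$ consists of real graded vector spaces $T^+=\bigoplus_{\alpha\in A^+}T^+_\alpha$, $T=\bigoplus_{\beta\in A}T_\beta$ with finite-dimensional homogeneous pieces, where $A^+\subset[0,\infty)$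 contains $0$ and is stable under addition, $A$ has a minimum $\beta_0$, and neither set has an accumulation point in $\mathbb R$; $T^+$ is a Hopf algebra with unit $\mathbf 1$ and coproduct $\Delta^+$, $T_0^+=\langle\mathbf 1\rangle$, $T^+_\alpha T^+_\beta\subset T^+_{\alpha+\beta}$, $\Delta^+\mathbf 1=\mathbf 1\otimes\mathbf 1$, $\Delta^+\tau\in\tau\otimes\mathbf 1+\mathbf 1\otimes\tau+\sum_{0<\beta<\alpha}T^+_\beta\otimes T^+_{\alpha-\beta}$ for $\tau\in T^+_\alpha$, $\alpha>0$; and $\Delta:T\to T\otimes T^+$ is linear with $\Delta\tau\in\tau\otimes\mathbf 1+\sum_{\beta<\alpha}T_\beta\otimes T^+_{\alpha-\beta}$ for $\tau\in T_\alpha$ and $(\Delta\otimes\mathrm{Id})\Delta=(\mathrm{Id}\otimes\Delta^+)\Delta$. Fix homogeneous bases $\mathcal B^+\ni\mathbf 1$ and $\mathcal B$ of $T^+$ and $T$, write $|\tau|$ for the homogeneity of $\tau$, define $\tau/\sigma\in T^+$ by $\Delta\tau=\sum_{\sigma\in\mathcal B}\sigma\otimes(\tau/\sigma)$ ($\tau\in\mathcal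 B$) and $\tau/^+\sigma$ by $\Delta^+\tau=\sum_{\sigma\in\mathcal B^+}\sigma\otimes(\tau/^+\sigma)$ ($\tau\in\mathcal B^+$), and write $\sigma<\tau$ (resp. $\sigma<^+\tau$) if $\sigma\ne\tau$ and $\tau/\sigma\ne0$ (resp. $\tau/^+\sigma\neq0$). Fix $r>|\beta_0\wedge0|$; let $\varphi$ range over smooth functions supported in the unit ball with $\|\varphi\|_{\mathcal C^r}\le1$, and put $\varphi_x^\lambda=\lambda^{-d}\varphi(\lambda^{-1}(\cdot-x))$, $0<\lambda\le1$. A *model* $\mathsf M=(\mathsf g,\mathsf\Pi)$ consists of characters $\mathsf g_x$ of $T^+$ ($x\in\mathbb R^d$) and a linear map $\mathsf\Pi:T\to\mathcal C^{\beta_0}$ such that, with $\mathsf g_x^{-1}=\mathsf g_x\circ\text{antipode}$, $\mathsf g_{yx}=(\mathsf g_y\otimes\mathsf g_x^{-1})\Delta^+$ and $\mathsf\Pi^{\mathsf g}_x=(\mathsf\Pi\otimes\mathsf g_x^{-1})\Delta$, $$\sup_{\tau\in\mathcal B^+,x}|\mathsf g_x(\tau)|+\sup_{\tau\in\mathcal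 B^+,x,y}\frac{|\mathsf g_{yx}(\tau)|}{|y-x|^{|\tau|}}<\infty,\qquad \|\mathsf\Pi\|^{\mathsf g}:=\sup_{\sigma\in\mathcal B}\|\mathsf\Pi\sigma\|_{\mathcal C^{\beta_0}}+\sup_{\sigma\in\mathcal B,\varphi,\lambda,x}\frac{|\langle\mathsf\Pi_x^{\mathsf g}\sigma,\varphi_x^\lambda\rangle|}{\lambda^{|\sigma|}}<\infty .$$ The distance of two models is the sum of the same suprema for the differences $\mathsf g_x-\mathsf g'_x$, $\mathsf g_{yx}-\mathsf g'_{yx}$, $\mathsf\Pi-\mathsf\Pi'$, $\mathsf\Pi_x^{\mathsf g}-\mathsf\Pi'^{\,\mathsf g'}_x$. For $\gamma\in\mathbb R$, $\mathcal D^\gamma(\mathscr T,\mathsf g)$ is the space of $\boldsymbol f=\sum_{|\sigma|<\gamma}f^\sigma\sigma:\mathbb R^d\to\bigoplus_{\beta<\gamma}T_\beta$ with $\max_{|\sigma|<\gamma}\sup_x|f^\sigma(x)|+\|\boldsymbol f\|_{\mathcal D^\gamma}<\infty$, where $$\|\boldsymbol f\|_{\mathcal D^\gamma}=\max_{|\sigma|<\gamma}\sup_{x,y}\frac{\big|\big(\boldsymbol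 f(y)-(\mathrm{Id}\otimes\mathsf g_{yx})\Delta\boldsymbol f(x)\big)^\sigma\big|}{|y-x|^{\gamma-|\sigma|}}.$$ **Theorem.** (1) For every model $\mathsf M=(\mathsf g,\mathsf\Pi)$ there are unique linear maps $[\![\cdot]\!]^{\mathsf g}:T^+\to\mathcal C^0$ (depending on $\mathsf g$ only) and $[\![\cdot]\!]^{\mathsf M}:T\to\mathcal C^{\beta_0}$ such that, all paraproducts being convergent in $\mathcal S'$, $$\mathsf g(\tau)=\sum_{\mathbf 1<^+\nu<^+\tau}\mathsf P_{\mathsf g(\tau/^+\nu)}[\![\nu]\!]^{\mathsf g}+[\![\tau]\!]^{\mathsf g}\ (\tau\in\mathcal B^+),\qquad \mathsf\Pi\sigma=\sum_{\mu<\sigma}\mathsf P_{\mathsf g(\sigma/\mu)}[\![\mu]\!]^{\mathsf M}+[\![\sigma]\!]^{\mathsf M}\ (\sigma\in\mathcal B).$$ For all homogeneous $\tau\in T^+$, $\sigma\in T$ one has $[\![\tau]\!]^{\mathsf g}\in\mathcal C^{|\tau|}$, $[\![\sigma]\!]^{\mathsf M}\in\mathcal C^{|\sigma|}$, and the maps $\mathsf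 M\mapsto[\![\tau]\!]^{\mathsf g}\in\mathcal C^{|\tau|}$, $\mathsf M\mapsto[\![\sigma]\!]^{\mathsf M}\in\mathcal C^{|\sigma|}$ are continuous. (2) Let $\mathsf M$ be a model and $\gamma\in\mathbb R$. To every $\boldsymbol f\in\mathcal D^\gamma(\mathscr T,\mathsf g)$ one can associate $[\![\boldsymbol f]\!]^{\mathsf M}\in\mathcal C^\gamma$ and $[\![f^\tau]\!]^{\mathsf g}\in\mathcal C^{\gamma-|\tau|}$ ($\tau\in\mathcal B$) such that, all paraproducts being convergent in $\mathcal S'$, $$f^\tau=\sum_{\tau<\mu,\,|\mu|<\gamma}\mathsf P_{f^\mu}[\![\mu/\tau]\!]^{\mathsf g}+[\![f^\tau]\!]^{\mathsf g}\qquad(\tau\in\mathcal B),$$ and, if $\gamma\neq0$, $$\mathsf R\boldsymbol f:=\sum_{|\tau|<\gamma}\mathsf P_{f^\tau}[\![\tau]\!]^{\mathsf M}+[\![\boldsymbol f]\!]^{\mathsf M}$$ is a reconstruction of $\boldsymbol f$: there is a constant $C$ with $$|\langle\mathsf R\boldsymbol f-\mathsf\Pi_x^{\mathsf g}\boldsymbol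 f(x),\varphi_x^\lambda\rangle|\le C\,\|\mathsf\Pi\|^{\mathsf g}\,\|\boldsymbol f\|_{\mathcal D^\gamma}\,\lambda^\gamma$$ for all $\boldsymbol f\in\mathcal D^\gamma(\mathscr T,\mathsf g)$, $\varphi$, $x\in\mathbb R^d$ and $0<\lambda\le1$. Moreover $\boldsymbol f\mapsto\big([\![\boldsymbol f]\!]^{\mathsf M},([\![f^\tau]\!]^{\mathsf g})_{\tau\in\mathcal B}\big)$ is continuous from $\mathcal D^\gamma(\mathscr T,\mathsf g)$ to $\mathcal C^\gamma\times\prod_{\tau\in\mathcal B}\mathcal C^{\gamma-|\tau|}$. -/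

import Mathlib

open scoped ENNReal NNReal ContDiff SchwartzMap FourierTransform TensorProduct

noncomputable section

namespace PCRS

/-! ## Littlewood-Paley theory on `ℝ^d` -/

/-- The Euclidean space `ℝ^d`. -/
abbrev E (d : ℕ) : Type := EuclideanSpace ℝ (Fin d)

/-- Real-valued tempered distributions on `ℝ^d`. -/
abbrev TDist (d : ℕ) : Type := 𝓢(E d, ℝ) →L[ℝ] ℝ

/-- A dyadic partition of unity `(ρ_i)_{i ≥ -1}` of `ℝ^d`. Indices are shifted by one:
`ρ n` stands for `ρ_{n-1}`. -/
structure DyadicPartition (d : ℕ) where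
  ρ : ℕ → E d → ℝ
  smooth : ∀ n, ContDiff ℝ ∞ (ρ n)
  mem_Icc : ∀ n x, ρ n x ∈ Set.Icc (0 : ℝ) 1
  radial : ∀ n x y, ‖x‖ = ‖y‖ → ρ n x = ρ n y
  compact : ∀ n, HasCompactSupport (ρ n)
  supp_zero : tsupport (ρ 0) ⊆ {x | ‖x‖ < 4 / 3}
  supp_one : tsupport (ρ 1) ⊆ {x | 3 / 4 < ‖x‖ ∧ ‖x‖ < 8 / 3}
  scaling : ∀ n x, ρ (n + 1) x = ρ 1 (((2 : ℝ) ^ n)⁻¹ • x)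
  sum_eq_one : ∀ x, HasSum (fun n => ρ n x) 1

section LittlewoodPaley

variable {d : ℕ}

/-- `ρ_{n-1}` as a complex-valued Schwartz function. -/
def DyadicPartition.symbol (LP : DyadicPartition d) (n : ℕ) : 𝓢(E d, ℂ) :=
  HasCompactSupport.toSchwartzMap (f := fun x => (LP.ρ n x : ℂ))
    ((LP.compact n).comp_left (g := fun t : ℝ => (t : ℂ)) Complex.ofReal_zero)
    (Complex.ofRealCLM.contDiff.comp (LP.smooth n))

/-- The kernel `Q_{n-1} = 𝓕⁻¹ ρ_{n-1}` of the Littlewood-Paley block. It is real-valued because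
`ρ_{n-1}` is real and even; taking the real part only changes the codomain. -/
def DyadicPartition.kernel (LP : DyadicPartition d) (n : ℕ) : 𝓢(E d, ℝ) :=
  SchwartzMap.postcompCLM (𝕜 := ℝ) Complex.reCLM (𝓕⁻ (LP.symbol n))

/-- The Schwartz function `y ↦ ψ (x - y)`. -/
def reflectAt (ψ : 𝓢(E d, ℝ)) (x : E d) : 𝓢(E d, ℝ) :=
  SchwartzMap.compSubConstCLM ℝ x
    (SchwartzMap.compCLMOfContinuousLinearEquiv ℝ (ContinuousLinearEquiv.neg ℝ) ψ)

theorem reflectAt_apply (ψ : 𝓢(E d, ℝ)) (x y : E d) : reflectAt ψ x y = ψ (x - y) := by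
  simp [reflectAt]

/-- The rescaled test function `φ_x^λ : y ↦ λ^{-d} φ (λ⁻¹ (y - x))`. -/
def rescale (φ : 𝓢(E d, ℝ)) (l : ℝ) (hl : 0 < l) (x : E d) : 𝓢(E d, ℝ) :=
  (l ^ d)⁻¹ • SchwartzMap.compSubConstCLM ℝ x
    (SchwartzMap.compCLMOfContinuousLinearEquiv ℝ
      (ContinuousLinearEquiv.smulLeft (R₁ := ℝ) (Units.mk0 l hl.ne')⁻¹) φ)

theorem rescale_apply (φ : 𝓢(E d, ℝ)) (l : ℝ) (hl : 0 < l) (x y : E d) :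
    rescale φ l hl x y = (l ^ d)⁻¹ * φ (l⁻¹ • (y - x)) := by
  simp [rescale, ContinuousLinearEquiv.smulLeft, Units.smul_def]

/-- The Littlewood-Paley block `Δ_{n-1} u = 𝓕⁻¹ (ρ_{n-1} 𝓕 u) = Q_{n-1} * u` of a tempered
distribution, as a (smooth) function. -/
def block (LP : DyadicPartition d) (n : ℕ) (u : TDist d) (x : E d) : ℝ :=
  u (reflectAt (LP.kernel n) x)

/-- The Littlewood-Paley block `Δ_{n-1} f = Q_{n-1} * f` of a bounded function. -/
def blockFun (LP : DyadicPartition d) (n : ℕ) (f : E d → ℝ) (x : E d) : ℝ :=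
  ∫ y, LP.kernel n (x - y) * f y

/-- The Hölder-Besov norm `‖u‖_{𝒞^α} = sup_{i ≥ -1} 2^{α i} ‖Δ_i u‖_{L^∞}`. -/
def holderNorm (LP : DyadicPartition d) (α : ℝ) (u : TDist d) : ℝ≥0∞ :=
  ⨆ n : ℕ, ENNReal.ofReal ((2 : ℝ) ^ (α * ((n : ℝ) - 1))) * ⨆ x : E d, ‖block LP n u x‖ₑ

/-- The norm `‖f‖_{𝒞^α}` of a function. -/
def holderNormFun (LP : DyadicPartition d) (α : ℝ) (f : E d → ℝ) : ℝ≥0∞ :=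
  ⨆ n : ℕ, ENNReal.ofReal ((2 : ℝ) ^ (α * ((n : ℝ) - 1))) * ⨆ x : E d, ‖blockFun LP n f x‖ₑ

/-- The space `𝒞^α(ℝ^d) = B^α_{∞∞}(ℝ^d)`. -/
def MemHolder (LP : DyadicPartition d) (α : ℝ) (u : TDist d) : Prop :=
  holderNorm LP α u < ⊤

/-- The distribution `u` is (given by integration against) the function `f`. -/
def Represents (u : TDist d) (f : E d → ℝ) : Prop :=
  ∀ φ : 𝓢(E d, ℝ), MeasureTheory.Integrable (fun x => φ x * f x) ∧ u φ = ∫ x, φ x * f x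

/-- The distribution `v` is the paraproduct `P_f u = ∑_{-1 ≤ i ≤ j - 2} Δ_i f Δ_j u`: the series in
`j` converges to `v` in the sense of tempered distributions. (With shifted indices `n = j + 1`,
`m = i + 1`, the condition `i ≤ j - 2` is `m < n - 1`.) -/
def HasParaprod (LP : DyadicPartition d) (f : E d → ℝ) (u v : TDist d) : Prop :=
  ∀ φ : 𝓢(E d, ℝ), HasSum
    (fun n : ℕ => ∫ x, φ x * ((∑ m ∈ Finset.range (n - 1), blockFun LP m f x) * block LP n u x))
    (v φ)

/-- The paraproduct of `f` and `u` is well defined. -/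
def ParaprodConverges (LP : DyadicPartition d) (f : E d → ℝ) (u : TDist d) : Prop :=
  ∃ v, HasParaprod LP f u v

open Classical in
/-- The paraproduct `P_f u` (zero by convention if the defining series does not converge). -/
def paraprod (LP : DyadicPartition d) (f : E d → ℝ) (u : TDist d) : TDist d :=
  if h : ParaprodConverges LP f u then h.choose else 0

/-- Test functions: supported in the unit ball, with `𝒞^r` norm at most one. -/
def IsTest (LP : DyadicPartition d) (r : ℝ) (φ : 𝓢(E d, ℝ)) : Prop :=
  Function.support φ ⊆ Metric.closedBall 0 1 ∧ holderNormFun LP r φ ≤ 1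

end LittlewoodPaley

/-! ## Concrete regularity structures -/

section Algebra

/-- For a basis `b` whose elements have degrees `deg`, the homogeneous subspace of degree `α`. -/
def homogeneous {ι V : Type*} [AddCommGroup V] [Module ℝ V] (b : Module.Basis ι ℝ V) (deg : ι → ℝ)
    (α : ℝ) : Submodule ℝ V :=
  Submodule.span ℝ (b '' {i | deg i = α})

/-- The subspace `U ⊗ W` of `V₁ ⊗ V₂`. -/
def tensorSub {V₁ V₂ : Type*} [AddCommGroup V₁] [Module ℝ V₁] [AddCommGroup V₂] [Module ℝ V₂]
    (U : Submodule ℝ V₁) (W : Submodule ℝ V₂) : Submodule ℝ (V₁ ⊗[ℝ] V₂) :=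
  Submodule.map₂ (TensorProduct.mk ℝ V₁ V₂) U W

/-- The map `F ⊗ k : V₁ ⊗ V₂ → V ⊗ ℝ = V`. -/
def tensorEval {V₁ V₂ V : Type*} [AddCommGroup V₁] [Module ℝ V₁] [AddCommGroup V₂] [Module ℝ V₂]
    [AddCommGroup V] [Module ℝ V] (F : V₁ →ₗ[ℝ] V) (k : V₂ →ₗ[ℝ] ℝ) : V₁ ⊗[ℝ] V₂ →ₗ[ℝ] V :=
  (TensorProduct.rid ℝ V).toLinearMap ∘ₗ TensorProduct.map F k

/-- A concrete regularity structure `((T⁺, Δ⁺), (T, Δ))`. The gradings `T⁺ = ⨁_{α ∈ A⁺} T⁺_α` and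
`T = ⨁_{β ∈ A} T_β` are given through the fixed homogeneous bases `ℬ⁺` and `ℬ`, indexed by `ιp` and
`ι`, and the homogeneities of their elements. The Hopf algebra structure of `T⁺` is that of the
instance argument. -/
structure ConcreteRegularityStructure (Tp T ιp ι : Type*) [Ring Tp] [HopfAlgebra ℝ Tp]
    [AddCommGroup T] [Module ℝ T] where
  /-- the index set `A⁺` -/
  Ap : Set ℝ
  /-- the index set `A` -/
  A : Set ℝ
  /-- `β₀ = min A` -/
  β₀ : ℝ
  Ap_nonneg : ∀ α ∈ Ap, 0 ≤ α
  zero_mem_Ap : (0 : ℝ) ∈ Ap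
  Ap_add : ∀ α ∈ Ap, ∀ β ∈ Ap, α + β ∈ Ap
  Ap_discrete : ∀ x : ℝ, ¬ AccPt x (Filter.principal Ap)
  A_isLeast : IsLeast A β₀
  A_discrete : ∀ x : ℝ, ¬ AccPt x (Filter.principal A)
  /-- the basis `ℬ⁺` -/
  bp : Module.Basis ιp ℝ Tp
  degp : ιp → ℝ
  degp_mem : ∀ i, degp i ∈ Ap
  finite_p : ∀ α, {i | degp i = α}.Finite
  /-- the basis `ℬ` -/
  b : Module.Basis ι ℝ T
  deg : ι → ℝ
  deg_mem : ∀ i, deg i ∈ A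
  finite : ∀ α, {i | deg i = α}.Finite
  /-- the index of the unit, `ℬ⁺_0 = {1}` -/
  one : ιp
  bp_one : bp one = 1
  degp_eq_zero_iff : ∀ i, degp i = 0 ↔ i = one
  mul_mem : ∀ α β : ℝ, ∀ x ∈ homogeneous bp degp α, ∀ y ∈ homogeneous bp degp β,
    x * y ∈ homogeneous bp degp (α + β)
  comul_mem : ∀ α : ℝ, 0 < α → ∀ x ∈ homogeneous bp degp α,
    (Coalgebra.comul x : Tp ⊗[ℝ] Tp) - x ⊗ₜ[ℝ] 1 - 1 ⊗ₜ[ℝ] x ∈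
      ⨆ β ∈ Set.Ioo 0 α, tensorSub (homogeneous bp degp β) (homogeneous bp degp (α - β))
  /-- the splitting map `Δ : T → T ⊗ T⁺` -/
  Δ : T →ₗ[ℝ] T ⊗[ℝ] Tp
  Δ_mem : ∀ α : ℝ, ∀ x ∈ homogeneous b deg α,
    Δ x - x ⊗ₜ[ℝ] (1 : Tp) ∈
      ⨆ β ∈ Set.Iio α, tensorSub (homogeneous b deg β) (homogeneous bp degp (α - β))
  comodule : (TensorProduct.assoc ℝ T Tp Tp).toLinearMap ∘ₗ Δ.rTensor Tp ∘ₗ Δ =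
    (Coalgebra.comul (R := ℝ) (A := Tp)).lTensor T ∘ₗ Δ

variable {Tp T ιp ι : Type*} [Ring Tp] [HopfAlgebra ℝ Tp] [AddCommGroup T] [Module ℝ T]

namespace ConcreteRegularityStructure

/-- `T⁺_α` -/
def Tphom (S : ConcreteRegularityStructure Tp T ιp ι) (α : ℝ) : Submodule ℝ Tp :=
  homogeneous S.bp S.degp α

/-- `T_α` -/
def Thom (S : ConcreteRegularityStructure Tp T ιp ι) (α : ℝ) : Submodule ℝ T :=
  homogeneous S.b S.deg α

/-- `T_{<γ}` -/
def Tlt (S : ConcreteRegularityStructure Tp T ιp ι) (γ : ℝ) : Submodule ℝ T :=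
  ⨆ β ∈ Set.Iio γ, S.Thom β

/-- `τ / σ ∈ T⁺`, for `σ, τ ∈ ℬ`: `Δ τ = ∑_σ σ ⊗ (τ / σ)`. -/
def quot (S : ConcreteRegularityStructure Tp T ιp ι) (τ σ : ι) : Tp :=
  TensorProduct.lid ℝ Tp ((S.b.coord σ).rTensor Tp (S.Δ (S.b τ)))

/-- `τ /⁺ σ ∈ T⁺`, for `σ, τ ∈ ℬ⁺`: `Δ⁺ τ = ∑_σ σ ⊗ (τ /⁺ σ)`. -/
def quotp (S : ConcreteRegularityStructure Tp T ιp ι) (τ σ : ιp) : Tp :=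
  TensorProduct.lid ℝ Tp ((S.bp.coord σ).rTensor Tp (Coalgebra.comul (S.bp τ)))

/-- `σ < τ` in `ℬ`: `σ ≠ τ` appears on the left-hand side of the tensor products in `Δ τ`. -/
def Lt (S : ConcreteRegularityStructure Tp T ιp ι) (σ τ : ι) : Prop :=
  S.quot τ σ ≠ 0 ∧ σ ≠ τ

/-- `σ <⁺ τ` in `ℬ⁺`. -/
def Ltp (S : ConcreteRegularityStructure Tp T ιp ι) (σ τ : ιp) : Prop :=
  S.quotp τ σ ≠ 0 ∧ σ ≠ τ

end ConcreteRegularityStructure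

theorem finite_coord_ne_zero {κ V W : Type*} [AddCommGroup V] [Module ℝ V] [AddCommGroup W]
    [Module ℝ W] (b : Module.Basis κ ℝ V) (t : V ⊗[ℝ] W) :
    {i | TensorProduct.lid ℝ W ((b.coord i).rTensor W t) ≠ 0}.Finite := by
  induction t using TensorProduct.induction_on with
  | zero => simp
  | tmul v w =>
    refine (b.repr v).support.finite_toSet.subset fun i hi => ?_
    simp only [LinearMap.rTensor_tmul, TensorProduct.lid_tmul, Set.mem_ofPred_eq] at hi
    simp only [Finset.mem_coe, Finsupp.mem_support_iff]
    intro h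
    apply hi
    simp [Module.Basis.coord_apply, h]
  | add s t hs ht =>
    refine (hs.union ht).subset fun i hi => ?_
    by_contra hcon
    simp only [Set.mem_union, Set.mem_ofPred_eq, not_or, not_not] at hcon
    apply hi
    rw [map_add, map_add, hcon.1, hcon.2, add_zero]

namespace ConcreteRegularityStructure

theorem finite_lt (S : ConcreteRegularityStructure Tp T ιp ι) (σ : ι) : {μ | S.Lt μ σ}.Finite :=
  (finite_coord_ne_zero S.b (S.Δ (S.b σ))).subset fun _ h => h.1

theorem finite_ltp (S : ConcreteRegularityStructure Tp T ιp ι) (τ : ιp) :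
    {ν | S.Ltp S.one ν ∧ S.Ltp ν τ}.Finite :=
  (finite_coord_ne_zero S.bp (Coalgebra.comul (S.bp τ))).subset fun _ h => h.2.1

theorem finite_deg_lt (S : ConcreteRegularityStructure Tp T ιp ι) (γ : ℝ) :
    {i | S.deg i < γ}.Finite := by
  have hA : (S.A ∩ Set.Icc S.β₀ γ).Finite := by
    by_contra h
    obtain ⟨x, -, hx⟩ := Set.Infinite.exists_accPt_of_subset_isCompact h
      (isCompact_Icc (a := S.β₀) (b := γ)) Set.inter_subset_right
    exact S.A_discrete x (hx.mono (Filter.principal_mono.2 Set.inter_subset_left))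
  refine (hA.biUnion fun a _ => S.finite a).subset fun i hi => ?_
  exact Set.mem_biUnion ⟨S.deg_mem i, S.A_isLeast.2 (S.deg_mem i), le_of_lt hi⟩ rfl

/-- The finite set of `μ ∈ ℬ` with `μ < σ`. -/
def below (S : ConcreteRegularityStructure Tp T ιp ι) (σ : ι) : Finset ι :=
  (S.finite_lt σ).toFinset

/-- The finite set of `ν ∈ ℬ⁺` with `1 <⁺ ν <⁺ τ`. -/
def betweenp (S : ConcreteRegularityStructure Tp T ιp ι) (τ : ιp) : Finset ιp :=
  (S.finite_ltp τ).toFinset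

/-- The finite set of `τ ∈ ℬ` with `|τ| < γ`. -/
def indexLt (S : ConcreteRegularityStructure Tp T ιp ι) (γ : ℝ) : Finset ι :=
  (S.finite_deg_lt γ).toFinset

/-- The finite set of `μ ∈ ℬ` with `τ < μ` and `|μ| < γ`. -/
def aboveLt (S : ConcreteRegularityStructure Tp T ιp ι) (γ : ℝ) (τ : ι) : Finset ι :=
  ((S.finite_deg_lt γ).subset (t := {μ | S.Lt τ μ ∧ S.deg μ < γ}) fun _ h => h.2).toFinset

end ConcreteRegularityStructure

/-- The inverse `g⁻¹ = g ∘ 𝒜` of a character for the convolution product. -/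
def charInv (g : Tp →ₐ[ℝ] ℝ) : Tp →ₗ[ℝ] ℝ :=
  g.toLinearMap ∘ₗ HopfAlgebra.antipode ℝ

/-- `g₁ * g₂⁻¹ = (g₁ ⊗ g₂⁻¹) Δ⁺`; for a map `x ↦ g_x`, `g_{yx}` is `convDiv (g y) (g x)`. -/
def convDiv (g₁ g₂ : Tp →ₐ[ℝ] ℝ) : Tp →ₗ[ℝ] ℝ :=
  tensorEval g₁.toLinearMap (charInv g₂) ∘ₗ Coalgebra.comul

/-- `ĝ = (Id ⊗ g) Δ : T → T`. -/
def ConcreteRegularityStructure.hat (S : ConcreteRegularityStructure Tp T ιp ι)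
    (g : Tp →ₗ[ℝ] ℝ) : T →ₗ[ℝ] T :=
  tensorEval LinearMap.id g ∘ₗ S.Δ

end Algebra

/-! ## Models -/

section Models

variable {d : ℕ} {Tp T ιp ι : Type*} [Ring Tp] [HopfAlgebra ℝ Tp] [AddCommGroup T] [Module ℝ T]

/-- `Π_x^g = (Π ⊗ g_x⁻¹) Δ : T → 𝓢'`. -/
def recenter (S : ConcreteRegularityStructure Tp T ιp ι) (g : E d → (Tp →ₐ[ℝ] ℝ))
    (P : T →ₗ[ℝ] TDist d) (x : E d) : T →ₗ[ℝ] TDist d :=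
  tensorEval P (charInv (g x)) ∘ₗ S.Δ

/-- For one- and two-parameter families `k`, `K` of linear forms on `T⁺`:
`sup_{τ,x} |k_x(τ)| + sup_{τ,x,y} |K_{yx}(τ)| / |y - x|^{|τ|}`, where `τ` runs over `ℬ⁺`. -/
def gSize (S : ConcreteRegularityStructure Tp T ιp ι) (k : E d → (Tp →ₗ[ℝ] ℝ))
    (K : E d → E d → (Tp →ₗ[ℝ] ℝ)) : ℝ≥0∞ :=
  (⨆ (τ : ιp) (x : E d), ‖k x (S.bp τ)‖ₑ) +
    ⨆ (τ : ιp) (x : E d) (y : E d), ‖K y x (S.bp τ)‖ₑ / ‖y - x‖ₑ ^ (S.degp τ)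

/-- For linear maps `P, P_x : T → 𝓢'`:
`sup_σ ‖P σ‖_{𝒞^{β₀}} + sup_{σ,φ,λ,x} |⟨P_x σ, φ_x^λ⟩| / λ^{|σ|}`, where `σ` runs over `ℬ`, `φ` over
test functions, `0 < λ ≤ 1` and `x ∈ ℝ^d`. -/
def piSize (S : ConcreteRegularityStructure Tp T ιp ι) (LP : DyadicPartition d) (r : ℝ)
    (P : T →ₗ[ℝ] TDist d) (Px : E d → (T →ₗ[ℝ] TDist d)) : ℝ≥0∞ :=
  (⨆ σ : ι, holderNorm LP S.β₀ (P (S.b σ))) +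
    ⨆ (σ : ι) (φ : 𝓢(E d, ℝ)) (_ : IsTest LP r φ) (l : ℝ) (hl : 0 < l) (_ : l ≤ 1) (x : E d),
      ‖Px x (S.b σ) (rescale φ l hl x)‖ₑ / ENNReal.ofReal (l ^ (S.deg σ))

/-- A model `M = (g, Π)` over the concrete regularity structure `S`. -/
structure RSModel (S : ConcreteRegularityStructure Tp T ιp ι) (LP : DyadicPartition d)
    (r : ℝ) where
  g : E d → (Tp →ₐ[ℝ] ℝ)
  Pi : T →ₗ[ℝ] TDist d
  g_bound : gSize S (fun x => (g x).toLinearMap) (fun y x => convDiv (g y) (g x)) < ⊤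
  Pi_bound : piSize S LP r Pi (recenter S g Pi) < ⊤

namespace RSModel

variable {S : ConcreteRegularityStructure Tp T ιp ι} {LP : DyadicPartition d} {r : ℝ}

/-- The norm `‖Π‖^g`. -/
def piNorm (M : RSModel S LP r) : ℝ≥0∞ :=
  piSize S LP r M.Pi (recenter S M.g M.Pi)

/-- The distance between two models:
`sup |g_x(τ) - g'_x(τ)| + sup |g_{yx}(τ) - g'_{yx}(τ)| / |y - x|^{|τ|}`
`+ sup ‖Π σ - Π' σ‖_{𝒞^{β₀}} + sup |⟨Π_x^g σ - Π'_x^{g'} σ, φ_x^λ⟩| / λ^{|σ|}`. -/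
def dist (M M' : RSModel S LP r) : ℝ≥0∞ :=
  gSize S (fun x => (M.g x).toLinearMap - (M'.g x).toLinearMap)
      (fun y x => convDiv (M.g y) (M.g x) - convDiv (M'.g y) (M'.g x)) +
    piSize S LP r (M.Pi - M'.Pi) (fun x => recenter S M.g M.Pi x - recenter S M'.g M'.Pi x)

end RSModel

end Models

/-! ## Modelled distributions -/

section Modelled

variable {d : ℕ} {Tp T ιp ι : Type*} [Ring Tp] [HopfAlgebra ℝ Tp] [AddCommGroup T] [Module ℝ T]

/-- `sup_{|σ| < γ} sup_x |f^σ(x)|`; the norm on `T_β` is the maximum of the coefficients. -/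
def dSup (S : ConcreteRegularityStructure Tp T ιp ι) (γ : ℝ) (f : E d → T) : ℝ≥0∞ :=
  ⨆ (σ : ι) (_ : S.deg σ < γ) (x : E d), ‖S.b.coord σ (f x)‖ₑ

/-- `‖f‖_{𝒟^γ} = sup_{|σ| < γ} sup_{x,y} |(f(y) - ĝ_{yx} f(x))^σ| / |y - x|^{γ - |σ|}`. -/
def dIncr (S : ConcreteRegularityStructure Tp T ιp ι) (g : E d → (Tp →ₐ[ℝ] ℝ)) (γ : ℝ)
    (f : E d → T) : ℝ≥0∞ :=
  ⨆ (σ : ι) (_ : S.deg σ < γ) (x : E d) (y : E d),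
    ‖S.b.coord σ (f y - S.hat (convDiv (g y) (g x)) (f x))‖ₑ / ‖y - x‖ₑ ^ (γ - S.deg σ)

/-- The full norm of `𝒟^γ`. -/
def dNorm (S : ConcreteRegularityStructure Tp T ιp ι) (g : E d → (Tp →ₐ[ℝ] ℝ)) (γ : ℝ)
    (f : E d → T) : ℝ≥0∞ :=
  dSup S γ f + dIncr S g γ f

/-- The space `𝒟^γ(𝒯, g)` of modelled distributions. -/
def ModelledDist (S : ConcreteRegularityStructure Tp T ιp ι) (g : E d → (Tp →ₐ[ℝ] ℝ)) (γ : ℝ) :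
    Type _ :=
  {f : E d → T // (∀ x, f x ∈ S.Tlt γ) ∧ dNorm S g γ f < ⊤}

/-- The coefficient `f^τ`. -/
def ModelledDist.coeff {S : ConcreteRegularityStructure Tp T ιp ι} {g : E d → (Tp →ₐ[ℝ] ℝ)}
    {γ : ℝ} (f : ModelledDist S g γ) (τ : ι) : E d → ℝ :=
  fun x => S.b.coord τ (f.1 x)

end Modelled

/-! ## Brackets -/

section Brackets

variable {d : ℕ} {Tp T ιp ι : Type*} [Ring Tp] [HopfAlgebra ℝ Tp] [AddCommGroup T] [Module ℝ T]

/-- The linear map `bg = ⟦·⟧^g` satisfies, for all `τ ∈ ℬ⁺`,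
`g(τ) = ∑_{1 <⁺ ν <⁺ τ} P_{g(τ /⁺ ν)} ⟦ν⟧^g + ⟦τ⟧^g`, where all paraproducts converge. -/
def IsBracketg (S : ConcreteRegularityStructure Tp T ιp ι) (LP : DyadicPartition d)
    (g : E d → (Tp →ₐ[ℝ] ℝ)) (bg : Tp →ₗ[ℝ] TDist d) : Prop :=
  ∀ τ : ιp,
    (∀ ν ∈ S.betweenp τ, ParaprodConverges LP (fun x => g x (S.quotp τ ν)) (bg (S.bp ν))) ∧
    Represents
      (∑ ν ∈ S.betweenp τ, paraprod LP (fun x => g x (S.quotp τ ν)) (bg (S.bp ν)) + bg (S.bp τ))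
      (fun x => g x (S.bp τ))

/-- The linear map `bM = ⟦·⟧^M` satisfies, for all `σ ∈ ℬ`,
`Π σ = ∑_{μ < σ} P_{g(σ / μ)} ⟦μ⟧^M + ⟦σ⟧^M`, where all paraproducts converge. -/
def IsBracketM (S : ConcreteRegularityStructure Tp T ιp ι) (LP : DyadicPartition d)
    (g : E d → (Tp →ₐ[ℝ] ℝ)) (P : T →ₗ[ℝ] TDist d) (bM : T →ₗ[ℝ] TDist d) : Prop :=
  ∀ σ : ι,
    (∀ μ ∈ S.below σ, ParaprodConverges LP (fun x => g x (S.quot σ μ)) (bM (S.b μ))) ∧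
    P (S.b σ) =
      ∑ μ ∈ S.below σ, paraprod LP (fun x => g x (S.quot σ μ)) (bM (S.b μ)) + bM (S.b σ)

/-- The map `R : 𝒟^γ → 𝓢'` is a reconstruction: `|⟨R f - Π_x^g f(x), φ_x^λ⟩| ≲ ‖Π‖^g ‖f‖_{𝒟^γ} λ^γ`,
uniformly in `f`, in the test function `φ`, in `x ∈ ℝ^d` and in `0 < λ ≤ 1`. -/
def IsReconstruction {S : ConcreteRegularityStructure Tp T ιp ι} {LP : DyadicPartition d} {r : ℝ}
    (M : RSModel S LP r) (γ : ℝ) (R : ModelledDist S M.g γ → TDist d) : Prop :=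
  ∃ C : ℝ≥0, ∀ (f : ModelledDist S M.g γ) (φ : 𝓢(E d, ℝ)), IsTest LP r φ →
    ∀ (l : ℝ) (hl : 0 < l), l ≤ 1 → ∀ x : E d,
      ‖(R f - recenter S M.g M.Pi x (f.1 x)) (rescale φ l hl x)‖ₑ ≤
        C * M.piNorm * dIncr S M.g γ f.1 * ENNReal.ofReal (l ^ γ)

end Brackets

end PCRS

end

open PCRS

noncomputable section

namespace PCRS

open MeasureTheory Filter Topology

/-! ### Schwartz seminorms; tempered distributions as functionals on a Banach space of jets -/

section

variable {d : ℕ}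

/-! ## Schwartz functions, translations and tempered distributions -/

/-! Existence and uniqueness of the brackets cost nothing: the defining relations are triangular in
the homogeneity and are solved by well-founded recursion. The content is regularity, and everything
rests on one paraproduct estimate, `exists_block_paraprod_le`. If `|F z| ≤ A |z - x| ^ s` for some
point `x` and some `s ≥ 0`, and if `u` is in `𝒞^α`, then the block of `P_F u` at scale `q = 2^{-j}`
is, at the point `y`, of order `q ^ α (q + |y - x|) ^ s`. A coefficient that vanishes to order `s`
at `x` thus gains `s` orders of smallness at `x` itself.

Brackets. Since `P_1 u` is `u` minus its two lowest blocks, the relation for `Π σ` reads `Π σ = ∑_μ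
P_{g(σ/μ)} ⟦μ⟧` up to low frequencies, the diagonal term now being part of the sum. Multiply by the
coefficients `g_x⁻¹(σ/μ)`, which are constants for the paraproduct once `x` is fixed. By
coassociativity the left side becomes `Π_x σ` and the coefficients become `y ↦ g_{yx}(σ/ν)`, equal
to `1` on the diagonal and of order `|y - x|^{|σ| - |ν|}` below it. Evaluated at `x`, a high block
of `⟦σ⟧` is therefore a block of `Π_x σ` minus blocks of paraproducts with `⟦ν⟧`, `|ν| < |σ|`; by
induction all of them are of order `2^{-j|σ|}`. As `T⁺` coacts on itself, the same argument with
`g(τ)` in place of `Π τ` covers `⟦·⟧^g`. The induction is run on the difference of two systems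
(`TriangularSystem.exists_blockBd_sub`): comparison with the zero system gives regularity,
comparison of two models gives continuity.

The bounds of a model concern compactly supported test functions, while Littlewood-Paley kernels
have tails; `exists_apply_rescale_le` passes from the former to the latter.

Modelled distributions. With the increment `f(y) - ĝ_{yx} f(x)` as coefficients, the same
recentering shows that the remainder of `f^τ` has blocks of order `2^{-j(γ - |τ|)}`. For the
reconstruction, put `paraIncr x = ∑_ν P_{(f - ĝ_{·x} f(x))^ν} ⟦ν⟧`. It is `∑_ν P_{f^ν} ⟦ν⟧ - Π_x
f(x)` plus an explicit low-frequency function `lowTerm`, and its blocks at `x` are of order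
`2^{-jγ}`. The remainder `⟦f⟧` is taken to be a function: at `y`, the value of `lowTerm` with base
point `y`, minus, when `γ > 0`, the sum of all blocks of `paraIncr y` at `y`. Against a test
function of scale `λ`, the blocks finer than `λ` are small because the test function has regularity
`r > |β₀ ∧ 0|`. In the coarser blocks the base point is moved from `x` to the running point `y`: the
blocks of `paraIncr y` at `y` are compensated by `⟦f⟧`, and the change of base point costs low
frequencies of `Π_y ν` at `y`, of order `λ^{|ν|}`, times increments of order `|y - x|^{γ - |ν|}`
(`exists_sum_block_add_remFun_le`). For `γ > 0` the same estimate gives `⟦f⟧ ∈ 𝒞^γ`; for `γ ≤ 0`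
boundedness is enough. -/

/-- The increasing family of seminorms defining the topology of the Schwartz space. -/
def sn (F : Type*) [NormedAddCommGroup F] [NormedSpace ℝ F] (N : ℕ) : Seminorm ℝ 𝓢(E d, F) :=
  (Finset.Iic (N, N)).sup (schwartzSeminormFamily ℝ (E d) F)

section

variable {F : Type*} [NormedAddCommGroup F] [NormedSpace ℝ F]

theorem sup_le_sn (s : Finset (ℕ × ℕ)) :
    ∃ N, ∀ f : 𝓢(E d, F), s.sup (schwartzSeminormFamily ℝ (E d) F) f ≤ sn F N f := by
  refine ⟨s.sup fun p => max p.1 p.2, fun f => ?_⟩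
  apply Seminorm.le_def.1
  refine Finset.sup_mono fun p hp => ?_
  have := Finset.le_sup (f := fun p : ℕ × ℕ => max p.1 p.2) hp
  simp only [Finset.mem_Iic]
  exact ⟨(le_max_left _ _).trans this, (le_max_right _ _).trans this⟩

theorem sn_mono {N M : ℕ} (h : N ≤ M) (f : 𝓢(E d, F)) : sn F N f ≤ sn F M f :=
  Seminorm.le_def.1 (Finset.sup_mono (Finset.Iic_subset_Iic.2 (Prod.mk_le_mk.2 ⟨h, h⟩))) f

theorem sn_nonneg (N : ℕ) (f : 𝓢(E d, F)) : 0 ≤ sn F N f := apply_nonneg _ _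

theorem seminorm_le_sn {k l N : ℕ} (hk : k ≤ N) (hl : l ≤ N) (f : 𝓢(E d, F)) :
    SchwartzMap.seminorm ℝ k l f ≤ sn F N f :=
  Seminorm.le_def.1 (Finset.le_sup (f := schwartzSeminormFamily ℝ (E d) F)
    (b := (k, l)) (Finset.mem_Iic.2 (Prod.mk_le_mk.2 ⟨hk, hl⟩))) f

theorem sn_le {N : ℕ} (f : 𝓢(E d, F)) {C : ℝ} (hC : 0 ≤ C)
    (h : ∀ k ≤ N, ∀ l ≤ N, ∀ x, ‖x‖ ^ k * ‖iteratedFDeriv ℝ l f x‖ ≤ C) : sn F N f ≤ C := by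
  refine Seminorm.finset_sup_apply_le hC fun p hp => ?_
  obtain ⟨h1, h2⟩ := Finset.mem_Iic.1 hp
  exact SchwartzMap.seminorm_le_bound ℝ _ _ f hC (h _ h1 _ h2)

theorem one_add_pow_mul_le_sn {k l N : ℕ} (hk : k ≤ N) (hl : l ≤ N) (f : 𝓢(E d, F)) (x : E d) :
    (1 + ‖x‖) ^ k * ‖iteratedFDeriv ℝ l f x‖ ≤ 2 ^ N * sn F N f :=
  SchwartzMap.one_add_le_sup_seminorm_apply (𝕜 := ℝ) (m := (N, N)) hk hl f x

theorem one_add_pow_mul_apply_le_sn {k N : ℕ} (hk : k ≤ N) (f : 𝓢(E d, F)) (x : E d) :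
    (1 + ‖x‖) ^ k * ‖f x‖ ≤ 2 ^ N * sn F N f := by
  simpa using one_add_pow_mul_le_sn hk (Nat.zero_le N) f x

/-- A continuous linear map between Schwartz spaces is bounded with respect to the seminorms. -/
theorem exists_sn_bound {G : Type*} [NormedAddCommGroup G] [NormedSpace ℝ G]
    (A : 𝓢(E d, F) →L[ℝ] 𝓢(E d, G)) (N : ℕ) :
    ∃ M C, 0 ≤ C ∧ ∀ f, sn G N (A f) ≤ C * sn F M f := by
  obtain ⟨s, C, -, h⟩ := Seminorm.bound_of_continuous (schwartz_withSeminorms ℝ (E d) F)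
    ((sn G N).comp A.toLinearMap) (by
      have h2 : Continuous (sn (d := d) G N) := by
        refine Seminorm.continuous (r := 1) ?_
        exact (schwartz_withSeminorms ℝ (E d) G).mem_nhds_iff _ _ |>.2
          ⟨Finset.Iic (N, N), 1, one_pos, subset_rfl⟩
      exact h2.comp A.continuous)
  obtain ⟨M, hM⟩ := sup_le_sn (d := d) (F := F) s
  refine ⟨M, C, C.2, fun f => (h f).trans ?_⟩
  exact mul_le_mul_of_nonneg_left (hM f) C.2

end

theorem TDist.exists_bound (u : TDist d) : ∃ N C, 0 ≤ C ∧ ∀ φ, |u φ| ≤ C * sn ℝ N φ := by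
  obtain ⟨s, C, -, h⟩ := Seminorm.bound_of_continuous (schwartz_withSeminorms ℝ (E d) ℝ)
    ((normSeminorm ℝ ℝ).comp u.toLinearMap) (continuous_norm.comp u.continuous)
  obtain ⟨N, hN⟩ := sup_le_sn (d := d) (F := ℝ) s
  refine ⟨N, C, C.2, fun φ => (h φ).trans ?_⟩
  exact mul_le_mul_of_nonneg_left (hN φ) C.2

/-- Construct a tempered distribution from a seminorm bound. -/
def TDist.mk' (A : 𝓢(E d, ℝ) → ℝ) (hadd : ∀ f g, A (f + g) = A f + A g)
    (hsmul : ∀ (a : ℝ) f, A (a • f) = a * A f)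
    (h : ∃ N C, 0 ≤ C ∧ ∀ φ, |A φ| ≤ C * sn ℝ N φ) : TDist d :=
  SchwartzMap.mkCLMtoNormedSpace A hadd hsmul
    (let ⟨N, C, hC, hb⟩ := h; ⟨Finset.Iic (N, N), C, hC, hb⟩)

@[simp] theorem TDist.mk'_apply (A : 𝓢(E d, ℝ) → ℝ) (hadd hsmul h) (φ : 𝓢(E d, ℝ)) :
    TDist.mk' A hadd hsmul h φ = A φ := rfl

/-- The Schwartz function `x ↦ K (x - y)`. -/
abbrev translate (K : 𝓢(E d, ℝ)) (y : E d) : 𝓢(E d, ℝ) := SchwartzMap.compSubConstCLM ℝ y K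

theorem one_add_norm_le_mul (x y : E d) : 1 + ‖x‖ ≤ (1 + ‖x - y‖) * (1 + ‖y‖) := by
  have := norm_add_le (x - y) y
  rw [sub_add_cancel] at this
  nlinarith [norm_nonneg (x - y), norm_nonneg y]

theorem sn_translate_le (K : 𝓢(E d, ℝ)) (y : E d) (N : ℕ) :
    sn ℝ N (translate K y) ≤ (1 + ‖y‖) ^ N * (2 ^ N * sn ℝ N K) := by
  refine sn_le _ (by have := sn_nonneg N K; positivity) fun k hk l hl x => ?_
  have h1 : iteratedFDeriv ℝ l (translate K y) x = iteratedFDeriv ℝ l K (x - y) := by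
    have : (translate K y : E d → ℝ) = fun z => K (z - y) := by ext z; simp
    rw [this, iteratedFDeriv_comp_sub]
  rw [h1]
  have h2 := one_add_pow_mul_le_sn hk hl K (x - y)
  have h3 : ‖x‖ ^ k ≤ (1 + ‖y‖) ^ N * (1 + ‖x - y‖) ^ k := by
    calc ‖x‖ ^ k ≤ ((1 + ‖x - y‖) * (1 + ‖y‖)) ^ k := by
          gcongr; linarith [one_add_norm_le_mul x y]
      _ = (1 + ‖y‖) ^ k * (1 + ‖x - y‖) ^ k := by rw [mul_pow, mul_comm]
      _ ≤ _ := by gcongr; linarith [norm_nonneg y]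
  calc _ ≤ (1 + ‖y‖) ^ N * (1 + ‖x - y‖) ^ k * ‖iteratedFDeriv ℝ l K (x - y)‖ := by gcongr
    _ = (1 + ‖y‖) ^ N * ((1 + ‖x - y‖) ^ k * ‖iteratedFDeriv ℝ l K (x - y)‖) := by ring
    _ ≤ _ := by gcongr

/-- Mean value inequality on the segment from `x - y₀` to `x - y`. As `‖y - y₀‖ ≤ 1`, every point
`z` of it satisfies `‖x - z‖ ≤ ‖y₀‖ + 1`, so the weights at `x` and at `z` differ by at most a power
of `2 + ‖y₀‖`. This makes translation continuous with values in the Schwartz space. -/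
theorem sn_translate_sub_le (K : 𝓢(E d, ℝ)) (y y₀ : E d) (h : ‖y - y₀‖ ≤ 1) (N : ℕ) :
    sn ℝ N (translate K y - translate K y₀) ≤
      (2 + ‖y₀‖) ^ N * (2 ^ (N + 1) * sn ℝ (N + 1) K) * ‖y - y₀‖ := by
  have hsn := sn_nonneg (N + 1) K
  refine sn_le _ (by positivity) fun k hk l hl x => ?_
  have h1 : ∀ y, iteratedFDeriv ℝ l (translate K y) x = iteratedFDeriv ℝ l K (x - y) := by
    intro y
    have : (translate K y : E d → ℝ) = fun z => K (z - y) := by ext z; simp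
    rw [this, iteratedFDeriv_comp_sub]
  have h0 : iteratedFDeriv ℝ l (translate K y - translate K y₀ : 𝓢(E d, ℝ)) x =
      iteratedFDeriv ℝ l K (x - y) - iteratedFDeriv ℝ l K (x - y₀) := by
    rw [← h1, ← h1]
    exact iteratedFDeriv_sub_apply ((translate K y).smooth l).contDiffAt
      ((translate K y₀).smooth l).contDiffAt
  rw [h0]
  set D := 2 ^ (N + 1) * sn ℝ (N + 1) K with hD
  have key : ‖iteratedFDeriv ℝ l K (x - y) - iteratedFDeriv ℝ l K (x - y₀)‖ ≤
      (D * ((2 + ‖y₀‖) ^ k / (1 + ‖x‖) ^ k)) * ‖(x - y) - (x - y₀)‖ := by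
    refine (convex_segment (x - y₀) (x - y)).norm_image_sub_le_of_norm_fderiv_le (𝕜 := ℝ)
      (f := iteratedFDeriv ℝ l K) (fun z _ => ?_) (fun z hz => ?_)
      (left_mem_segment ℝ _ _) (right_mem_segment ℝ _ _)
    · exact ((K.smooth ⊤).differentiable_iteratedFDeriv (mod_cast (WithTop.coe_lt_top l))).differentiableAt
    · rw [norm_fderiv_iteratedFDeriv]
      have h2 := one_add_pow_mul_le_sn (hk.trans (Nat.le_succ N)) (Nat.succ_le_succ hl) K z
      obtain ⟨t, ht, rfl⟩ := (segment_eq_image' ℝ (x - y₀) (x - y)) ▸ hz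
      set z := (x - y₀) + t • ((x - y) - (x - y₀)) with hzdef
      have hz' : x - z = y₀ + t • (y - y₀) := by rw [hzdef]; module
      have hxz : ‖x - z‖ ≤ ‖y₀‖ + 1 := by
        rw [hz']
        refine (norm_add_le _ _).trans ?_
        rw [norm_smul, Real.norm_of_nonneg ht.1]
        nlinarith [ht.1, ht.2, norm_nonneg (y - y₀)]
      have h3 : 1 + ‖x‖ ≤ (1 + ‖z‖) * (2 + ‖y₀‖) := by
        have := one_add_norm_le_mul x z
        have := norm_add_le (x - z) z
        rw [sub_add_cancel] at this
        nlinarith [norm_nonneg z, norm_nonneg y₀]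
      have h4 : (1 + ‖x‖) ^ k ≤ (1 + ‖z‖) ^ k * (2 + ‖y₀‖) ^ k := by
        rw [← mul_pow]; gcongr
      rw [← mul_div_assoc, le_div_iff₀ (by positivity)]
      calc _ ≤ ‖iteratedFDeriv ℝ (l + 1) K z‖ * ((1 + ‖z‖) ^ k * (2 + ‖y₀‖) ^ k) := by gcongr
        _ = ((1 + ‖z‖) ^ k * ‖iteratedFDeriv ℝ (l + 1) K z‖) * (2 + ‖y₀‖) ^ k := by ring
        _ ≤ _ := by gcongr
  have h5 : ‖(x - y) - (x - y₀)‖ = ‖y - y₀‖ := by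
    rw [← norm_neg]; congr 1; abel
  rw [h5] at key
  calc _ ≤ (1 + ‖x‖) ^ k * ((D * ((2 + ‖y₀‖) ^ k / (1 + ‖x‖) ^ k)) * ‖y - y₀‖) := by
        gcongr; linarith [norm_nonneg x]
    _ = (2 + ‖y₀‖) ^ k * D * ‖y - y₀‖ := by field_simp
    _ ≤ _ := by gcongr; linarith [norm_nonneg y₀]

theorem continuous_translate (K : 𝓢(E d, ℝ)) : Continuous (translate K) := by
  rw [continuous_iff_continuousAt]
  intro y₀
  rw [ContinuousAt, (schwartz_withSeminorms ℝ (E d) ℝ).tendsto_nhds]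
  rintro ⟨k, l⟩ ε hε
  set N := max k l
  set C := (2 + ‖y₀‖) ^ N * (2 ^ (N + 1) * sn ℝ (N + 1) K) with hC
  have hC0 : 0 ≤ C := by have := sn_nonneg (N + 1) K; positivity
  have : Tendsto (fun y : E d => C * ‖y - y₀‖) (𝓝 y₀) (𝓝 0) := by
    have : Continuous fun y : E d => C * ‖y - y₀‖ := by fun_prop
    simpa using this.tendsto y₀
  filter_upwards [this.eventually (gt_mem_nhds hε), Metric.ball_mem_nhds y₀ one_pos] with y h1 h2
  rw [Metric.mem_ball, dist_eq_norm] at h2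
  refine lt_of_le_of_lt ?_ h1
  exact (seminorm_le_sn (le_max_left k l) (le_max_right k l) _).trans
    (sn_translate_sub_le K y y₀ h2.le N)

theorem continuous_reflectAt (K : 𝓢(E d, ℝ)) : Continuous (reflectAt K) :=
  continuous_translate _

theorem continuous_block (LP : DyadicPartition d) (n : ℕ) (u : TDist d) :
    Continuous (block LP n u) :=
  u.continuous.comp (continuous_reflectAt _)

/-- The embedding `f ↦ ‖x‖ ^ k D^l f` of Schwartz functions in a Banach space. -/
def weightedDeriv (k l : ℕ) :
    𝓢(E d, ℝ) →L[ℝ] BoundedContinuousFunction (E d) (E d [×l]→L[ℝ] ℝ) :=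
  SchwartzMap.mkCLMtoNormedSpace
    (fun f => BoundedContinuousFunction.ofNormedAddCommGroup
      (fun x => ‖x‖ ^ k • iteratedFDeriv ℝ l f x)
      (((continuous_norm.pow k)).smul
        ((f.smooth ⊤).continuous_iteratedFDeriv (mod_cast le_top)))
      (SchwartzMap.seminorm ℝ k l f)
      (fun x => by
        rw [norm_smul, norm_pow, norm_norm]; exact SchwartzMap.le_seminorm ℝ k l f x))
    (fun f g => by
      ext1 x
      simp only [BoundedContinuousFunction.coe_ofNormedAddCommGroup,
        BoundedContinuousFunction.coe_add, Pi.add_apply]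
      rw [← smul_add]
      congr 1
      exact iteratedFDeriv_add_apply (f.smooth l).contDiffAt (g.smooth l).contDiffAt)
    (fun a f => by
      ext1 x
      simp only [BoundedContinuousFunction.coe_ofNormedAddCommGroup,
        BoundedContinuousFunction.coe_smul, RingHom.id_apply]
      rw [smul_comm]
      congr 1
      exact iteratedFDeriv_const_smul_apply (f.smooth l).contDiffAt)
    ⟨{(k, l)}, 1, zero_le_one, fun f => by
      rw [one_mul, Finset.sup_singleton]
      refine BoundedContinuousFunction.norm_ofNormedAddCommGroup_le _ (apply_nonneg _ _) _⟩

theorem weightedDeriv_apply (k l : ℕ) (f : 𝓢(E d, ℝ)) (x : E d) :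
    weightedDeriv k l f x = ‖x‖ ^ k • iteratedFDeriv ℝ l f x := rfl

theorem seminorm_le_norm_weightedDeriv (k l : ℕ) (f : 𝓢(E d, ℝ)) :
    SchwartzMap.seminorm ℝ k l f ≤ ‖weightedDeriv k l f‖ := by
  refine SchwartzMap.seminorm_le_bound ℝ k l f
    (norm_nonneg (weightedDeriv k l f)) fun x => ?_
  have := (weightedDeriv k l f).norm_coe_le_norm x
  rwa [weightedDeriv_apply, norm_smul, norm_pow, norm_norm] at this

theorem norm_weightedDeriv_le (k l : ℕ) (f : 𝓢(E d, ℝ)) :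
    ‖weightedDeriv k l f‖ ≤ SchwartzMap.seminorm ℝ k l f := by
  refine (BoundedContinuousFunction.norm_le (apply_nonneg _ _)).2 fun x => ?_
  rw [weightedDeriv_apply, norm_smul, norm_pow, norm_norm]
  exact SchwartzMap.le_seminorm ℝ k l f x

/-- The target of the maps `weightedDeriv`, for all orders up to `N`. -/
def JetSpace (d N : ℕ) : Type :=
  ∀ p : Finset.Iic (N, N), BoundedContinuousFunction (E d) (E d [×p.1.2]→L[ℝ] ℝ)

instance (N : ℕ) : NormedAddCommGroup (JetSpace d N) :=
  Pi.normedAddCommGroup (G := fun p : Finset.Iic (N, N) =>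
    BoundedContinuousFunction (E d) (E d [×p.1.2]→L[ℝ] ℝ))

instance (N : ℕ) : NormedSpace ℝ (JetSpace d N) :=
  Pi.normedSpace (E := fun p : Finset.Iic (N, N) =>
    BoundedContinuousFunction (E d) (E d [×p.1.2]→L[ℝ] ℝ))

instance (N : ℕ) : CompleteSpace (JetSpace d N) :=
  Pi.complete (fun p : Finset.Iic (N, N) =>
    BoundedContinuousFunction (E d) (E d [×p.1.2]→L[ℝ] ℝ))

/-- The embedding of Schwartz functions in `JetSpace`. -/
def jet (N : ℕ) : 𝓢(E d, ℝ) →L[ℝ] JetSpace d N :=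
  ContinuousLinearMap.pi fun p : Finset.Iic (N, N) => weightedDeriv (d := d) p.1.1 p.1.2

/-- The evaluation of an element of `JetSpace` at a point. -/
def jetEval {N : ℕ} (p : Finset.Iic (N, N)) (x : E d) : JetSpace d N →L[ℝ] (E d [×p.1.2]→L[ℝ] ℝ) :=
  (BoundedContinuousFunction.evalCLM ℝ x).comp
    (ContinuousLinearMap.proj (R := ℝ) (φ := fun p : Finset.Iic (N, N) =>
      BoundedContinuousFunction (E d) (E d [×p.1.2]→L[ℝ] ℝ)) p)

theorem jetSpace_ext {N : ℕ} {a b : JetSpace d N} (h : ∀ p x, jetEval p x a = jetEval p x b) :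
    a = b := by
  funext p
  exact BoundedContinuousFunction.ext fun x => h p x

theorem jetEval_jet {N : ℕ} (p : Finset.Iic (N, N)) (x : E d) (f : 𝓢(E d, ℝ)) :
    jetEval p x (jet N f) = ‖x‖ ^ p.1.1 • iteratedFDeriv ℝ p.1.2 f x := rfl

theorem sn_le_norm_jet (N : ℕ) (f : 𝓢(E d, ℝ)) : sn ℝ N f ≤ ‖jet N f‖ := by
  refine Seminorm.finset_sup_apply_le (norm_nonneg _) fun p hp => ?_
  refine (seminorm_le_norm_weightedDeriv p.1 p.2 f).trans ?_
  exact norm_le_pi_norm (G := fun p : Finset.Iic (N, N) =>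
    BoundedContinuousFunction (E d) (E d [×p.1.2]→L[ℝ] ℝ)) (jet N f) ⟨p, hp⟩

theorem norm_jet_le (N : ℕ) (f : 𝓢(E d, ℝ)) : ‖jet N f‖ ≤ sn ℝ N f := by
  refine (pi_norm_le_iff_of_nonneg (G := fun p : Finset.Iic (N, N) =>
    BoundedContinuousFunction (E d) (E d [×p.1.2]→L[ℝ] ℝ)) (sn_nonneg N _)).2 fun p => ?_
  obtain ⟨h1, h2⟩ := Prod.mk_le_mk.1 (Finset.mem_Iic.1 p.2)
  exact (norm_weightedDeriv_le _ _ _).trans (seminorm_le_sn h1 h2 _)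

/-- Every tempered distribution factors through one of the maps `jet N`. -/
theorem TDist.exists_factorization (u : TDist d) :
    ∃ (N : ℕ) (v : JetSpace d N →L[ℝ] ℝ), ∀ φ, u φ = v (jet N φ) := by
  obtain ⟨N, C, hC, hu⟩ := u.exists_bound
  refine ⟨N, ?_⟩
  set ι : 𝓢(E d, ℝ) →ₗ[ℝ] JetSpace d N := (jet N).toLinearMap with hι
  have hb : ∀ φ, |u φ| ≤ C * ‖ι φ‖ := fun φ =>
    (hu φ).trans (mul_le_mul_of_nonneg_left (sn_le_norm_jet N φ) hC)
  have hker : LinearMap.ker ι ≤ LinearMap.ker u.toLinearMap := fun φ hφ => by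
    rw [LinearMap.mem_ker] at hφ ⊢
    have := hb φ
    rw [hφ, norm_zero, mul_zero] at this
    exact abs_eq_zero.1 (le_antisymm this (abs_nonneg _))
  -- `u` vanishes on the kernel of `ι`, hence descends to the range of `ι`; there the seminorm bound
  -- is continuity for the norm of `JetSpace`, and Hahn-Banach extends the functional to the whole
  -- space.
  set f₀ : LinearMap.range ι →ₗ[ℝ] ℝ :=
    (LinearMap.ker ι).liftQ u.toLinearMap hker ∘ₗ ι.quotKerEquivRange.symm.toLinearMap with hf₀
  have hf₀' : ∀ φ, f₀ ⟨ι φ, LinearMap.mem_range_self ι φ⟩ = u φ := fun φ => by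
    have : ι.quotKerEquivRange.symm ⟨ι φ, LinearMap.mem_range_self ι φ⟩ =
        (LinearMap.ker ι).mkQ φ := by
      rw [LinearEquiv.symm_apply_eq]; rfl
    simp only [hf₀, LinearMap.comp_apply, LinearEquiv.coe_coe, this]
    rfl
  set f : StrongDual ℝ (LinearMap.range ι) := f₀.mkContinuous C (by
    rintro ⟨_, φ, rfl⟩
    rw [hf₀']
    exact hb φ)
  obtain ⟨v, hv, -⟩ := exists_extension_norm_eq (LinearMap.range ι) f
  refine ⟨v, fun φ => ?_⟩
  exact (hf₀' φ).symm.trans (hv ⟨ι φ, LinearMap.mem_range_self ι φ⟩).symm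

/-- A tempered distribution can be exchanged with the integral of a family of test functions. -/
theorem TDist.integral_comm (u : TDist d) {Φ : E d → 𝓢(E d, ℝ)} (hΦ : Continuous Φ)
    (hInt : ∀ N, Integrable fun y => sn ℝ N (Φ y)) {I : 𝓢(E d, ℝ)}
    (hI : ∀ l x, iteratedFDeriv ℝ l I x = ∫ y, iteratedFDeriv ℝ l (Φ y) x) :
    Integrable (fun y => u (Φ y)) ∧ u I = ∫ y, u (Φ y) := by
  -- The Schwartz space is not normed, so the integral of `Φ` is taken as a Bochner integral of
  -- jets, with which the continuous functional `v` commutes.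
  obtain ⟨N, v, hv⟩ := u.exists_factorization
  have hΨc : Continuous fun y => jet N (Φ y) := (jet N).continuous.comp hΦ
  have hΨi : Integrable fun y => jet N (Φ y) := by
    have : SecondCountableTopologyEither (E d) (JetSpace d N) :=
      secondCountableTopologyEither_of_left _ _
    exact (hInt N).mono' hΨc.aestronglyMeasurable (Eventually.of_forall fun y => norm_jet_le N _)
  have hIΨ : jet N I = ∫ y, jet N (Φ y) := by
    refine jetSpace_ext fun p x => ?_
    rw [← (jetEval p x).integral_comp_comm hΨi, jetEval_jet, hI, ← integral_smul]
    rfl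
  have huΨ : (fun y => u (Φ y)) = fun y => v (jet N (Φ y)) := by ext y; exact hv _
  rw [huΨ]
  refine ⟨v.integrable_comp hΨi, ?_⟩
  rw [hv, hIΨ, v.integral_comp_comm hΨi]

/-- Differentiation of a convolution integral. -/
theorem iteratedFDeriv_integral_mul_sub (K : 𝓢(E d, ℝ)) {ψ : E d → ℝ} (hψ : Integrable ψ)
    (l : ℕ) (x : E d) :
    iteratedFDeriv ℝ l (fun x => ∫ y, ψ y * K (x - y)) x =
      ∫ y, ψ y • iteratedFDeriv ℝ l K (x - y) := by
  have hcont : ∀ l, Continuous (iteratedFDeriv ℝ l K) := fun l =>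
    (K.smooth ⊤).continuous_iteratedFDeriv (mod_cast le_top)
  have hInt : ∀ l x, Integrable fun y => ψ y • iteratedFDeriv ℝ l K (x - y) := fun l x => by
    refine Integrable.mono' (hψ.norm.mul_const (SchwartzMap.seminorm ℝ 0 l K))
      (hψ.aestronglyMeasurable.smul
        ((hcont l).comp (continuous_const.sub continuous_id)).aestronglyMeasurable)
      (Eventually.of_forall fun y => ?_)
    rw [norm_smul]
    gcongr
    exact SchwartzMap.norm_iteratedFDeriv_le_seminorm ℝ K l _
  induction l generalizing x with
  | zero =>
    rw [iteratedFDeriv_zero_eq_comp]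
    simp only [Function.comp_apply, iteratedFDeriv_zero_eq_comp]
    have e : ∀ y, ψ y • (continuousMultilinearCurryFin0 ℝ (E d) ℝ).symm (K (x - y)) =
        (continuousMultilinearCurryFin0 ℝ (E d) ℝ).symm.toContinuousLinearEquiv
          (ψ y * K (x - y)) := fun y => by
      rw [← smul_eq_mul, map_smul]; rfl
    simp only [e]
    rw [ContinuousLinearEquiv.integral_comp_comm]
    rfl
  | succ l ih =>
    rw [iteratedFDeriv_succ_eq_comp_left]
    simp only [Function.comp_apply]
    have hD : HasFDerivAt (iteratedFDeriv ℝ l fun x => ∫ y, ψ y * K (x - y))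
        (∫ y, ψ y • fderiv ℝ (iteratedFDeriv ℝ l K) (x - y)) x := by
      have : (iteratedFDeriv ℝ l fun x => ∫ y, ψ y * K (x - y)) =
          fun x => ∫ y, ψ y • iteratedFDeriv ℝ l K (x - y) := funext ih
      rw [this]
      refine hasFDerivAt_integral_of_dominated_of_fderiv_le (𝕜 := ℝ) (s := Set.univ)
        (F := fun x y => ψ y • iteratedFDeriv ℝ l K (x - y))
        (F' := fun x y => ψ y • fderiv ℝ (iteratedFDeriv ℝ l K) (x - y))
        (bound := fun y => ‖ψ y‖ * SchwartzMap.seminorm ℝ 0 (l + 1) K) univ_mem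
        (Eventually.of_forall fun x => (hInt l x).aestronglyMeasurable) (hInt l x) ?_
        (Eventually.of_forall fun y x _ => ?_) (hψ.norm.mul_const _)
        (Eventually.of_forall fun y x _ => ?_)
      · have : SecondCountableTopologyEither (E d) (E d →L[ℝ] E d [×l]→L[ℝ] ℝ) :=
          secondCountableTopologyEither_of_left _ _
        refine hψ.aestronglyMeasurable.smul (Continuous.aestronglyMeasurable ?_)
        have : Continuous (fderiv ℝ (iteratedFDeriv ℝ l K)) := by
          rw [fderiv_iteratedFDeriv]
          exact (LinearIsometryEquiv.continuous _).comp (hcont (l + 1))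
        exact this.comp (continuous_const.sub continuous_id)
      · rw [norm_smul, norm_fderiv_iteratedFDeriv]
        gcongr
        exact SchwartzMap.norm_iteratedFDeriv_le_seminorm ℝ K (l + 1) _
      · have hd : HasFDerivAt (iteratedFDeriv ℝ l K) (fderiv ℝ (iteratedFDeriv ℝ l K) (x - y))
            (x - y) := ((K.smooth ⊤).differentiable_iteratedFDeriv
              (mod_cast (WithTop.coe_lt_top l))).differentiableAt.hasFDerivAt
        have hd2 : HasFDerivAt (fun x => iteratedFDeriv ℝ l K (x - y))
            (fderiv ℝ (iteratedFDeriv ℝ l K) (x - y)) x := (hasFDerivAt_comp_sub _).2 hd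
        exact hd2.const_smul (ψ y)
    rw [hD.fderiv]
    have e : ∀ y, ψ y • iteratedFDeriv ℝ (l + 1) K (x - y) =
        ((continuousMultilinearCurryLeftEquiv ℝ (fun _ : Fin (l + 1) => E d)
          ℝ).symm.toContinuousLinearEquiv (ψ y • fderiv ℝ (iteratedFDeriv ℝ l K) (x - y))) :=
      fun y => by
        rw [map_smul]; rfl
    simp only [e]
    exact (ContinuousLinearEquiv.integral_comp_comm (𝕜 := ℝ) (μ := volume)
      (E := E d →L[ℝ] E d [×l]→L[ℝ] ℝ) (F := E d [×(l + 1)]→L[ℝ] ℝ)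
      (continuousMultilinearCurryLeftEquiv ℝ
        (fun _ : Fin (l + 1) => E d) ℝ).symm.toContinuousLinearEquiv
      (fun y : E d => ψ y • fderiv ℝ (iteratedFDeriv ℝ l K) (x - y))).symm

end

/-! ### Frequency localization of Schwartz functions -/

section

variable {d : ℕ}

/-! ## Convolutions and Fourier supports -/

/-- The complexification of a real Schwartz function. -/
abbrev toC : 𝓢(E d, ℝ) →L[ℝ] 𝓢(E d, ℂ) := SchwartzMap.postcompCLM Complex.ofRealCLM

/-- The real part of a Schwartz function. -/
abbrev reS : 𝓢(E d, ℂ) →L[ℝ] 𝓢(E d, ℝ) := SchwartzMap.postcompCLM Complex.reCLM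

theorem toC_apply (f : 𝓢(E d, ℝ)) (x : E d) : toC f x = (f x : ℂ) := by simp

theorem reS_toC (f : 𝓢(E d, ℝ)) : reS (toC f) = f := by ext x; simp

/-- The convolution of real Schwartz functions. -/
def convS (K φ : 𝓢(E d, ℝ)) : 𝓢(E d, ℝ) :=
  reS (SchwartzMap.convolution (ContinuousLinearMap.mul ℂ ℂ) (toC φ) (toC K))

theorem convC_apply (K φ : 𝓢(E d, ℝ)) (x : E d) :
    SchwartzMap.convolution (ContinuousLinearMap.mul ℂ ℂ) (toC φ) (toC K) x =
      ((∫ y, φ y * K (x - y) : ℝ) : ℂ) := by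
  rw [SchwartzMap.convolution_apply, MeasureTheory.convolution_def, ← integral_complex_ofReal]
  simp

theorem convS_apply (K φ : 𝓢(E d, ℝ)) (x : E d) : convS K φ x = ∫ y, φ y * K (x - y) := by
  simp [convS, convC_apply]

theorem toC_convS (K φ : 𝓢(E d, ℝ)) :
    toC (convS K φ) = SchwartzMap.convolution (ContinuousLinearMap.mul ℂ ℂ) (toC φ) (toC K) := by
  ext x
  rw [toC_apply, convS_apply, convC_apply]

theorem convS_add_left (K K' φ : 𝓢(E d, ℝ)) : convS (K + K') φ = convS K φ + convS K' φ := by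
  simp [convS]

theorem convS_sum_left {ι : Type*} (s : Finset ι) (K : ι → 𝓢(E d, ℝ)) (φ : 𝓢(E d, ℝ)) :
    convS (∑ i ∈ s, K i) φ = ∑ i ∈ s, convS (K i) φ := by
  simp [convS]

theorem fourier_toC_convS (K φ : 𝓢(E d, ℝ)) (ξ : E d) :
    𝓕 (toC (convS K φ)) ξ = 𝓕 (toC K) ξ * 𝓕 (toC φ) ξ := by
  rw [toC_convS, SchwartzMap.fourier_convolution, SchwartzMap.pairing_apply_apply]
  simp [mul_comm]

theorem integrable_sn_smul_translate (K ψ : 𝓢(E d, ℝ)) (N : ℕ) :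
    Integrable fun y => sn ℝ N (ψ y • translate K y) := by
  have hc : Continuous fun y => sn ℝ N (ψ y • translate K y) := by
    have h1 : Continuous fun y => ψ y • translate K y :=
      ψ.continuous.smul (continuous_translate K)
    have h2 : Continuous (sn (d := d) ℝ N) := by
      refine Seminorm.continuous (r := 1) ?_
      exact (schwartz_withSeminorms ℝ (E d) ℝ).mem_nhds_iff _ _ |>.2
        ⟨Finset.Iic (N, N), 1, one_pos, subset_rfl⟩
    exact h2.comp h1
  have hi : Integrable fun y => (2 ^ N * (‖ψ y‖ + ‖y‖ ^ N * ‖ψ y‖)) * (2 ^ N * sn ℝ N K) :=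
    ((ψ.integrable.norm.add (ψ.integrable_pow_mul volume N)).const_mul _).mul_const _
  refine hi.mono' hc.aestronglyMeasurable (Eventually.of_forall fun y => ?_)
  rw [Real.norm_of_nonneg (sn_nonneg _ _), map_smul_eq_mul]
  have hle : (1 + ‖y‖) ^ N ≤ 2 ^ N * (1 + ‖y‖ ^ N) := by
    have h0 := norm_nonneg y
    have h1 : (1 + ‖y‖) ^ N ≤ (2 * max 1 ‖y‖) ^ N := by
      gcongr
      rcases le_total 1 ‖y‖ with h | h
      · rw [max_eq_right h]; linarith
      · rw [max_eq_left h]; linarith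
    refine h1.trans ?_
    rw [mul_pow]
    gcongr
    rcases le_total 1 ‖y‖ with h | h
    · rw [max_eq_right h]; linarith
    · rw [max_eq_left h, one_pow]; linarith [pow_nonneg h0 N]
  calc _ ≤ ‖ψ y‖ * ((1 + ‖y‖) ^ N * (2 ^ N * sn ℝ N K)) := by
        gcongr; exact sn_translate_le K y N
    _ ≤ ‖ψ y‖ * ((2 ^ N * (1 + ‖y‖ ^ N)) * (2 ^ N * sn ℝ N K)) := by
        have := sn_nonneg N K
        gcongr
    _ = _ := by ring

/-- A tempered distribution applied to a convolution. -/
theorem TDist.apply_convS (u : TDist d) (K ψ : 𝓢(E d, ℝ)) :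
    Integrable (fun y => ψ y * u (translate K y)) ∧
      u (convS K ψ) = ∫ y, ψ y * u (translate K y) := by
  have h := u.integral_comm (Φ := fun y => ψ y • translate K y) (I := convS K ψ)
    (ψ.continuous.smul (continuous_translate K)) (integrable_sn_smul_translate K ψ) ?_
  · simpa using h
  · intro l x
    have e1 : (convS K ψ : E d → ℝ) = fun x => ∫ y, ψ y * K (x - y) := by
      ext x; exact convS_apply K ψ x
    rw [e1, iteratedFDeriv_integral_mul_sub K ψ.integrable]
    refine integral_congr_ae (Eventually.of_forall fun y => ?_)
    have e2 : ((ψ y • translate K y : 𝓢(E d, ℝ)) : E d → ℝ) = ψ y • fun z => K (z - y) := by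
      ext z; simp
    simp only [e2]
    rw [iteratedFDeriv_const_smul_apply, iteratedFDeriv_comp_sub]
    exact ((K.smooth l).comp (contDiff_id.sub contDiff_const)).contDiffAt

/-- The product `p q` is the Fourier transform of the convolution of `𝓕⁻ p` and `𝓕⁻ q`. Moving that
transform onto `f` turns the integral into one of `𝓕 f` against the convolution, whose integrand
vanishes pointwise under `h`. -/
theorem integral_mul_mul_eq_zero_of_fourier {f p q : 𝓢(E d, ℂ)}
    (h : ∀ ξ η, 𝓕 f ξ * (𝓕⁻ p η * 𝓕⁻ q (ξ - η)) = 0) : ∫ y, f y * (p y * q y) = 0 := by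
  have e := SchwartzMap.integral_fourier_mul_eq f
    (SchwartzMap.convolution (ContinuousLinearMap.mul ℂ ℂ) (𝓕⁻ p) (𝓕⁻ q))
  rw [SchwartzMap.fourier_convolution] at e
  simp only [FourierTransform.fourier_fourierInv_eq, SchwartzMap.pairing_apply_apply,
    ContinuousLinearMap.mul_apply'] at e
  rw [← e]
  refine integral_eq_zero_of_ae (Eventually.of_forall fun ξ => ?_)
  simp only [Pi.zero_apply]
  rw [SchwartzMap.convolution_apply, MeasureTheory.convolution_def, ← integral_const_mul]
  refine integral_eq_zero_of_ae (Eventually.of_forall fun η => ?_)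
  simpa using h ξ η

theorem fourier_toC_rescale (ψ : 𝓢(E d, ℝ)) {l : ℝ} (hl : 0 < l) (x ξ : E d) :
    𝓕 (toC (rescale ψ l hl x)) ξ =
      Complex.exp (↑(-2 * Real.pi * inner ℝ x ξ) * Complex.I) * 𝓕 (toC ψ) (l • ξ) := by
  rw [SchwartzMap.fourier_coe, SchwartzMap.fourier_coe, Real.fourier_eq', Real.fourier_eq',
    ← integral_const_mul]
  set F : E d → ℂ := fun v => Complex.exp (↑(-2 * Real.pi * inner ℝ x ξ) * Complex.I) *
    (Complex.exp (↑(-2 * Real.pi * inner ℝ v (l • ξ)) * Complex.I) • toC ψ v) with hF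
  have h1 : ∫ v, F v = ∫ v, ((l ^ d)⁻¹ : ℝ) • F (l⁻¹ • (v - x)) := by
    rw [integral_smul, integral_sub_right_eq_self (fun v => F (l⁻¹ • v)),
      Measure.integral_comp_inv_smul_of_nonneg volume F hl.le]
    simp only [finrank_euclideanSpace, Fintype.card_fin]
    rw [smul_smul, inv_mul_cancel₀ (by positivity), one_smul]
  rw [h1]
  refine integral_congr_ae (Eventually.of_forall fun v => ?_)
  simp only [hF, smul_eq_mul, toC_apply, rescale_apply, Complex.real_smul]
  rw [inner_smul_left, inner_smul_right, inner_sub_left]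
  simp only [conj_trivial]
  have e : (l⁻¹ * (l * (inner ℝ v ξ - inner ℝ x ξ)) : ℝ) = inner ℝ v ξ - inner ℝ x ξ := by
    field_simp
  rw [e]
  have e2 : Complex.exp (↑(-2 * Real.pi * inner ℝ v ξ) * Complex.I) =
      Complex.exp (↑(-2 * Real.pi * inner ℝ x ξ) * Complex.I) *
      Complex.exp (↑(-2 * Real.pi * (inner ℝ v ξ - inner ℝ x ξ)) * Complex.I) := by
    rw [← Complex.exp_add]; congr 1; push_cast; ring
  rw [e2]
  push_cast
  ring

theorem fourierInv_apply_eq_fourier_neg (f : 𝓢(E d, ℂ)) (ξ : E d) : 𝓕⁻ f ξ = 𝓕 f (-ξ) := by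
  rw [SchwartzMap.fourier_coe, SchwartzMap.fourierInv_coe, Real.fourierInv_eq_fourier_neg]

namespace DyadicPartition

variable (LP : DyadicPartition d)

theorem symbol_apply (n : ℕ) (x : E d) : LP.symbol n x = (LP.ρ n x : ℂ) := rfl

theorem ρ_neg (n : ℕ) (x : E d) : LP.ρ n (-x) = LP.ρ n x := LP.radial n _ _ (norm_neg x)

theorem fourierInv_symbol_neg (n : ℕ) (x : E d) :
    𝓕⁻ (LP.symbol n) (-x) = 𝓕⁻ (LP.symbol n) x := by
  rw [SchwartzMap.fourierInv_coe, Real.fourierInv_eq', Real.fourierInv_eq',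
    ← integral_neg_eq_self]
  refine integral_congr_ae (Eventually.of_forall fun v => ?_)
  simp [symbol_apply, ρ_neg]

theorem conj_fourierInv_symbol (n : ℕ) (x : E d) :
    (starRingEnd ℂ) (𝓕⁻ (LP.symbol n) x) = 𝓕⁻ (LP.symbol n) x := by
  conv_rhs => rw [← fourierInv_symbol_neg]
  rw [SchwartzMap.fourierInv_coe, Real.fourierInv_eq', Real.fourierInv_eq', ← integral_conj]
  refine integral_congr_ae (Eventually.of_forall fun v => ?_)
  simp only [symbol_apply, smul_eq_mul, map_mul, ← Complex.exp_conj, Complex.conj_ofReal,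
    Complex.conj_I, inner_neg_right]
  congr 2
  push_cast
  ring

/-- The symbol is real and even, so its inverse Fourier transform is already real. Hence kernel
identities can be checked on the Fourier side, where kernels are the functions `ρ`. -/
theorem toC_kernel (n : ℕ) : toC (LP.kernel n) = 𝓕⁻ (LP.symbol n) := by
  ext x
  rw [toC_apply]
  have h := Complex.conj_eq_iff_re.1 (LP.conj_fourierInv_symbol n x)
  exact h

theorem fourier_kernel (n : ℕ) (ξ : E d) : 𝓕 (toC (LP.kernel n)) ξ = (LP.ρ n ξ : ℂ) := by
  rw [toC_kernel, FourierTransform.fourier_fourierInv_eq, symbol_apply]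

theorem kernel_neg (n : ℕ) (x : E d) : LP.kernel n (-x) = LP.kernel n x := by
  have := LP.fourierInv_symbol_neg n x
  rw [← toC_kernel, toC_apply, toC_apply] at this
  exact_mod_cast this

theorem translate_kernel (n : ℕ) (y : E d) :
    translate (LP.kernel n) y = reflectAt (LP.kernel n) y := by
  ext x
  rw [reflectAt_apply, ← kernel_neg]
  simp

/-- The function `∑_{m < N} ρ_{m-1}` is a rescaled bump function. -/
theorem sum_ρ (n : ℕ) (x : E d) :
    ∑ m ∈ Finset.range (n + 1), LP.ρ m x = LP.ρ 0 (((2 : ℝ) ^ n)⁻¹ • x) := by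
  -- By scaling, the tail of the partition of unity at `x` after index `n` is the tail at `2⁻ⁿ x`
  -- after index `0`. Both tails complete a finite sum to `1`.
  have h1 := (hasSum_nat_add_iff' (n + 1)).2 (LP.sum_eq_one x)
  have h2 := (hasSum_nat_add_iff' 1).2 (LP.sum_eq_one (((2 : ℝ) ^ n)⁻¹ • x))
  have h3 : (fun m => LP.ρ (m + (n + 1)) x) = fun m => LP.ρ (m + 1) (((2 : ℝ) ^ n)⁻¹ • x) := by
    ext m
    rw [← add_assoc, LP.scaling, LP.scaling m, smul_smul, ← mul_inv, ← pow_add]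
  rw [h3] at h1
  have := h1.unique h2
  simp only [Finset.range_one, Finset.sum_singleton] at this
  linarith

end DyadicPartition

/-- The scale `2^{1-n}` of the `n`-th block. -/
def sc (n : ℕ) : ℝ := 2 / 2 ^ n

theorem sc_pos (n : ℕ) : 0 < sc n := by unfold sc; positivity

theorem sc_succ (n : ℕ) : sc (n + 1) = ((2 : ℝ) ^ n)⁻¹ := by
  unfold sc; rw [pow_succ]; field_simp

theorem sc_le_two (n : ℕ) : sc n ≤ 2 := by
  unfold sc
  rw [div_le_iff₀ (by positivity)]
  linarith [one_le_pow₀ (n := n) (one_le_two (α := ℝ))]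

theorem injective_fourier_toC {f g : 𝓢(E d, ℝ)} (h : ∀ ξ, 𝓕 (toC f) ξ = 𝓕 (toC g) ξ) :
    f = g := by
  have h1 : 𝓕 (toC f) = 𝓕 (toC g) := by ext ξ; exact h ξ
  have h2 : toC f = toC g := by
    calc toC f = 𝓕⁻ (𝓕 (toC f)) := (FourierTransform.fourierInv_fourier_eq _).symm
      _ = 𝓕⁻ (𝓕 (toC g)) := by rw [h1]
      _ = toC g := FourierTransform.fourierInv_fourier_eq _
  rw [← reS_toC f, h2, reS_toC]

theorem translate_eq_rescale (K : 𝓢(E d, ℝ)) (x : E d) : translate K x = rescale K 1 one_pos x := by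
  ext y
  rw [rescale_apply]
  simp

theorem rescale_rescale_zero (K : 𝓢(E d, ℝ)) {a b : ℝ} (ha : 0 < a) (hb : 0 < b) (x : E d) :
    rescale (rescale K a ha 0) b hb x = rescale K (b * a) (mul_pos hb ha) x := by
  ext y
  simp only [rescale_apply, sub_zero, smul_smul, mul_pow, mul_inv]
  rw [mul_comm a⁻¹ b⁻¹]
  ring

namespace DyadicPartition

variable (LP : DyadicPartition d)

/-- The kernel of the operator `∑_{m < N} Δ_{m-1}`. -/
def lowKernel (N : ℕ) : 𝓢(E d, ℝ) := ∑ m ∈ Finset.range N, LP.kernel m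

theorem fourier_lowKernel (n : ℕ) (ξ : E d) :
    𝓕 (toC (LP.lowKernel (n + 1))) ξ = (LP.ρ 0 (((2 : ℝ) ^ n)⁻¹ • ξ) : ℂ) := by
  rw [← sum_ρ, lowKernel, map_sum]
  have : 𝓕 (∑ m ∈ Finset.range (n + 1), toC (LP.kernel m)) =
      ∑ m ∈ Finset.range (n + 1), 𝓕 (toC (LP.kernel m)) :=
    map_sum (FourierTransform.fourierCLM ℝ 𝓢(E d, ℂ)) _ _
  rw [this]
  simp [fourier_kernel]

theorem kernel_succ (n : ℕ) :
    LP.kernel (n + 1) = rescale (LP.kernel 1) (sc (n + 1)) (sc_pos _) 0 := by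
  refine injective_fourier_toC fun ξ => ?_
  rw [fourier_toC_rescale, fourier_kernel, fourier_kernel, LP.scaling n, sc_succ]
  simp

theorem lowKernel_succ (n : ℕ) :
    LP.lowKernel (n + 1) = rescale (LP.kernel 0) (sc (n + 1)) (sc_pos _) 0 := by
  refine injective_fourier_toC fun ξ => ?_
  rw [fourier_toC_rescale, fourier_lowKernel, fourier_kernel, sc_succ]
  simp

theorem norm_lt_of_ρ_zero_ne {ξ : E d} (h : LP.ρ 0 ξ ≠ 0) : ‖ξ‖ < 4 / 3 :=
  LP.supp_zero (subset_tsupport _ h)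

theorem norm_mem_of_ρ_one_ne {ξ : E d} (h : LP.ρ 1 ξ ≠ 0) : 3 / 4 < ‖ξ‖ ∧ ‖ξ‖ < 8 / 3 :=
  LP.supp_one (subset_tsupport _ h)

theorem lt_of_ρ_ne {n : ℕ} {ξ : E d} (h : LP.ρ n ξ ≠ 0) : sc n * ‖ξ‖ < 8 / 3 := by
  rcases n with _ | n
  · have := LP.norm_lt_of_ρ_zero_ne h
    simp only [sc, pow_zero, div_one]; linarith
  · rw [LP.scaling] at h
    have := (LP.norm_mem_of_ρ_one_ne h).2
    rwa [norm_smul, Real.norm_of_nonneg (by positivity), ← sc_succ] at this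

theorem gt_of_ρ_ne {n : ℕ} (hn : n ≠ 0) {ξ : E d} (h : LP.ρ n ξ ≠ 0) : 3 / 4 < sc n * ‖ξ‖ := by
  obtain ⟨n, rfl⟩ := Nat.exists_eq_succ_of_ne_zero hn
  rw [LP.scaling] at h
  have := (LP.norm_mem_of_ρ_one_ne h).1
  rwa [norm_smul, Real.norm_of_nonneg (by positivity), ← sc_succ] at this

theorem ρ_zero_eq_one {x : E d} (hx : ‖x‖ ≤ 3 / 4) : LP.ρ 0 x = 1 := by
  have h : ∀ n ≠ 0, LP.ρ n x = 0 := fun n hn => by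
    obtain ⟨n, rfl⟩ := Nat.exists_eq_succ_of_ne_zero hn
    by_contra hne
    rw [LP.scaling] at hne
    have := (LP.norm_mem_of_ρ_one_ne hne).1
    rw [norm_smul, Real.norm_of_nonneg (by positivity)] at this
    have h1 : ((2 : ℝ) ^ n)⁻¹ ≤ 1 := inv_le_one_of_one_le₀ (one_le_pow₀ one_le_two)
    nlinarith [norm_nonneg x]
  exact (hasSum_single 0 h).unique (LP.sum_eq_one x)

theorem convS_kernel_rescale_eq_zero (i j : ℕ) {l : ℝ} (hl : 0 < l) (x : E d)
    (h : ∀ ξ, LP.ρ i (l • ξ) = 0 ∨ LP.ρ j ξ = 0) :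
    convS (LP.kernel j) (rescale (LP.kernel i) l hl x) = 0 := by
  refine injective_fourier_toC fun ξ => ?_
  rw [fourier_toC_convS, fourier_kernel, fourier_toC_rescale, fourier_kernel]
  have h0 : 𝓕 (toC (0 : 𝓢(E d, ℝ))) ξ = 0 := by
    rw [map_zero]
    have : 𝓕 (0 : 𝓢(E d, ℂ)) = 0 := map_zero (FourierTransform.fourierCLM ℝ 𝓢(E d, ℂ))
    rw [this]; rfl
  rw [h0]
  rcases h ξ with h | h <;> simp [h]

theorem convS_kernel_comm (K φ : 𝓢(E d, ℝ)) : convS K φ = convS φ K := by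
  refine injective_fourier_toC fun ξ => ?_
  rw [fourier_toC_convS, fourier_toC_convS, mul_comm]

/-- The product of two Schwartz functions. -/
abbrev _root_.PCRS.mulS (f g : 𝓢(E d, ℝ)) : 𝓢(E d, ℝ) :=
  SchwartzMap.pairing (ContinuousLinearMap.mul ℝ ℝ) f g

/-- The spectrum of a product lies in the sum of the spectra. This is the frequency localization of
paraproduct terms seen from the test function side: the block acting on the distribution has been
moved onto a product of two kernels. -/
theorem convS_kernel_mulS_eq_zero (k m n : ℕ) (x z : E d)
    (h : ∀ ξ η, LP.ρ k ξ = 0 ∨ LP.ρ m η = 0 ∨ LP.ρ n (ξ - η) = 0) :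
    convS (LP.kernel n) (mulS (reflectAt (LP.kernel k) x) (translate (LP.kernel m) z)) = 0 := by
  ext w
  rw [convS_apply]
  have hF : ∀ i (a ξ : E d), LP.ρ i ξ = 0 → 𝓕 (toC (translate (LP.kernel i) a)) ξ = 0 := by
    intro i a ξ hξ
    rw [translate_eq_rescale, fourier_toC_rescale, fourier_kernel, one_smul, hξ]
    simp
  have key := integral_mul_mul_eq_zero_of_fourier (f := toC (translate (LP.kernel k) x))
    (p := toC (translate (LP.kernel m) z)) (q := toC (translate (LP.kernel n) w)) (by
      intro ξ η
      simp only [fourierInv_apply_eq_fourier_neg]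
      rcases h ξ η with h | h | h
      · rw [hF _ _ _ h, zero_mul]
      · rw [hF m z (-η) (by rw [ρ_neg, h]), zero_mul, mul_zero]
      · rw [hF n w (-(ξ - η)) (by rw [ρ_neg, h]), mul_zero, mul_zero])
  have e : ∀ y, toC (translate (LP.kernel k) x) y * (toC (translate (LP.kernel m) z) y *
      toC (translate (LP.kernel n) w) y) =
      (((mulS (reflectAt (LP.kernel k) x) (translate (LP.kernel m) z)) y *
        LP.kernel n (w - y) : ℝ) : ℂ) := by
    intro y
    rw [translate_kernel, translate_kernel LP n]
    simp only [toC_apply, SchwartzMap.pairing_apply_apply, ContinuousLinearMap.mul_apply',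
      reflectAt_apply]
    push_cast; ring
  simp only [e, integral_complex_ofReal] at key
  exact_mod_cast key

end DyadicPartition

theorem apply_convS_kernel (LP : DyadicPartition d) (n : ℕ) (u : TDist d) (ψ : 𝓢(E d, ℝ)) :
    Integrable (fun y => ψ y * block LP n u y) ∧
      u (convS (LP.kernel n) ψ) = ∫ y, ψ y * block LP n u y := by
  have := u.apply_convS (LP.kernel n) ψ
  simp only [LP.translate_kernel] at this
  exact this

theorem blockFun_eq_convS (LP : DyadicPartition d) (n : ℕ) (φ : 𝓢(E d, ℝ)) (x : E d) :
    blockFun LP n φ x = convS (LP.kernel n) φ x := by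
  rw [convS_apply, blockFun]
  simp only [mul_comm]

/-! ## Smooth truncations -/

theorem hasTemperateGrowth_ρ_zero (LP : DyadicPartition d) (ε : ℝ) :
    (fun x => LP.ρ 0 (ε • x)).HasTemperateGrowth := by
  have h1 : (LP.ρ 0).HasTemperateGrowth :=
    ((LP.compact 0).toSchwartzMap (LP.smooth 0)).hasTemperateGrowth
  have h2 : (fun x : E d => ε • x).HasTemperateGrowth :=
    (ε • ContinuousLinearMap.id ℝ (E d)).hasTemperateGrowth
  exact h1.comp h2

/-- The truncation `ρ_{-1}(ε ·) f` of a Schwartz function. -/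
def cutoff (LP : DyadicPartition d) {F : Type*} [NormedAddCommGroup F] [NormedSpace ℝ F]
    (ε : ℝ) : 𝓢(E d, F) →L[ℝ] 𝓢(E d, F) :=
  SchwartzMap.smulLeftCLM F fun x => LP.ρ 0 (ε • x)

section

variable {F : Type*} [NormedAddCommGroup F] [NormedSpace ℝ F]

theorem cutoff_apply (LP : DyadicPartition d) (ε : ℝ) (f : 𝓢(E d, F)) (x : E d) :
    cutoff LP ε f x = LP.ρ 0 (ε • x) • f x :=
  SchwartzMap.smulLeftCLM_apply_apply (hasTemperateGrowth_ρ_zero LP ε) f x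

/-- The difference vanishes for `‖x‖ < 3 / (4 ε)`. Elsewhere `(4/3 ε ‖x‖) ^ M ≥ 1`, so the factor `ε
^ M` is bought with `M` additional powers of decay of `f`. The Leibniz rule handles the derivatives
of the cutoff, which stay bounded for `ε ≤ 1`. -/
theorem sn_sub_cutoff_le (LP : DyadicPartition d) (N M : ℕ) :
    ∃ C, 0 ≤ C ∧ ∀ ε : ℝ, 0 < ε → ε ≤ 1 → ∀ f : 𝓢(E d, F),
      sn F N (f - cutoff LP ε f) ≤ C * ε ^ M * sn F (N + M) f := by
  set P : 𝓢(E d, ℝ) := (LP.compact 0).toSchwartzMap (LP.smooth 0) with hP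
  have hPρ : (P : E d → ℝ) = LP.ρ 0 := rfl
  set B := sn ℝ N P with hB
  have hB0 : 0 ≤ B := sn_nonneg N P
  refine ⟨(4 / 3) ^ M * (1 + 2 ^ N * B), by positivity, fun ε hε hε1 f => ?_⟩
  have hS := sn_nonneg (N + M) f
  refine sn_le _ (by positivity) fun k hk l hl x => ?_
  have hfun : ((f - cutoff LP ε f : 𝓢(E d, F)) : E d → F) =
      fun x => f x - LP.ρ 0 (ε • x) • f x := by
    ext x; simp [cutoff_apply]
  rcases lt_or_ge ‖x‖ (3 / 4 / ε) with hx | hx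
  · have hev : ((f - cutoff LP ε f : 𝓢(E d, F)) : E d → F) =ᶠ[𝓝 x] fun _ => 0 := by
      have : {y : E d | ‖y‖ < 3 / 4 / ε} ∈ 𝓝 x :=
        (isOpen_lt continuous_norm continuous_const).mem_nhds hx
      filter_upwards [this] with y hy
      rw [hfun]
      have : LP.ρ 0 (ε • y) = 1 := LP.ρ_zero_eq_one (by
        rw [norm_smul, Real.norm_of_nonneg hε.le, mul_comm]
        exact ((lt_div_iff₀ hε).1 hy).le)
      simp [this]
    have h0 : iteratedFDeriv ℝ l ((f - cutoff LP ε f : 𝓢(E d, F)) : E d → F) x = 0 := by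
      rw [(hev.iteratedFDeriv ℝ l).eq_of_nhds]
      simp
    rw [h0, norm_zero, mul_zero]
    positivity
  · have hρs : ContDiff ℝ l fun x => LP.ρ 0 (ε • x) := by
      have := (LP.smooth 0).of_le (m := l) (mod_cast le_top)
      exact this.comp (contDiff_const_smul ε)
    have hxk : ∀ i ≤ N, ‖x‖ ^ k * ‖iteratedFDeriv ℝ i f x‖ ≤
        (4 / 3) ^ M * ε ^ M * sn F (N + M) f := by
      intro i hi
      have h1 : 1 ≤ (4 / 3 * ε * ‖x‖) ^ M := by
        refine one_le_pow₀ ?_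
        rw [div_le_iff₀ hε] at hx
        linarith
      have h2 : ‖x‖ ^ (k + M) * ‖iteratedFDeriv ℝ i f x‖ ≤ sn F (N + M) f :=
        (SchwartzMap.le_seminorm ℝ _ _ f x).trans
          (seminorm_le_sn (by omega) (by omega) f)
      calc _ ≤ (‖x‖ ^ k * ‖iteratedFDeriv ℝ i f x‖) * (4 / 3 * ε * ‖x‖) ^ M :=
            le_mul_of_one_le_right (by positivity) h1
        _ = (4 / 3) ^ M * ε ^ M * (‖x‖ ^ (k + M) * ‖iteratedFDeriv ℝ i f x‖) := by
            rw [mul_pow, mul_pow, pow_add]; ring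
        _ ≤ _ := by gcongr
    have hder : ∀ i ≤ N, ‖iteratedFDeriv ℝ i (fun x => LP.ρ 0 (ε • x)) x‖ ≤ B := by
      intro i hi
      have hc := congrFun (iteratedFDeriv_comp_const_smul (𝕜 := ℝ) (i := i) ε
        ((LP.smooth 0).of_le (m := i) (mod_cast le_top))) x
      rw [hc, norm_smul, norm_pow, Real.norm_of_nonneg hε.le]
      calc _ ≤ 1 * ‖iteratedFDeriv ℝ i (LP.ρ 0) (ε • x)‖ := by
            gcongr; exact pow_le_one₀ hε.le hε1
        _ ≤ B := by
            rw [one_mul, ← hPρ]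
            refine (SchwartzMap.norm_iteratedFDeriv_le_seminorm ℝ P i _).trans ?_
            exact seminorm_le_sn (Nat.zero_le _) hi P
    have hD : ‖iteratedFDeriv ℝ l ((f - cutoff LP ε f : 𝓢(E d, F)) : E d → F) x‖ ≤
        ‖iteratedFDeriv ℝ l f x‖ +
          ∑ i ∈ Finset.range (l + 1), (l.choose i : ℝ) *
            ‖iteratedFDeriv ℝ i (fun x => LP.ρ 0 (ε • x)) x‖ * ‖iteratedFDeriv ℝ (l - i) f x‖ := by
      have hsub : iteratedFDeriv ℝ l ((f - cutoff LP ε f : 𝓢(E d, F)) : E d → F) x =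
          iteratedFDeriv ℝ l f x - iteratedFDeriv ℝ l (fun x => LP.ρ 0 (ε • x) • f x) x := by
        rw [hfun]
        exact iteratedFDeriv_sub_apply (f := f) (f.smooth l).contDiffAt
          (hρs.smul (f.smooth l)).contDiffAt
      rw [hsub]
      refine (norm_sub_le _ _).trans (add_le_add_right ?_ _)
      exact norm_iteratedFDeriv_smul_le hρs (f.smooth l) x le_rfl
    set A := (4 / 3) ^ M * ε ^ M * sn F (N + M) f with hA
    have hA0 : 0 ≤ A := by positivity
    calc _ ≤ ‖x‖ ^ k * (‖iteratedFDeriv ℝ l f x‖ +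
          ∑ i ∈ Finset.range (l + 1), (l.choose i : ℝ) * B * ‖iteratedFDeriv ℝ (l - i) f x‖) := by
          refine mul_le_mul_of_nonneg_left (hD.trans ?_) (by positivity)
          gcongr with i hi
          exact hder i (by have := Finset.mem_range.1 hi; omega)
      _ = ‖x‖ ^ k * ‖iteratedFDeriv ℝ l f x‖ +
          ∑ i ∈ Finset.range (l + 1), (l.choose i : ℝ) * B *
            (‖x‖ ^ k * ‖iteratedFDeriv ℝ (l - i) f x‖) := by
          rw [mul_add, Finset.mul_sum]
          congr 1
          exact Finset.sum_congr rfl fun i _ => by ring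
      _ ≤ A + ∑ i ∈ Finset.range (l + 1), (l.choose i : ℝ) * B * A := by
          gcongr with i hi
          · exact hxk l hl
          · exact hxk (l - i) (by omega)
      _ = A * (1 + 2 ^ l * B) := by
          rw [← Finset.sum_mul, ← Finset.sum_mul]
          have : ∑ i ∈ Finset.range (l + 1), (l.choose i : ℝ) = 2 ^ l := by
            exact_mod_cast Nat.sum_range_choose l
          rw [this]; ring
      _ ≤ A * (1 + 2 ^ N * B) := by gcongr; exact one_le_two
      _ = _ := by rw [hA]; ring

end

/-- Rapid decay of the high frequencies of a Schwartz function. -/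
theorem sn_sub_convS_lowKernel_le (LP : DyadicPartition d) (N M : ℕ) :
    ∃ N' C, 0 ≤ C ∧ ∀ (n : ℕ) (φ : 𝓢(E d, ℝ)),
      sn ℝ N (φ - convS (LP.lowKernel (n + 1)) φ) ≤ C * (((2 : ℝ) ^ n)⁻¹) ^ M * sn ℝ N' φ := by
  obtain ⟨N₁, C₁, hC₁, h₁⟩ := exists_sn_bound (d := d)
    (reS ∘L (FourierTransform.fourierInvCLM ℝ 𝓢(E d, ℂ) : 𝓢(E d, ℂ) →L[ℝ] 𝓢(E d, ℂ))) N
  obtain ⟨C₂, hC₂, h₂⟩ := sn_sub_cutoff_le LP (F := ℂ) N₁ M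
  obtain ⟨N₃, C₃, hC₃, h₃⟩ := exists_sn_bound (d := d)
    ((FourierTransform.fourierCLM ℝ 𝓢(E d, ℂ) : 𝓢(E d, ℂ) →L[ℝ] 𝓢(E d, ℂ)) ∘L toC) (N₁ + M)
  refine ⟨N₃, C₁ * C₂ * C₃, by positivity, fun n φ => ?_⟩
  set ε : ℝ := ((2 : ℝ) ^ n)⁻¹ with hε
  have hε0 : 0 < ε := by positivity
  have hε1 : ε ≤ 1 := inv_le_one_of_one_le₀ (one_le_pow₀ one_le_two)
  -- In Fourier variables the low-pass filter is the cutoff at `ε = 2⁻ⁿ`; the bound of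
  -- `sn_sub_cutoff_le` is carried back by continuity of the transform and of its inverse.
  have e : 𝓕 (toC (φ - convS (LP.lowKernel (n + 1)) φ)) =
      𝓕 (toC φ) - cutoff LP ε (𝓕 (toC φ)) := by
    ext ξ
    have : 𝓕 (toC (φ - convS (LP.lowKernel (n + 1)) φ)) =
        𝓕 (toC φ) - 𝓕 (toC (convS (LP.lowKernel (n + 1)) φ)) := by
      rw [map_sub]
      exact map_sub (FourierTransform.fourierCLM ℝ 𝓢(E d, ℂ)) _ _
    rw [this, sub_apply, sub_apply, fourier_toC_convS,
      LP.fourier_lowKernel, cutoff_apply, Complex.real_smul]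
  have e2 : φ - convS (LP.lowKernel (n + 1)) φ =
      reS (𝓕⁻ (𝓕 (toC φ) - cutoff LP ε (𝓕 (toC φ)))) := by
    rw [← e, FourierTransform.fourierInv_fourier_eq, reS_toC]
  rw [e2]
  calc _ ≤ C₁ * sn ℂ N₁ (𝓕 (toC φ) - cutoff LP ε (𝓕 (toC φ))) := h₁ _
    _ ≤ C₁ * (C₂ * ε ^ M * sn ℂ (N₁ + M) (𝓕 (toC φ))) := by
        gcongr; exact h₂ ε hε0 hε1 _
    _ ≤ C₁ * (C₂ * ε ^ M * (C₃ * sn ℝ N₃ φ)) := by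
        gcongr; exact h₃ φ
    _ = _ := by ring

end

/-! ### Littlewood-Paley analysis with polynomial weights -/

section

variable {d : ℕ}

/-! ## Littlewood-Paley decomposition -/

section Scales

theorem sc_eq_rpow (n : ℕ) : sc n = (2 : ℝ) ^ (1 - (n : ℝ)) := by
  rw [Real.rpow_sub two_pos, Real.rpow_one, Real.rpow_natCast]; rfl

theorem sc_le_sc_mul (m n k : ℕ) (h : n ≤ m + k) : sc m ≤ 2 ^ k * sc n := by
  unfold sc
  rw [← mul_div_assoc, div_le_div_iff₀ (by positivity) (by positivity)]
  have : (2 : ℝ) ^ n ≤ 2 ^ (m + k) := pow_le_pow_right₀ one_le_two h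
  rw [pow_add] at this
  nlinarith

theorem sc_rpow_pos (n : ℕ) (α : ℝ) : 0 < sc n ^ α := Real.rpow_pos_of_pos (sc_pos n) α

theorem sc_rpow_le_sc_rpow (m n k : ℕ) (h1 : m ≤ n + k) (h2 : n ≤ m + k) (α : ℝ) :
    sc m ^ α ≤ ((2 : ℝ) ^ k) ^ |α| * sc n ^ α := by
  rcases le_total 0 α with h | h
  · rw [abs_of_nonneg h, ← Real.mul_rpow (by positivity) (sc_pos n).le]
    exact Real.rpow_le_rpow (sc_pos m).le (sc_le_sc_mul m n k h2) h
  · rw [abs_of_nonpos h, Real.rpow_neg (by positivity), ← Real.inv_rpow (by positivity),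
      ← Real.mul_rpow (by positivity) (sc_pos n).le]
    refine Real.rpow_le_rpow_of_nonpos (mul_pos (by positivity) (sc_pos n)) ?_ h
    rw [inv_mul_le_iff₀ (by positivity)]
    exact sc_le_sc_mul n m k h1

end Scales

/-- All blocks of `u` satisfy `|Δ_{n-1} u| ≤ B 2^{-α(n-1)}`. -/
def BlockBd (LP : DyadicPartition d) (α B : ℝ) (u : TDist d) : Prop :=
  ∀ n x, |block LP n u x| ≤ B * sc n ^ α

theorem holderNorm_le_iff (LP : DyadicPartition d) (α : ℝ) {B : ℝ} (hB : 0 ≤ B) (u : TDist d) :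
    holderNorm LP α u ≤ ENNReal.ofReal B ↔ BlockBd LP α B u := by
  have key : ∀ (n : ℕ) x, ENNReal.ofReal ((2 : ℝ) ^ (α * ((n : ℝ) - 1))) * ‖block LP n u x‖ₑ ≤
      ENNReal.ofReal B ↔ |block LP n u x| ≤ B * sc n ^ α := by
    intro n x
    have hs : (2 : ℝ) ^ (α * ((n : ℝ) - 1)) = (sc n ^ α)⁻¹ := by
      rw [sc_eq_rpow, ← Real.rpow_mul two_pos.le, ← Real.rpow_neg two_pos.le]
      congr 1; ring
    rw [hs, ← ofReal_norm, ← ENNReal.ofReal_mul (inv_nonneg.2 (sc_rpow_pos n α).le),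
      ENNReal.ofReal_le_ofReal_iff hB, inv_mul_le_iff₀ (sc_rpow_pos n α), mul_comm B,
      Real.norm_eq_abs]
  unfold holderNorm BlockBd
  simp only [ENNReal.mul_iSup, iSup_le_iff, key]

theorem memHolder_iff (LP : DyadicPartition d) (α : ℝ) (u : TDist d) :
    MemHolder LP α u ↔ ∃ B, 0 ≤ B ∧ BlockBd LP α B u := by
  constructor
  · intro h
    refine ⟨(holderNorm LP α u).toReal, ENNReal.toReal_nonneg, ?_⟩
    rw [← holderNorm_le_iff LP α ENNReal.toReal_nonneg, ENNReal.ofReal_toReal h.ne]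
  · rintro ⟨B, hB, h⟩
    exact ((holderNorm_le_iff LP α hB u).2 h).trans_lt ENNReal.ofReal_lt_top

theorem block_add (LP : DyadicPartition d) (n : ℕ) (u v : TDist d) (x : E d) :
    block LP n (u + v) x = block LP n u x + block LP n v x := rfl

theorem block_sub (LP : DyadicPartition d) (n : ℕ) (u v : TDist d) (x : E d) :
    block LP n (u - v) x = block LP n u x - block LP n v x := rfl

theorem block_smul (LP : DyadicPartition d) (n : ℕ) (c : ℝ) (u : TDist d) (x : E d) :
    block LP n (c • u) x = c * block LP n u x := rfl

theorem block_zero (LP : DyadicPartition d) (n : ℕ) (x : E d) :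
    block LP n (0 : TDist d) x = 0 := rfl

theorem block_sum (LP : DyadicPartition d) (n : ℕ) {ι : Type*} (s : Finset ι) (u : ι → TDist d)
    (x : E d) : block LP n (∑ i ∈ s, u i) x = ∑ i ∈ s, block LP n (u i) x := by
  simp [block]

theorem BlockBd.mono {LP : DyadicPartition d} {α B B' : ℝ} {u : TDist d} (h : BlockBd LP α B u)
    (hB : B ≤ B') : BlockBd LP α B' u := fun n x =>
  (h n x).trans (mul_le_mul_of_nonneg_right hB (sc_rpow_pos n α).le)

theorem BlockBd.add {LP : DyadicPartition d} {α B B' : ℝ} {u v : TDist d} (h : BlockBd LP α B u)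
    (h' : BlockBd LP α B' v) : BlockBd LP α (B + B') (u + v) := fun n x => by
  rw [block_add, add_mul]
  exact (abs_add_le _ _).trans (add_le_add (h n x) (h' n x))

theorem BlockBd.smul {LP : DyadicPartition d} {α B : ℝ} {u : TDist d} (h : BlockBd LP α B u)
    (c : ℝ) : BlockBd LP α (|c| * B) (c • u) := fun n x => by
  rw [block_smul, abs_mul, mul_assoc]
  exact mul_le_mul_of_nonneg_left (h n x) (abs_nonneg c)

theorem BlockBd.zero (LP : DyadicPartition d) (α : ℝ) : BlockBd LP α 0 (0 : TDist d) :=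
  fun n x => by simp [block_zero]

theorem BlockBd.sum {LP : DyadicPartition d} {α : ℝ} {ι : Type*} (s : Finset ι) {B : ι → ℝ}
    {u : ι → TDist d} (h : ∀ i ∈ s, BlockBd LP α (B i) (u i)) :
    BlockBd LP α (∑ i ∈ s, B i) (∑ i ∈ s, u i) := fun n x => by
  rw [block_sum, Finset.sum_mul]
  exact (Finset.abs_sum_le_sum_abs _ _).trans (Finset.sum_le_sum fun i hi => h i hi n x)

theorem BlockBd.of_le {LP : DyadicPartition d} {α β B : ℝ} {u : TDist d} (h : BlockBd LP α B u)
    (hB : 0 ≤ B) (hβ : β ≤ α) : BlockBd LP β (2 ^ (α - β) * B) u := fun n x => by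
  refine (h n x).trans ?_
  have : sc n ^ α ≤ 2 ^ (α - β) * sc n ^ β := by
    have e : sc n ^ α = sc n ^ (α - β) * sc n ^ β := by
      rw [← Real.rpow_add (sc_pos n)]; congr 1; ring
    rw [e]
    exact mul_le_mul_of_nonneg_right
      (Real.rpow_le_rpow (sc_pos n).le (sc_le_two n) (by linarith)) (sc_rpow_pos n β).le
  nlinarith

theorem convS_sub_right (K φ ψ : 𝓢(E d, ℝ)) : convS K (φ - ψ) = convS K φ - convS K ψ := by
  rw [DyadicPartition.convS_kernel_comm, DyadicPartition.convS_kernel_comm K φ,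
    DyadicPartition.convS_kernel_comm K ψ]
  simp [convS]

theorem lowKernel_succ_eq_add (LP : DyadicPartition d) (n : ℕ) :
    LP.lowKernel (n + 1) = LP.lowKernel n + LP.kernel n := by
  rw [DyadicPartition.lowKernel, Finset.sum_range_succ]; rfl

theorem half_pow_mul_two_pow (n : ℕ) : (((2 : ℝ) ^ n)⁻¹) = (1 / 2) ^ n := by
  rw [one_div, inv_pow]

/-- The Littlewood-Paley decomposition of a tempered distribution. -/
theorem hasSum_integral_block (LP : DyadicPartition d) (u : TDist d) (φ : 𝓢(E d, ℝ)) :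
    HasSum (fun n => ∫ y, φ y * block LP n u y) (u φ) := by
  obtain ⟨N, C, hC, hu⟩ := u.exists_bound
  obtain ⟨N', C', hC', hφ⟩ := sn_sub_convS_lowKernel_le LP N 1
  have hb : ∀ n, |u φ - u (convS (LP.lowKernel (n + 1)) φ)| ≤
      (C * (C' * sn ℝ N' φ)) * (1 / 2) ^ n := fun n => by
    rw [← map_sub]
    refine (hu _).trans ?_
    calc _ ≤ C * (C' * (((2 : ℝ) ^ n)⁻¹) ^ 1 * sn ℝ N' φ) := by gcongr; exact hφ n φ
      _ = _ := by rw [pow_one, half_pow_mul_two_pow]; ring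
  have hgeo : Tendsto (fun n : ℕ => (C * (C' * sn ℝ N' φ)) * (1 / 2 : ℝ) ^ n) atTop (𝓝 0) := by
    simpa using (tendsto_pow_atTop_nhds_zero_of_lt_one (r := (1 / 2 : ℝ)) (by norm_num)
      (by norm_num)).const_mul (C * (C' * sn ℝ N' φ))
  have hlim : Tendsto (fun n => u (convS (LP.lowKernel (n + 1)) φ)) atTop (𝓝 (u φ)) := by
    rw [tendsto_iff_norm_sub_tendsto_zero]
    refine squeeze_zero (fun _ => norm_nonneg _) (fun n => ?_) hgeo
    rw [norm_sub_rev]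
    exact hb n
  have hterm : ∀ n, ∫ y, φ y * block LP n u y = u (convS (LP.kernel n) φ) := fun n =>
    (apply_convS_kernel LP n u φ).2.symm
  simp only [hterm]
  have hsum : ∀ n, ∑ m ∈ Finset.range n, u (convS (LP.kernel m) φ) =
      u (convS (LP.lowKernel n) φ) := fun n => by
    rw [DyadicPartition.lowKernel, convS_sum_left, map_sum]
  -- `HasSum` is unconditional, so convergence of the partial sums is not enough. Each term is a
  -- difference of two consecutive low-pass errors, hence is geometrically small.
  have hsm : Summable fun n => u (convS (LP.kernel n) φ) := by
    rw [← summable_nat_add_iff 1]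
    refine Summable.of_norm_bounded (g := fun n : ℕ => 2 * (C * (C' * sn ℝ N' φ)) * (1 / 2 : ℝ) ^ n)
      ((summable_geometric_of_lt_one (by norm_num) (by norm_num)).mul_left _) fun n => ?_
    have e : convS (LP.kernel (n + 1)) φ =
        convS (LP.lowKernel (n + 1 + 1)) φ - convS (LP.lowKernel (n + 1)) φ := by
      rw [lowKernel_succ_eq_add LP (n + 1), convS_add_left]; abel
    rw [e, map_sub, Real.norm_eq_abs]
    have h1 := hb n
    have h2 := hb (n + 1)
    rw [abs_le] at h1 h2 ⊢
    have h3 : (C * (C' * sn ℝ N' φ)) * (1 / 2 : ℝ) ^ (n + 1) ≤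
        (C * (C' * sn ℝ N' φ)) * (1 / 2 : ℝ) ^ n := by
      have := sn_nonneg N' φ
      refine mul_le_mul_of_nonneg_left ?_ (by positivity)
      exact pow_le_pow_of_le_one (by norm_num) (by norm_num) (Nat.le_succ n)
    constructor <;> linarith [h1.1, h1.2, h2.1, h2.2]
  rw [hsm.hasSum_iff_tendsto_nat]
  simp only [hsum]
  exact (tendsto_add_atTop_iff_nat 1).1 hlim

theorem eq_zero_of_block_eq_zero (LP : DyadicPartition d) {u : TDist d}
    (h : ∀ n x, block LP n u x = 0) : u = 0 := by
  ext φ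
  have := hasSum_integral_block LP u φ
  simp only [h, mul_zero, integral_zero] at this
  exact this.unique hasSum_zero

/-! ## Weighted kernel bounds -/

section Weights

theorem exists_weighted_integral_le (M : ℕ) : ∃ (N : ℕ) (C : ℝ), 0 ≤ C ∧ ∀ ψ : 𝓢(E d, ℝ),
    Integrable (fun y => (1 + ‖y‖) ^ M * |ψ y|) ∧
      ∫ y, (1 + ‖y‖) ^ M * |ψ y| ≤ C * sn ℝ N ψ := by
  set n := d + 1
  have hi : Integrable fun y : E d => (1 + ‖y‖) ^ (-(n : ℝ)) := by
    apply integrable_one_add_norm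
    simp [n]
  refine ⟨M + n, 2 ^ (M + n) * ∫ y : E d, (1 + ‖y‖) ^ (-(n : ℝ)), ?_, fun ψ => ?_⟩
  · have : 0 ≤ ∫ y : E d, (1 + ‖y‖) ^ (-(n : ℝ)) := integral_nonneg fun y => by positivity
    positivity
  have hle : ∀ y, (1 + ‖y‖) ^ M * |ψ y| ≤
      (2 ^ (M + n) * sn ℝ (M + n) ψ) * (1 + ‖y‖) ^ (-(n : ℝ)) := fun y => by
    have := one_add_pow_mul_apply_le_sn (le_refl (M + n)) ψ y
    rw [Real.rpow_neg (by positivity), Real.rpow_natCast, ← div_eq_mul_inv,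
      le_div_iff₀ (by positivity)]
    calc _ = (1 + ‖y‖) ^ (M + n) * ‖ψ y‖ := by rw [pow_add, Real.norm_eq_abs]; ring
      _ ≤ _ := this
  have hInt : Integrable fun y => (1 + ‖y‖) ^ M * |ψ y| := by
    refine (hi.const_mul (2 ^ (M + n) * sn ℝ (M + n) ψ)).mono' ?_
      (Eventually.of_forall fun y => ?_)
    · have : Continuous ψ := ψ.continuous
      exact Continuous.aestronglyMeasurable (by fun_prop)
    · rw [Real.norm_of_nonneg (by positivity)]
      exact hle y
  refine ⟨hInt, ?_⟩
  refine (integral_mono hInt (hi.const_mul _) hle).trans ?_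
  rw [integral_const_mul]
  exact le_of_eq (by ring)

theorem exists_integral_abs_le : ∃ (N : ℕ) (C : ℝ), 0 ≤ C ∧ ∀ ψ : 𝓢(E d, ℝ),
    ∫ y, |ψ y| ≤ C * sn ℝ N ψ := by
  obtain ⟨N, C, hC, h⟩ := exists_weighted_integral_le (d := d) 0
  exact ⟨N, C, hC, fun ψ => by simpa using (h ψ).2⟩

theorem integral_comp_rescale (G : E d → ℝ) {l : ℝ} (hl : 0 < l) (z : E d) :
    ∫ v, (l ^ d)⁻¹ * G (l⁻¹ • (z - v)) = ∫ v, G v := by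
  rw [integral_const_mul, integral_sub_left_eq_self (fun v => G (l⁻¹ • v)),
    Measure.integral_comp_inv_smul_of_nonneg volume G hl.le]
  simp only [finrank_euclideanSpace, Fintype.card_fin, smul_eq_mul]
  rw [← mul_assoc, inv_mul_cancel₀ (by positivity), one_mul]

theorem integrable_comp_rescale {G : E d → ℝ} (hG : Integrable G) {l : ℝ} (hl : 0 < l) (z : E d) :
    Integrable fun v => (l ^ d)⁻¹ * G (l⁻¹ • (z - v)) :=
  ((hG.comp_smul (inv_ne_zero hl.ne')).comp_sub_left z).const_mul _

/-- Rescaled Schwartz kernels preserve polynomial weights. -/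
theorem exists_rescale_weight (ψ : 𝓢(E d, ℝ)) {s : ℝ} (hs : 0 ≤ s) :
    ∃ C, 0 ≤ C ∧ ∀ (l : ℝ) (hl : 0 < l) (a : ℝ), l ≤ a → ∀ z x : E d,
      Integrable (fun v => |rescale ψ l hl 0 (z - v)| * (a + ‖v - x‖) ^ s) ∧
      ∫ v, |rescale ψ l hl 0 (z - v)| * (a + ‖v - x‖) ^ s ≤ C * (a + ‖z - x‖) ^ s := by
  set M := ⌈s⌉₊
  obtain ⟨N, C, hC, h⟩ := exists_weighted_integral_le (d := d) M
  obtain ⟨hi, hle⟩ := h ψ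
  refine ⟨C * sn ℝ N ψ, by have := sn_nonneg N ψ; positivity, fun l hl a hla z x => ?_⟩
  have ha : 0 < a := hl.trans_le hla
  have hpt : ∀ v, |rescale ψ l hl 0 (z - v)| * (a + ‖v - x‖) ^ s ≤
      (a + ‖z - x‖) ^ s * ((l ^ d)⁻¹ * ((1 + ‖l⁻¹ • (z - v)‖) ^ M * |ψ (l⁻¹ • (z - v))|)) := by
    intro v
    rw [rescale_apply, sub_zero, abs_mul, abs_of_nonneg (by positivity : 0 ≤ (l ^ d)⁻¹)]
    have h1 : a + ‖v - x‖ ≤ (a + ‖z - x‖) * (1 + ‖l⁻¹ • (z - v)‖) := by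
      have h2 : ‖v - x‖ ≤ ‖z - v‖ + ‖z - x‖ := by
        have := norm_add_le (v - z) (z - x)
        rwa [sub_add_sub_cancel, norm_sub_rev v z] at this
      rw [norm_smul, Real.norm_of_nonneg (inv_nonneg.2 hl.le)]
      have h3 : ‖z - v‖ ≤ a * (l⁻¹ * ‖z - v‖) := by
        rw [← mul_assoc]
        refine le_mul_of_one_le_left (norm_nonneg _) ?_
        rw [← div_eq_mul_inv, one_le_div hl]; exact hla
      have h4 : 0 ≤ ‖z - x‖ * (l⁻¹ * ‖z - v‖) := by positivity
      nlinarith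
    have h5 : (a + ‖v - x‖) ^ s ≤ (a + ‖z - x‖) ^ s * (1 + ‖l⁻¹ • (z - v)‖) ^ M := by
      calc _ ≤ ((a + ‖z - x‖) * (1 + ‖l⁻¹ • (z - v)‖)) ^ s := by
            refine Real.rpow_le_rpow (by positivity) h1 hs
        _ = (a + ‖z - x‖) ^ s * (1 + ‖l⁻¹ • (z - v)‖) ^ s :=
            Real.mul_rpow (by positivity) (by positivity)
        _ ≤ _ := by
            gcongr
            rw [← Real.rpow_natCast]
            refine Real.rpow_le_rpow_of_exponent_le ?_ (Nat.le_ceil s)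
            linarith [norm_nonneg (l⁻¹ • (z - v))]
    calc _ ≤ ((l ^ d)⁻¹ * |ψ (l⁻¹ • (z - v))|) *
          ((a + ‖z - x‖) ^ s * (1 + ‖l⁻¹ • (z - v)‖) ^ M) := by gcongr
      _ = _ := by ring
  have hmaj : Integrable fun v => (a + ‖z - x‖) ^ s *
      ((l ^ d)⁻¹ * ((1 + ‖l⁻¹ • (z - v)‖) ^ M * |ψ (l⁻¹ • (z - v))|)) :=
    (integrable_comp_rescale hi hl z).const_mul _
  have hInt : Integrable fun v => |rescale ψ l hl 0 (z - v)| * (a + ‖v - x‖) ^ s := by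
    refine hmaj.mono' (Continuous.aestronglyMeasurable ?_) (Eventually.of_forall fun v => ?_)
    · have hc : Continuous (rescale ψ l hl 0) := (rescale ψ l hl 0).continuous
      refine (hc.comp (continuous_const.sub continuous_id)).abs.mul ?_
      refine Continuous.rpow_const (by fun_prop) fun v => Or.inr hs
    · rw [Real.norm_of_nonneg (by positivity)]
      exact hpt v
  refine ⟨hInt, (integral_mono hInt hmaj hpt).trans ?_⟩
  rw [integral_const_mul,
    integral_comp_rescale (fun v => (1 + ‖v‖) ^ M * |ψ v|) hl z, mul_comm]
  gcongr

theorem rescale_one_zero (ψ : 𝓢(E d, ℝ)) : rescale ψ 1 one_pos 0 = ψ := by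
  ext x; rw [rescale_apply]; simp

/-- The constant is uniform in `n` because all kernels are rescalings of two fixed Schwartz
functions. The kernel of index `0` has natural scale `1`, whereas `sc 0 = 2`; this only makes the
condition on `a` stronger. -/
theorem exists_kernel_weight (LP : DyadicPartition d) {s : ℝ} (hs : 0 ≤ s) :
    ∃ C, 0 ≤ C ∧ ∀ (n : ℕ) (a : ℝ), sc n ≤ a → ∀ z x : E d,
      Integrable (fun v => |LP.kernel n (z - v)| * (a + ‖v - x‖) ^ s) ∧
      ∫ v, |LP.kernel n (z - v)| * (a + ‖v - x‖) ^ s ≤ C * (a + ‖z - x‖) ^ s := by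
  obtain ⟨C₀, hC₀, h₀⟩ := exists_rescale_weight (LP.kernel 0) hs
  obtain ⟨C₁, hC₁, h₁⟩ := exists_rescale_weight (LP.kernel 1) hs
  refine ⟨max C₀ C₁, by positivity, fun n a ha z x => ?_⟩
  have ha0 : 0 < a := (sc_pos n).trans_le ha
  rcases n with _ | n
  · have := h₀ 1 one_pos a (by simp [sc] at ha; linarith) z x
    rw [rescale_one_zero] at this
    exact ⟨this.1, this.2.trans (by gcongr; exact le_max_left _ _)⟩
  · rw [LP.kernel_succ]
    have := h₁ _ (sc_pos (n + 1)) a ha z x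
    exact ⟨this.1, this.2.trans (by gcongr; exact le_max_right _ _)⟩

theorem exists_lowKernel_weight (LP : DyadicPartition d) {s : ℝ} (hs : 0 ≤ s) :
    ∃ C, 0 ≤ C ∧ ∀ (n : ℕ) (a : ℝ), sc n ≤ a → ∀ z x : E d,
      Integrable (fun v => |LP.lowKernel n (z - v)| * (a + ‖v - x‖) ^ s) ∧
      ∫ v, |LP.lowKernel n (z - v)| * (a + ‖v - x‖) ^ s ≤ C * (a + ‖z - x‖) ^ s := by
  obtain ⟨C₀, hC₀, h₀⟩ := exists_rescale_weight (LP.kernel 0) hs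
  refine ⟨C₀, hC₀, fun n a ha z x => ?_⟩
  have ha0 : 0 < a := (sc_pos n).trans_le ha
  rcases n with _ | n
  · simp only [DyadicPartition.lowKernel, Finset.range_zero, Finset.sum_empty, zero_apply,
      abs_zero, zero_mul, integral_zero]
    exact ⟨integrable_zero _ _ _, by positivity⟩
  · rw [LP.lowKernel_succ]
    exact h₀ _ (sc_pos (n + 1)) a ha z x

end Weights

/-! ## Bounds for tempered distributions with bounded blocks -/

theorem convS_translate (K ψ : 𝓢(E d, ℝ)) (x : E d) :
    convS K (translate ψ x) = translate (convS K ψ) x := by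
  refine injective_fourier_toC fun ξ => ?_
  rw [fourier_toC_convS, translate_eq_rescale, translate_eq_rescale, fourier_toC_rescale,
    fourier_toC_rescale, one_smul, fourier_toC_convS]
  ring

/-- The blocks `m ≤ n - 2` have `sc m ≥ 4 sc n`, and `8/3 < 4 · 3/4` separates their spectra from
that of block `n`. For `n ≤ 1` the low-pass kernel is an empty sum. -/
theorem convS_kernel_lowKernel_eq_zero (LP : DyadicPartition d) (n : ℕ) (φ : 𝓢(E d, ℝ)) :
    convS (LP.kernel n) (convS (LP.lowKernel (n - 1)) φ) = 0 := by
  rw [DyadicPartition.lowKernel, convS_sum_left]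
  refine injective_fourier_toC fun ξ => ?_
  have hsum : 𝓕 (toC (∑ i ∈ Finset.range (n - 1), convS (LP.kernel i) φ)) =
      ∑ i ∈ Finset.range (n - 1), 𝓕 (toC (convS (LP.kernel i) φ)) := by
    rw [map_sum]
    exact map_sum (FourierTransform.fourierCLM ℝ 𝓢(E d, ℂ)) _ _
  have h0 : 𝓕 (toC (0 : 𝓢(E d, ℝ))) ξ = 0 := by
    rw [map_zero]
    have : 𝓕 (0 : 𝓢(E d, ℂ)) = 0 := map_zero (FourierTransform.fourierCLM ℝ 𝓢(E d, ℂ))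
    rw [this]; rfl
  rw [fourier_toC_convS, hsum, h0, LP.fourier_kernel]
  by_cases hn : LP.ρ n ξ = 0
  · simp [hn]
  rw [sum_apply, Finset.sum_eq_zero, mul_zero]
  intro m hm
  rw [fourier_toC_convS, LP.fourier_kernel]
  have hm' := Finset.mem_range.1 hm
  have hρ : LP.ρ m ξ = 0 := by
    by_contra hne
    have h1 := LP.lt_of_ρ_ne hne
    have h2 := LP.gt_of_ρ_ne (by omega) hn
    have h3 : 4 * sc n ≤ sc m := by
      unfold sc
      rw [← mul_div_assoc, div_le_div_iff₀ (by positivity) (by positivity)]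
      have : (2 : ℝ) ^ (m + 2) ≤ 2 ^ n := pow_le_pow_right₀ one_le_two (by omega)
      rw [pow_add] at this
      linarith
    nlinarith [norm_nonneg ξ]
  simp [hρ]

/-- What block `n` of a distribution, or term `n` of a paraproduct, sees of a test function once its
invisible low frequencies are removed: in `L¹` this decays faster than any power of `2⁻ⁿ`. -/
theorem exists_integral_sub_convS_lowKernel_le (LP : DyadicPartition d) (c M : ℕ) :
    ∃ (N : ℕ) (D : ℝ), 0 ≤ D ∧ ∀ (n : ℕ) (ψ : 𝓢(E d, ℝ)),
      ∫ y, |(ψ - convS (LP.lowKernel (n - c)) ψ) y| ≤ D * ((1 / 2) ^ n) ^ M * sn ℝ N ψ := by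
  obtain ⟨N₀, C₀, hC₀, h₀⟩ := exists_integral_abs_le (d := d)
  obtain ⟨N₁, C₁, hC₁, h₁⟩ := sn_sub_convS_lowKernel_le LP N₀ M
  set N := max N₀ N₁
  set b : ℝ := 2 ^ (c + 1) with hb
  have hb0 : 0 < b := by positivity
  set D : ℝ := C₀ * (C₁ * b ^ M + b ^ M) with hD
  refine ⟨N, D, by positivity, fun n ψ => ?_⟩
  refine (h₀ _).trans ?_
  have hs := sn_nonneg N ψ
  rcases Nat.lt_or_ge n (c + 1) with hn | hn
  -- Here the truncated subtraction gives `n - c = 0` and nothing is removed; the missing decay is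
  -- absorbed in `b ^ M`, since `b (1/2) ^ n ≥ 1`.
  · have h0 : LP.lowKernel (n - c) = 0 := by
      rw [show n - c = 0 by omega]; simp [DyadicPartition.lowKernel]
    have : convS (0 : 𝓢(E d, ℝ)) ψ = 0 := by simp [convS]
    rw [h0, this, sub_zero]
    have h2 : (1 : ℝ) ≤ b ^ M * ((1 / 2) ^ n) ^ M := by
      rw [← mul_pow]
      refine one_le_pow₀ ?_
      rw [one_div, inv_pow, ← div_eq_mul_inv, one_le_div (by positivity)]
      exact pow_le_pow_right₀ one_le_two hn.le
    calc C₀ * sn ℝ N₀ ψ ≤ C₀ * sn ℝ N ψ := by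
          gcongr; exact sn_mono (le_max_left _ _) ψ
      _ = C₀ * 1 * sn ℝ N ψ := by ring
      _ ≤ C₀ * (b ^ M * ((1 / 2) ^ n) ^ M) * sn ℝ N ψ := by gcongr
      _ ≤ C₀ * ((C₁ * b ^ M + b ^ M) * ((1 / 2) ^ n) ^ M) * sn ℝ N ψ := by
          gcongr; linarith [show 0 ≤ C₁ * b ^ M by positivity]
      _ = _ := by rw [hD]; ring
  · obtain ⟨k, rfl⟩ := Nat.exists_eq_add_of_le' hn
    have hk : k + (c + 1) - c = k + 1 := by omega
    rw [hk]
    calc _ ≤ C₀ * (C₁ * (((2 : ℝ) ^ k)⁻¹) ^ M * sn ℝ N₁ ψ) := by gcongr; exact h₁ k ψ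
      _ ≤ C₀ * (C₁ * (((2 : ℝ) ^ k)⁻¹) ^ M * sn ℝ N ψ) := by
          gcongr; exact sn_mono (le_max_right _ _) ψ
      _ = C₀ * (C₁ * b ^ M) * ((1 / 2) ^ (k + (c + 1))) ^ M * sn ℝ N ψ := by
          have : (((2 : ℝ) ^ k)⁻¹) ^ M = b ^ M * ((1 / 2) ^ (k + (c + 1))) ^ M := by
            rw [half_pow_mul_two_pow, ← mul_pow, hb]; congr 1
            rw [pow_add (1 / 2 : ℝ), mul_left_comm, ← mul_pow]; norm_num
          rw [this]; ring
      _ ≤ _ := by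
          rw [hD]; gcongr; linarith [show (0 : ℝ) ≤ b ^ M by positivity]

/-- The exponent `⌈|α|⌉₊ + 1` beats the possible growth of `sc n ^ α` and leaves one geometric
factor, which makes series over the blocks converge whatever the sign of `α`. -/
theorem half_pow_mul_sc_rpow_le (n : ℕ) (α : ℝ) :
    ((1 / 2 : ℝ) ^ n) ^ (⌈|α|⌉₊ + 1) * sc n ^ α ≤ 2 ^ |α| * (1 / 2) ^ n := by
  have h1 : sc n ^ α = 2 ^ α * ((1 / 2 : ℝ) ^ n) ^ α := by
    rw [← Real.mul_rpow (by norm_num) (by positivity)]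
    congr 1
    rw [sc, one_div, inv_pow]; rfl
  set t : ℝ := (1 / 2) ^ n with ht
  have ht0 : 0 < t := by positivity
  have ht1 : t ≤ 1 := pow_le_one₀ (by norm_num) (by norm_num)
  have h2 : t ^ (⌈|α|⌉₊ + 1) * t ^ α ≤ t := by
    rw [← Real.rpow_natCast, ← Real.rpow_add ht0]
    calc t ^ (((⌈|α|⌉₊ + 1 : ℕ) : ℝ) + α) ≤ t ^ (1 : ℝ) := by
          refine Real.rpow_le_rpow_of_exponent_ge ht0 ht1 ?_
          have h4 := Nat.le_ceil |α|
          have h5 := neg_abs_le α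
          push_cast; linarith
      _ = t := Real.rpow_one t
  rw [h1]
  calc t ^ (⌈|α|⌉₊ + 1) * (2 ^ α * t ^ α) = 2 ^ α * (t ^ (⌈|α|⌉₊ + 1) * t ^ α) := by ring
    _ ≤ 2 ^ |α| * t := by
        gcongr
        · exact one_le_two
        · exact le_abs_self α

theorem BlockBd.nonneg {LP : DyadicPartition d} {α B : ℝ} {u : TDist d} (hu : BlockBd LP α B u) :
    0 ≤ B :=
  nonneg_of_mul_nonneg_left ((abs_nonneg _).trans (hu 0 0)) (sc_rpow_pos 0 α)

/-- A distribution with bounded blocks is bounded by a translation invariant seminorm. -/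
theorem exists_apply_translate_le (LP : DyadicPartition d) (α : ℝ) :
    ∃ (N : ℕ) (C : ℝ), 0 ≤ C ∧ ∀ (B : ℝ) (u : TDist d), BlockBd LP α B u →
      ∀ (ψ : 𝓢(E d, ℝ)) (x : E d), |u (translate ψ x)| ≤ C * B * sn ℝ N ψ := by
  obtain ⟨N, D, hD, hL1⟩ := exists_integral_sub_convS_lowKernel_le LP 1 (⌈|α|⌉₊ + 1)
  refine ⟨N, ∑' n : ℕ, 2 ^ |α| * D * (1 / 2) ^ n, tsum_nonneg fun n => by positivity,
    fun B u hu ψ x => ?_⟩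
  have hB := hu.nonneg
  have hterm : ∀ n, ‖∫ y, translate ψ x y * block LP n u y‖ ≤
      (2 ^ |α| * D * (1 / 2) ^ n) * (B * sn ℝ N ψ) := by
    intro n
    -- The low frequencies of `ψ` are invisible to block `n` and are subtracted, so that the fast
    -- `L¹` decay of the rest is available. Bounds on the blocks and `L¹` norms are both translation
    -- invariant, hence no loss in `x`.
    have e : ∫ y, translate ψ x y * block LP n u y =
        ∫ y, (ψ - convS (LP.lowKernel (n - 1)) ψ) (y - x) * block LP n u y := by
      rw [← (apply_convS_kernel LP n u (translate ψ x)).2]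
      have h2 := (apply_convS_kernel LP n u
        (translate (ψ - convS (LP.lowKernel (n - 1)) ψ) x)).2
      simp only [SchwartzMap.compSubConstCLM_apply] at h2
      rw [← h2]
      congr 1
      have h3 : translate (ψ - convS (LP.lowKernel (n - 1)) ψ) x =
        translate ψ x - translate (convS (LP.lowKernel (n - 1)) ψ) x := map_sub _ _ _
      rw [h3, convS_sub_right, ← convS_translate, convS_kernel_lowKernel_eq_zero, sub_zero]
    rw [e]
    calc _ ≤ ∫ y, |(ψ - convS (LP.lowKernel (n - 1)) ψ) (y - x)| * (B * sc n ^ α) := by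
          refine norm_integral_le_of_norm_le ?_ (Eventually.of_forall fun y => ?_)
          · exact ((ψ - convS (LP.lowKernel (n - 1)) ψ).integrable.abs.comp_sub_right x).mul_const _
          · rw [norm_mul]
            exact mul_le_mul_of_nonneg_left (hu n y) (norm_nonneg _)
      _ = (∫ y, |(ψ - convS (LP.lowKernel (n - 1)) ψ) y|) * (B * sc n ^ α) := by
          rw [integral_mul_const, integral_sub_right_eq_self
            (fun y => |(ψ - convS (LP.lowKernel (n - 1)) ψ) y|)]
      _ ≤ (D * ((1 / 2) ^ n) ^ (⌈|α|⌉₊ + 1) * sn ℝ N ψ) * (B * sc n ^ α) := by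
          have := (sc_rpow_pos n α).le
          gcongr
          exact hL1 n ψ
      _ = D * (B * sn ℝ N ψ) * (((1 / 2) ^ n) ^ (⌈|α|⌉₊ + 1) * sc n ^ α) := by ring
      _ ≤ D * (B * sn ℝ N ψ) * (2 ^ |α| * (1 / 2) ^ n) := by
          have := sn_nonneg N ψ
          exact mul_le_mul_of_nonneg_left (half_pow_mul_sc_rpow_le n α) (by positivity)
      _ = _ := by ring
  have hsm : Summable fun n : ℕ => 2 ^ |α| * D * (1 / 2 : ℝ) ^ n :=
    (summable_geometric_of_lt_one (by norm_num) (by norm_num)).mul_left _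
  rw [← (hasSum_integral_block LP u (translate ψ x)).tsum_eq, ← Real.norm_eq_abs]
  calc _ ≤ ∑' n : ℕ, (2 ^ |α| * D * (1 / 2) ^ n) * (B * sn ℝ N ψ) :=
        tsum_of_norm_bounded (hsm.mul_right _).hasSum hterm
    _ = _ := by rw [tsum_mul_right]; ring

end

/-! ### Paraproducts: convergence and weighted block estimates -/

section

variable {d : ℕ}

/-! ## Bounded continuous functions as distributions -/

/-- Bounded continuous functions. -/
structure BddCont (F : E d → ℝ) : Prop where
  cont : Continuous F
  bdd : ∃ A, ∀ x, |F x| ≤ A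

namespace BddCont

theorem const (c : ℝ) : BddCont fun _ : E d => c := ⟨continuous_const, |c|, fun _ => le_rfl⟩

theorem add {F G : E d → ℝ} (hF : BddCont F) (hG : BddCont G) : BddCont fun x => F x + G x := by
  obtain ⟨hFc, A, hA⟩ := hF
  obtain ⟨hGc, B, hB⟩ := hG
  exact ⟨hFc.add hGc, A + B, fun x => (abs_add_le _ _).trans (add_le_add (hA x) (hB x))⟩

theorem mul {F G : E d → ℝ} (hF : BddCont F) (hG : BddCont G) : BddCont fun x => F x * G x := by
  obtain ⟨hFc, A, hA⟩ := hF
  obtain ⟨hGc, B, hB⟩ := hG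
  refine ⟨hFc.mul hGc, A * B, fun x => ?_⟩
  rw [abs_mul]
  exact mul_le_mul (hA x) (hB x) (abs_nonneg _) ((abs_nonneg _).trans (hA x))

theorem const_mul {F : E d → ℝ} (hF : BddCont F) (c : ℝ) : BddCont fun x => c * F x :=
  (const c).mul hF

theorem sub {F G : E d → ℝ} (hF : BddCont F) (hG : BddCont G) : BddCont fun x => F x - G x := by
  simpa [sub_eq_add_neg] using hF.add (hG.const_mul (-1))

theorem sum {ι : Type*} (s : Finset ι) {F : ι → E d → ℝ} (hF : ∀ i ∈ s, BddCont (F i)) :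
    BddCont fun x => ∑ i ∈ s, F i x := by
  classical
  induction s using Finset.induction_on with
  | empty => simpa using const 0
  | insert a s ha ih =>
    simp only [Finset.sum_insert ha]
    exact (hF a (Finset.mem_insert_self a s)).add
      (ih fun i hi => hF i (Finset.mem_insert_of_mem hi))

theorem nonneg_bound {F : E d → ℝ} {A : ℝ} (h : ∀ x, |F x| ≤ A) : 0 ≤ A :=
  (abs_nonneg _).trans (h 0)

theorem integrable_mul {F : E d → ℝ} (hF : BddCont F) {g : E d → ℝ} (hg : Integrable g) :
    Integrable fun x => g x * F x := by
  obtain ⟨hFc, A, hA⟩ := hF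
  exact hg.mul_bdd hFc.aestronglyMeasurable (Eventually.of_forall hA)

end BddCont

theorem integrable_comp_sub_left (K : 𝓢(E d, ℝ)) (x : E d) : Integrable fun y => K (x - y) :=
  K.integrable.comp_sub_left x

theorem BddCont.integrable_conv {F : E d → ℝ} (hF : BddCont F) (K : 𝓢(E d, ℝ)) (x : E d) :
    Integrable fun y => K (x - y) * F y :=
  hF.integrable_mul (integrable_comp_sub_left K x)

theorem BddCont.conv {F : E d → ℝ} (hF : BddCont F) (K : 𝓢(E d, ℝ)) :
    BddCont fun x => ∫ y, K (x - y) * F y := by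
  obtain ⟨hFc, A, hA⟩ := hF
  have e : (fun x => ∫ y, K (x - y) * F y) = fun x => ∫ y, K y * F (x - y) := by
    ext x
    rw [← integral_sub_left_eq_self _ volume x]
    simp
  constructor
  · rw [e]
    refine continuous_of_dominated (bound := fun y => ‖K y‖ * A) (fun x => ?_) (fun x => ?_)
      (K.integrable.norm.mul_const A) (Eventually.of_forall fun y => ?_)
    · exact (K.continuous.mul (hFc.comp (continuous_const.sub continuous_id))).aestronglyMeasurable
    · refine Eventually.of_forall fun y => ?_
      rw [norm_mul]
      exact mul_le_mul_of_nonneg_left (hA _) (norm_nonneg _)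
    · exact continuous_const.mul (hFc.comp (continuous_id.sub continuous_const))
  · refine ⟨∫ y, ‖K y‖ * A, fun x => ?_⟩
    rw [congrFun e x, ← Real.norm_eq_abs]
    refine norm_integral_le_of_norm_le (K.integrable.norm.mul_const A)
      (Eventually.of_forall fun y => ?_)
    rw [norm_mul]
    exact mul_le_mul_of_nonneg_left (hA _) (norm_nonneg _)

open Classical in
/-- The tempered distribution given by integration against a bounded continuous function (zero for
other functions). -/
def distOf (F : E d → ℝ) : TDist d :=
  if hF : BddCont F then
    TDist.mk' (fun φ => ∫ x, φ x * F x)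
      (fun f g => by
        simp only [add_apply, add_mul]
        exact integral_add (hF.integrable_mul f.integrable) (hF.integrable_mul g.integrable))
      (fun a f => by
        simp only [smul_apply, smul_eq_mul, mul_assoc]
        exact integral_const_mul _ _)
      (by
        obtain ⟨N, C, hC, h⟩ := exists_integral_abs_le (d := d)
        obtain ⟨A, hA⟩ := hF.bdd
        have hA0 := BddCont.nonneg_bound hA
        refine ⟨N, C * A, by positivity, fun φ => ?_⟩
        rw [← Real.norm_eq_abs]
        calc _ ≤ ∫ x, |φ x| * A := by
              refine norm_integral_le_of_norm_le (φ.integrable.abs.mul_const A)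
                (Eventually.of_forall fun y => ?_)
              rw [norm_mul]
              exact mul_le_mul_of_nonneg_left (hA _) (norm_nonneg _)
          _ = (∫ x, |φ x|) * A := integral_mul_const _ _
          _ ≤ (C * sn ℝ N φ) * A := by gcongr; exact h φ
          _ = _ := by ring)
  else 0

theorem distOf_apply {F : E d → ℝ} (hF : BddCont F) (φ : 𝓢(E d, ℝ)) :
    distOf F φ = ∫ x, φ x * F x := by
  rw [distOf, dif_pos hF, TDist.mk'_apply]

theorem represents_distOf {F : E d → ℝ} (hF : BddCont F) : Represents (distOf F) F := fun φ =>
  ⟨hF.integrable_mul φ.integrable, distOf_apply hF φ⟩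

theorem Represents.unique {u v : TDist d} {F : E d → ℝ} (hu : Represents u F)
    (hv : Represents v F) : u = v := by
  ext φ
  rw [(hu φ).2, (hv φ).2]

theorem block_distOf (LP : DyadicPartition d) {F : E d → ℝ} (hF : BddCont F) (n : ℕ) (x : E d) :
    block LP n (distOf F) x = blockFun LP n F x := by
  rw [block, distOf_apply hF, blockFun]
  simp only [reflectAt_apply]

theorem distOf_add {F G : E d → ℝ} (hF : BddCont F) (hG : BddCont G) :
    distOf (fun x => F x + G x) = distOf F + distOf G := by
  ext φ
  rw [distOf_apply (hF.add hG), add_apply, distOf_apply hF, distOf_apply hG,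
    ← integral_add (hF.integrable_mul φ.integrable) (hG.integrable_mul φ.integrable)]
  simp only [mul_add]

theorem distOf_const_mul {F : E d → ℝ} (hF : BddCont F) (c : ℝ) :
    distOf (fun x => c * F x) = c • distOf F := by
  ext φ
  rw [distOf_apply (hF.const_mul c), smul_apply, distOf_apply hF, smul_eq_mul,
    ← integral_const_mul]
  simp only [mul_left_comm]

theorem distOf_sub {F G : E d → ℝ} (hF : BddCont F) (hG : BddCont G) :
    distOf (fun x => F x - G x) = distOf F - distOf G := by
  ext φ
  rw [distOf_apply (hF.sub hG), sub_apply, distOf_apply hF, distOf_apply hG,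
    ← integral_sub (hF.integrable_mul φ.integrable) (hG.integrable_mul φ.integrable)]
  simp only [mul_sub]

theorem distOf_sum {ι : Type*} (s : Finset ι) {F : ι → E d → ℝ} (hF : ∀ i ∈ s, BddCont (F i)) :
    distOf (fun x => ∑ i ∈ s, F i x) = ∑ i ∈ s, distOf (F i) := by
  ext φ
  rw [distOf_apply (BddCont.sum s hF), sum_apply]
  simp only [Finset.mul_sum]
  rw [integral_finsetSum s fun i hi => (hF i hi).integrable_mul φ.integrable]
  exact Finset.sum_congr rfl fun i hi => (distOf_apply (hF i hi) φ).symm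

/-! ## Paraproducts -/

/-- The low frequency part `∑_{m < n} Δ_{m-1} F` of a function. -/
def lowFun (LP : DyadicPartition d) (n : ℕ) (F : E d → ℝ) (x : E d) : ℝ :=
  ∑ m ∈ Finset.range n, blockFun LP m F x

theorem lowFun_eq_integral (LP : DyadicPartition d) (n : ℕ) {F : E d → ℝ} (hF : BddCont F)
    (x : E d) : lowFun LP n F x = ∫ y, LP.lowKernel n (x - y) * F y := by
  simp only [lowFun, blockFun, DyadicPartition.lowKernel, sum_apply, Finset.sum_mul]
  rw [integral_finsetSum _ fun m _ => hF.integrable_conv (LP.kernel m) x]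

theorem BddCont.blockFun {F : E d → ℝ} (hF : BddCont F) (LP : DyadicPartition d) (n : ℕ) :
    BddCont (PCRS.blockFun LP n F) := hF.conv (LP.kernel n)

theorem BddCont.lowFun {F : E d → ℝ} (hF : BddCont F) (LP : DyadicPartition d) (n : ℕ) :
    BddCont (PCRS.lowFun LP n F) :=
  BddCont.sum _ fun m _ => hF.blockFun LP m

theorem abs_integral_kernel_le {K F : E d → ℝ} {A C a s : ℝ} {x y : E d} (hA0 : 0 ≤ A)
    (hs : 0 ≤ s) (ha : 0 ≤ a) (hA : ∀ z, |F z| ≤ A * ‖z - x‖ ^ s)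
    (h1 : Integrable fun v => |K (y - v)| * (a + ‖v - x‖) ^ s)
    (h2 : ∫ v, |K (y - v)| * (a + ‖v - x‖) ^ s ≤ C * (a + ‖y - x‖) ^ s) :
    |∫ v, K (y - v) * F v| ≤ C * A * (a + ‖y - x‖) ^ s := by
  rw [← Real.norm_eq_abs]
  calc _ ≤ ∫ v, A * (|K (y - v)| * (a + ‖v - x‖) ^ s) := by
        refine norm_integral_le_of_norm_le (h1.const_mul A) (Eventually.of_forall fun v => ?_)
        rw [norm_mul, Real.norm_eq_abs, Real.norm_eq_abs, mul_left_comm]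
        refine mul_le_mul_of_nonneg_left ((hA v).trans ?_) (abs_nonneg _)
        gcongr
        linarith
    _ = A * ∫ v, |K (y - v)| * (a + ‖v - x‖) ^ s := integral_const_mul _ _
    _ ≤ A * (C * (a + ‖y - x‖) ^ s) := by gcongr
    _ = _ := by ring

/-- A filter at scale `sc n` cannot resolve the vanishing of `F` at `x` below that scale, which is
why `‖y - x‖` becomes `sc n + ‖y - x‖`. -/
theorem exists_lowFun_le (LP : DyadicPartition d) {s : ℝ} (hs : 0 ≤ s) :
    ∃ C, 0 ≤ C ∧ ∀ (n : ℕ) (F : E d → ℝ), BddCont F → ∀ (A : ℝ) (x : E d), 0 ≤ A →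
      (∀ z, |F z| ≤ A * ‖z - x‖ ^ s) → ∀ y, |lowFun LP n F y| ≤ C * A * (sc n + ‖y - x‖) ^ s := by
  obtain ⟨C, hC, h⟩ := exists_lowKernel_weight LP hs
  refine ⟨C, hC, fun n F hF A x hA0 hA y => ?_⟩
  obtain ⟨h1, h2⟩ := h n (sc n) le_rfl y x
  rw [lowFun_eq_integral LP n hF]
  exact abs_integral_kernel_le hA0 hs (sc_pos n).le hA h1 h2

theorem exists_blockFun_le (LP : DyadicPartition d) {s : ℝ} (hs : 0 ≤ s) :
    ∃ C, 0 ≤ C ∧ ∀ (n : ℕ) (F : E d → ℝ), ∀ (A : ℝ) (x : E d), 0 ≤ A →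
      (∀ z, |F z| ≤ A * ‖z - x‖ ^ s) → ∀ y, |blockFun LP n F y| ≤ C * A * (sc n + ‖y - x‖) ^ s := by
  obtain ⟨C, hC, h⟩ := exists_kernel_weight LP hs
  refine ⟨C, hC, fun n F A x hA0 hA y => ?_⟩
  obtain ⟨h1, h2⟩ := h n (sc n) le_rfl y x
  exact abs_integral_kernel_le hA0 hs (sc_pos n).le hA h1 h2

theorem integral_mul_conv {a : E d → ℝ} (ha : Integrable a) (K : 𝓢(E d, ℝ)) {F : E d → ℝ}
    (hF : BddCont F) :
    ∫ y, a y * ∫ z, K (y - z) * F z = ∫ z, F z * ∫ y, a y * K (y - z) := by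
  have h0 : Integrable (fun p : E d × E d => (a p.2 * K (p.2 - p.1)) * F p.1)
      (volume.prod volume) := by
    obtain ⟨hFc, A, hA⟩ := hF
    refine Integrable.mul_bdd (c := A) ?_ (hFc.comp continuous_fst).aestronglyMeasurable
      (Eventually.of_forall fun p => hA p.1)
    have := Integrable.convolution_integrand (L := ContinuousLinearMap.mul ℝ ℝ) (μ := volume)
      (ν := volume) ha (K.integrable.comp_neg (μ := volume))
    simpa using this
  have e := integral_integral_swap (f := fun z y => (a y * K (y - z)) * F z) h0
  calc _ = ∫ y, ∫ z, (a y * K (y - z)) * F z := by simp only [← integral_const_mul, mul_assoc]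
    _ = ∫ z, ∫ y, (a y * K (y - z)) * F z := e.symm
    _ = _ := by simp only [integral_mul_const, mul_comm (F _)]

/-- The `n`-th term of the paraproduct series. -/
def paraTerm (LP : DyadicPartition d) (F : E d → ℝ) (u : TDist d) (n : ℕ) (y : E d) : ℝ :=
  lowFun LP (n - 1) F y * block LP n u y

theorem BlockBd.bddCont_block {LP : DyadicPartition d} {α B : ℝ} {u : TDist d}
    (hu : BlockBd LP α B u) (n : ℕ) : BddCont (block LP n u) :=
  ⟨continuous_block LP n u, B * sc n ^ α, fun x => hu n x⟩

theorem BlockBd.bddCont_paraTerm {LP : DyadicPartition d} {α B : ℝ} {u : TDist d}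
    (hu : BlockBd LP α B u) {F : E d → ℝ} (hF : BddCont F) (n : ℕ) :
    BddCont (paraTerm LP F u n) :=
  (hF.lowFun LP (n - 1)).mul (hu.bddCont_block n)

theorem sc_le_of_lt {m n k : ℕ} (h : n + k ≤ m) : 2 ^ k * sc m ≤ sc n := by
  have h1 : (2 : ℝ) ^ (n + k) ≤ 2 ^ m := pow_le_pow_right₀ (by norm_num) h
  unfold sc
  rw [mul_div_assoc', div_le_div_iff₀ (by positivity) (by positivity)]
  rw [pow_add] at h1
  nlinarith

/-- From `m ≤ n - 2` one gets `sc n ‖η‖ < 2/3`, strictly less than the inner radius `3/4` of block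
`n`. Hence `1/12 < sc n ‖ξ‖ < 10/3`, still an annulus. A shift by more than five indices is then
impossible, because `32 · 1/12 = 8/3` and `32 · 3/4 > 10/3`. -/
theorem DyadicPartition.ρ_triple_eq_zero (LP : DyadicPartition d) {k m n : ℕ} (hm : m < n - 1)
    (hk : ¬(k ≤ n + 5 ∧ n ≤ k + 5)) (ξ η : E d) :
    LP.ρ k ξ = 0 ∨ LP.ρ m η = 0 ∨ LP.ρ n (ξ - η) = 0 := by
  by_contra! hcon
  obtain ⟨h1, h2, h3⟩ := hcon
  have hn0 : n ≠ 0 := by omega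
  have a1 := LP.lt_of_ρ_ne h1
  have a2 := LP.lt_of_ρ_ne h2
  have a3 := LP.lt_of_ρ_ne h3
  have b3 := LP.gt_of_ρ_ne hn0 h3
  have hmn : 2 ^ 2 * sc n ≤ sc m := sc_le_of_lt (by omega)
  have t1 : ‖ξ‖ ≤ ‖ξ - η‖ + ‖η‖ := by simpa using norm_add_le (ξ - η) η
  have t2 : ‖ξ - η‖ ≤ ‖ξ‖ + ‖η‖ := norm_sub_le _ _
  have hn := sc_pos n
  have hkp := sc_pos k
  have c1 : sc n * ‖η‖ < 2 / 3 := by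
    have : 2 ^ 2 * sc n * ‖η‖ ≤ sc m * ‖η‖ := by gcongr
    linarith
  have c2 : sc n * ‖ξ‖ < 10 / 3 := by
    have : sc n * ‖ξ‖ ≤ sc n * (‖ξ - η‖ + ‖η‖) := by gcongr
    linarith
  have c3 : 1 / 12 < sc n * ‖ξ‖ := by
    have : sc n * ‖ξ - η‖ ≤ sc n * (‖ξ‖ + ‖η‖) := by gcongr
    linarith
  rcases not_and_or.1 hk with hk | hk
  · have e : 2 ^ 5 * sc k ≤ sc n := sc_le_of_lt (by omega)
    have b1 := LP.gt_of_ρ_ne (by omega) h1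
    have : 2 ^ 5 * sc k * ‖ξ‖ ≤ sc n * ‖ξ‖ := by gcongr
    linarith
  · have e : 2 ^ 5 * sc n ≤ sc k := sc_le_of_lt (by omega)
    have : 2 ^ 5 * sc n * ‖ξ‖ ≤ sc k * ‖ξ‖ := by gcongr
    linarith

/-- Expanding the low-frequency factor and applying Fubini isolates `F`. What remains is `u` applied
to block `n` of a product of two kernels, and `ρ_triple_eq_zero` makes that block vanish. -/
theorem BlockBd.integral_kernel_mul_paraTerm_eq_zero {LP : DyadicPartition d} {α B : ℝ}
    {u : TDist d} (hu : BlockBd LP α B u) {F : E d → ℝ} (hF : BddCont F) {k n : ℕ}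
    (hk : ¬(k ≤ n + 5 ∧ n ≤ k + 5)) (x : E d) :
    ∫ y, LP.kernel k (x - y) * paraTerm LP F u n y = 0 := by
  have hInt : Integrable fun y => LP.kernel k (x - y) * block LP n u y :=
    (hu.bddCont_block n).integrable_conv _ x
  have e : ∀ y, LP.kernel k (x - y) * paraTerm LP F u n y =
      ∑ m ∈ Finset.range (n - 1),
        (LP.kernel k (x - y) * block LP n u y) * ∫ z, LP.kernel m (y - z) * F z := by
    intro y
    rw [paraTerm, lowFun, ← Finset.mul_sum]
    simp only [blockFun]
    ring
  simp only [e]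
  rw [integral_finsetSum _ fun m _ => (hF.conv (LP.kernel m)).integrable_mul hInt]
  refine Finset.sum_eq_zero fun m hm => ?_
  rw [integral_mul_conv hInt _ hF]
  have e2 : ∀ z, ∫ y, LP.kernel k (x - y) * block LP n u y * LP.kernel m (y - z) = 0 := by
    intro z
    have h := (apply_convS_kernel LP n u
      (mulS (reflectAt (LP.kernel k) x) (translate (LP.kernel m) z))).2
    rw [LP.convS_kernel_mulS_eq_zero k m n x z
      (LP.ρ_triple_eq_zero (Finset.mem_range.1 hm) hk), map_zero] at h
    rw [h]
    refine integral_congr_ae (Eventually.of_forall fun y => ?_)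
    simp only [mulS, reflectAt_apply, SchwartzMap.pairing_apply_apply, SchwartzMap.compSubConstCLM_apply, ContinuousLinearMap.mul_apply']
    ring
  simp [e2]

theorem BlockBd.integral_convS_kernel_mul_paraTerm_eq_zero {LP : DyadicPartition d} {α B : ℝ}
    {u : TDist d} (hu : BlockBd LP α B u) {F : E d → ℝ} (hF : BddCont F) {k n : ℕ}
    (hk : ¬(k ≤ n + 5 ∧ n ≤ k + 5)) (φ : 𝓢(E d, ℝ)) :
    ∫ y, convS (LP.kernel k) φ y * paraTerm LP F u n y = 0 := by
  have hb := hu.bddCont_paraTerm hF n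
  rw [← distOf_apply hb, (apply_convS_kernel LP k _ φ).2]
  simp only [block_distOf LP hb, blockFun, hu.integral_kernel_mul_paraTerm_eq_zero hF hk, mul_zero,
    integral_zero]

theorem BlockBd.integral_convS_lowKernel_mul_paraTerm_eq_zero {LP : DyadicPartition d} {α B : ℝ}
    {u : TDist d} (hu : BlockBd LP α B u) {F : E d → ℝ} (hF : BddCont F) (n : ℕ) (φ : 𝓢(E d, ℝ)) :
    ∫ y, convS (LP.lowKernel (n - 5)) φ y * paraTerm LP F u n y = 0 := by
  have hb := hu.bddCont_paraTerm hF n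
  rw [← distOf_apply hb, DyadicPartition.lowKernel, convS_sum_left, map_sum]
  refine Finset.sum_eq_zero fun k hk => ?_
  rw [distOf_apply hb]
  refine hu.integral_convS_kernel_mul_paraTerm_eq_zero hF ?_ φ
  have := Finset.mem_range.1 hk
  omega

/-- The `n`-th term has frequencies of order `2ⁿ`, so only the corresponding frequencies of `φ`
matter and these decay fast. Hence the paraproduct series converges for every `α`, with merely
bounded `F`. -/
theorem exists_paraTerm_le (LP : DyadicPartition d) (α : ℝ) :
    ∃ (N : ℕ) (C : ℝ), 0 ≤ C ∧ ∀ (A B : ℝ) (u : TDist d) (F : E d → ℝ), BlockBd LP α B u →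
      BddCont F → (∀ x, |F x| ≤ A) → ∀ (n : ℕ) (φ : 𝓢(E d, ℝ)),
        |∫ y, φ y * paraTerm LP F u n y| ≤ C * A * B * sn ℝ N φ * (1 / 2) ^ n := by
  obtain ⟨C₁, hC₁, h₁⟩ := exists_lowFun_le LP (le_refl (0 : ℝ))
  obtain ⟨N, D, hD, h₂⟩ := exists_integral_sub_convS_lowKernel_le LP 5 (⌈|α|⌉₊ + 1)
  refine ⟨N, C₁ * D * 2 ^ |α|, by positivity, fun A B u F hu hF hA n φ => ?_⟩
  have hA0 := BddCont.nonneg_bound hA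
  have hB0 := hu.nonneg
  set ψ := φ - convS (LP.lowKernel (n - 5)) φ with hψ
  have hb := hu.bddCont_paraTerm hF n
  have e : ∫ y, φ y * paraTerm LP F u n y = ∫ y, ψ y * paraTerm LP F u n y := by
    rw [← distOf_apply hb, ← distOf_apply hb, hψ, map_sub, distOf_apply hb (convS _ _),
      hu.integral_convS_lowKernel_mul_paraTerm_eq_zero hF, sub_zero]
  have hp : ∀ y, |paraTerm LP F u n y| ≤ C₁ * A * (B * sc n ^ α) := by
    intro y
    rw [paraTerm, abs_mul]
    refine mul_le_mul ?_ (hu n y) (abs_nonneg _) (by positivity)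
    simpa using h₁ (n - 1) F hF A 0 hA0 (by simpa using hA) y
  rw [e, ← Real.norm_eq_abs]
  calc _ ≤ ∫ y, |ψ y| * (C₁ * A * (B * sc n ^ α)) := by
        refine norm_integral_le_of_norm_le (ψ.integrable.abs.mul_const _)
          (Eventually.of_forall fun y => ?_)
        rw [norm_mul]
        exact mul_le_mul_of_nonneg_left (hp y) (norm_nonneg _)
    _ = (∫ y, |ψ y|) * (C₁ * A * (B * sc n ^ α)) := integral_mul_const _ _
    _ ≤ (D * ((1 / 2) ^ n) ^ (⌈|α|⌉₊ + 1) * sn ℝ N φ) * (C₁ * A * (B * sc n ^ α)) := by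
        have := (sc_rpow_pos n α).le
        gcongr
        exact h₂ n φ
    _ = C₁ * D * A * B * sn ℝ N φ * (((1 / 2) ^ n) ^ (⌈|α|⌉₊ + 1) * sc n ^ α) := by ring
    _ ≤ C₁ * D * A * B * sn ℝ N φ * (2 ^ |α| * (1 / 2) ^ n) := by
        have := sn_nonneg N φ
        exact mul_le_mul_of_nonneg_left (half_pow_mul_sc_rpow_le n α) (by positivity)
    _ = _ := by ring

theorem BlockBd.paraprodConverges {LP : DyadicPartition d} {α B : ℝ} {u : TDist d}
    (hu : BlockBd LP α B u) {F : E d → ℝ} (hF : BddCont F) : ParaprodConverges LP F u := by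
  obtain ⟨N, C, hC, h⟩ := exists_paraTerm_le LP α
  obtain ⟨A, hA⟩ := hF.bdd
  have hA0 := BddCont.nonneg_bound hA
  have hB0 := hu.nonneg
  have hs : ∀ φ : 𝓢(E d, ℝ), Summable fun n => ∫ y, φ y * paraTerm LP F u n y := fun φ =>
    Summable.of_norm_bounded (summable_geometric_two.mul_left (C * A * B * sn ℝ N φ))
      fun n => h A B u F hu hF hA n φ
  have hi : ∀ (φ : 𝓢(E d, ℝ)) n, Integrable fun y => φ y * paraTerm LP F u n y := fun φ n =>
    (hu.bddCont_paraTerm hF n).integrable_mul φ.integrable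
  refine ⟨TDist.mk' (fun φ => ∑' n, ∫ y, φ y * paraTerm LP F u n y) (fun f g => ?_)
    (fun a f => ?_) ⟨N, C * A * B * 2, by positivity, fun φ => ?_⟩, fun φ => ?_⟩
  · rw [← (hs f).tsum_add (hs g)]
    congr with n
    rw [← integral_add (hi f n) (hi g n)]
    simp only [add_apply, add_mul]
  · rw [← tsum_mul_left]
    congr with n
    rw [← integral_const_mul]
    simp only [smul_apply, smul_eq_mul, mul_assoc]
  · rw [← Real.norm_eq_abs]
    have := tsum_of_norm_bounded (f := fun n => ∫ y, φ y * paraTerm LP F u n y)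
      (summable_geometric_two.mul_left (C * A * B * sn ℝ N φ)).hasSum
      (fun n => h A B u F hu hF hA n φ)
    rw [tsum_mul_left, tsum_geometric_two] at this
    linarith
  · exact (hs φ).hasSum

theorem hasParaprod_paraprod {LP : DyadicPartition d} {F : E d → ℝ} {u : TDist d}
    (h : ParaprodConverges LP F u) : HasParaprod LP F u (paraprod LP F u) := by
  rw [paraprod, dif_pos h]
  exact h.choose_spec

theorem HasParaprod.paraprod_eq {LP : DyadicPartition d} {F : E d → ℝ} {u v : TDist d}
    (h : HasParaprod LP F u v) : paraprod LP F u = v := by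
  ext φ
  exact (hasParaprod_paraprod ⟨v, h⟩ φ).unique (h φ)

theorem BlockBd.hasSum_paraTerm {LP : DyadicPartition d} {α B : ℝ} {u : TDist d}
    (hu : BlockBd LP α B u) {F : E d → ℝ} (hF : BddCont F) (φ : 𝓢(E d, ℝ)) :
    HasSum (fun n => ∫ y, φ y * paraTerm LP F u n y) (paraprod LP F u φ) :=
  hasParaprod_paraprod (hu.paraprodConverges hF) φ

theorem BlockBd.block_paraprod {LP : DyadicPartition d} {α B : ℝ} {u : TDist d}
    (hu : BlockBd LP α B u) {F : E d → ℝ} (hF : BddCont F) (k : ℕ) (x : E d) :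
    block LP k (paraprod LP F u) x =
      ∑ n ∈ Finset.Icc (k - 5) (k + 5), ∫ y, LP.kernel k (x - y) * paraTerm LP F u n y := by
  refine (hu.hasSum_paraTerm hF (reflectAt (LP.kernel k) x)).unique ?_
  simp only [reflectAt_apply]
  refine hasSum_sum_of_ne_finset_zero fun n hn => ?_
  refine hu.integral_kernel_mul_paraTerm_eq_zero hF ?_ x
  simp only [Finset.mem_Icc] at hn
  omega

/-- Only the terms with `|n - j| ≤ 5` reach block `j`. In each, the low-frequency factor is bounded
by a weight at a scale comparable to `sc j`, and averaging against the kernel preserves such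
weights. Only the vanishing of `F` at `x` is used, not its regularity elsewhere. -/
theorem exists_block_paraprod_le (LP : DyadicPartition d) (α : ℝ) {s : ℝ} (hs : 0 ≤ s) :
    ∃ C, 0 ≤ C ∧ ∀ (A B : ℝ) (u : TDist d) (F : E d → ℝ) (x : E d), BlockBd LP α B u →
      BddCont F → 0 ≤ A → (∀ z, |F z| ≤ A * ‖z - x‖ ^ s) → ∀ (j : ℕ) (y : E d),
        |block LP j (paraprod LP F u) y| ≤ C * A * B * sc j ^ α * (sc j + ‖y - x‖) ^ s := by
  obtain ⟨C₁, hC₁, h₁⟩ := exists_lowFun_le LP hs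
  obtain ⟨C₂, hC₂, h₂⟩ := exists_kernel_weight LP hs
  -- There are at most `11` terms; `(2 ^ 5) ^ |α|` compares `sc n ^ α` with `sc j ^ α`, and `(2 ^ 6)
  -- ^ s` pays for enlarging the weight from `sc (n - 1)` to `2 ^ 6 * sc j`.
  refine ⟨11 * (C₁ * ((2 : ℝ) ^ 5) ^ |α| * (C₂ * (2 ^ 6) ^ s)), by positivity,
    fun A B u F x hu hF hA0 hA j y => ?_⟩
  have hB0 := hu.nonneg
  have hscj := sc_pos j
  have key : ∀ n ∈ Finset.Icc (j - 5) (j + 5),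
      |∫ z, LP.kernel j (y - z) * paraTerm LP F u n z| ≤
        (C₁ * ((2 : ℝ) ^ 5) ^ |α| * (C₂ * (2 ^ 6) ^ s)) * A * B * sc j ^ α *
          (sc j + ‖y - x‖) ^ s := by
    intro n hn
    rw [Finset.mem_Icc] at hn
    obtain ⟨i1, i2⟩ := h₂ j (2 ^ 6 * sc j) (by linarith) y x
    have hsc : sc (n - 1) ≤ 2 ^ 6 * sc j := sc_le_sc_mul _ _ _ (by omega)
    have hα := (sc_rpow_pos j α).le
    have hp : ∀ z, |paraTerm LP F u n z| ≤
        (C₁ * A * B * (((2 : ℝ) ^ 5) ^ |α| * sc j ^ α)) * (2 ^ 6 * sc j + ‖z - x‖) ^ s := by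
      intro z
      have hp1 := h₁ (n - 1) F hF A x hA0 hA z
      have hsn := sc_pos (n - 1)
      have hp2 : (sc (n - 1) + ‖z - x‖) ^ s ≤ (2 ^ 6 * sc j + ‖z - x‖) ^ s :=
        Real.rpow_le_rpow (by positivity) (by linarith) hs
      have hp3 := (hu n z).trans (mul_le_mul_of_nonneg_left
        (sc_rpow_le_sc_rpow n j 5 (by omega) (by omega) α) hB0)
      rw [paraTerm, abs_mul]
      calc _ ≤ (C₁ * A * (2 ^ 6 * sc j + ‖z - x‖) ^ s) *
            (B * (((2 : ℝ) ^ 5) ^ |α| * sc j ^ α)) := by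
            refine mul_le_mul (hp1.trans ?_) hp3 (abs_nonneg _) (by positivity)
            gcongr
        _ = _ := by ring
    rw [← Real.norm_eq_abs]
    set D := C₁ * A * B * (((2 : ℝ) ^ 5) ^ |α| * sc j ^ α) with hD
    have hD0 : 0 ≤ D := by positivity
    calc _ ≤ ∫ z, D * (|LP.kernel j (y - z)| * (2 ^ 6 * sc j + ‖z - x‖) ^ s) := by
          refine norm_integral_le_of_norm_le (i1.const_mul D) (Eventually.of_forall fun z => ?_)
          rw [norm_mul, Real.norm_eq_abs, Real.norm_eq_abs, mul_left_comm]
          exact mul_le_mul_of_nonneg_left (hp z) (abs_nonneg _)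
      _ = D * ∫ z, |LP.kernel j (y - z)| * (2 ^ 6 * sc j + ‖z - x‖) ^ s := integral_const_mul _ _
      _ ≤ D * (C₂ * (2 ^ 6 * sc j + ‖y - x‖) ^ s) := by gcongr
      _ ≤ D * (C₂ * ((2 ^ 6) ^ s * (sc j + ‖y - x‖) ^ s)) := by
          rw [← Real.mul_rpow (by positivity) (by positivity)]
          gcongr
          have := norm_nonneg (y - x)
          linarith
      _ = _ := by rw [hD]; ring
  rw [hu.block_paraprod hF]
  refine (Finset.abs_sum_le_sum_abs _ _).trans ((Finset.sum_le_sum key).trans ?_)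
  rw [Finset.sum_const, nsmul_eq_mul]
  have hcard : ((Finset.Icc (j - 5) (j + 5)).card : ℝ) ≤ 11 := by
    rw [Nat.card_Icc]
    exact_mod_cast (by omega : j + 5 + 1 - (j - 5) ≤ 11)
  have hα := (sc_rpow_pos j α).le
  calc _ ≤ 11 * _ := mul_le_mul_of_nonneg_right hcard (by positivity)
    _ = _ := by ring

end

/-! ### Algebra of the paraproduct -/

section

variable {d : ℕ}

/-! ## Bilinearity of the paraproduct -/

/-- The distribution belongs to some Hölder-Besov space. -/
def IsBesov (LP : DyadicPartition d) (u : TDist d) : Prop := ∃ α B, BlockBd LP α B u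

theorem BlockBd.isBesov {LP : DyadicPartition d} {α B : ℝ} {u : TDist d} (hu : BlockBd LP α B u) :
    IsBesov LP u := ⟨α, B, hu⟩

theorem TDist.neg_one_smul (u : TDist d) : (-1 : ℝ) • u = -u := by
  ext φ
  simp

namespace IsBesov

variable {LP : DyadicPartition d} {u v : TDist d} {F G : E d → ℝ}

theorem add (hu : IsBesov LP u) (hv : IsBesov LP v) : IsBesov LP (u + v) := by
  obtain ⟨α, B, hu⟩ := hu
  obtain ⟨β, B', hv⟩ := hv
  exact ⟨min α β, _, (hu.of_le hu.nonneg (min_le_left α β)).add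
    (hv.of_le hv.nonneg (min_le_right α β))⟩

theorem smul (hu : IsBesov LP u) (c : ℝ) : IsBesov LP (c • u) := by
  obtain ⟨α, B, hu⟩ := hu
  exact ⟨α, _, hu.smul c⟩

theorem sub (hu : IsBesov LP u) (hv : IsBesov LP v) : IsBesov LP (u - v) := by
  have := hu.add (hv.smul (-1))
  rwa [TDist.neg_one_smul, ← sub_eq_add_neg] at this

theorem zero (LP : DyadicPartition d) : IsBesov LP (0 : TDist d) := ⟨0, 0, BlockBd.zero LP 0⟩

theorem sum {ι : Type*} (s : Finset ι) {u : ι → TDist d} (h : ∀ i ∈ s, IsBesov LP (u i)) :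
    IsBesov LP (∑ i ∈ s, u i) := by
  classical
  induction s using Finset.induction_on with
  | empty => simpa using zero LP
  | insert a s ha ih =>
    rw [Finset.sum_insert ha]
    exact (h a (Finset.mem_insert_self a s)).add (ih fun i hi => h i (Finset.mem_insert_of_mem hi))

theorem bddCont_block (hu : IsBesov LP u) (n : ℕ) : BddCont (block LP n u) := by
  obtain ⟨α, B, hu⟩ := hu
  exact hu.bddCont_block n

theorem bddCont_paraTerm (hu : IsBesov LP u) (hF : BddCont F) (n : ℕ) :
    BddCont (paraTerm LP F u n) := by
  obtain ⟨α, B, hu⟩ := hu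
  exact hu.bddCont_paraTerm hF n

theorem paraprodConverges (hu : IsBesov LP u) (hF : BddCont F) : ParaprodConverges LP F u := by
  obtain ⟨α, B, hu⟩ := hu
  exact hu.paraprodConverges hF

theorem hasSum_paraTerm (hu : IsBesov LP u) (hF : BddCont F) (φ : 𝓢(E d, ℝ)) :
    HasSum (fun n => ∫ y, φ y * paraTerm LP F u n y) (paraprod LP F u φ) :=
  hasParaprod_paraprod (hu.paraprodConverges hF) φ

theorem paraprod_eq_of_paraTerm (hu : IsBesov LP u) (hF : BddCont F) {w : TDist d}
    (hw : ∀ φ, HasSum (fun n => ∫ y, φ y * paraTerm LP F u n y) (w φ)) : paraprod LP F u = w := by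
  ext φ
  exact (hu.hasSum_paraTerm hF φ).unique (hw φ)

theorem paraprod_isBesov (hu : IsBesov LP u) (hF : BddCont F) : IsBesov LP (paraprod LP F u) := by
  obtain ⟨α, B, hu⟩ := hu
  obtain ⟨C, hC, h⟩ := exists_block_paraprod_le LP α (le_refl (0 : ℝ))
  obtain ⟨A, hA⟩ := hF.bdd
  refine ⟨α, C * A * B, fun j y => ?_⟩
  simpa using h A B u F 0 hu hF (BddCont.nonneg_bound hA) (by simpa using hA) j y

end IsBesov

theorem blockFun_add (LP : DyadicPartition d) {F G : E d → ℝ} (hF : BddCont F) (hG : BddCont G)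
    (n : ℕ) (x : E d) :
    blockFun LP n (fun x => F x + G x) x = blockFun LP n F x + blockFun LP n G x := by
  simp only [blockFun, mul_add]
  exact integral_add (hF.integrable_conv _ x) (hG.integrable_conv _ x)

theorem blockFun_const_mul (LP : DyadicPartition d) (F : E d → ℝ) (c : ℝ)
    (n : ℕ) (x : E d) :
    blockFun LP n (fun x => c * F x) x = c * blockFun LP n F x := by
  simp only [blockFun, mul_left_comm _ c]
  exact integral_const_mul _ _

theorem lowFun_add (LP : DyadicPartition d) {F G : E d → ℝ} (hF : BddCont F) (hG : BddCont G)
    (n : ℕ) (x : E d) :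
    lowFun LP n (fun x => F x + G x) x = lowFun LP n F x + lowFun LP n G x := by
  simp only [lowFun, blockFun_add LP hF hG, Finset.sum_add_distrib]

theorem lowFun_const_mul (LP : DyadicPartition d) (F : E d → ℝ) (c : ℝ)
    (n : ℕ) (x : E d) :
    lowFun LP n (fun x => c * F x) x = c * lowFun LP n F x := by
  simp only [lowFun, blockFun_const_mul LP, Finset.mul_sum]

theorem paraprod_add_left {LP : DyadicPartition d} {u : TDist d} (hu : IsBesov LP u)
    {F G : E d → ℝ} (hF : BddCont F) (hG : BddCont G) :
    paraprod LP (fun x => F x + G x) u = paraprod LP F u + paraprod LP G u := by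
  refine hu.paraprod_eq_of_paraTerm (hF.add hG) fun φ => ?_
  refine ((hu.hasSum_paraTerm hF φ).add (hu.hasSum_paraTerm hG φ)).congr_fun fun n => ?_
  rw [← integral_add ((hu.bddCont_paraTerm hF n).integrable_mul φ.integrable)
    ((hu.bddCont_paraTerm hG n).integrable_mul φ.integrable)]
  congr with y
  simp only [paraTerm, lowFun_add LP hF hG]
  ring

theorem paraprod_const_mul_left {LP : DyadicPartition d} {u : TDist d} (hu : IsBesov LP u)
    {F : E d → ℝ} (hF : BddCont F) (c : ℝ) :
    paraprod LP (fun x => c * F x) u = c • paraprod LP F u := by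
  refine hu.paraprod_eq_of_paraTerm (hF.const_mul c) fun φ => ?_
  refine ((hu.hasSum_paraTerm hF φ).mul_left c).congr_fun fun n => ?_
  rw [← integral_const_mul]
  congr with y
  simp only [paraTerm, lowFun_const_mul LP]
  ring

theorem paraprod_zero_left {LP : DyadicPartition d} {u : TDist d} (hu : IsBesov LP u) :
    paraprod LP (fun _ => 0) u = 0 := by
  simpa using paraprod_const_mul_left hu (BddCont.const 0) 0

theorem paraprod_sub_left {LP : DyadicPartition d} {u : TDist d} (hu : IsBesov LP u)
    {F G : E d → ℝ} (hF : BddCont F) (hG : BddCont G) :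
    paraprod LP (fun x => F x - G x) u = paraprod LP F u - paraprod LP G u := by
  have h := paraprod_add_left hu hF (hG.const_mul (-1))
  rw [paraprod_const_mul_left hu hG, TDist.neg_one_smul] at h
  simpa [sub_eq_add_neg] using h

theorem paraprod_sum_left {LP : DyadicPartition d} {u : TDist d} (hu : IsBesov LP u) {ι : Type*}
    (s : Finset ι) {F : ι → E d → ℝ} (hF : ∀ i ∈ s, BddCont (F i)) :
    paraprod LP (fun x => ∑ i ∈ s, F i x) u = ∑ i ∈ s, paraprod LP (F i) u := by
  classical
  induction s using Finset.induction_on with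
  | empty => simpa using paraprod_zero_left hu
  | insert a s ha ih =>
    have hs : ∀ i ∈ s, BddCont (F i) := fun i hi => hF i (Finset.mem_insert_of_mem hi)
    simp only [Finset.sum_insert ha]
    rw [paraprod_add_left hu (hF a (Finset.mem_insert_self a s)) (BddCont.sum s hs), ih hs]

theorem paraprod_add_right {LP : DyadicPartition d} {u v : TDist d} (hu : IsBesov LP u)
    (hv : IsBesov LP v) {F : E d → ℝ} (hF : BddCont F) :
    paraprod LP F (u + v) = paraprod LP F u + paraprod LP F v := by
  refine (hu.add hv).paraprod_eq_of_paraTerm hF fun φ => ?_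
  refine ((hu.hasSum_paraTerm hF φ).add (hv.hasSum_paraTerm hF φ)).congr_fun fun n => ?_
  rw [← integral_add ((hu.bddCont_paraTerm hF n).integrable_mul φ.integrable)
    ((hv.bddCont_paraTerm hF n).integrable_mul φ.integrable)]
  congr with y
  simp only [paraTerm, block_add]
  ring

theorem paraprod_smul_right {LP : DyadicPartition d} {u : TDist d} (hu : IsBesov LP u)
    {F : E d → ℝ} (hF : BddCont F) (c : ℝ) :
    paraprod LP F (c • u) = c • paraprod LP F u := by
  refine (hu.smul c).paraprod_eq_of_paraTerm hF fun φ => ?_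
  refine ((hu.hasSum_paraTerm hF φ).mul_left c).congr_fun fun n => ?_
  rw [← integral_const_mul]
  congr with y
  simp only [paraTerm, block_smul]
  ring

theorem paraprod_sub_right {LP : DyadicPartition d} {u v : TDist d} (hu : IsBesov LP u)
    (hv : IsBesov LP v) {F : E d → ℝ} (hF : BddCont F) :
    paraprod LP F (u - v) = paraprod LP F u - paraprod LP F v := by
  have h := paraprod_add_right hu (hv.smul (-1)) hF
  rw [paraprod_smul_right hv hF, TDist.neg_one_smul, TDist.neg_one_smul] at h
  simpa [sub_eq_add_neg] using h

/-! ## The paraproduct with a constant -/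

theorem DyadicPartition.convS_kernel_reflectAt_kernel_eq_zero (LP : DyadicPartition d) {j k : ℕ}
    (h : j + 2 ≤ k) (x : E d) : convS (LP.kernel j) (reflectAt (LP.kernel k) x) = 0 := by
  rw [← LP.translate_kernel, translate_eq_rescale]
  refine LP.convS_kernel_rescale_eq_zero k j one_pos x fun ξ => ?_
  rw [one_smul]
  by_contra! hcon
  have h1 := LP.gt_of_ρ_ne (by omega) hcon.1
  have h2 := LP.lt_of_ρ_ne hcon.2
  have h3 : 2 ^ 2 * sc k ≤ sc j := sc_le_of_lt h
  have : 2 ^ 2 * sc k * ‖ξ‖ ≤ sc j * ‖ξ‖ := by gcongr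
  linarith

theorem DyadicPartition.lowKernel_neg (LP : DyadicPartition d) (n : ℕ) (x : E d) :
    LP.lowKernel n (-x) = LP.lowKernel n x := by
  simp only [DyadicPartition.lowKernel, sum_apply, LP.kernel_neg]

theorem DyadicPartition.convS_kernel_lowKernel (LP : DyadicPartition d) {j N : ℕ}
    (h : j + 2 ≤ N) : convS (LP.kernel j) (LP.lowKernel N) = LP.kernel j := by
  obtain ⟨n, rfl⟩ : ∃ n, N = n + 1 := ⟨N - 1, by omega⟩
  refine injective_fourier_toC fun ξ => ?_
  rw [fourier_toC_convS, LP.fourier_lowKernel, LP.fourier_kernel]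
  by_cases hρ : LP.ρ j ξ = 0
  · simp [hρ]
  rw [LP.ρ_zero_eq_one, Complex.ofReal_one, mul_one]
  have h1 := LP.lt_of_ρ_ne hρ
  have h2 : 2 ^ 2 * sc (n + 1) ≤ sc j := sc_le_of_lt h
  rw [norm_smul, ← sc_succ, Real.norm_of_nonneg (sc_pos _).le]
  have : 2 ^ 2 * sc (n + 1) * ‖ξ‖ ≤ sc j * ‖ξ‖ := by gcongr
  linarith

theorem DyadicPartition.integral_lowKernel (LP : DyadicPartition d) (n : ℕ) (x : E d) :
    ∫ y, LP.lowKernel (n + 1) (x - y) = 1 := by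
  rw [integral_sub_left_eq_self (fun y => LP.lowKernel (n + 1) y) volume x]
  have h := LP.fourier_lowKernel n 0
  rw [smul_zero, LP.ρ_zero_eq_one (by simp; norm_num), SchwartzMap.fourier_coe, Real.fourier_eq] at h
  simp only [inner_zero_right, neg_zero, AddChar.map_zero_eq_one, one_smul, toC_apply] at h
  have e := integral_ofReal (𝕜 := ℂ) (μ := volume) (f := fun v => LP.lowKernel (n + 1) v)
  exact Complex.ofReal_injective (e.symm.trans h)

/-- The sum of the first two Littlewood-Paley blocks, as a distribution. -/
def lowPart (LP : DyadicPartition d) (u : TDist d) : TDist d :=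
  distOf fun x => block LP 0 u x + block LP 1 u x

theorem IsBesov.bddCont_low {LP : DyadicPartition d} {u : TDist d} (hu : IsBesov LP u) :
    BddCont fun x => block LP 0 u x + block LP 1 u x :=
  (hu.bddCont_block 0).add (hu.bddCont_block 1)

/-- A nonempty low-pass filter reproduces constants, so the `n`-th term with coefficient `1` is the
full block as soon as `n - 1 ≥ 1`. The terms `n = 0, 1` have an empty filter, and their blocks are
the ones missing from the result. -/
theorem paraprod_one {LP : DyadicPartition d} {u : TDist d} (hu : IsBesov LP u) :
    paraprod LP (fun _ => 1) u = u - lowPart LP u := by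
  refine hu.paraprod_eq_of_paraTerm (BddCont.const 1) fun φ => ?_
  have hlow : lowPart LP u φ = ∑ n ∈ Finset.range 2, ∫ y, φ y * block LP n u y := by
    rw [lowPart, distOf_apply hu.bddCont_low, Finset.sum_range_succ, Finset.sum_range_one,
      ← integral_add ((hu.bddCont_block 0).integrable_mul φ.integrable)
      ((hu.bddCont_block 1).integrable_mul φ.integrable)]
    simp only [mul_add]
  have h1 := (hasSum_nat_add_iff' 2).2 (hasSum_integral_block LP u φ)
  rw [sub_apply, hlow]
  rw [← hasSum_nat_add_iff' 2]
  convert h1 using 1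
  · ext n
    congr with y
    rw [paraTerm, lowFun_eq_integral LP _ (BddCont.const 1)]
    simp only [mul_one]
    rw [show n + 2 - 1 = n + 1 from rfl, LP.integral_lowKernel, one_mul]
  · simp [paraTerm, lowFun, Finset.sum_range_succ]

/-- Blocks `0` and `1` share no frequency with block `k ≥ 3`. This is the origin of the threshold `3
≤ k` used from here on: above it low parts are invisible, below it finitely many scales are treated
by crude bounds. -/
theorem block_lowPart_eq_zero {LP : DyadicPartition d} {u : TDist d} (hu : IsBesov LP u) {k : ℕ}
    (hk : 3 ≤ k) (x : E d) : block LP k (lowPart LP u) x = 0 := by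
  have h : ∀ j, j + 2 ≤ k → blockFun LP k (block LP j u) x = 0 := by
    intro j hj
    have := (apply_convS_kernel LP j u (reflectAt (LP.kernel k) x)).2
    rw [LP.convS_kernel_reflectAt_kernel_eq_zero hj, map_zero] at this
    simp only [reflectAt_apply] at this
    exact this.symm
  rw [lowPart, block_distOf LP hu.bddCont_low,
    blockFun_add LP (hu.bddCont_block 0) (hu.bddCont_block 1), h 0 (by omega), h 1 (by omega),
    add_zero]

theorem lowFun_block {LP : DyadicPartition d} {u : TDist d} (hu : IsBesov LP u) {j N : ℕ}
    (h : j + 2 ≤ N) (x : E d) : lowFun LP N (block LP j u) x = block LP j u x := by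
  rw [lowFun_eq_integral LP N (hu.bddCont_block j)]
  have h1 := (apply_convS_kernel LP j u (reflectAt (LP.lowKernel N) x)).2
  simp only [reflectAt_apply] at h1
  have e : reflectAt (LP.lowKernel N) x = translate (LP.lowKernel N) x := by
    ext y
    rw [reflectAt_apply, SchwartzMap.compSubConstCLM_apply, ← LP.lowKernel_neg, neg_sub]
  rw [← h1, e, convS_translate, LP.convS_kernel_lowKernel h, LP.translate_kernel]
  rfl

theorem lowFun_low {LP : DyadicPartition d} {u : TDist d} (hu : IsBesov LP u) {N : ℕ}
    (h : 3 ≤ N) (x : E d) : lowFun LP N (fun x => block LP 0 u x + block LP 1 u x) x =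
      block LP 0 u x + block LP 1 u x := by
  rw [lowFun_add LP (hu.bddCont_block 0) (hu.bddCont_block 1), lowFun_block hu (by omega),
    lowFun_block hu (by omega)]

theorem block_distOf_const (LP : DyadicPartition d) (c : ℝ) {k : ℕ} (hk : k ≠ 0) (x : E d) :
    block LP k (distOf fun _ => c) x = 0 := by
  obtain ⟨n, rfl⟩ := Nat.exists_eq_succ_of_ne_zero hk
  have e : LP.kernel (n + 1) = LP.lowKernel (n + 2) - LP.lowKernel (n + 1) := by
    rw [lowKernel_succ_eq_add LP (n + 1)]; abel
  rw [block_distOf LP (BddCont.const c), blockFun, integral_mul_const, Nat.succ_eq_add_one, e]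
  simp only [sub_apply]
  rw [integral_sub (integrable_comp_sub_left _ x) (integrable_comp_sub_left _ x),
    LP.integral_lowKernel, LP.integral_lowKernel, sub_self, zero_mul]

/-- A constant has only its block of index `0`, and there the low-pass factor is an empty sum. Hence
terms carrying the bracket of the unit may be added to or dropped from the recursive formulas. -/
theorem paraprod_distOf_const {LP : DyadicPartition d} (c : ℝ) (F : E d → ℝ) :
    paraprod LP F (distOf fun _ => c) = 0 := by
  refine HasParaprod.paraprod_eq fun φ => ?_
  rw [zero_apply]
  refine hasSum_zero.congr_fun fun n => ?_
  rcases Nat.eq_zero_or_pos n with rfl | hn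
  · simp
  · simp [block_distOf_const LP c hn.ne']

end

/-! ### From compactly supported test functions to Schwartz functions -/

section

variable {d : ℕ}

/-! ## Test functions -/

theorem bddCont_schwartz (φ : 𝓢(E d, ℝ)) : BddCont φ :=
  ⟨φ.continuous, sn ℝ 0 φ, fun x => by
    simpa using one_add_pow_mul_apply_le_sn (le_refl 0) φ x⟩

theorem abs_apply_le_sn (N : ℕ) (φ : 𝓢(E d, ℝ)) (x : E d) : |φ x| ≤ sn ℝ N φ := by
  have h : |φ x| ≤ sn ℝ 0 φ := by simpa using one_add_pow_mul_apply_le_sn (le_refl 0) φ x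
  exact h.trans (sn_mono (Nat.zero_le N) φ)

theorem isTest_iff (LP : DyadicPartition d) (r : ℝ) (φ : 𝓢(E d, ℝ)) :
    IsTest LP r φ ↔ Function.support φ ⊆ Metric.closedBall 0 1 ∧
      ∀ n x, |blockFun LP n φ x| ≤ sc n ^ r := by
  have e : holderNormFun LP r φ = holderNorm LP r (distOf φ) := by
    simp only [holderNormFun, holderNorm, block_distOf LP (bddCont_schwartz φ)]
  have h := holderNorm_le_iff LP r zero_le_one (distOf φ)
  rw [ENNReal.ofReal_one] at h
  simp only [BlockBd, block_distOf LP (bddCont_schwartz φ), one_mul] at h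
  rw [IsTest, e, h]

theorem lowKernel_zero (LP : DyadicPartition d) : LP.lowKernel 0 = 0 := by
  simp [DyadicPartition.lowKernel]

theorem convS_zero_left (φ : 𝓢(E d, ℝ)) : convS 0 φ = 0 := by
  ext x
  simp [convS_apply]

theorem exists_convS_kernel_le (LP : DyadicPartition d) (M : ℕ) :
    ∃ (N : ℕ) (C : ℝ), 0 ≤ C ∧ ∀ (n : ℕ) (ψ : 𝓢(E d, ℝ)) (x : E d),
      |convS (LP.kernel n) ψ x| ≤ C * sc n ^ M * sn ℝ N ψ := by
  obtain ⟨N, C, hC, h⟩ := sn_sub_convS_lowKernel_le LP 0 M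
  refine ⟨N, 1 + 2 * C, by positivity, fun n ψ x => ?_⟩
  have hS := sn_nonneg N ψ
  have hsc := sc_pos n
  have h1 : |(ψ - convS (LP.lowKernel (n + 1)) ψ) x| ≤ C * sc n ^ M * sn ℝ N ψ := by
    refine (abs_apply_le_sn 0 _ x).trans ((h n ψ).trans ?_)
    rw [← sc_succ]
    have : sc (n + 1) ≤ sc n := by
      have := sc_le_of_lt (show n + 1 ≤ n + 1 from le_rfl)
      have := sc_pos (n + 1)
      linarith
    have := (sc_pos (n + 1)).le
    gcongr
  have h2 : |(ψ - convS (LP.lowKernel n) ψ) x| ≤ (1 + C) * sc n ^ M * sn ℝ N ψ := by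
    rcases Nat.eq_zero_or_pos n with rfl | hn
    · rw [lowKernel_zero, convS_zero_left, sub_zero]
      have h3 : (1 : ℝ) ≤ sc 0 ^ M := one_le_pow₀ (by norm_num [sc])
      have h4 := abs_apply_le_sn N ψ x
      calc _ ≤ 1 * 1 * sn ℝ N ψ := by linarith
        _ ≤ _ := by gcongr; linarith
    · obtain ⟨m, rfl⟩ := Nat.exists_eq_succ_of_ne_zero hn.ne'
      refine (abs_apply_le_sn 0 _ x).trans ((h m ψ).trans ?_)
      rw [← sc_succ]
      have : 0 ≤ sc (m + 1) ^ M * sn ℝ N ψ := by positivity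
      simp only [Nat.succ_eq_add_one]
      nlinarith
  have e : convS (LP.kernel n) ψ x = (ψ - convS (LP.lowKernel n) ψ) x -
      (ψ - convS (LP.lowKernel (n + 1)) ψ) x := by
    rw [lowKernel_succ_eq_add, convS_add_left]
    simp
  rw [e]
  refine (abs_sub _ _).trans ((add_le_add h2 h1).trans_eq ?_)
  ring

theorem exists_blockFun_le_rpow (LP : DyadicPartition d) (r : ℝ) :
    ∃ (N : ℕ) (C : ℝ), 0 < C ∧ ∀ (n : ℕ) (ψ : 𝓢(E d, ℝ)) (x : E d),
      |blockFun LP n ψ x| ≤ C * sn ℝ N ψ * sc n ^ r := by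
  set M := ⌈r⌉₊
  obtain ⟨N, C, hC, h⟩ := exists_convS_kernel_le LP M
  refine ⟨N, (C + 1) * 2 ^ ((M : ℝ) - r), by positivity, fun n ψ x => ?_⟩
  have hS := sn_nonneg N ψ
  have hsc := sc_pos n
  rw [blockFun_eq_convS]
  have h1 : sc n ^ M ≤ 2 ^ ((M : ℝ) - r) * sc n ^ r := by
    rw [← Real.rpow_natCast, show (M : ℝ) = (M - r) + r by ring, Real.rpow_add hsc,
      show (M : ℝ) - r + r - r = M - r by ring]
    gcongr
    · exact sub_nonneg.2 (Nat.le_ceil r)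
    · exact sc_le_two n
  calc _ ≤ C * sc n ^ M * sn ℝ N ψ := h n ψ x
    _ ≤ (C + 1) * (2 ^ ((M : ℝ) - r) * sc n ^ r) * sn ℝ N ψ := by gcongr; linarith
    _ = _ := by ring

theorem rescale_smul (c : ℝ) (φ : 𝓢(E d, ℝ)) {l : ℝ} (hl : 0 < l) (x : E d) :
    rescale (c • φ) l hl x = c • rescale φ l hl x := by
  ext y
  simp only [rescale_apply, smul_apply, smul_eq_mul]
  ring

theorem rescale_add (φ ψ : 𝓢(E d, ℝ)) {l : ℝ} (hl : 0 < l) (x : E d) :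
    rescale (φ + ψ) l hl x = rescale φ l hl x + rescale ψ l hl x := by
  ext y
  simp only [rescale_apply, add_apply]
  ring

theorem rescale_sum {ι : Type*} (s : Finset ι) (φ : ι → 𝓢(E d, ℝ)) {l : ℝ} (hl : 0 < l) (x : E d) :
    rescale (∑ i ∈ s, φ i) l hl x = ∑ i ∈ s, rescale (φ i) l hl x := by
  ext y
  simp only [rescale_apply, sum_apply, Finset.mul_sum]

/-- Homogeneity: a smooth function supported in the unit ball becomes an admissible test function
after division by its `𝒞^r` norm, which a Schwartz seminorm controls. -/
theorem exists_apply_rescale_le_of_isTest (LP : DyadicPartition d) (r : ℝ) :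
    ∃ (N : ℕ) (C : ℝ), 0 < C ∧ ∀ (v : TDist d) (x : E d) (l : ℝ) (hl : 0 < l) (a : ℝ),
      (∀ φ, IsTest LP r φ → |v (rescale φ l hl x)| ≤ a) →
      ∀ η : 𝓢(E d, ℝ), Function.support η ⊆ Metric.closedBall 0 1 →
        |v (rescale η l hl x)| ≤ C * sn ℝ N η * a := by
  obtain ⟨N, C, hC, h⟩ := exists_blockFun_le_rpow LP r
  refine ⟨N, C, hC, fun v x l hl a ha η hη => ?_⟩
  -- Division is by any `t` strictly larger than the norm bound, followed by a limit; this avoids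
  -- dividing by zero when the seminorm vanishes.
  have key : ∀ t : ℝ, C * sn ℝ N η < t → |v (rescale η l hl x)| ≤ t * a := by
    intro t ht
    have hS := sn_nonneg N η
    have ht0 : 0 < t := lt_of_le_of_lt (by positivity) ht
    have h1 : IsTest LP r (t⁻¹ • η) := by
      rw [isTest_iff]
      refine ⟨fun y hy => hη ?_, fun n y => ?_⟩
      · rw [Function.mem_support] at hy ⊢
        intro h0
        apply hy
        simp [h0]
      · have e : blockFun LP n (t⁻¹ • η : 𝓢(E d, ℝ)) y = t⁻¹ * blockFun LP n η y := by
          rw [← blockFun_const_mul]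
          rfl
        rw [e, abs_mul, abs_of_pos (inv_pos.2 ht0), inv_mul_le_iff₀ ht0]
        exact (h n η y).trans (mul_le_mul_of_nonneg_right ht.le (sc_rpow_pos n r).le)
    have h2 := ha _ h1
    rw [rescale_smul, map_smul, smul_eq_mul, abs_mul, abs_of_pos (inv_pos.2 ht0),
      inv_mul_le_iff₀ ht0] at h2
    exact h2
  have hcont : Tendsto (fun t : ℝ => t * a) (𝓝[>] (C * sn ℝ N η)) (𝓝 (C * sn ℝ N η * a)) :=
    ((continuous_id.mul continuous_const).tendsto _).mono_left nhdsWithin_le_nhds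
  exact ge_of_tendsto hcont (eventually_nhdsWithin_of_forall key)

theorem sn_rescale_le (N : ℕ) (ψ : 𝓢(E d, ℝ)) {l : ℝ} (hl : 0 < l) (hl1 : l ≤ 1) :
    sn ℝ N (rescale ψ l hl 0) ≤ (l⁻¹) ^ (d + N) * sn ℝ N ψ := by
  have hS := sn_nonneg N ψ
  have h1 : 1 ≤ l⁻¹ := (one_le_inv₀ hl).2 hl1
  refine sn_le _ (by positivity) fun k hk j hj x => ?_
  have e : ⇑(rescale ψ l hl 0) = fun y => (l ^ d)⁻¹ • (fun z => ψ (l⁻¹ • z)) y := by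
    ext y
    simp [rescale_apply]
  have hc : ContDiff ℝ j fun z => ψ (l⁻¹ • z) :=
    (ψ.smooth j).comp (contDiff_const_smul _)
  rw [e, iteratedFDeriv_const_smul_apply' hc.contDiffAt,
    iteratedFDeriv_comp_const_smul _ (ψ.smooth j), norm_smul, norm_smul]
  have h2 := (ψ.le_seminorm ℝ k j (l⁻¹ • x)).trans (seminorm_le_sn hk hj ψ)
  rw [norm_smul, mul_pow] at h2
  rw [norm_inv, norm_pow, norm_pow, Real.norm_of_nonneg hl.le, Real.norm_of_nonneg (by positivity)]
  rw [Real.norm_of_nonneg (by positivity)] at h2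
  have h3 : ‖x‖ ^ k * ‖iteratedFDeriv ℝ j ψ (l⁻¹ • x)‖ ≤ sn ℝ N ψ := by
    refine le_trans ?_ h2
    refine mul_le_mul_of_nonneg_right ?_ (norm_nonneg _)
    exact le_mul_of_one_le_left (by positivity) (one_le_pow₀ h1)
  calc _ = (l ^ d)⁻¹ * (l⁻¹) ^ j * (‖x‖ ^ k * ‖iteratedFDeriv ℝ j ψ (l⁻¹ • x)‖) := by ring
    _ ≤ (l ^ d)⁻¹ * (l⁻¹) ^ N * sn ℝ N ψ := by gcongr
    _ = _ := by rw [pow_add, inv_pow l d]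

theorem rescale_eq_translate (ψ : 𝓢(E d, ℝ)) {l : ℝ} (hl : 0 < l) (x : E d) :
    rescale ψ l hl x = translate (rescale ψ l hl 0) x := by
  ext y
  simp [rescale_apply]

theorem rpow_le_pow_of_one_le {t : ℝ} (ht : 1 ≤ t) {α : ℝ} {K : ℕ} (hK : |α| ≤ K) :
    t ^ α ≤ t ^ K := by
  rw [← Real.rpow_natCast]
  exact Real.rpow_le_rpow_of_exponent_le ht ((le_abs_self α).trans hK)

theorem pow_le_rpow_of_le_one {t : ℝ} (h0 : 0 < t) (ht : t ≤ 1) {α : ℝ} {K : ℕ} (hK : |α| ≤ K) :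
    t ^ K ≤ t ^ α := by
  rw [← Real.rpow_natCast]
  exact Real.rpow_le_rpow_of_exponent_ge h0 ht ((le_abs_self α).trans hK)

-- `ψ` is cut into dyadic shells. A shell of radius about `2 ^ p`, shrunk to the unit ball, is a
-- test function at the larger scale `l * 2 ^ (p + 2)`. The shrinking and the change of scale cost a
-- fixed power of `2 ^ p`, which the decay of `ψ` overcompensates, so the shells sum up. Shells with
-- `l * 2 ^ p` of order one or more are out of reach of the first hypothesis and are left to the
-- second, crude one, which ignores the scale.
set_option maxHeartbeats 1000000 in
theorem exists_apply_rescale_le (LP : DyadicPartition d) (r α : ℝ) (N₀ : ℕ) (ψ : 𝓢(E d, ℝ)) :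
    ∃ C, 0 ≤ C ∧ ∀ (v : TDist d) (x : E d) (A : ℝ), 0 ≤ A →
      (∀ φ, IsTest LP r φ → ∀ (l : ℝ) (hl : 0 < l), l ≤ 1 → |v (rescale φ l hl x)| ≤ A * l ^ α) →
      (∀ η, |v (translate η x)| ≤ A * sn ℝ N₀ η) →
      ∀ (l : ℝ) (hl : 0 < l), l ≤ 1 → |v (rescale ψ l hl x)| ≤ C * A * l ^ α := by
  obtain ⟨N₁, C₁, hC₁, hloc⟩ := exists_apply_rescale_le_of_isTest LP r
  obtain ⟨N, hN₀, hN₁⟩ : ∃ N, N₀ ≤ N ∧ N₁ ≤ N := ⟨max N₀ N₁, le_max_left _ _, le_max_right _ _⟩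
  obtain ⟨K, hK⟩ : ∃ K : ℕ, |α| ≤ K := ⟨_, Nat.le_ceil _⟩
  -- `d + N` is the loss of `sn_rescale_le`, and `K ≥ |α|` the loss in `(l * 2 ^ q) ^ α`. The
  -- truncation error is taken with one more power, `Q + 1`, which leaves a convergent geometric
  -- sum.
  obtain ⟨Q, hQ⟩ : ∃ Q, Q = d + N + K := ⟨_, rfl⟩
  obtain ⟨C₂, hC₂, hcut⟩ := sn_sub_cutoff_le (F := ℝ) LP N (Q + 1)
  obtain ⟨S, hS⟩ : ∃ S, S = sn ℝ (N + (Q + 1)) ψ := ⟨_, rfl⟩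
  have hS0 : 0 ≤ S := hS ▸ sn_nonneg _ ψ
  have hcut' : ∀ p : ℕ, sn ℝ N (ψ - cutoff LP ((1 / 2) ^ p) ψ) ≤ C₂ * ((1 / 2) ^ p) ^ (Q + 1) * S :=
    fun p => hS ▸ hcut _ (by positivity) (pow_le_one₀ (by norm_num) (by norm_num)) ψ
  have hψS : sn ℝ N ψ ≤ S := hS ▸ sn_mono (by omega) ψ
  obtain ⟨C₃, hC₃⟩ : ∃ C₃, C₃ = C₁ * (4 ^ Q * ((1 + C₂) * S)) := ⟨_, rfl⟩
  obtain ⟨C₄, hC₄⟩ : ∃ C₄, C₄ = C₁ * (4 ^ Q * (2 * C₂ * S)) := ⟨_, rfl⟩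
  have hC₃0 : 0 ≤ C₃ := by rw [hC₃]; positivity
  have hC₄0 : 0 ≤ C₄ := by rw [hC₄]; positivity
  refine ⟨4 ^ (d + N) * S * 4 ^ K + (C₃ + C₄ * 2 + C₂ * S * 4 ^ (Q + 1)), by positivity,
    fun v x A hA hv hcrude l hl hl1 => ?_⟩
  have hlα : 0 < l ^ α := Real.rpow_pos_of_pos hl α
  have hcr : ∀ η : 𝓢(E d, ℝ), |v (rescale η l hl x)| ≤ A * ((l⁻¹) ^ (d + N) * sn ℝ N η) := by
    intro η
    rw [rescale_eq_translate]
    refine (hcrude _).trans (mul_le_mul_of_nonneg_left ?_ hA)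
    exact (sn_mono hN₀ _).trans (sn_rescale_le N η hl hl1)
  have hpiece : ∀ (q : ℕ) (η : 𝓢(E d, ℝ)), (∀ y, η y ≠ 0 → ‖y‖ ≤ 2 ^ q) → l * 2 ^ q ≤ 1 →
      |v (rescale η l hl x)| ≤ C₁ * ((2 ^ q) ^ Q * sn ℝ N η) * (A * l ^ α) := by
    intro q η hη hlq
    have ha : (0 : ℝ) < (2 ^ q)⁻¹ := by positivity
    have ha1 : ((2 : ℝ) ^ q)⁻¹ ≤ 1 := inv_le_one_of_one_le₀ (one_le_pow₀ (by norm_num))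
    have hb : 0 < l * 2 ^ q := by positivity
    have e : rescale η l hl x = rescale (rescale η _ ha 0) (l * 2 ^ q) hb x := by
      rw [rescale_rescale_zero]
      congr 1
      field_simp
    rw [e]
    have hsupp : Function.support (rescale η _ ha 0) ⊆ Metric.closedBall 0 1 := by
      intro y hy
      rw [Function.mem_support, rescale_apply, sub_zero, inv_inv] at hy
      have := hη _ (right_ne_zero_of_mul hy)
      rw [norm_smul, Real.norm_of_nonneg (by positivity)] at this
      rw [mem_closedBall_zero_iff]
      exact le_of_mul_le_mul_left (by linarith) (by positivity : (0 : ℝ) < 2 ^ q)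
    refine (hloc v x _ hb _ (fun φ hφ => hv φ hφ _ hb hlq) _ hsupp).trans ?_
    have h1 : sn ℝ N₁ (rescale η _ ha 0) ≤ (2 ^ q) ^ (d + N) * sn ℝ N η := by
      have := (sn_mono hN₁ _).trans (sn_rescale_le N η ha ha1)
      rwa [inv_inv] at this
    have h2 : (l * 2 ^ q) ^ α ≤ l ^ α * (2 ^ q) ^ K := by
      rw [Real.mul_rpow hl.le (by positivity)]
      gcongr
      exact rpow_le_pow_of_one_le (one_le_pow₀ (by norm_num)) hK
    have hSη := sn_nonneg N η
    calc _ ≤ C₁ * ((2 ^ q) ^ (d + N) * sn ℝ N η) * (A * (l ^ α * (2 ^ q) ^ K)) := by gcongr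
      _ = _ := by rw [hQ, pow_add]; ring
  rcases lt_or_ge (1 / 4) l with hl4 | hl4
  · have h1 : l⁻¹ ≤ 4 := by
      rw [inv_le_comm₀ hl (by norm_num)]
      linarith
    have h2 : 1 ≤ 4 ^ K * l ^ α := by
      have := pow_le_rpow_of_le_one hl hl1 hK
      calc (1 : ℝ) = 4 ^ K * (1 / 4) ^ K := by rw [← mul_pow]; norm_num
        _ ≤ 4 ^ K * l ^ K := by gcongr
        _ ≤ _ := by gcongr
    calc _ ≤ A * ((l⁻¹) ^ (d + N) * sn ℝ N ψ) := hcr ψ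
      _ ≤ A * (4 ^ (d + N) * S) * 1 := by rw [mul_one]; gcongr
      _ ≤ A * (4 ^ (d + N) * S) * (4 ^ K * l ^ α) := by gcongr
      _ = 4 ^ (d + N) * S * 4 ^ K * A * l ^ α := by ring
      _ ≤ _ := by
        have : 0 ≤ C₃ + C₄ * 2 + C₂ * S * 4 ^ (Q + 1) := by positivity
        gcongr
        linarith
  -- With `n = m + 1`, the number of shells satisfies `2 ^ (m + 1) ≤ l⁻¹ < 2 ^ (m + 2)`: all shells
  -- `p < m` fit in balls of radius `2 ^ (p + 2)` with `l * 2 ^ (p + 2) ≤ 1`, and the truncation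
  -- error of `χ m` is a power of `l`.
  · obtain ⟨n, hn1, hn2⟩ := exists_nat_pow_near (x := l⁻¹) (y := (2 : ℝ))
      ((one_le_inv₀ hl).2 hl1) (by norm_num)
    have hn : n ≠ 0 := by
      rintro rfl
      have : (4 : ℝ) ≤ l⁻¹ := by
        rw [le_inv_comm₀ (by norm_num) hl]
        linarith
      norm_num at hn2
      linarith
    obtain ⟨m, rfl⟩ := Nat.exists_eq_succ_of_ne_zero hn
    rw [Nat.succ_eq_add_one] at hn1 hn2
    have hm1 : l * 2 ^ (m + 1) ≤ 1 := by
      have := mul_le_mul_of_nonneg_left hn1 hl.le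
      rwa [mul_inv_cancel₀ hl.ne'] at this
    have hm2 : (1 / 2 : ℝ) ^ m ≤ 4 * l := by
      have := (mul_lt_mul_of_pos_left hn2 hl).le
      rw [mul_inv_cancel₀ hl.ne'] at this
      calc (1 / 2 : ℝ) ^ m = (1 / 2) ^ m * 1 := by ring
        _ ≤ (1 / 2) ^ m * (l * 2 ^ (m + 1 + 1)) := by gcongr
        _ = ((1 / 2) * 2) ^ m * 4 * l := by rw [mul_pow]; ring
        _ = _ := by norm_num
    set χ : ℕ → 𝓢(E d, ℝ) := fun p => cutoff LP ((1 / 2) ^ p) ψ with hχ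
    have hdec : ψ = χ 0 + ∑ p ∈ Finset.range m, (χ (p + 1) - χ p) + (ψ - χ m) := by
      rw [Finset.sum_range_sub]
      abel
    have hsuppχ : ∀ p y, χ p y ≠ 0 → ‖y‖ ≤ 4 / 3 * 2 ^ p := by
      intro p y hy
      rw [hχ] at hy
      simp only [cutoff_apply] at hy
      have := LP.norm_lt_of_ρ_zero_ne (left_ne_zero_of_smul hy)
      rw [norm_smul, Real.norm_of_nonneg (by positivity), ← half_pow_mul_two_pow,
        inv_mul_lt_iff₀ (by positivity)] at this
      linarith
    have hsnχ : ∀ p, sn ℝ N (χ (p + 1) - χ p) ≤ 2 * C₂ * S * ((1 / 2) ^ p) ^ (Q + 1) := by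
      intro p
      have e : χ (p + 1) - χ p = (ψ - χ p) - (ψ - χ (p + 1)) := by abel
      rw [e]
      refine (map_sub_le_add (sn ℝ N) _ _).trans ((add_le_add (hcut' p) (hcut' (p + 1))).trans ?_)
      have : ((1 / 2 : ℝ) ^ (p + 1)) ^ (Q + 1) ≤ ((1 / 2) ^ p) ^ (Q + 1) := by
        refine pow_le_pow_left₀ (by positivity) ?_ _
        exact pow_le_pow_of_le_one (by norm_num) (by norm_num) (Nat.le_succ p)
      have h2 : 0 ≤ C₂ * S := by positivity
      nlinarith
    have hfirst : |v (rescale (χ 0) l hl x)| ≤ C₃ * (A * l ^ α) := by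
      refine (hpiece 2 (χ 0) (fun y hy => (hsuppχ 0 y hy).trans (by norm_num)) (by linarith)).trans ?_
      have e : χ 0 = ψ - (ψ - χ 0) := by abel
      have h1 : sn ℝ N (χ 0) ≤ (1 + C₂) * S := by
        rw [e]
        refine (map_sub_le_add (sn ℝ N) _ _).trans ((add_le_add hψS (hcut' 0)).trans_eq ?_)
        simp
        ring
      rw [hC₃, show (2 : ℝ) ^ 2 = 4 by norm_num]
      gcongr
    have hmid : ∀ p ∈ Finset.range m,
        |v (rescale (χ (p + 1) - χ p) l hl x)| ≤ C₄ * (A * l ^ α) * (1 / 2) ^ p := by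
      intro p hp
      have hp' := Finset.mem_range.1 hp
      refine (hpiece (p + 2) _ (fun y hy => ?_) ?_).trans ?_
      · by_cases h1 : χ (p + 1) y = 0
        · have h2 : χ p y ≠ 0 := by
            intro h2
            apply hy
            simp [h1, h2]
          refine (hsuppχ p y h2).trans ?_
          have : (0 : ℝ) < 2 ^ p := by positivity
          rw [pow_add]
          linarith
        · refine (hsuppχ _ y h1).trans ?_
          have : (0 : ℝ) < 2 ^ p := by positivity
          rw [pow_add, pow_add]
          linarith
      · refine le_trans ?_ hm1
        exact mul_le_mul_of_nonneg_left (pow_le_pow_right₀ (by norm_num) (by omega)) hl.le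
      · have e : ((2 : ℝ) ^ (p + 2)) ^ Q * ((1 / 2) ^ p) ^ (Q + 1) = 4 ^ Q * (1 / 2) ^ p := by
          rw [pow_add (2 : ℝ) p 2, mul_pow, pow_succ ((1 / 2 : ℝ) ^ p) Q]
          have : ((2 : ℝ) ^ p) ^ Q * ((1 / 2) ^ p) ^ Q = 1 := by
            rw [← mul_pow, ← mul_pow]
            norm_num
          calc _ = (((2 : ℝ) ^ p) ^ Q * ((1 / 2) ^ p) ^ Q) * ((2 ^ 2) ^ Q * (1 / 2) ^ p) := by ring
            _ = _ := by rw [this]; norm_num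
        calc _ ≤ C₁ * ((2 ^ (p + 2)) ^ Q * (2 * C₂ * S * ((1 / 2) ^ p) ^ (Q + 1))) *
              (A * l ^ α) := by
              gcongr
              exact hsnχ p
          _ = C₁ * (((2 ^ (p + 2)) ^ Q * ((1 / 2) ^ p) ^ (Q + 1)) * (2 * C₂ * S)) *
              (A * l ^ α) := by ring
          _ = _ := by rw [e, hC₄]; ring
    -- The negative power `l⁻¹ ^ (d + N)` of the crude bound is paid by the factor `(4 l) ^ (Q + 1)`
    -- from the tail of `ψ`, which leaves `l ^ (K + 1) ≤ l ^ α`.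
    have hlast : |v (rescale (ψ - χ m) l hl x)| ≤ C₂ * S * 4 ^ (Q + 1) * (A * l ^ α) := by
      refine (hcr _).trans ?_
      have h1 : l ^ (K + 1) ≤ l ^ α := by
        refine pow_le_rpow_of_le_one hl hl1 ?_
        push_cast
        linarith
      have h2 : (l⁻¹) ^ (d + N) * l ^ (Q + 1) = l ^ (K + 1) := by
        rw [hQ, show d + N + K + 1 = (d + N) + (K + 1) by ring, pow_add l, ← mul_assoc, ← mul_pow,
          inv_mul_cancel₀ hl.ne', one_pow, one_mul]
      calc _ ≤ A * ((l⁻¹) ^ (d + N) * (C₂ * (4 * l) ^ (Q + 1) * S)) := by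
            have := hcut' m
            gcongr
            refine this.trans ?_
            gcongr
        _ = A * C₂ * S * 4 ^ (Q + 1) * ((l⁻¹) ^ (d + N) * l ^ (Q + 1)) := by rw [mul_pow]; ring
        _ ≤ A * C₂ * S * 4 ^ (Q + 1) * l ^ α := by rw [h2]; gcongr
        _ = _ := by ring
    have hgeom : ∑ p ∈ Finset.range m, (1 / 2 : ℝ) ^ p ≤ 2 := by
      have := Summable.sum_le_tsum (Finset.range m) (fun p _ => by positivity)
        (summable_geometric_two)
      rwa [tsum_geometric_two] at this
    have htot : |v (rescale ψ l hl x)| ≤ C₃ * (A * l ^ α) + C₄ * (A * l ^ α) * 2 +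
        C₂ * S * 4 ^ (Q + 1) * (A * l ^ α) := by
      conv_lhs => rw [hdec]
      rw [rescale_add, rescale_add, rescale_sum, map_add, map_add, map_sum]
      refine (abs_add_le _ _).trans (add_le_add ((abs_add_le _ _).trans
        (add_le_add hfirst ?_)) hlast)
      refine (Finset.abs_sum_le_sum_abs _ _).trans ((Finset.sum_le_sum hmid).trans ?_)
      rw [← Finset.mul_sum]
      gcongr
    refine htot.trans ?_
    have : 0 ≤ 4 ^ (d + N) * S * 4 ^ K * (A * l ^ α) := by positivity
    nlinarith

end

/-! ### Estimates uniform over the test functions of a model -/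

section

variable {d : ℕ}

/-! ## Dyadic sums -/

theorem sc_add (k m : ℕ) : sc (k + m) = sc k * (1 / 2) ^ m := by
  unfold sc
  rw [pow_add, one_div_pow]
  field_simp

theorem sc_antitone : Antitone sc := by
  intro m n h
  obtain ⟨k, rfl⟩ := Nat.exists_eq_add_of_le h
  rw [sc_add]
  exact mul_le_of_le_one_right (sc_pos m).le (pow_le_one₀ (by norm_num) (by norm_num))

theorem sc_add_rpow (k m : ℕ) (s : ℝ) : sc (k + m) ^ s = sc k ^ s * ((1 / 2 : ℝ) ^ s) ^ m := by
  rw [sc_add, Real.mul_rpow (sc_pos k).le (by positivity), ← Real.rpow_natCast,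
    ← Real.rpow_natCast, ← Real.rpow_mul (by norm_num), ← Real.rpow_mul (by norm_num), mul_comm s]

theorem hasSum_sc_rpow {s : ℝ} (hs : 0 < s) (k : ℕ) :
    HasSum (fun m => sc (k + m) ^ s) (sc k ^ s * (1 - (1 / 2 : ℝ) ^ s)⁻¹) := by
  simp only [sc_add_rpow]
  exact (hasSum_geometric_of_lt_one (by positivity)
    (Real.rpow_lt_one (by norm_num) (by norm_num) hs)).mul_left _

theorem geom_const_nonneg {s : ℝ} (hs : 0 < s) : 0 ≤ (1 - (1 / 2 : ℝ) ^ s)⁻¹ :=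
  inv_nonneg.2 (sub_nonneg.2 (Real.rpow_lt_one (by norm_num) (by norm_num) hs).le)

theorem abs_tsum_le_sc {s : ℝ} (hs : 0 < s) (k : ℕ) {a : ℕ → ℝ} {A : ℝ}
    (h : ∀ m, |a m| ≤ A * sc (k + m) ^ s) :
    Summable a ∧ |∑' m, a m| ≤ A * (1 - (1 / 2 : ℝ) ^ s)⁻¹ * sc k ^ s := by
  have hS := (hasSum_sc_rpow hs k).mul_left A
  refine ⟨Summable.of_norm_bounded hS.summable h, ?_⟩
  refine (tsum_of_norm_bounded (f := a) hS h).trans_eq ?_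
  ring

/-- `∑_{j < k} sc j ^ s` for negative `s` is dominated by its last term. -/
theorem sum_sc_rpow_le {s : ℝ} (hs : s < 0) (k : ℕ) :
    ∑ j ∈ Finset.range k, sc j ^ s ≤ (1 - (1 / 2 : ℝ) ^ (-s))⁻¹ * sc k ^ s := by
  set q := (1 / 2 : ℝ) ^ (-s) with hq
  have hq1 : q < 1 := Real.rpow_lt_one (by norm_num) (by norm_num) (neg_pos.2 hs)
  have hq0 : 0 < q := by positivity
  have e : ∀ j, sc j ^ s = q * sc (j + 1) ^ s := by
    intro j
    rw [sc_add_rpow, pow_one, hq, mul_left_comm, ← Real.rpow_add (by norm_num), neg_add_cancel,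
      Real.rpow_zero, mul_one]
  induction k with
  | zero =>
    simp only [Finset.range_zero, Finset.sum_empty]
    exact mul_nonneg (inv_nonneg.2 (sub_nonneg.2 hq1.le)) (sc_rpow_pos _ _).le
  | succ k ih =>
    rw [Finset.sum_range_succ]
    have h1 : (1 - q)⁻¹ * sc k ^ s + sc k ^ s ≤ (1 - q)⁻¹ * sc (k + 1) ^ s := by
      rw [e k]
      have : (1 - q)⁻¹ * (q * sc (k + 1) ^ s) + q * sc (k + 1) ^ s =
          q * ((1 - q)⁻¹ * (1 + (1 - q))) * sc (k + 1) ^ s := by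
        have : 1 - q ≠ 0 := by linarith
        field_simp
      rw [this]
      have h2 : 0 < 1 - q := by linarith
      refine mul_le_mul_of_nonneg_right ?_ (sc_rpow_pos _ _).le
      rw [← mul_assoc, mul_comm q, mul_assoc]
      refine mul_le_of_le_one_right (inv_nonneg.2 h2.le) ?_
      nlinarith [sq_nonneg (1 - q)]
    linarith

theorem exists_sc_between {t : ℝ} (h0 : 0 < t) (h2 : t ≤ 2) : ∃ i, t ≤ sc i ∧ sc i < 2 * t := by
  obtain ⟨n, h1, h3⟩ := exists_nat_pow_near (x := 2 / t) (y := (2 : ℝ))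
    ((one_le_div h0).2 h2) (by norm_num)
  refine ⟨n, ?_, ?_⟩
  · unfold sc
    rw [le_div_iff₀ (by positivity)]
    rw [le_div_iff₀ h0] at h1
    linarith
  · unfold sc
    rw [div_lt_iff₀ (by positivity)]
    rw [div_lt_iff₀ h0, pow_succ] at h3
    linarith

/-! ## Decay of the Littlewood-Paley blocks of test functions -/

theorem tendsto_convS_lowKernel (LP : DyadicPartition d) (φ : 𝓢(E d, ℝ)) (x : E d) :
    Tendsto (fun n => convS (LP.lowKernel n) φ x) atTop (𝓝 (φ x)) := by
  obtain ⟨N, C, hC, h⟩ := sn_sub_convS_lowKernel_le LP 0 1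
  rw [← tendsto_add_atTop_iff_nat 1]
  rw [tendsto_iff_norm_sub_tendsto_zero]
  have hz : Tendsto (fun n : ℕ => C * (1 / 2 : ℝ) ^ n * sn ℝ N φ) atTop (𝓝 0) := by
    have := ((tendsto_pow_atTop_nhds_zero_of_lt_one (r := (1 / 2 : ℝ)) (by norm_num)
      (by norm_num)).const_mul C).mul_const (sn ℝ N φ)
    simpa using this
  refine squeeze_zero (fun n => norm_nonneg _) (fun n => ?_) hz
  rw [norm_sub_rev]
  refine (abs_apply_le_sn 0 (φ - convS (LP.lowKernel (n + 1)) φ) x).trans ((h n φ).trans_eq ?_)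
  rw [pow_one, half_pow_mul_two_pow]

theorem hasSum_blockFun (LP : DyadicPartition d) (φ : 𝓢(E d, ℝ)) (x : E d)
    (hs : Summable fun n => blockFun LP n φ x) (i : ℕ) :
    HasSum (fun n => blockFun LP (i + n) φ x) ((φ - convS (LP.lowKernel i) φ) x) := by
  have e : ∀ n, ∑ m ∈ Finset.range n, blockFun LP m φ x = convS (LP.lowKernel n) φ x := by
    intro n
    rw [DyadicPartition.lowKernel, convS_sum_left, sum_apply]
    simp only [blockFun_eq_convS]
  have h1 : HasSum (fun n => blockFun LP n φ x) (φ x) := by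
    refine (hs.hasSum_iff_tendsto_nat).2 ?_
    simp only [e]
    exact tendsto_convS_lowKernel LP φ x
  have h2 := (hasSum_nat_add_iff' i).2 h1
  rw [e] at h2
  simpa only [sub_apply, add_comm] using h2

/-- The high-frequency part of a test function is no longer compactly supported, but it decays
polynomially, uniformly over test functions. For `‖z‖ ≤ 2` the `𝒞^r` bound is enough. For `‖z‖ > 2`
the support of `φ` is at distance at least `‖z‖ / 2`, and the decay of the kernel gives both `‖z‖ ^
(-P)` and `sc m ^ P`. The choice `P ≥ M, r` makes this fit the claim, and the blocks are summed
using `r > 0`. -/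
theorem exists_isTest_decay (LP : DyadicPartition d) {r : ℝ} (hr : 0 < r) (M : ℕ) :
    ∃ C, 0 ≤ C ∧ ∀ φ, IsTest LP r φ → ∀ (i : ℕ) (z : E d),
      |(φ - convS (LP.lowKernel i) φ) z| * (1 + ‖z‖) ^ M ≤ C * sc i ^ r := by
  set Q := (1 - (1 / 2 : ℝ) ^ r)⁻¹ with hQ
  have hQ0 : 0 ≤ Q := geom_const_nonneg hr
  obtain ⟨P, hPM, hPr⟩ : ∃ P : ℕ, M ≤ P ∧ r ≤ P :=
    ⟨max M ⌈r⌉₊, le_max_left _ _, (Nat.le_ceil r).trans (by exact_mod_cast le_max_right _ _)⟩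
  obtain ⟨C₁, hC₁, h₁⟩ := exists_kernel_weight LP (Nat.cast_nonneg P)
  set S := Q * sc 0 ^ r with hS
  have hS0 : 0 ≤ S := mul_nonneg hQ0 (sc_rpow_pos _ _).le
  set C := 3 ^ M + 4 ^ M * S * C₁ * 2 ^ ((P : ℝ) - r) with hC
  refine ⟨C * Q, by positivity, fun φ hφ i z => ?_⟩
  rw [isTest_iff] at hφ
  obtain ⟨hsupp, hb⟩ := hφ
  have hsum : ∀ x, Summable fun n => blockFun LP n φ x := fun x =>
    (abs_tsum_le_sc hr 0 (A := 1) fun m => by simpa using hb m x).1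
  have hsup : ∀ x, |φ x| ≤ S := by
    intro x
    have h2 := (hasSum_blockFun LP φ x (hsum x) 0).tsum_eq
    have h3 := (abs_tsum_le_sc hr 0 (A := 1) (a := fun n => blockFun LP (0 + n) φ x)
      fun m => by simpa using hb m x).2
    rw [h2, lowKernel_zero, convS_zero_left, sub_zero, one_mul] at h3
    exact h3
  have key : ∀ m, |blockFun LP m φ z| * (1 + ‖z‖) ^ M ≤ C * sc m ^ r := by
    intro m
    have hscr := sc_rpow_pos m r
    rcases le_or_gt ‖z‖ 2 with hz | hz
    · calc _ ≤ sc m ^ r * 3 ^ M := by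
            gcongr
            · exact hb m z
            · linarith
        _ = 3 ^ M * sc m ^ r := mul_comm _ _
        _ ≤ _ := by
            gcongr
            rw [hC]
            exact le_add_of_nonneg_right (by positivity)
    · have hsc := sc_pos m
      obtain ⟨i1, i2⟩ := h₁ m (sc m) le_rfl z z
      simp only [Real.rpow_natCast, sub_self, norm_zero, add_zero] at i1 i2
      have hpt : ∀ v, ‖LP.kernel m (z - v) * φ v‖ ≤
          (S * (2 / ‖z‖) ^ P) * (|LP.kernel m (z - v)| * (sc m + ‖v - z‖) ^ P) := by
        intro v
        rw [norm_mul, Real.norm_eq_abs, Real.norm_eq_abs]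
        by_cases hv : φ v = 0
        · rw [hv, abs_zero, mul_zero]
          positivity
        have hv1 : ‖v‖ ≤ 1 := by simpa using hsupp hv
        have h4 : 1 ≤ (2 / ‖z‖) ^ P * (sc m + ‖v - z‖) ^ P := by
          rw [← mul_pow]
          refine one_le_pow₀ ?_
          rw [div_mul_eq_mul_div, one_le_div (by linarith)]
          have : ‖z‖ ≤ ‖v‖ + ‖v - z‖ := by
            have := norm_sub_le v (v - z)
            simpa using this
          linarith
        calc _ ≤ |LP.kernel m (z - v)| * (S * 1) := by
              rw [mul_one]
              gcongr
              exact hsup v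
          _ ≤ |LP.kernel m (z - v)| * (S * ((2 / ‖z‖) ^ P * (sc m + ‖v - z‖) ^ P)) := by gcongr
          _ = _ := by ring
      have h5 : |blockFun LP m φ z| ≤ (S * (2 / ‖z‖) ^ P) * (C₁ * sc m ^ P) := by
        rw [blockFun, ← Real.norm_eq_abs]
        refine (norm_integral_le_of_norm_le (i1.const_mul _) (Eventually.of_forall hpt)).trans ?_
        rw [integral_const_mul]
        gcongr
      have h6 : (2 / ‖z‖) ^ P * (1 + ‖z‖) ^ M ≤ 4 ^ M := by
        have hz1 : 2 / ‖z‖ ≤ 1 := (div_le_one (by linarith)).2 hz.le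
        calc _ ≤ (2 / ‖z‖) ^ M * (1 + ‖z‖) ^ M := by
              refine mul_le_mul_of_nonneg_right ?_ (by positivity)
              exact pow_le_pow_of_le_one (by positivity) hz1 hPM
          _ = (2 / ‖z‖ * (1 + ‖z‖)) ^ M := (mul_pow _ _ _).symm
          _ ≤ 4 ^ M := by
              refine pow_le_pow_left₀ (by positivity) ?_ _
              rw [div_mul_eq_mul_div, div_le_iff₀ (by linarith)]
              linarith
      have h7 : sc m ^ P ≤ 2 ^ ((P : ℝ) - r) * sc m ^ r := by
        rw [← Real.rpow_natCast, ← sub_add_cancel (P : ℝ) r, Real.rpow_add hsc, add_sub_cancel_right]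
        refine mul_le_mul_of_nonneg_right ?_ hscr.le
        exact Real.rpow_le_rpow hsc.le (sc_le_two m) (sub_nonneg.2 hPr)
      calc _ ≤ (S * (2 / ‖z‖) ^ P) * (C₁ * sc m ^ P) * (1 + ‖z‖) ^ M := by gcongr
        _ = ((2 / ‖z‖) ^ P * (1 + ‖z‖) ^ M) * (S * C₁) * sc m ^ P := by ring
        _ ≤ 4 ^ M * (S * C₁) * (2 ^ ((P : ℝ) - r) * sc m ^ r) := by gcongr
        _ = 4 ^ M * S * C₁ * 2 ^ ((P : ℝ) - r) * sc m ^ r := by ring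
        _ ≤ _ := by
            gcongr
            rw [hC]
            exact le_add_of_nonneg_left (by positivity)
  have hz0 : 0 < (1 + ‖z‖) ^ M := by positivity
  rw [← (hasSum_blockFun LP φ z (hsum z) i).tsum_eq, ← le_div_iff₀ hz0]
  have := (abs_tsum_le_sc hr i (A := C / (1 + ‖z‖) ^ M) (a := fun n => blockFun LP (i + n) φ z)
    fun m => by
      rw [div_mul_eq_mul_div, le_div_iff₀ hz0]
      exact key (i + m)).2
  refine this.trans_eq ?_
  ring

/-! ## Testing functions of polynomial growth against rescaled functions -/

/-- A bound for `∫ η_x^l F` when `η` decays and `F` grows at most polynomially around `x`. -/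
theorem abs_integral_rescale_mul_le {η : 𝓢(E d, ℝ)} {F : E d → ℝ} {D a b s l : ℝ} {M : ℕ}
    {x : E d} (hs : 0 ≤ s) (hM : ⌈s⌉₊ + (d + 1) ≤ M) (hb : 0 ≤ b) (hl : 0 < l) (ha : 0 ≤ a)
    (hη : ∀ z, |η z| * (1 + ‖z‖) ^ M ≤ D) (hF : ∀ y, |F y| ≤ a * (b + ‖y - x‖) ^ s) :
    |∫ y, rescale η l hl x y * F y| ≤
      (∫ z : E d, (1 + ‖z‖) ^ (-((d + 1 : ℕ) : ℝ))) * a * D * (b + l) ^ s := by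
  have hi : Integrable fun y : E d => (1 + ‖y‖) ^ (-((d + 1 : ℕ) : ℝ)) := by
    apply integrable_one_add_norm
    simp
  have hpt : ∀ y, ‖rescale η l hl x y * F y‖ ≤ (a * D * (b + l) ^ s) *
      ((l ^ d)⁻¹ * (1 + ‖l⁻¹ • (x - y)‖) ^ (-((d + 1 : ℕ) : ℝ))) := by
    intro y
    set w := l⁻¹ • (y - x) with hw
    have e1 : ‖l⁻¹ • (x - y)‖ = ‖w‖ := by rw [hw, norm_smul, norm_smul, norm_sub_rev]
    have e2 : ‖y - x‖ = l * ‖w‖ := by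
      rw [hw, norm_smul, Real.norm_of_nonneg (inv_nonneg.2 hl.le), mul_inv_cancel_left₀ hl.ne']
    have h1 : (b + ‖y - x‖) ^ s ≤ (b + l) ^ s * (1 + ‖w‖) ^ ⌈s⌉₊ := by
      calc _ ≤ ((b + l) * (1 + ‖w‖)) ^ s := by
            refine Real.rpow_le_rpow (by positivity) ?_ hs
            rw [e2]
            have := mul_nonneg hb (norm_nonneg w)
            nlinarith
        _ = (b + l) ^ s * (1 + ‖w‖) ^ s := Real.mul_rpow (by positivity) (by positivity)
        _ ≤ _ := by
            refine mul_le_mul_of_nonneg_left ?_ (by positivity)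
            rw [← Real.rpow_natCast]
            refine Real.rpow_le_rpow_of_exponent_le ?_ (Nat.le_ceil s)
            linarith [norm_nonneg w]
    have h2 : |η w| * (1 + ‖w‖) ^ ⌈s⌉₊ ≤ D * (1 + ‖w‖) ^ (-((d + 1 : ℕ) : ℝ)) := by
      rw [Real.rpow_neg (by positivity), Real.rpow_natCast, ← div_eq_mul_inv,
        le_div_iff₀ (by positivity), mul_assoc, ← pow_add]
      refine le_trans ?_ (hη w)
      gcongr
      linarith [norm_nonneg w]
    rw [rescale_apply, norm_mul, Real.norm_eq_abs, Real.norm_eq_abs, abs_mul,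
      abs_of_nonneg (by positivity : 0 ≤ (l ^ d)⁻¹), e1]
    calc _ ≤ (l ^ d)⁻¹ * |η w| * (a * ((b + l) ^ s * (1 + ‖w‖) ^ ⌈s⌉₊)) := by
          gcongr
          exact (hF y).trans (mul_le_mul_of_nonneg_left h1 ha)
      _ = (l ^ d)⁻¹ * (a * (b + l) ^ s) * (|η w| * (1 + ‖w‖) ^ ⌈s⌉₊) := by ring
      _ ≤ (l ^ d)⁻¹ * (a * (b + l) ^ s) * (D * (1 + ‖w‖) ^ (-((d + 1 : ℕ) : ℝ))) := by gcongr
      _ = _ := by ring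
  rw [← Real.norm_eq_abs]
  refine (norm_integral_le_of_norm_le ((integrable_comp_rescale hi hl x).const_mul _)
    (Eventually.of_forall hpt)).trans_eq ?_
  rw [integral_const_mul, integral_comp_rescale (fun z => (1 + ‖z‖) ^ (-((d + 1 : ℕ) : ℝ))) hl x]
  ring

theorem exists_isTest_integral_le (LP : DyadicPartition d) {r : ℝ} (hr : 0 < r) {s : ℝ}
    (hs : 0 ≤ s) :
    ∃ C, 0 ≤ C ∧ ∀ φ, IsTest LP r φ → ∀ (l : ℝ) (hl : 0 < l) (x : E d) (F : E d → ℝ) (a b : ℝ),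
      0 ≤ a → 0 ≤ b → (∀ y, |F y| ≤ a * (b + ‖y - x‖) ^ s) →
        |∫ y, rescale φ l hl x y * F y| ≤ C * a * (b + l) ^ s := by
  obtain ⟨C, hC, h⟩ := exists_isTest_decay LP hr (⌈s⌉₊ + (d + 1))
  have hI : 0 ≤ ∫ z : E d, (1 + ‖z‖) ^ (-((d + 1 : ℕ) : ℝ)) :=
    integral_nonneg fun z => by positivity
  have h0 := (sc_rpow_pos 0 r).le
  refine ⟨(∫ z : E d, (1 + ‖z‖) ^ (-((d + 1 : ℕ) : ℝ))) * (C * sc 0 ^ r), by positivity,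
    fun φ hφ l hl x F a b ha hb hF => ?_⟩
  have h1 := h φ hφ 0
  simp only [lowKernel_zero, convS_zero_left, sub_zero] at h1
  refine (abs_integral_rescale_mul_le hs le_rfl hb hl ha h1 hF).trans_eq ?_
  ring

theorem DyadicPartition.convS_kernel_rescale_lowKernel_eq_zero (LP : DyadicPartition d) {i j : ℕ}
    {l : ℝ} (hl : 0 < l) (h : 2 * sc j ≤ l * sc i) (hj : j ≠ 0) (x : E d) (φ : 𝓢(E d, ℝ)) :
    convS (LP.kernel j) (rescale (convS (LP.lowKernel i) φ) l hl x) = 0 := by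
  refine injective_fourier_toC fun ξ => ?_
  have h0 : 𝓕 (toC (0 : 𝓢(E d, ℝ))) ξ = 0 := by
    rw [map_zero]
    have : 𝓕 (0 : 𝓢(E d, ℂ)) = 0 := map_zero (FourierTransform.fourierCLM ℝ 𝓢(E d, ℂ))
    rw [this]; rfl
  rcases Nat.eq_zero_or_pos i with rfl | hi
  · rw [lowKernel_zero, convS_zero_left]
    have : rescale (0 : 𝓢(E d, ℝ)) l hl x = 0 := by
      ext y
      simp [rescale_apply]
    rw [this, fourier_toC_convS, h0, mul_zero]
  obtain ⟨n, rfl⟩ := Nat.exists_eq_succ_of_ne_zero hi.ne'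
  rw [fourier_toC_convS, LP.fourier_kernel, fourier_toC_rescale, fourier_toC_convS,
    Nat.succ_eq_add_one, LP.fourier_lowKernel, h0]
  by_cases h1 : LP.ρ j ξ = 0
  · simp [h1]
  have h2 : LP.ρ 0 (((2 : ℝ) ^ n)⁻¹ • l • ξ) = 0 := by
    by_contra h2
    have h3 := LP.norm_lt_of_ρ_zero_ne h2
    have h4 := LP.gt_of_ρ_ne hj h1
    rw [← sc_succ, norm_smul, norm_smul, Real.norm_of_nonneg (sc_pos _).le,
      Real.norm_of_nonneg hl.le] at h3
    have : 2 * sc j * ‖ξ‖ ≤ l * sc (n + 1) * ‖ξ‖ := by gcongr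
    linarith
  simp [h2]

/-- Here the regularity `r` enters. A block of scale `sc j ≤ l` only sees the frequencies of `φ` of
order `l / sc j` and higher, and that part of `φ` has size `(sc j / l) ^ r`. -/
theorem exists_isTest_integral_block_le (LP : DyadicPartition d) {r : ℝ} (hr : 0 < r) {s : ℝ}
    (hs : 0 ≤ s) :
    ∃ C, 0 ≤ C ∧ ∀ φ, IsTest LP r φ → ∀ (l : ℝ) (hl : 0 < l) (x : E d) (j : ℕ), j ≠ 0 →
      sc j ≤ l → ∀ (v : TDist d) (a : ℝ), 0 ≤ a →
        (∀ y, |block LP j v y| ≤ a * (sc j + ‖y - x‖) ^ s) →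
        |∫ y, rescale φ l hl x y * block LP j v y| ≤ C * a * l ^ s * (sc j / l) ^ r := by
  obtain ⟨C, hC, h⟩ := exists_isTest_decay LP hr (⌈s⌉₊ + (d + 1))
  set I := ∫ z : E d, (1 + ‖z‖) ^ (-((d + 1 : ℕ) : ℝ)) with hI
  have hI0 : 0 ≤ I := integral_nonneg fun z => by positivity
  refine ⟨I * C * 4 ^ r * 2 ^ s, by positivity, fun φ hφ l hl x j hj hjl v a ha hv => ?_⟩
  have hscj := sc_pos j
  -- The index `i` is the cutoff frequency for `φ`. The condition `2 sc j ≤ l sc i` puts the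
  -- rescaled low-pass part, in `sc i l ‖ξ‖ < 4/3`, inside the annulus `sc j ‖ξ‖ > 3/4` of block
  -- `j`.
  obtain ⟨i, hi1, hi2⟩ := exists_sc_between (t := 2 * sc j / l) (by positivity)
    (by rw [div_le_iff₀ hl]; linarith)
  have h1 : 2 * sc j ≤ l * sc i := by
    rw [div_le_iff₀ hl] at hi1
    linarith
  set η := φ - convS (LP.lowKernel i) φ with hη
  have e : ∫ y, rescale φ l hl x y * block LP j v y = ∫ y, rescale η l hl x y * block LP j v y := by
    rw [← (apply_convS_kernel LP j v _).2, ← (apply_convS_kernel LP j v _).2]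
    have : rescale φ l hl x = rescale η l hl x + rescale (convS (LP.lowKernel i) φ) l hl x := by
      rw [← rescale_add, hη, sub_add_cancel]
    rw [this, DyadicPartition.convS_kernel_comm, DyadicPartition.convS_kernel_comm _ (rescale η l hl x), convS_add_left,
      DyadicPartition.convS_kernel_comm (rescale (convS (LP.lowKernel i) φ) l hl x),
      LP.convS_kernel_rescale_lowKernel_eq_zero hl h1 hj, add_zero]
  rw [e]
  refine (abs_integral_rescale_mul_le hs le_rfl hscj.le hl ha (h φ hφ i) hv).trans ?_
  have h2 : sc i ^ r ≤ 4 ^ r * (sc j / l) ^ r := by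
    rw [← Real.mul_rpow (by norm_num) (by positivity)]
    refine Real.rpow_le_rpow (sc_pos i).le ?_ hr.le
    refine hi2.le.trans_eq ?_
    ring
  have h3 : (sc j + l) ^ s ≤ 2 ^ s * l ^ s := by
    rw [← Real.mul_rpow (by norm_num) hl.le]
    exact Real.rpow_le_rpow (by positivity) (by linarith) hs
  calc _ ≤ I * a * (C * (4 ^ r * (sc j / l) ^ r)) * (2 ^ s * l ^ s) := by gcongr
    _ = _ := by ring

end

/-! ### Coassociativity and the antipode in coordinates -/

section

/-! ## Coordinates in tensor products -/

section TensorCoordinates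

variable {κ V W : Type*} [AddCommGroup V] [Module ℝ V] [AddCommGroup W] [Module ℝ W]

/-- The `i`-th coordinate, in `W`, of an element of `V ⊗ W` with respect to a basis of `V`. -/
def leftCoord (b : Module.Basis κ ℝ V) (W : Type*) [AddCommGroup W] [Module ℝ W] (i : κ) :
    V ⊗[ℝ] W →ₗ[ℝ] W :=
  (TensorProduct.lid ℝ W).toLinearMap ∘ₗ (b.coord i).rTensor W

theorem leftCoord_tmul (b : Module.Basis κ ℝ V) (i : κ) (v : V) (w : W) :
    leftCoord b W i (v ⊗ₜ w) = b.coord i v • w := by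
  simp [leftCoord]

theorem basis_eq_sum (b : Module.Basis κ ℝ V) (v : V) {I : Finset κ}
    (hI : ∀ i ∉ I, b.coord i v = 0) : v = ∑ i ∈ I, b.coord i v • b i := by
  conv_lhs => rw [← b.linearCombination_repr v, Finsupp.linearCombination_apply]
  refine Finsupp.sum_of_support_subset _ (fun i hi => ?_) _ fun i _ => zero_smul _ _
  by_contra h
  exact (Finsupp.mem_support_iff.1 hi) (hI i h)

theorem tensor_eq_sum (b : Module.Basis κ ℝ V) (t : V ⊗[ℝ] W) {I : Finset κ}
    (hI : ∀ i ∉ I, leftCoord b W i t = 0) : t = ∑ i ∈ I, b i ⊗ₜ[ℝ] leftCoord b W i t := by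
  classical
  have key : ∃ J : Finset κ, ∀ I, J ⊆ I → t = ∑ i ∈ I, b i ⊗ₜ[ℝ] leftCoord b W i t := by
    clear hI
    induction t using TensorProduct.induction_on with
    | zero => exact ⟨∅, fun I _ => by simp⟩
    | tmul v w =>
      refine ⟨(b.repr v).support, fun I hI => ?_⟩
      have h := basis_eq_sum b v (I := I) fun i hi => by
        by_contra h
        exact hi (hI (Finsupp.mem_support_iff.2 h))
      conv_lhs => rw [h, TensorProduct.sum_tmul]
      simp only [leftCoord_tmul, TensorProduct.smul_tmul]
    | add s t hs ht =>
      obtain ⟨J₁, h₁⟩ := hs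
      obtain ⟨J₂, h₂⟩ := ht
      refine ⟨J₁ ∪ J₂, fun I hI => ?_⟩
      simp only [map_add, TensorProduct.tmul_add, Finset.sum_add_distrib]
      rw [← h₁ I (Finset.union_subset_left hI), ← h₂ I (Finset.union_subset_right hI)]
  obtain ⟨J, hJ⟩ := key
  conv_lhs => rw [hJ (I ∪ J) Finset.subset_union_right]
  refine (Finset.sum_subset Finset.subset_union_left fun i _ hi => ?_).symm
  rw [hI i hi, TensorProduct.tmul_zero]

theorem tensorEval_tmul {V' : Type*} [AddCommGroup V'] [Module ℝ V'] (F : V →ₗ[ℝ] V')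
    (k : W →ₗ[ℝ] ℝ) (v : V) (w : W) : tensorEval F k (v ⊗ₜ w) = k w • F v := by
  simp [tensorEval]

theorem coord_eq_zero_of_mem_homogeneous {b : Module.Basis κ ℝ V} {deg : κ → ℝ} {α : ℝ} {v : V}
    (hv : v ∈ homogeneous b deg α) {i : κ} (hi : deg i ≠ α) : b.coord i v = 0 := by
  classical
  have : homogeneous b deg α ≤ LinearMap.ker (b.coord i) := by
    refine Submodule.span_le.2 ?_
    rintro _ ⟨j, hj, rfl⟩
    have hij : j ≠ i := by
      rintro rfl
      exact hi hj
    simp [Module.Basis.coord_apply, Finsupp.single_eq_of_ne hij.symm]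
  exact this hv

theorem basis_mem_homogeneous (b : Module.Basis κ ℝ V) (deg : κ → ℝ) (i : κ) :
    b i ∈ homogeneous b deg (deg i) :=
  Submodule.subset_span ⟨i, rfl, rfl⟩

theorem leftCoord_mem_of_mem_iSup {κ' : Type*} {b : Module.Basis κ ℝ V} {deg : κ → ℝ}
    {b' : Module.Basis κ' ℝ W} {deg' : κ' → ℝ} {α : ℝ} {s : Set ℝ} {t : V ⊗[ℝ] W}
    (ht : t ∈ ⨆ β ∈ s, tensorSub (homogeneous b deg β) (homogeneous b' deg' (α - β))) (i : κ) :
    leftCoord b W i t ∈ homogeneous b' deg' (α - deg i) ∧ (deg i ∉ s → leftCoord b W i t = 0) := by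
  have h : ∀ U : Submodule ℝ W, (∀ β ∈ s, ∀ v ∈ homogeneous b deg β,
      ∀ w ∈ homogeneous b' deg' (α - β), leftCoord b W i (v ⊗ₜ w) ∈ U) → leftCoord b W i t ∈ U := by
    intro U hU
    have : (⨆ β ∈ s, tensorSub (homogeneous b deg β) (homogeneous b' deg' (α - β))) ≤
        U.comap (leftCoord b W i) :=
      iSup₂_le fun β hβ => Submodule.map₂_le.2 fun v hv w hw => hU β hβ v hv w hw
    exact this ht
  constructor
  · refine h _ fun β hβ v hv w hw => ?_
    rw [leftCoord_tmul]
    by_cases hi : deg i = β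
    · rw [hi]
      exact Submodule.smul_mem _ _ hw
    · rw [coord_eq_zero_of_mem_homogeneous hv hi, zero_smul]
      exact Submodule.zero_mem _
  · intro hs
    have := h ⊥ fun β hβ v hv w hw => by
      rw [leftCoord_tmul, coord_eq_zero_of_mem_homogeneous hv (by rintro rfl; exact hs hβ),
        zero_smul]
      exact Submodule.zero_mem _
    simpa using this

end TensorCoordinates

/-! ## The algebra of a concrete regularity structure -/

namespace ConcreteRegularityStructure

variable {Tp T ιp ι : Type*} [Ring Tp] [HopfAlgebra ℝ Tp] [AddCommGroup T] [Module ℝ T]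
variable (S : ConcreteRegularityStructure Tp T ιp ι)

theorem quot_eq_leftCoord (τ σ : ι) : S.quot τ σ = leftCoord S.b Tp σ (S.Δ (S.b τ)) := rfl

theorem leftCoord_basis (τ σ : ι) [Decidable (τ = σ)] :
    leftCoord S.b Tp σ (S.b τ ⊗ₜ[ℝ] (1 : Tp)) = if τ = σ then 1 else 0 := by
  classical
  rw [leftCoord_tmul, Module.Basis.coord_apply, S.b.repr_self, Finsupp.single_apply]
  split_ifs <;> simp

theorem quot_sub (τ σ : ι) [Decidable (τ = σ)] :
    S.quot τ σ - (if τ = σ then 1 else 0) ∈ S.Tphom (S.deg τ - S.deg σ) ∧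
      (S.deg τ ≤ S.deg σ → S.quot τ σ = if τ = σ then 1 else 0) := by
  have h := leftCoord_mem_of_mem_iSup (S.Δ_mem _ _ (basis_mem_homogeneous S.b S.deg τ)) σ
  rw [map_sub, ← quot_eq_leftCoord, leftCoord_basis] at h
  exact ⟨h.1, fun hle => sub_eq_zero.1 (h.2 (by simpa using hle))⟩

theorem quot_self (τ : ι) : S.quot τ τ = 1 := by
  classical
  simpa using (S.quot_sub τ τ).2 le_rfl

theorem quot_eq_zero {τ σ : ι} (h : σ ≠ τ) (hd : S.deg τ ≤ S.deg σ) : S.quot τ σ = 0 := by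
  classical
  simpa [h.symm] using (S.quot_sub τ σ).2 hd

theorem one_mem : (1 : Tp) ∈ S.Tphom 0 := by
  rw [← S.bp_one]
  have := basis_mem_homogeneous S.bp S.degp S.one
  rwa [(S.degp_eq_zero_iff S.one).2 rfl] at this

theorem quot_mem (τ σ : ι) : S.quot τ σ ∈ S.Tphom (S.deg τ - S.deg σ) := by
  classical
  by_cases h : τ = σ
  · subst h
    rw [quot_self, sub_self]
    exact S.one_mem
  · simpa [h] using (S.quot_sub τ σ).1

theorem deg_lt_of_quot_ne {τ σ : ι} (h : σ ≠ τ) (hq : S.quot τ σ ≠ 0) : S.deg σ < S.deg τ := by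
  by_contra hd
  exact hq (S.quot_eq_zero h (not_lt.1 hd))

/-- A finite set of indices that contains, with `τ`, every `σ` such that `τ / σ ≠ 0`. -/
def IsLower (I : Finset ι) : Prop := ∀ τ ∈ I, ∀ σ, S.deg σ < S.deg τ → σ ∈ I

variable {S}

theorem IsLower.quot_eq_zero {I : Finset ι} (hI : S.IsLower I) {τ σ : ι} (hτ : τ ∈ I)
    (hσ : σ ∉ I) : S.quot τ σ = 0 := by
  by_contra h
  have hne : σ ≠ τ := by
    rintro rfl
    exact hσ hτ
  exact hσ (hI τ hτ σ (S.deg_lt_of_quot_ne hne h))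

theorem IsLower.Δ_eq_sum {I : Finset ι} (hI : S.IsLower I) {τ : ι} (hτ : τ ∈ I) :
    S.Δ (S.b τ) = ∑ σ ∈ I, S.b σ ⊗ₜ[ℝ] S.quot τ σ :=
  tensor_eq_sum S.b _ fun _ hσ => hI.quot_eq_zero hτ hσ

/-- This is the `ν`-th left coordinate of the comodule identity applied to `τ`. It says that `τ / ν`
is multiplied like the entries of a triangular matrix, which is what turns convolutions of
characters into matrix products. -/
theorem IsLower.comul_quot {I : Finset ι} (hI : S.IsLower I) {τ : ι} (hτ : τ ∈ I) {ν : ι}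
    (hν : ν ∈ I) :
    (Coalgebra.comul (S.quot τ ν) : Tp ⊗[ℝ] Tp) = ∑ μ ∈ I, S.quot μ ν ⊗ₜ[ℝ] S.quot τ μ := by
  classical
  have h := LinearMap.congr_fun S.comodule (S.b τ)
  simp only [LinearMap.comp_apply, hI.Δ_eq_sum hτ, map_sum, LinearMap.rTensor_tmul,
    LinearMap.lTensor_tmul, LinearEquiv.coe_coe] at h
  have h2 := congrArg (leftCoord S.b (Tp ⊗[ℝ] Tp) ν) h
  simp only [map_sum] at h2
  have e1 : ∀ σ ∈ I, leftCoord S.b (Tp ⊗[ℝ] Tp) ν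
      (S.b σ ⊗ₜ[ℝ] (Coalgebra.comul (S.quot τ σ) : Tp ⊗[ℝ] Tp)) =
      if σ = ν then Coalgebra.comul (S.quot τ σ) else 0 := by
    intro σ _
    rw [leftCoord_tmul, Module.Basis.coord_apply, S.b.repr_self, Finsupp.single_apply]
    split_ifs <;> simp
  rw [Finset.sum_congr rfl e1, Finset.sum_ite_eq' I ν, if_pos hν] at h2
  rw [← h2]
  refine Finset.sum_congr rfl fun μ hμ => ?_
  rw [hI.Δ_eq_sum hμ, TensorProduct.sum_tmul, map_sum, map_sum]
  have e2 : ∀ σ ∈ I, leftCoord S.b (Tp ⊗[ℝ] Tp) ν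
      (TensorProduct.assoc ℝ T Tp Tp ((S.b σ ⊗ₜ[ℝ] S.quot μ σ) ⊗ₜ[ℝ] S.quot τ μ)) =
      if σ = ν then S.quot μ σ ⊗ₜ[ℝ] S.quot τ μ else 0 := by
    intro σ _
    rw [TensorProduct.assoc_tmul, leftCoord_tmul, Module.Basis.coord_apply, S.b.repr_self,
      Finsupp.single_apply]
    split_ifs <;> simp
  rw [Finset.sum_congr rfl e2, Finset.sum_ite_eq' I ν, if_pos hν]

variable (S)

/-- The left-hand factor `T⁺` seen as the model space of a regularity structure over itself. -/
def selfStructure : ConcreteRegularityStructure Tp Tp ιp ιp where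
  Ap := S.Ap
  A := S.Ap
  β₀ := 0
  Ap_nonneg := S.Ap_nonneg
  zero_mem_Ap := S.zero_mem_Ap
  Ap_add := S.Ap_add
  Ap_discrete := S.Ap_discrete
  A_isLeast := ⟨S.zero_mem_Ap, S.Ap_nonneg⟩
  A_discrete := S.Ap_discrete
  bp := S.bp
  degp := S.degp
  degp_mem := S.degp_mem
  finite_p := S.finite_p
  b := S.bp
  deg := S.degp
  deg_mem := S.degp_mem
  finite := S.finite_p
  one := S.one
  bp_one := S.bp_one
  degp_eq_zero_iff := S.degp_eq_zero_iff
  mul_mem := S.mul_mem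
  comul_mem := S.comul_mem
  Δ := Coalgebra.comul
  Δ_mem := by
    intro α x hx
    -- For `α < 0` there is nothing; for `α = 0` only multiples of the unit; for `α > 0` the summand
    -- `1 ⊗ x`, excluded from the reduced coproduct, is the contribution of degree `β = 0`.
    rcases lt_trichotomy α 0 with hα | rfl | hα
    · have : x = 0 := by
        rw [basis_eq_sum S.bp x (I := ∅) fun i _ => coord_eq_zero_of_mem_homogeneous hx
          (hα.trans_le (S.Ap_nonneg _ (S.degp_mem i))).ne', Finset.sum_empty]
      rw [this, map_zero, TensorProduct.zero_tmul, sub_zero]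
      exact Submodule.zero_mem _
    · have : x = S.bp.coord S.one x • 1 := by
        conv_lhs => rw [basis_eq_sum S.bp x (I := {S.one}) fun i hi =>
          coord_eq_zero_of_mem_homogeneous hx fun h =>
            hi (Finset.mem_singleton.2 ((S.degp_eq_zero_iff i).1 h))]
        rw [Finset.sum_singleton, S.bp_one]
      rw [this, map_smul, Bialgebra.comul_one, Algebra.TensorProduct.one_def,
        TensorProduct.smul_tmul', sub_self]
      exact Submodule.zero_mem _
    · have h := S.comul_mem α hα x hx
      have h1 : (1 : Tp) ⊗ₜ[ℝ] x ∈ ⨆ β ∈ Set.Iio α,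
          tensorSub (homogeneous S.bp S.degp β) (homogeneous S.bp S.degp (α - β)) := by
        refine Submodule.mem_iSup_of_mem 0 (Submodule.mem_iSup_of_mem hα ?_)
        refine Submodule.apply_mem_map₂ _ S.one_mem ?_
        rwa [sub_zero]
      have h2 : (⨆ β ∈ Set.Ioo 0 α,
          tensorSub (homogeneous S.bp S.degp β) (homogeneous S.bp S.degp (α - β))) ≤ ⨆ β ∈ Set.Iio α,
          tensorSub (homogeneous S.bp S.degp β) (homogeneous S.bp S.degp (α - β)) :=
        biSup_mono fun β hβ => hβ.2
      have := Submodule.add_mem _ (h2 h) h1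
      rwa [sub_add_cancel] at this
  comodule := Coalgebra.coassoc

theorem quot_selfStructure (τ σ : ιp) : S.selfStructure.quot τ σ = S.quotp τ σ := rfl

/-- `τ /⁺ 1 = τ`. -/
theorem quotp_one {τ : ιp} (hτ : τ ≠ S.one) : S.quotp τ S.one = S.bp τ := by
  have hpos : 0 < S.degp τ := lt_of_le_of_ne (S.Ap_nonneg _ (S.degp_mem τ)) fun h =>
    hτ ((S.degp_eq_zero_iff τ).1 h.symm)
  have h := (leftCoord_mem_of_mem_iSup
    (S.comul_mem _ hpos _ (basis_mem_homogeneous S.bp S.degp τ)) S.one).2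
    (by simp [(S.degp_eq_zero_iff S.one).2 rfl])
  rw [map_sub, map_sub, sub_eq_zero, leftCoord_tmul, leftCoord_tmul,
    coord_eq_zero_of_mem_homogeneous (basis_mem_homogeneous S.bp S.degp τ)
      (by rw [(S.degp_eq_zero_iff S.one).2 rfl]; exact hpos.ne), zero_smul, sub_zero,
    ← S.bp_one] at h
  simpa [quotp, leftCoord, Module.Basis.coord_apply] using h

/-- Apply the counit to the left factor of the coproduct and the coordinate along the unit to the
right factor. The counit axiom gives the unit coordinate of `x`, which is zero; the middle terms
have right factors of positive degree, so only `counit x` from `x ⊗ 1` remains. -/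
theorem counit_eq_zero {α : ℝ} (hα : 0 < α) {x : Tp} (hx : x ∈ S.Tphom α) :
    Coalgebra.counit (R := ℝ) x = 0 := by
  have h := S.comul_mem α hα x hx
  have hone : S.bp.coord S.one (1 : Tp) = 1 := by
    rw [← S.bp_one]
    simp [Module.Basis.coord_apply]
  set L : Tp ⊗[ℝ] Tp →ₗ[ℝ] ℝ := S.bp.coord S.one ∘ₗ (TensorProduct.lid ℝ Tp).toLinearMap ∘ₗ
    (Coalgebra.counit (R := ℝ) (A := Tp)).rTensor Tp with hL
  have hLt : ∀ v w : Tp, L (v ⊗ₜ w) = Coalgebra.counit (R := ℝ) v * S.bp.coord S.one w := by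
    intro v w
    simp [hL]
  have h0 : (⨆ β ∈ Set.Ioo 0 α, tensorSub (homogeneous S.bp S.degp β)
      (homogeneous S.bp S.degp (α - β))) ≤ LinearMap.ker L := by
    refine iSup₂_le fun β hβ => Submodule.map₂_le.2 fun v _ w hw => ?_
    rw [LinearMap.mem_ker, TensorProduct.mk_apply, hLt,
      coord_eq_zero_of_mem_homogeneous hw, mul_zero]
    rw [(S.degp_eq_zero_iff S.one).2 rfl]
    have := hβ.2
    intro hcon
    linarith
  have h1 := LinearMap.mem_ker.1 (h0 h)
  have hc : L (Coalgebra.comul x) = S.bp.coord S.one x := by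
    simp only [hL, LinearMap.comp_apply, Coalgebra.rTensor_counit_comul]
    simp
  have hx0 : S.bp.coord S.one x = 0 := coord_eq_zero_of_mem_homogeneous hx
    (by rw [(S.degp_eq_zero_iff S.one).2 rfl]; exact hα.ne)
  rw [map_sub, map_sub, hLt, hLt, hc, hone, hx0] at h1
  simpa using h1

theorem counit_quot (τ σ : ι) [Decidable (τ = σ)] :
    Coalgebra.counit (R := ℝ) (S.quot τ σ) = if τ = σ then 1 else 0 := by
  split_ifs with h
  · subst h
    rw [quot_self, Bialgebra.counit_one]
  · by_cases hq : S.quot τ σ = 0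
    · rw [hq, map_zero]
    · have := S.deg_lt_of_quot_ne (Ne.symm h) hq
      exact S.counit_eq_zero (sub_pos.2 this) (S.quot_mem τ σ)

variable {S}

theorem IsLower.convDiv_quot {I : Finset ι} (hI : S.IsLower I) {τ ν : ι} (hτ : τ ∈ I) (hν : ν ∈ I)
    (g₁ g₂ : Tp →ₐ[ℝ] ℝ) :
    convDiv g₁ g₂ (S.quot τ ν) = ∑ μ ∈ I, g₁ (S.quot μ ν) * charInv g₂ (S.quot τ μ) := by
  rw [convDiv, LinearMap.comp_apply, hI.comul_quot hτ hν, map_sum]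
  refine Finset.sum_congr rfl fun μ _ => ?_
  rw [tensorEval_tmul, smul_eq_mul, mul_comm]
  rfl

theorem charInv_conv (g : Tp →ₐ[ℝ] ℝ) (t : Tp) :
    tensorEval (charInv g) g.toLinearMap (Coalgebra.comul t) = Coalgebra.counit (R := ℝ) t := by
  have h := LinearMap.congr_fun (HopfAlgebra.mul_antipode_rTensor_comul (R := ℝ) (A := Tp)) t
  have e : tensorEval (charInv g) g.toLinearMap (Coalgebra.comul t) = g (LinearMap.mul' ℝ Tp
      ((HopfAlgebra.antipode ℝ (A := Tp)).rTensor Tp (Coalgebra.comul t))) := by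
    generalize (Coalgebra.comul (R := ℝ) t) = u
    induction u using TensorProduct.induction_on with
    | zero => simp
    | tmul v w => simp [tensorEval, charInv, mul_comm]
    | add u v hu hv => rw [map_add, hu, hv, map_add, map_add, map_add]
  rw [e]
  simp only [LinearMap.comp_apply] at h
  rw [h]
  simp

/-- The antipode axiom, through `comul_quot`: the matrices with entries `g⁻¹(τ / ν)` and `g(τ / ν)`
are inverse to each other. -/
theorem IsLower.sum_charInv_mul {I : Finset ι} (hI : S.IsLower I) {τ ν : ι} (hτ : τ ∈ I)
    (hν : ν ∈ I) (g : Tp →ₐ[ℝ] ℝ) [Decidable (τ = ν)] :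
    ∑ μ ∈ I, charInv g (S.quot μ ν) * g (S.quot τ μ) = if τ = ν then 1 else 0 := by
  rw [← S.counit_quot, ← charInv_conv g, hI.comul_quot hτ hν, map_sum]
  refine Finset.sum_congr rfl fun μ _ => ?_
  rw [tensorEval_tmul, smul_eq_mul, mul_comm]
  rfl

theorem charInv_one (g : Tp →ₐ[ℝ] ℝ) : charInv g 1 = 1 := by
  simp [charInv, HopfAlgebra.antipode_one]

theorem IsLower.hat_basis {I : Finset ι} (hI : S.IsLower I) {τ : ι} (hτ : τ ∈ I)
    (k : Tp →ₗ[ℝ] ℝ) : S.hat k (S.b τ) = ∑ μ ∈ I, k (S.quot τ μ) • S.b μ := by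
  rw [hat, LinearMap.comp_apply, hI.Δ_eq_sum hτ, map_sum]
  exact Finset.sum_congr rfl fun μ _ => tensorEval_tmul _ _ _ _

theorem IsLower.coord_hat {I : Finset ι} (hI : S.IsLower I) {t : T}
    (ht : ∀ i ∉ I, S.b.coord i t = 0) (k : Tp →ₗ[ℝ] ℝ) {ν : ι} (hν : ν ∈ I) :
    S.b.coord ν (S.hat k t) = ∑ τ ∈ I, S.b.coord τ t * k (S.quot τ ν) := by
  classical
  conv_lhs => rw [basis_eq_sum S.b t ht, map_sum, map_sum]
  refine Finset.sum_congr rfl fun τ hτ => ?_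
  rw [map_smul, map_smul, hI.hat_basis hτ, map_sum, smul_eq_mul]
  congr 1
  rw [Finset.sum_eq_single ν]
  · simp [Module.Basis.coord_apply]
  · intro μ _ hμ
    simp [Module.Basis.coord_apply, Finsupp.single_eq_of_ne hμ.symm]
  · exact fun h => (h hν).elim

theorem IsLower.recenter_basis {d : ℕ} {I : Finset ι} (hI : S.IsLower I) {τ : ι} (hτ : τ ∈ I)
    (g : E d → (Tp →ₐ[ℝ] ℝ)) (P : T →ₗ[ℝ] TDist d) (x : E d) :
    recenter S g P x (S.b τ) = ∑ μ ∈ I, charInv (g x) (S.quot τ μ) • P (S.b μ) := by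
  rw [recenter, LinearMap.comp_apply, hI.Δ_eq_sum hτ, map_sum]
  exact Finset.sum_congr rfl fun μ _ => tensorEval_tmul _ _ _ _

variable (S)

theorem mem_indexLt {γ : ℝ} {τ : ι} : τ ∈ S.indexLt γ ↔ S.deg τ < γ := by
  simp [indexLt]

theorem isLower_indexLt (γ : ℝ) : S.IsLower (S.indexLt γ) := fun _ hτ _ hσ =>
  S.mem_indexLt.2 (hσ.trans (S.mem_indexLt.1 hτ))

theorem mem_below {μ σ : ι} : μ ∈ S.below σ ↔ S.quot σ μ ≠ 0 ∧ μ ≠ σ := by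
  simp [below, Lt]

theorem mem_aboveLt {γ : ℝ} {τ μ : ι} :
    μ ∈ S.aboveLt γ τ ↔ (S.quot μ τ ≠ 0 ∧ τ ≠ μ) ∧ S.deg μ < γ := by
  simp [aboveLt, Lt]

theorem mem_betweenp {ν τ : ιp} :
    ν ∈ S.betweenp τ ↔ (S.quotp ν S.one ≠ 0 ∧ S.one ≠ ν) ∧ S.quotp τ ν ≠ 0 ∧ ν ≠ τ := by
  simp [betweenp, Ltp]

theorem mem_betweenp_iff {ν τ : ιp} :
    ν ∈ S.betweenp τ ↔ ν ∈ S.selfStructure.below τ ∧ ν ≠ S.one := by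
  rw [mem_betweenp, mem_below, quot_selfStructure]
  constructor
  · rintro ⟨⟨-, h1⟩, h2⟩
    exact ⟨h2, h1.symm⟩
  · rintro ⟨h1, h2⟩
    refine ⟨⟨?_, h2.symm⟩, h1⟩
    rw [S.quotp_one h2]
    exact S.bp.ne_zero ν

theorem deg_wellFounded : WellFounded fun i j : ι => S.deg i < S.deg j := by
  rw [WellFounded.wellFounded_iff_has_min]
  intro s hs
  obtain ⟨i, hi⟩ := hs
  by_cases h : (s ∩ {j | S.deg j < S.deg i}).Nonempty
  · obtain ⟨m, hm, hmin⟩ := Set.exists_min_image _ S.deg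
      ((S.finite_deg_lt (S.deg i)).subset Set.inter_subset_right) h
    refine ⟨m, hm.1, fun j hj hjm => ?_⟩
    exact absurd (hmin j ⟨hj, hjm.trans hm.2⟩) (not_le.2 hjm)
  · refine ⟨i, hi, fun j hj hji => h ⟨j, hj, hji⟩⟩

end ConcreteRegularityStructure

end

/-! ### Stability of triangular paracontrolled systems -/

section

variable {d : ℕ}

/-! ## Paracontrolled systems -/

/-- A finite family of distributions `u σ`, `σ ∈ I`, paracontrolled by the family `b`:
`u σ = ∑_{μ ∈ I} P_{G σ μ} b μ` up to low frequencies. -/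
structure IsSystem {κ : Type*} (LP : DyadicPartition d) (I : Finset κ) (G : κ → κ → E d → ℝ)
    (u b : κ → TDist d) : Prop where
  bddCont : ∀ σ ∈ I, ∀ μ ∈ I, BddCont (G σ μ)
  isBesov : ∀ σ ∈ I, IsBesov LP (b σ)
  rel : ∀ σ ∈ I, u σ = ∑ μ ∈ I, paraprod LP (G σ μ) (b μ) + lowPart LP (b σ)

theorem bddCont_sum_mul {κ : Type*} {I : Finset κ} {G : κ → κ → E d → ℝ}
    (hG : ∀ σ ∈ I, ∀ μ ∈ I, BddCont (G σ μ)) (c : κ → ℝ) {ν : κ} (hν : ν ∈ I) :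
    BddCont fun y => ∑ σ ∈ I, c σ * G σ ν y :=
  BddCont.sum I fun σ hσ => (hG σ hσ ν hν).const_mul (c σ)

/-- The recentering step. The `c σ` will depend on a base point `x`, but with `x` frozen they are
constants and may enter the coefficient of the paraproduct by linearity. -/
theorem IsSystem.sum_smul {κ : Type*} {LP : DyadicPartition d} {I : Finset κ}
    {G : κ → κ → E d → ℝ} {u b : κ → TDist d} (h : IsSystem LP I G u b) (c : κ → ℝ) :
    ∑ σ ∈ I, c σ • u σ =
      ∑ ν ∈ I, paraprod LP (fun y => ∑ σ ∈ I, c σ * G σ ν y) (b ν) +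
        ∑ σ ∈ I, c σ • lowPart LP (b σ) := by
  have e : ∀ ν ∈ I, paraprod LP (fun y => ∑ σ ∈ I, c σ * G σ ν y) (b ν) =
      ∑ σ ∈ I, c σ • paraprod LP (G σ ν) (b ν) := by
    intro ν hν
    rw [paraprod_sum_left (h.isBesov ν hν) I fun σ hσ => (h.bddCont σ hσ ν hν).const_mul (c σ)]
    exact Finset.sum_congr rfl fun σ hσ =>
      paraprod_const_mul_left (h.isBesov ν hν) (h.bddCont σ hσ ν hν) (c σ)
  rw [Finset.sum_congr rfl e, Finset.sum_comm, ← Finset.sum_add_distrib]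
  refine Finset.sum_congr rfl fun σ hσ => ?_
  rw [h.rel σ hσ, smul_add, Finset.smul_sum]

theorem IsSystem.block_sum_smul {κ : Type*} {LP : DyadicPartition d} {I : Finset κ}
    {G : κ → κ → E d → ℝ} {u b : κ → TDist d} (h : IsSystem LP I G u b) (c : κ → ℝ) {k : ℕ}
    (hk : 3 ≤ k) (y : E d) :
    block LP k (∑ σ ∈ I, c σ • u σ) y =
      ∑ ν ∈ I, block LP k (paraprod LP (fun y => ∑ σ ∈ I, c σ * G σ ν y) (b ν)) y := by
  rw [h.sum_smul c, block_add, block_sum, block_sum, add_eq_left]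
  refine Finset.sum_eq_zero fun σ hσ => ?_
  rw [block_smul, block_lowPart_eq_zero (h.isBesov σ hσ) hk, mul_zero]

/-- A paracontrolled system with unipotent triangular coefficients `G`, with respect to the
degrees `a`, together with recentering coefficients `H`. -/
structure TriangularSystem {κ : Type*} (LP : DyadicPartition d) (I : Finset κ) (a : κ → ℝ) where
  G : κ → κ → E d → ℝ
  H : κ → κ → E d → ℝ
  u : κ → TDist d
  b : κ → TDist d
  isSystem : IsSystem LP I G u b
  G_self : ∀ σ ∈ I, ∀ y, G σ σ y = 1
  G_zero : ∀ σ ∈ I, ∀ ν ∈ I, ν ≠ σ → a σ ≤ a ν → ∀ y, G σ ν y = 0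
  self : ∀ σ ∈ I, ∀ x y, ∑ μ ∈ I, H σ μ x * G μ σ y = 1
  zero : ∀ σ ∈ I, ∀ ν ∈ I, ν ≠ σ → a σ ≤ a ν → ∀ x y, ∑ μ ∈ I, H σ μ x * G μ ν y = 0

namespace TriangularSystem

variable {κ : Type*} {LP : DyadicPartition d} {I : Finset κ} {a : κ → ℝ}

/-- The transport coefficients. -/
def trans (s : TriangularSystem LP I a) (σ ν : κ) (x y : E d) : ℝ :=
  ∑ μ ∈ I, s.H σ μ x * s.G μ ν y

/-- The recentered distributions. -/
def recentered (s : TriangularSystem LP I a) (σ : κ) (x : E d) : TDist d :=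
  ∑ μ ∈ I, s.H σ μ x • s.u μ

theorem bddCont_trans (s : TriangularSystem LP I a) (σ : κ) {ν : κ} (hν : ν ∈ I) (x : E d) :
    BddCont (s.trans σ ν x) :=
  bddCont_sum_mul s.isSystem.bddCont (fun μ => s.H σ μ x) hν

open Classical in
theorem sum_eq (s : TriangularSystem LP I a) {σ : κ} (hσ : σ ∈ I) {F : κ → E d → ℝ}
    (h1 : ∀ y, F σ y = 1) (h0 : ∀ ν ∈ I, ν ≠ σ → a σ ≤ a ν → ∀ y, F ν y = 0) :
    ∑ ν ∈ I, paraprod LP (F ν) (s.b ν) =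
      (s.b σ - lowPart LP (s.b σ)) +
        ∑ ν ∈ I.filter (fun ν => a ν < a σ), paraprod LP (F ν) (s.b ν) := by
  rw [← Finset.add_sum_erase I _ hσ]
  congr 1
  · rw [← paraprod_one (s.isSystem.isBesov σ hσ)]
    congr 1
    ext y
    exact h1 y
  · symm
    refine Finset.sum_subset (fun ν hν => ?_) fun ν hν hν' => ?_
    · rw [Finset.mem_filter] at hν
      rw [Finset.mem_erase]
      refine ⟨?_, hν.1⟩
      rintro rfl
      exact lt_irrefl _ hν.2
    · rw [Finset.mem_erase] at hν
      rw [Finset.mem_filter, not_and, not_lt] at hν'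
      rw [show F ν = fun _ => 0 from funext fun y => h0 ν hν.2 hν.1 (hν' hν.2) y]
      exact paraprod_zero_left (s.isSystem.isBesov ν hν.2)

open Classical in
theorem b_eq (s : TriangularSystem LP I a) {σ : κ} (hσ : σ ∈ I) :
    s.b σ = s.u σ - ∑ ν ∈ I.filter (fun ν => a ν < a σ), paraprod LP (s.G σ ν) (s.b ν) := by
  rw [s.isSystem.rel σ hσ, s.sum_eq hσ (s.G_self σ hσ) (s.G_zero σ hσ)]
  abel

-- The identity behind all regularity results for brackets: the base point of the recentering is
-- also the point of evaluation. On the right the coefficients `s.trans σ ν x` vanish at `x` to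
-- order `a σ - a ν`, and only brackets of smaller degree occur.
open Classical in
theorem block_b_eq (s : TriangularSystem LP I a) {σ : κ} (hσ : σ ∈ I) {k : ℕ} (hk : 3 ≤ k)
    (x : E d) :
    block LP k (s.b σ) x = block LP k (s.recentered σ x) x -
      ∑ ν ∈ I.filter (fun ν => a ν < a σ),
        block LP k (paraprod LP (s.trans σ ν x) (s.b ν)) x := by
  have h := s.isSystem.block_sum_smul (fun μ => s.H σ μ x) hk x
  have h2 := congrArg (fun v => block LP k v x) (s.sum_eq hσ
    (F := fun ν y => ∑ μ ∈ I, s.H σ μ x * s.G μ ν y) (s.self σ hσ x)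
    (fun ν hν h1 h2 => s.zero σ hσ ν hν h1 h2 x))
  simp only [block_sum LP k I, block_add, block_sub,
    block_lowPart_eq_zero (s.isSystem.isBesov σ hσ) hk, sub_zero, block_sum LP k (I.filter _)] at h2
  rw [recentered, h, h2]
  exact (add_sub_cancel_right _ _).symm

/-- Quantitative closeness of two systems: `A` bounds the coefficients of `s`, `B` the brackets of
`t`, and `δ` the difference between `s` and `t`. -/
structure Close (s t : TriangularSystem LP I a) (β A B δ : ℝ) : Prop where
  trans_le : ∀ σ ∈ I, ∀ ν ∈ I, a ν < a σ → ∀ x y, |s.trans σ ν x y| ≤ A * ‖y - x‖ ^ (a σ - a ν)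
  trans_sub_le : ∀ σ ∈ I, ∀ ν ∈ I, a ν < a σ → ∀ x y,
    |s.trans σ ν x y - t.trans σ ν x y| ≤ δ * ‖y - x‖ ^ (a σ - a ν)
  G_le : ∀ σ ∈ I, ∀ ν ∈ I, ∀ y, |s.G σ ν y| ≤ A
  G_sub_le : ∀ σ ∈ I, ∀ ν ∈ I, ∀ y, |s.G σ ν y - t.G σ ν y| ≤ δ
  blockBd : ∀ ν ∈ I, BlockBd LP (a ν) B (t.b ν)
  blockBd_sub : ∀ σ ∈ I, BlockBd LP β δ (s.u σ - t.u σ)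
  recentered_sub_le : ∀ σ ∈ I, ∀ k x,
    |block LP k (s.recentered σ x - t.recentered σ x) x| ≤ δ * sc k ^ a σ

end TriangularSystem

theorem sc_rpow_le_of_lt_three {k : ℕ} (hk : k < 3) (p q : ℝ) :
    sc k ^ p ≤ 2 ^ |p - q| * sc k ^ q := by
  have h := sc_pos k
  rw [show p = (p - q) + q by ring, Real.rpow_add h, add_sub_cancel_right]
  refine mul_le_mul_of_nonneg_right ?_ (sc_rpow_pos k q).le
  rcases le_total 0 (p - q) with hpq | hpq
  · rw [abs_of_nonneg hpq]
    exact Real.rpow_le_rpow h.le (sc_le_two k) hpq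
  · rw [abs_of_nonpos hpq, Real.rpow_neg two_pos.le, ← Real.inv_rpow two_pos.le]
    refine Real.rpow_le_rpow_of_nonpos (by norm_num) ?_ hpq
    have h2 := sc_antitone (show k ≤ 2 by omega)
    refine le_trans ?_ h2
    norm_num [sc]

theorem paraprod_sub_paraprod {LP : DyadicPartition d} {u v : TDist d} (hu : IsBesov LP u)
    (hv : IsBesov LP v) {F G : E d → ℝ} (hF : BddCont F) (hG : BddCont G) :
    paraprod LP F u - paraprod LP G v =
      paraprod LP F (u - v) + paraprod LP (fun y => F y - G y) v := by
  rw [paraprod_sub_right hu hv hF, paraprod_sub_left hv hF hG]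
  abel

/-- Bilinearity splits the difference into `P_F (u - v)` and `P_{F - G} v`. The point of evaluation
is the point where the coefficients vanish, so the weight reduces to `sc k ^ s`. -/
theorem exists_block_paraprod_sub_le (LP : DyadicPartition d) (α : ℝ) {s : ℝ} (hs : 0 ≤ s) :
    ∃ C, 0 ≤ C ∧ ∀ (A B D δ : ℝ) (u v : TDist d) (F G : E d → ℝ) (x : E d), 0 ≤ A → 0 ≤ δ →
      IsBesov LP u → BlockBd LP α B v → BlockBd LP α (D * δ) (u - v) → BddCont F → BddCont G →
      (∀ z, |F z| ≤ A * ‖z - x‖ ^ s) → (∀ z, |F z - G z| ≤ δ * ‖z - x‖ ^ s) → ∀ k,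
        |block LP k (paraprod LP F u) x - block LP k (paraprod LP G v) x| ≤
          C * (A * D + B) * δ * sc k ^ (α + s) := by
  obtain ⟨C, hC, h⟩ := exists_block_paraprod_le LP α hs
  refine ⟨C, hC, fun A B D δ u v F G x hA hδ hu hv huv hF hG hFx hFG k => ?_⟩
  rw [← block_sub, paraprod_sub_paraprod hu hv.isBesov hF hG, block_add]
  have h1 := h A (D * δ) (u - v) F x huv hF hA hFx k x
  have h2 := h δ B v _ x hv (hF.sub hG) hδ hFG k x
  rw [sub_self, norm_zero, add_zero, mul_assoc, ← Real.rpow_add (sc_pos k)] at h1 h2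
  refine (abs_add_le _ _).trans ((add_le_add h1 h2).trans_eq ?_)
  ring

-- Induction on the degree. The high blocks come from `block_b_eq`, the blocks `k < 3` from `b_eq`
-- with coefficients that are merely bounded. The constant depends on the two systems only through
-- `A` and `B`, and the estimate is linear in `δ`, so one statement yields both regularity and local
-- Lipschitz dependence.
open Classical in
theorem TriangularSystem.exists_blockBd_sub {κ : Type*} (LP : DyadicPartition d) (I : Finset κ)
    {a : κ → ℝ} (wf : WellFounded fun i j => a i < a j) (β : ℝ) {A B : ℝ} (hA : 0 ≤ A)
    (hB : 0 ≤ B) (σ : κ) (hσ : σ ∈ I) :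
    ∃ C, 0 ≤ C ∧ ∀ (s t : TriangularSystem LP I a) (δ : ℝ), 0 ≤ δ → s.Close t β A B δ →
      BlockBd LP (a σ) (C * δ) (s.b σ - t.b σ) := by
  induction σ using wf.induction with
  | _ σ ih =>
  set J := I.filter fun ν => a ν < a σ with hJ
  have hJI : ∀ ν ∈ J, ν ∈ I ∧ a ν < a σ := fun ν hν => Finset.mem_filter.1 hν
  -- The condition `ν ∈ J` is moved under the existential so that `choose` produces constants for
  -- all `ν`.
  have ih' : ∀ ν, ∃ D, 0 ≤ D ∧ (ν ∈ J → ∀ (s t : TriangularSystem LP I a) (δ : ℝ), 0 ≤ δ →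
      s.Close t β A B δ → BlockBd LP (a ν) (D * δ) (s.b ν - t.b ν)) := by
    intro ν
    by_cases hν : ν ∈ J
    · obtain ⟨D, hD, h⟩ := ih ν (hJI ν hν).2 (hJI ν hν).1
      exact ⟨D, hD, fun _ => h⟩
    · exact ⟨0, le_rfl, fun h => (hν h).elim⟩
  choose D hD hDb using ih'
  have hp : ∀ ν, ∃ C, 0 ≤ C ∧ (ν ∈ J → ∀ (A B D δ : ℝ) (u v : TDist d) (F G : E d → ℝ) (x : E d),
      0 ≤ A → 0 ≤ δ →
      IsBesov LP u → BlockBd LP (a ν) B v → BlockBd LP (a ν) (D * δ) (u - v) → BddCont F →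
      BddCont G → (∀ z, |F z| ≤ A * ‖z - x‖ ^ (a σ - a ν)) →
      (∀ z, |F z - G z| ≤ δ * ‖z - x‖ ^ (a σ - a ν)) → ∀ k,
        |block LP k (paraprod LP F u) x - block LP k (paraprod LP G v) x| ≤
          C * (A * D + B) * δ * sc k ^ (a ν + (a σ - a ν))) := by
    intro ν
    by_cases hν : ν ∈ J
    · obtain ⟨C, hC, h⟩ := exists_block_paraprod_sub_le LP (a ν)
        (sub_nonneg.2 (hJI ν hν).2.le)
      exact ⟨C, hC, fun _ => h⟩
    · exact ⟨0, le_rfl, fun h => (hν h).elim⟩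
  choose P hP hPb using hp
  choose Q hQ hQb using fun ν => exists_block_paraprod_sub_le LP (a ν) (le_refl (0 : ℝ))
  set X := ∑ ν ∈ J, P ν * (A * D ν + B) with hX
  set Y := ∑ ν ∈ J, Q ν * (A * D ν + B) * 2 ^ |a ν - a σ| with hY
  have hX0 : 0 ≤ X := Finset.sum_nonneg fun ν _ => by
    have := hP ν; have := hD ν; positivity
  have hY0 : 0 ≤ Y := Finset.sum_nonneg fun ν _ => by
    have := hQ ν; have := hD ν; positivity
  refine ⟨(1 + X) + (2 ^ |β - a σ| + Y), by positivity, fun s t δ hδ hst k x => ?_⟩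
  have hsc := (sc_rpow_pos k (a σ)).le
  rcases le_or_gt 3 k with hk | hk
  · have e : block LP k (s.b σ - t.b σ) x =
        block LP k (s.recentered σ x - t.recentered σ x) x -
        ∑ ν ∈ J, (block LP k (paraprod LP (s.trans σ ν x) (s.b ν)) x -
          block LP k (paraprod LP (t.trans σ ν x) (t.b ν)) x) := by
      rw [block_sub, s.block_b_eq hσ hk, t.block_b_eq hσ hk, block_sub, Finset.sum_sub_distrib]
      ring
    rw [e]
    have h1 := hst.recentered_sub_le σ hσ k x
    have h2 : ∀ ν ∈ J, |block LP k (paraprod LP (s.trans σ ν x) (s.b ν)) x -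
          block LP k (paraprod LP (t.trans σ ν x) (t.b ν)) x| ≤
          P ν * (A * D ν + B) * (δ * sc k ^ a σ) := by
      intro ν hν
      obtain ⟨hνI, hνσ⟩ := hJI ν hν
      have := hPb ν hν A B (D ν) δ (s.b ν) (t.b ν) (s.trans σ ν x) (t.trans σ ν x) x hA hδ
        (s.isSystem.isBesov ν hνI) (hst.blockBd ν hνI) (hDb ν hν s t δ hδ hst)
        (s.bddCont_trans σ hνI x) (t.bddCont_trans σ hνI x) (hst.trans_le σ hσ ν hνI hνσ x)
        (hst.trans_sub_le σ hσ ν hνI hνσ x) k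
      rw [add_sub_cancel] at this
      refine this.trans_eq ?_
      ring
    calc _ ≤ δ * sc k ^ a σ + ∑ ν ∈ J, P ν * (A * D ν + B) * (δ * sc k ^ a σ) :=
          (abs_sub _ _).trans (add_le_add h1 ((Finset.abs_sum_le_sum_abs _ _).trans
            (Finset.sum_le_sum h2)))
      _ = (1 + X) * δ * sc k ^ a σ := by rw [← Finset.sum_mul, ← hX]; ring
      _ ≤ _ := mul_le_mul_of_nonneg_right (mul_le_mul_of_nonneg_right
          (le_add_of_nonneg_right (by positivity)) hδ) hsc
  -- For the finitely many scales `k < 3` all powers of `sc k` are comparable; no vanishing of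
  -- coefficients is needed, and any regularity `β` of the data will do.
  · have e : block LP k (s.b σ - t.b σ) x =
        block LP k (s.u σ - t.u σ) x -
        ∑ ν ∈ J, (block LP k (paraprod LP (s.G σ ν) (s.b ν)) x -
          block LP k (paraprod LP (t.G σ ν) (t.b ν)) x) := by
      conv_lhs => rw [s.b_eq hσ, t.b_eq hσ, block_sub, block_sub, block_sub, block_sum, block_sum]
      rw [block_sub, Finset.sum_sub_distrib]
      ring
    rw [e]
    have h1 : |block LP k (s.u σ - t.u σ) x| ≤ 2 ^ |β - a σ| * (δ * sc k ^ a σ) := by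
      refine (hst.blockBd_sub σ hσ k x).trans ?_
      rw [mul_left_comm]
      exact mul_le_mul_of_nonneg_left (sc_rpow_le_of_lt_three hk _ _) hδ
    have h2 : ∀ ν ∈ J, |block LP k (paraprod LP (s.G σ ν) (s.b ν)) x -
          block LP k (paraprod LP (t.G σ ν) (t.b ν)) x| ≤
          Q ν * (A * D ν + B) * 2 ^ |a ν - a σ| * (δ * sc k ^ a σ) := by
      intro ν hν
      obtain ⟨hνI, hνσ⟩ := hJI ν hν
      have := hQb ν A B (D ν) δ (s.b ν) (t.b ν) (s.G σ ν) (t.G σ ν) x hA hδ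
        (s.isSystem.isBesov ν hνI) (hst.blockBd ν hνI) (hDb ν hν s t δ hδ hst)
        (s.isSystem.bddCont σ hσ ν hνI) (t.isSystem.bddCont σ hσ ν hνI)
        (by simpa using hst.G_le σ hσ ν hνI) (by simpa using hst.G_sub_le σ hσ ν hνI) k
      rw [add_zero] at this
      refine this.trans ?_
      have h3 := sc_rpow_le_of_lt_three hk (a ν) (a σ)
      have := hQ ν
      have := hD ν
      calc _ ≤ Q ν * (A * D ν + B) * δ * (2 ^ |a ν - a σ| * sc k ^ a σ) := by gcongr
        _ = _ := by ring
    calc _ ≤ 2 ^ |β - a σ| * (δ * sc k ^ a σ) +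
          ∑ ν ∈ J, Q ν * (A * D ν + B) * 2 ^ |a ν - a σ| * (δ * sc k ^ a σ) :=
          (abs_sub _ _).trans (add_le_add h1 ((Finset.abs_sum_le_sum_abs _ _).trans
            (Finset.sum_le_sum h2)))
      _ = (2 ^ |β - a σ| + Y) * δ * sc k ^ a σ := by rw [← Finset.sum_mul, ← hY]; ring
      _ ≤ _ := mul_le_mul_of_nonneg_right (mul_le_mul_of_nonneg_right
          (le_add_of_nonneg_left (by positivity)) hδ) hsc

end

/-! ### Real-valued forms of the norms of a model -/

section

variable {d : ℕ}

/-! ## Real bounds from extended norms -/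

theorem enorm_le_ofReal_iff {a A : ℝ} (hA : 0 ≤ A) : ‖a‖ₑ ≤ ENNReal.ofReal A ↔ |a| ≤ A := by
  rw [← ofReal_norm, ENNReal.ofReal_le_ofReal_iff hA, Real.norm_eq_abs]

/-- The diagonal `z = 0` carries information: for `s > 0` the quotient `‖a‖ₑ / 0` is infinite unless
`a = 0`, so a finite supremum forces increments to vanish at coinciding points. -/
theorem abs_le_of_enorm_div_le {a A s : ℝ} (hA : 0 ≤ A) (hs : 0 ≤ s) {z : E d}
    (h : ‖a‖ₑ / ‖z‖ₑ ^ s ≤ ENNReal.ofReal A) : |a| ≤ A * ‖z‖ ^ s := by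
  rcases eq_or_ne z 0 with rfl | hz
  · rcases hs.eq_or_lt with rfl | hs
    · simpa [enorm_le_ofReal_iff hA] using h
    · rw [enorm_zero, ENNReal.zero_rpow_of_pos hs] at h
      by_cases ha : a = 0
      · rw [ha, abs_zero]
        positivity
      · rw [ENNReal.div_zero (by simpa using ha)] at h
        exact absurd h (by simp)
  · have hz' : 0 < ‖z‖ := norm_pos_iff.2 hz
    rw [← ofReal_norm z, ENNReal.ofReal_rpow_of_pos hz', ENNReal.div_le_iff_le_mul
      (Or.inl (by simpa using Real.rpow_pos_of_pos hz' s)) (Or.inl ENNReal.ofReal_ne_top),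
      ← ENNReal.ofReal_mul hA, enorm_le_ofReal_iff (by positivity)] at h
    exact h

theorem enorm_div_le_of_abs_le {a A s : ℝ} (hA : 0 ≤ A) {l : ℝ} (hl : 0 < l) :
    ‖a‖ₑ / ENNReal.ofReal (l ^ s) ≤ ENNReal.ofReal A ↔ |a| ≤ A * l ^ s := by
  have hls := Real.rpow_pos_of_pos hl s
  rw [ENNReal.div_le_iff_le_mul (Or.inl (by simpa using hls)) (Or.inl ENNReal.ofReal_ne_top),
    ← ENNReal.ofReal_mul hA, enorm_le_ofReal_iff (by positivity)]

/-- A local Lipschitz bound, known only for data at distance at most one, gives continuity. -/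
theorem exists_pos_of_forall_le_mul {X : Type*} {D N : X → ℝ≥0∞} {C : ℝ} (hC : 0 ≤ C)
    (h : ∀ x t, 0 ≤ t → t ≤ 1 → D x ≤ ENNReal.ofReal t → N x ≤ ENNReal.ofReal (C * t)) {ε : ℝ≥0∞}
    (hε : 0 < ε) : ∃ δ : ℝ≥0∞, 0 < δ ∧ ∀ x, D x < δ → N x < ε := by
  obtain ⟨e, he0, he⟩ : ∃ e : ℝ, 0 < e ∧ ENNReal.ofReal e ≤ ε := by
    rcases eq_or_ne ε ⊤ with rfl | ht
    · exact ⟨1, one_pos, le_top⟩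
    · exact ⟨ε.toReal, ENNReal.toReal_pos hε.ne' ht, (ENNReal.ofReal_toReal ht).le⟩
  have hC1 : 0 < C + 1 := by linarith
  set t := min 1 (e / (C + 1)) with ht
  have ht0 : 0 < t := lt_min one_pos (by positivity)
  refine ⟨ENNReal.ofReal t, ENNReal.ofReal_pos.2 ht0, fun x hx => ?_⟩
  refine (h x t ht0.le (min_le_left _ _) hx.le).trans_lt (lt_of_lt_of_le ?_ he)
  rw [ENNReal.ofReal_lt_ofReal_iff he0]
  have h1 : t * (C + 1) ≤ e := by
    rw [← le_div_iff₀ hC1]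
    exact min_le_right _ _
  nlinarith

/-- The `ℓ¹` norm of the coordinates. -/
def coordSum {κ V : Type*} [AddCommGroup V] [Module ℝ V] (b : Module.Basis κ ℝ V) (v : V) : ℝ :=
  ∑ i ∈ (b.repr v).support, |b.coord i v|

theorem coordSum_nonneg {κ V : Type*} [AddCommGroup V] [Module ℝ V] (b : Module.Basis κ ℝ V)
    (v : V) : 0 ≤ coordSum b v := Finset.sum_nonneg fun _ _ => abs_nonneg _

theorem eq_sum_support {κ V : Type*} [AddCommGroup V] [Module ℝ V] (b : Module.Basis κ ℝ V)
    (v : V) : v = ∑ i ∈ (b.repr v).support, b.coord i v • b i :=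
  basis_eq_sum b v fun i hi => by simpa using hi

theorem abs_apply_le_coordSum {κ V : Type*} [AddCommGroup V] [Module ℝ V]
    (b : Module.Basis κ ℝ V) (k : V →ₗ[ℝ] ℝ) (v : V) {a : ℝ}
    (h : ∀ i, b.coord i v ≠ 0 → |k (b i)| ≤ a) : |k v| ≤ coordSum b v * a := by
  conv_lhs => rw [eq_sum_support b v, map_sum]
  rw [coordSum, Finset.sum_mul]
  refine (Finset.abs_sum_le_sum_abs _ _).trans (Finset.sum_le_sum fun i hi => ?_)
  rw [map_smul, smul_eq_mul, abs_mul]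
  exact mul_le_mul_of_nonneg_left (h i (Finsupp.mem_support_iff.1 hi)) (abs_nonneg _)

section Sizes

variable {Tp T ιp ι : Type*} [Ring Tp] [HopfAlgebra ℝ Tp] [AddCommGroup T] [Module ℝ T]

/-- `A` bounds the forms `k_x` and `K_{yx} / |y - x|^{|·|}` on the basis of `T⁺`. -/
structure GBound (S : ConcreteRegularityStructure Tp T ιp ι) (k : E d → (Tp →ₗ[ℝ] ℝ))
    (K : E d → E d → (Tp →ₗ[ℝ] ℝ)) (A : ℝ) : Prop where
  nonneg : 0 ≤ A
  one : ∀ τ x, |k x (S.bp τ)| ≤ A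
  two : ∀ τ x y, |K y x (S.bp τ)| ≤ A * ‖y - x‖ ^ S.degp τ

theorem gBound_of_gSize_le {S : ConcreteRegularityStructure Tp T ιp ι} {k : E d → (Tp →ₗ[ℝ] ℝ)}
    {K : E d → E d → (Tp →ₗ[ℝ] ℝ)} {A : ℝ} (hA : 0 ≤ A) (h : gSize S k K ≤ ENNReal.ofReal A) :
    GBound S k K A := by
  refine ⟨hA, fun τ x => ?_, fun τ x y => ?_⟩
  · have h1 := le_self_add.trans h
    simp only [iSup_le_iff, enorm_le_ofReal_iff hA] at h1
    exact h1 τ x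
  · have h1 := le_add_self.trans h
    simp only [iSup_le_iff] at h1
    exact abs_le_of_enorm_div_le hA (S.Ap_nonneg _ (S.degp_mem τ)) (h1 τ x y)

theorem GBound.mono {S : ConcreteRegularityStructure Tp T ιp ι} {k : E d → (Tp →ₗ[ℝ] ℝ)}
    {K : E d → E d → (Tp →ₗ[ℝ] ℝ)} {A A' : ℝ} (h : GBound S k K A) (hA : A ≤ A') :
    GBound S k K A' :=
  ⟨h.nonneg.trans hA, fun τ x => (h.one τ x).trans hA, fun τ x y => (h.two τ x y).trans
    (mul_le_mul_of_nonneg_right hA (by positivity))⟩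

theorem GBound.abs_le {S : ConcreteRegularityStructure Tp T ιp ι} {k : E d → (Tp →ₗ[ℝ] ℝ)}
    {K : E d → E d → (Tp →ₗ[ℝ] ℝ)} {A : ℝ} (h : GBound S k K A) (t : Tp) (x : E d) :
    |k x t| ≤ coordSum S.bp t * A :=
  abs_apply_le_coordSum S.bp (k x) t fun τ _ => h.one τ x

theorem GBound.abs_le_rpow {S : ConcreteRegularityStructure Tp T ιp ι} {k : E d → (Tp →ₗ[ℝ] ℝ)}
    {K : E d → E d → (Tp →ₗ[ℝ] ℝ)} {A : ℝ} (h : GBound S k K A) {α : ℝ} {t : Tp}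
    (ht : t ∈ S.Tphom α) (x y : E d) : |K y x t| ≤ coordSum S.bp t * A * ‖y - x‖ ^ α := by
  rw [mul_assoc]
  refine abs_apply_le_coordSum S.bp (K y x) t fun τ hτ => ?_
  have : S.degp τ = α := by
    by_contra hne
    exact hτ (coord_eq_zero_of_mem_homogeneous ht hne)
  rw [← this]
  exact h.two τ x y

/-- `A` bounds the distributions `P` and the recentered distributions `Px`. -/
structure PiBound (S : ConcreteRegularityStructure Tp T ιp ι) (LP : DyadicPartition d) (r : ℝ)
    (P : T →ₗ[ℝ] TDist d) (Px : E d → (T →ₗ[ℝ] TDist d)) (A : ℝ) : Prop where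
  nonneg : 0 ≤ A
  blockBd : ∀ σ, BlockBd LP S.β₀ A (P (S.b σ))
  test : ∀ σ φ, IsTest LP r φ → ∀ (l : ℝ) (hl : 0 < l), l ≤ 1 → ∀ x,
    |Px x (S.b σ) (rescale φ l hl x)| ≤ A * l ^ S.deg σ

theorem piBound_of_piSize_le {S : ConcreteRegularityStructure Tp T ιp ι} {LP : DyadicPartition d}
    {r : ℝ} {P : T →ₗ[ℝ] TDist d} {Px : E d → (T →ₗ[ℝ] TDist d)} {A : ℝ} (hA : 0 ≤ A)
    (h : piSize S LP r P Px ≤ ENNReal.ofReal A) : PiBound S LP r P Px A := by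
  refine ⟨hA, fun σ => ?_, fun σ φ hφ l hl hl1 x => ?_⟩
  · have h1 := le_self_add.trans h
    simp only [iSup_le_iff, holderNorm_le_iff LP _ hA] at h1
    exact h1 σ
  · have h1 := le_add_self.trans h
    simp only [iSup_le_iff] at h1
    exact (enorm_div_le_of_abs_le hA hl).1 (h1 σ φ hφ l hl hl1 x)

end Sizes

/-! ## Kernels as test functions -/

theorem reflectAt_kernel_zero (LP : DyadicPartition d) (x : E d) :
    reflectAt (LP.kernel 0) x = rescale (LP.kernel 0) 1 one_pos x := by
  rw [← LP.translate_kernel, translate_eq_rescale]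

theorem reflectAt_kernel_succ (LP : DyadicPartition d) (n : ℕ) (x : E d) :
    reflectAt (LP.kernel (n + 1)) x = rescale (LP.kernel 1) (sc (n + 1)) (sc_pos _) x := by
  rw [← LP.translate_kernel, LP.kernel_succ, ← rescale_eq_translate]

theorem sc_succ_le_one (n : ℕ) : sc (n + 1) ≤ 1 := by
  rw [sc_succ]
  exact inv_le_one_of_one_le₀ (one_le_pow₀ (by norm_num))

theorem exists_block_le_of_isTest (LP : DyadicPartition d) (r α : ℝ) (N : ℕ) :
    ∃ C, 0 ≤ C ∧ ∀ (v : TDist d) (x : E d) (A : ℝ), 0 ≤ A →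
      (∀ φ, IsTest LP r φ → ∀ (l : ℝ) (hl : 0 < l), l ≤ 1 → |v (rescale φ l hl x)| ≤ A * l ^ α) →
      (∀ η, |v (translate η x)| ≤ A * sn ℝ N η) →
      ∀ k, |block LP k v x| ≤ C * A * sc k ^ α := by
  obtain ⟨C₀, hC₀, h₀⟩ := exists_apply_rescale_le LP r α N (LP.kernel 0)
  obtain ⟨C₁, hC₁, h₁⟩ := exists_apply_rescale_le LP r α N (LP.kernel 1)
  have hpos := sc_rpow_pos 0 α
  refine ⟨C₀ * (sc 0 ^ α)⁻¹ + C₁, by positivity, fun v x A hA hv hc k => ?_⟩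
  have hk := sc_rpow_pos k α
  rcases Nat.eq_zero_or_pos k with rfl | hk0
  · have := h₀ v x A hA hv hc 1 one_pos le_rfl
    rw [← reflectAt_kernel_zero, Real.one_rpow, mul_one] at this
    calc _ ≤ C₀ * A := this
      _ = C₀ * (sc 0 ^ α)⁻¹ * A * sc 0 ^ α := by field_simp
      _ ≤ _ := by
        gcongr
        exact le_add_of_nonneg_right hC₁
  · obtain ⟨n, rfl⟩ := Nat.exists_eq_succ_of_ne_zero hk0.ne'
    have := h₁ v x A hA hv hc (sc (n + 1)) (sc_pos _) (sc_succ_le_one n)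
    rw [← reflectAt_kernel_succ] at this
    refine this.trans ?_
    simp only [Nat.succ_eq_add_one] at hk ⊢
    gcongr
    exact le_add_of_nonneg_left (by positivity)

/-- The partial sum is one rescaled kernel at scale `sc k`, tested at once. Adding up the bounds of
the separate blocks would fail for `α ≥ 0`, where `∑_{j < k} sc j ^ α` is not of order `sc k ^ α`.
-/
theorem exists_lowKernel_le_of_isTest (LP : DyadicPartition d) (r α : ℝ) (N : ℕ) :
    ∃ C, 0 ≤ C ∧ ∀ (v : TDist d) (x : E d) (A : ℝ), 0 ≤ A →
      (∀ φ, IsTest LP r φ → ∀ (l : ℝ) (hl : 0 < l), l ≤ 1 → |v (rescale φ l hl x)| ≤ A * l ^ α) →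
      (∀ η, |v (translate η x)| ≤ A * sn ℝ N η) →
      ∀ k, k ≠ 0 → |∑ j ∈ Finset.range k, block LP j v x| ≤ C * A * sc k ^ α := by
  obtain ⟨C₀, hC₀, h₀⟩ := exists_apply_rescale_le LP r α N (LP.kernel 0)
  refine ⟨C₀, hC₀, fun v x A hA hv hc k hk => ?_⟩
  obtain ⟨n, rfl⟩ := Nat.exists_eq_succ_of_ne_zero hk
  have := h₀ v x A hA hv hc (sc (n + 1)) (sc_pos _) (sc_succ_le_one n)
  rw [rescale_eq_translate, ← LP.lowKernel_succ, DyadicPartition.lowKernel] at this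
  have e : translate (∑ m ∈ Finset.range (n + 1), LP.kernel m) x =
      ∑ m ∈ Finset.range (n + 1), reflectAt (LP.kernel m) x := by
    rw [translate, map_sum]
    exact Finset.sum_congr rfl fun m _ => LP.translate_kernel m x
  rw [e, map_sum] at this
  exact this

end

/-! ### Characters of a model and the recursion for the brackets -/

section

variable {d : ℕ}

/-! ## Characters -/

variable {Tp T ιp ι : Type*} [Ring Tp] [HopfAlgebra ℝ Tp] [AddCommGroup T] [Module ℝ T]
  {S : ConcreteRegularityStructure Tp T ιp ι}

theorem convDiv_one (g₁ g₂ : Tp →ₐ[ℝ] ℝ) : convDiv g₁ g₂ 1 = 1 := by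
  rw [convDiv, LinearMap.comp_apply, Bialgebra.comul_one, Algebra.TensorProduct.one_def,
    tensorEval_tmul, ConcreteRegularityStructure.charInv_one]
  simp

theorem ConcreteRegularityStructure.IsLower.sum_convDiv_mul {I : Finset ι} (hI : S.IsLower I)
    {τ ν : ι} (hτ : τ ∈ I) (hν : ν ∈ I) (g₁ g₂ : Tp →ₐ[ℝ] ℝ) :
    ∑ μ ∈ I, convDiv g₁ g₂ (S.quot μ ν) * g₂ (S.quot τ μ) = g₁ (S.quot τ ν) := by
  classical
  have e : ∀ μ ∈ I, convDiv g₁ g₂ (S.quot μ ν) * g₂ (S.quot τ μ) =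
      ∑ κ ∈ I, g₁ (S.quot κ ν) * (charInv g₂ (S.quot μ κ) * g₂ (S.quot τ μ)) := by
    intro μ hμ
    rw [hI.convDiv_quot hμ hν, Finset.sum_mul]
    exact Finset.sum_congr rfl fun κ _ => by ring
  rw [Finset.sum_congr rfl e, Finset.sum_comm]
  have e2 : ∀ κ ∈ I, ∑ μ ∈ I, g₁ (S.quot κ ν) * (charInv g₂ (S.quot μ κ) * g₂ (S.quot τ μ)) =
      if τ = κ then g₁ (S.quot κ ν) else 0 := by
    intro κ hκ
    rw [← Finset.mul_sum, hI.sum_charInv_mul hτ hκ]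
    split_ifs <;> simp
  rw [Finset.sum_congr rfl e2, Finset.sum_ite_eq I τ, if_pos hτ]

theorem ConcreteRegularityStructure.quotp_one_right (S : ConcreteRegularityStructure Tp T ιp ι)
    (τ : ιp) : S.quotp τ S.one = S.bp τ := by
  by_cases h : τ = S.one
  · rw [h, ← S.quot_selfStructure, S.selfStructure.quot_self, S.bp_one]
  · exact S.quotp_one h

theorem ConcreteRegularityStructure.degp_one (S : ConcreteRegularityStructure Tp T ιp ι) :
    S.degp S.one = 0 := (S.degp_eq_zero_iff S.one).2 rfl

theorem ConcreteRegularityStructure.degp_nonneg (S : ConcreteRegularityStructure Tp T ιp ι)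
    (τ : ιp) : 0 ≤ S.degp τ := S.Ap_nonneg _ (S.degp_mem τ)

/-- A bound for the characters of a model. -/
abbrev CharBound (S : ConcreteRegularityStructure Tp T ιp ι) (g : E d → (Tp →ₐ[ℝ] ℝ)) (A : ℝ) :
    Prop :=
  GBound S (fun x => (g x).toLinearMap) (fun y x => convDiv (g y) (g x)) A

/-- Continuity of `g` is not part of the definition of a model. It follows from `g_y = g_{yx} g_x`,
expanded on `τ`: every term with `μ ≠ 1` contains `g_{yx}(μ)`, which is of order `|y - x| ^ |μ|`
with `|μ| > 0`. -/
theorem CharBound.continuous_basis {g : E d → (Tp →ₐ[ℝ] ℝ)} {A : ℝ} (h : CharBound S g A)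
    (τ : ιp) : Continuous fun x => g x (S.bp τ) := by
  rw [continuous_iff_continuousAt]
  intro x
  -- Any finite lower set containing `τ` and the unit would do; the bound `|τ| + 1` merely includes
  -- `τ` itself.
  set I := S.selfStructure.indexLt (S.degp τ + 1)
  have hI : S.selfStructure.IsLower I := S.selfStructure.isLower_indexLt _
  have hτ : τ ∈ I := S.selfStructure.mem_indexLt.2 (lt_add_one _)
  have h1 : S.one ∈ I := S.selfStructure.mem_indexLt.2
    (by change S.degp S.one < _; rw [S.degp_one]; linarith [S.degp_nonneg τ])
  have e : ∀ y, g y (S.bp τ) =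
      ∑ μ ∈ I, convDiv (g y) (g x) (S.bp μ) * g x (S.quotp τ μ) := by
    intro y
    have := hI.sum_convDiv_mul hτ h1 (g y) (g x)
    simp only [S.quot_selfStructure, S.quotp_one_right] at this
    exact this.symm
  rw [ContinuousAt, e x]
  simp only [e]
  refine tendsto_finsetSum I fun μ _ => Tendsto.mul_const _ ?_
  by_cases hμ : μ = S.one
  · simp only [hμ, S.bp_one, convDiv_one]
    exact tendsto_const_nhds
  · have hpos : 0 < S.degp μ := lt_of_le_of_ne (S.degp_nonneg μ) fun h0 =>
      hμ ((S.degp_eq_zero_iff μ).1 h0.symm)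
    have h0 : convDiv (g x) (g x) (S.bp μ) = 0 := by
      have := h.two μ x x
      rw [sub_self, norm_zero, Real.zero_rpow hpos.ne', mul_zero] at this
      exact abs_nonpos_iff.1 this
    rw [h0]
    refine squeeze_zero_norm (fun y => h.two μ x y) ?_
    have hc : Continuous fun y : E d => A * ‖y - x‖ ^ S.degp μ :=
      continuous_const.mul ((continuous_id.sub continuous_const).norm.rpow_const
        fun _ => Or.inr hpos.le)
    have := hc.tendsto x
    simpa [Real.zero_rpow hpos.ne'] using this

theorem CharBound.bddCont {g : E d → (Tp →ₐ[ℝ] ℝ)} {A : ℝ} (h : CharBound S g A) (t : Tp) :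
    BddCont fun x => g x t := by
  refine ⟨?_, _, fun x => h.abs_le t x⟩
  have e : (fun x => g x t) = fun x => ∑ i ∈ (S.bp.repr t).support, S.bp.coord i t *
      g x (S.bp i) := by
    ext x
    conv_lhs => rw [eq_sum_support S.bp t, map_sum]
    simp only [map_smul, smul_eq_mul]
  rw [e]
  exact continuous_finsetSum _ fun i _ => continuous_const.mul (h.continuous_basis i)

/-! ## Brackets -/

theorem ConcreteRegularityStructure.deg_lt_of_mem_below {μ σ : ι} (h : μ ∈ S.below σ) :
    S.deg μ < S.deg σ :=
  S.deg_lt_of_quot_ne ((S.mem_below).1 h).2 ((S.mem_below).1 h).1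

/-- The solution `b` of `u σ = ∑_{μ < σ} P_{g(σ / μ)} b μ + b σ`. -/
def bracket (S : ConcreteRegularityStructure Tp T ιp ι) (LP : DyadicPartition d)
    (g : E d → (Tp →ₐ[ℝ] ℝ)) (u : ι → TDist d) : ι → TDist d :=
  S.deg_wellFounded.fix fun σ rec => u σ - ∑ μ ∈ (S.below σ).attach,
    paraprod LP (fun x => g x (S.quot σ μ)) (rec μ.1 (S.deg_lt_of_mem_below μ.2))

theorem bracket_eq (LP : DyadicPartition d) (g : E d → (Tp →ₐ[ℝ] ℝ)) (u : ι → TDist d) (σ : ι) :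
    bracket S LP g u σ = u σ - ∑ μ ∈ S.below σ,
      paraprod LP (fun x => g x (S.quot σ μ)) (bracket S LP g u μ) := by
  conv_lhs => rw [bracket, WellFounded.fix_eq]
  rw [← Finset.sum_attach (S.below σ)]
  rfl

theorem eq_bracket {LP : DyadicPartition d} {g : E d → (Tp →ₐ[ℝ] ℝ)} {u b : ι → TDist d}
    (h : ∀ σ, u σ = ∑ μ ∈ S.below σ, paraprod LP (fun x => g x (S.quot σ μ)) (b μ) + b σ) :
    b = bracket S LP g u := by
  ext1 σ
  induction σ using S.deg_wellFounded.induction with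
  | _ σ ih =>
  rw [bracket_eq, h σ, ← Finset.sum_congr rfl fun μ hμ => by
    rw [ih μ (S.deg_lt_of_mem_below hμ)]]
  abel

theorem isBesov_bracket {LP : DyadicPartition d} {g : E d → (Tp →ₐ[ℝ] ℝ)} {u : ι → TDist d}
    (hg : ∀ t, BddCont fun x => g x t) (hu : ∀ σ, IsBesov LP (u σ)) (σ : ι) :
    IsBesov LP (bracket S LP g u σ) := by
  induction σ using S.deg_wellFounded.induction with
  | _ σ ih =>
  rw [bracket_eq]
  exact (hu σ).sub (IsBesov.sum _ fun μ hμ =>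
    (ih μ (S.deg_lt_of_mem_below hμ)).paraprod_isBesov (hg _))

theorem paraprod_zero_right {LP : DyadicPartition d} {F : E d → ℝ} (hF : BddCont F) :
    paraprod LP F 0 = 0 := by
  have := paraprod_smul_right (IsBesov.zero LP) hF 0
  simpa using this

theorem lowPart_zero (LP : DyadicPartition d) : lowPart LP 0 = 0 := by
  have := distOf_const_mul (BddCont.const (d := d) 0) 0
  simpa [lowPart, block_zero] using this

/-- The triangular system attached to characters and to a bracket relation. -/
def triangularSystem {LP : DyadicPartition d} {I : Finset ι} (hI : S.IsLower I)
    {g : E d → (Tp →ₐ[ℝ] ℝ)} (hg : ∀ t, BddCont fun x => g x t) {u b : ι → TDist d}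
    (hb : ∀ σ, IsBesov LP (b σ))
    (h : ∀ σ, u σ = ∑ μ ∈ S.below σ, paraprod LP (fun x => g x (S.quot σ μ)) (b μ) + b σ) :
    TriangularSystem LP I S.deg where
  G := fun σ μ y => g y (S.quot σ μ)
  H := fun σ μ x => charInv (g x) (S.quot σ μ)
  u := u
  b := b
  isSystem := by
    classical
    refine ⟨fun σ _ μ _ => hg _, fun σ _ => hb σ, fun σ hσ => ?_⟩
    have e : ∑ μ ∈ S.below σ, paraprod LP (fun x => g x (S.quot σ μ)) (b μ) =
        ∑ μ ∈ I.erase σ, paraprod LP (fun x => g x (S.quot σ μ)) (b μ) := by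
      refine Finset.sum_subset (fun μ hμ => ?_) fun μ _ hμ' => ?_
      · exact Finset.mem_erase.2 ⟨((S.mem_below).1 hμ).2,
          hI σ hσ μ (S.deg_lt_of_mem_below hμ)⟩
      · have hq : S.quot σ μ = 0 := by
          by_contra hq
          rename_i hμ
          exact hμ' ((S.mem_below).2 ⟨hq, (Finset.mem_erase.1 hμ).1⟩)
        simp only [hq, map_zero]
        exact paraprod_zero_left (hb μ)
    -- The sum over `I` contains the diagonal term `P_1 (b σ) = b σ - lowPart (b σ)`; adding the low
    -- part restores `b σ`.
    rw [h σ, e, ← Finset.add_sum_erase I _ hσ]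
    simp only [S.quot_self, map_one]
    rw [paraprod_one (hb σ)]
    abel
  G_self := fun σ _ y => by simp [S.quot_self]
  G_zero := fun σ _ ν _ h1 h2 y => by simp [S.quot_eq_zero h1 h2]
  self := fun σ hσ x y => by
    rw [← convDiv_one (g y) (g x), ← S.quot_self σ, hI.convDiv_quot hσ hσ]
    exact Finset.sum_congr rfl fun _ _ => mul_comm _ _
  zero := fun σ hσ ν hν h1 h2 x y => by
    have := hI.convDiv_quot hσ hν (g y) (g x)
    rw [S.quot_eq_zero h1 h2, map_zero] at this
    rw [this]
    exact Finset.sum_congr rfl fun _ _ => mul_comm _ _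

theorem trans_triangularSystem {LP : DyadicPartition d} {I : Finset ι} (hI : S.IsLower I)
    {g : E d → (Tp →ₐ[ℝ] ℝ)} (hg : ∀ t, BddCont fun x => g x t) {u b : ι → TDist d}
    (hb : ∀ σ, IsBesov LP (b σ))
    (h : ∀ σ, u σ = ∑ μ ∈ S.below σ, paraprod LP (fun x => g x (S.quot σ μ)) (b μ) + b σ)
    {σ ν : ι} (hσ : σ ∈ I) (hν : ν ∈ I) (x y : E d) :
    (triangularSystem hI hg hb h).trans σ ν x y = convDiv (g y) (g x) (S.quot σ ν) := by
  rw [hI.convDiv_quot hσ hν, TriangularSystem.trans]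
  exact Finset.sum_congr rfl fun _ _ => mul_comm _ _

/-- `∑_μ g_x⁻¹(σ / μ) u_μ`. -/
def recenterSum (S : ConcreteRegularityStructure Tp T ιp ι) (I : Finset ι)
    (g : E d → (Tp →ₐ[ℝ] ℝ)) (u : ι → TDist d) (σ : ι) (x : E d) : TDist d :=
  ∑ μ ∈ I, charInv (g x) (S.quot σ μ) • u μ

/-- The zero family solves the recursion for any characters. Comparing a system with this one turns
the stability estimate into a regularity statement, and uniqueness makes the brackets vanish when
the data do. -/
theorem zero_bracket_relation {LP : DyadicPartition d} {g : E d → (Tp →ₐ[ℝ] ℝ)}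
    (hg : ∀ t, BddCont fun x => g x t) (σ : ι) : (0 : ι → TDist d) σ =
      ∑ μ ∈ S.below σ, paraprod LP (fun x => g x (S.quot σ μ)) ((0 : ι → TDist d) μ) +
        (0 : ι → TDist d) σ := by
  simp only [Pi.zero_apply, add_zero]
  exact (Finset.sum_eq_zero fun μ _ => paraprod_zero_right (hg _)).symm

theorem bracket_relation (LP : DyadicPartition d) (g : E d → (Tp →ₐ[ℝ] ℝ)) (u : ι → TDist d)
    (σ : ι) : u σ = ∑ μ ∈ S.below σ,
      paraprod LP (fun x => g x (S.quot σ μ)) (bracket S LP g u μ) + bracket S LP g u σ := by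
  rw [bracket_eq LP g u σ]
  abel

/-- The `ℓ¹` norms of the coefficients `σ / μ` and of their antipodes, over a finite set. -/
def quotSum (S : ConcreteRegularityStructure Tp T ιp ι) (I : Finset ι) : ℝ :=
  ∑ σ ∈ I, ∑ μ ∈ I, (coordSum S.bp (S.quot σ μ) +
    coordSum S.bp (HopfAlgebra.antipode ℝ (S.quot σ μ)))

theorem coordSum_le_quotSum {I : Finset ι} {σ μ : ι} (hσ : σ ∈ I) (hμ : μ ∈ I) :
    coordSum S.bp (S.quot σ μ) ≤ quotSum S I ∧
      coordSum S.bp (HopfAlgebra.antipode ℝ (S.quot σ μ)) ≤ quotSum S I := by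
  have h0 : ∀ σ μ, 0 ≤ coordSum S.bp (S.quot σ μ) +
      coordSum S.bp (HopfAlgebra.antipode ℝ (S.quot σ μ)) := fun σ μ =>
    add_nonneg (coordSum_nonneg _ _) (coordSum_nonneg _ _)
  have h1 : coordSum S.bp (S.quot σ μ) + coordSum S.bp (HopfAlgebra.antipode ℝ (S.quot σ μ)) ≤
      quotSum S I :=
    (Finset.single_le_sum (f := fun μ => coordSum S.bp (S.quot σ μ) +
      coordSum S.bp (HopfAlgebra.antipode ℝ (S.quot σ μ))) (fun μ _ => h0 σ μ) hμ).trans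
    (Finset.single_le_sum (f := fun σ => ∑ μ ∈ I, (coordSum S.bp (S.quot σ μ) +
      coordSum S.bp (HopfAlgebra.antipode ℝ (S.quot σ μ))))
      (fun σ _ => Finset.sum_nonneg fun μ _ => h0 σ μ) hσ)
  have := coordSum_nonneg S.bp (S.quot σ μ)
  have := coordSum_nonneg S.bp (HopfAlgebra.antipode ℝ (S.quot σ μ))
  constructor <;> linarith

theorem quotSum_nonneg (S : ConcreteRegularityStructure Tp T ιp ι) (I : Finset ι) :
    0 ≤ quotSum S I :=
  Finset.sum_nonneg fun _ _ => Finset.sum_nonneg fun _ _ =>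
    add_nonneg (coordSum_nonneg _ _) (coordSum_nonneg _ _)

/-- The bound for the difference between the forms of two families of characters. -/
abbrev CharDiff (S : ConcreteRegularityStructure Tp T ιp ι) (g g' : E d → (Tp →ₐ[ℝ] ℝ)) (δ : ℝ) :
    Prop :=
  GBound S (fun x => (g x).toLinearMap - (g' x).toLinearMap)
    (fun y x => convDiv (g y) (g x) - convDiv (g' y) (g' x)) δ

theorem charDiff_self (g : E d → (Tp →ₐ[ℝ] ℝ)) {δ : ℝ} (hδ : 0 ≤ δ) : CharDiff S g g δ :=
  ⟨hδ, fun τ x => by simpa using hδ, fun τ x y => by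
    simp only [sub_self, LinearMap.zero_apply, abs_zero]
    positivity⟩

theorem CharBound.abs_charInv_le {I : Finset ι} {g : E d → (Tp →ₐ[ℝ] ℝ)} {A : ℝ}
    (h : CharBound S g A) {σ μ : ι} (hσ : σ ∈ I) (hμ : μ ∈ I) (x : E d) :
    |charInv (g x) (S.quot σ μ)| ≤ quotSum S I * A :=
  (h.abs_le (HopfAlgebra.antipode ℝ (S.quot σ μ)) x).trans
    (mul_le_mul_of_nonneg_right (coordSum_le_quotSum hσ hμ).2 h.nonneg)

theorem CharDiff.abs_charInv_sub_le {I : Finset ι} {g g' : E d → (Tp →ₐ[ℝ] ℝ)} {δ : ℝ}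
    (h : CharDiff S g g' δ) {σ μ : ι} (hσ : σ ∈ I) (hμ : μ ∈ I) (x : E d) :
    |charInv (g x) (S.quot σ μ) - charInv (g' x) (S.quot σ μ)| ≤ quotSum S I * δ :=
  (h.abs_le (HopfAlgebra.antipode ℝ (S.quot σ μ)) x).trans
    (mul_le_mul_of_nonneg_right (coordSum_le_quotSum hσ hμ).2 h.nonneg)

/-- Stability of brackets: the difference of two families of brackets is controlled by the
difference of the data. -/
theorem exists_blockBd_bracket_sub (S : ConcreteRegularityStructure Tp T ιp ι)
    (LP : DyadicPartition d) {I : Finset ι} (hI : S.IsLower I) (β : ℝ) {A B : ℝ} (hA : 0 ≤ A)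
    (hB : 0 ≤ B) {σ : ι} (hσ : σ ∈ I) :
    ∃ C, 0 ≤ C ∧ ∀ (g g' : E d → (Tp →ₐ[ℝ] ℝ)) (u u' b b' : ι → TDist d) (δ : ℝ),
      CharBound S g A → (∀ t, BddCont fun x => g' x t) → CharDiff S g g' δ →
      (∀ σ, IsBesov LP (b σ)) → (∀ σ, IsBesov LP (b' σ)) →
      (∀ σ, u σ = ∑ μ ∈ S.below σ, paraprod LP (fun x => g x (S.quot σ μ)) (b μ) + b σ) →
      (∀ σ, u' σ = ∑ μ ∈ S.below σ, paraprod LP (fun x => g' x (S.quot σ μ)) (b' μ) + b' σ) →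
      (∀ ν ∈ I, BlockBd LP (S.deg ν) B (b' ν)) →
      (∀ σ ∈ I, BlockBd LP β δ (u σ - u' σ)) →
      (∀ σ ∈ I, ∀ k x, |block LP k (recenterSum S I g u σ x - recenterSum S I g' u' σ x) x| ≤
        δ * sc k ^ S.deg σ) →
      BlockBd LP (S.deg σ) (C * δ) (b σ - b' σ) := by
  have hQ := quotSum_nonneg S I
  obtain ⟨C, hC, h⟩ := TriangularSystem.exists_blockBd_sub LP I S.deg_wellFounded β
    (A := quotSum S I * A) (B := B) (by positivity) hB σ hσ
  refine ⟨C * (quotSum S I + 1), by positivity,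
    fun g g' u u' b b' δ hg hg' hgg hb hb' hu hu' hbB huu hrec => ?_⟩
  have hδ := hgg.nonneg
  have hle : δ ≤ (quotSum S I + 1) * δ := by nlinarith
  have := h (triangularSystem hI hg.bddCont hb hu) (triangularSystem hI hg' hb' hu')
    ((quotSum S I + 1) * δ) (by positivity) ?_
  · rw [← mul_assoc] at this
    exact this
  refine ⟨fun σ hσ ν hν _ x y => ?_, fun σ hσ ν hν _ x y => ?_, fun σ hσ ν hν y => ?_,
    fun σ hσ ν hν y => ?_, hbB, fun σ hσ => (huu σ hσ).mono hle, fun σ hσ k x => ?_⟩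
  · rw [trans_triangularSystem hI _ _ _ hσ hν]
    refine (hg.abs_le_rpow (S.quot_mem σ ν) x y).trans ?_
    have := (coordSum_le_quotSum (S := S) hσ hν).1
    gcongr
  · rw [trans_triangularSystem hI _ _ _ hσ hν, trans_triangularSystem hI _ _ _ hσ hν]
    refine (hgg.abs_le_rpow (S.quot_mem σ ν) x y).trans ?_
    have := (coordSum_le_quotSum (S := S) hσ hν).1
    gcongr
    linarith
  · refine (hg.abs_le (S.quot σ ν) y).trans ?_
    have := (coordSum_le_quotSum (S := S) hσ hν).1
    gcongr
  · refine (hgg.abs_le (S.quot σ ν) y).trans ?_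
    have := (coordSum_le_quotSum (S := S) hσ hν).1
    gcongr
    linarith
  · refine (hrec σ hσ k x).trans ?_
    have := (sc_rpow_pos k (S.deg σ)).le
    gcongr

/-- Regularity of brackets. -/
theorem exists_blockBd_bracket {LP : DyadicPartition d} {I : Finset ι} (hI : S.IsLower I) (β : ℝ)
    {A : ℝ} {g : E d → (Tp →ₐ[ℝ] ℝ)} {u b : ι → TDist d} (hg : CharBound S g A)
    (hb : ∀ σ, IsBesov LP (b σ))
    (hu : ∀ σ, u σ = ∑ μ ∈ S.below σ, paraprod LP (fun x => g x (S.quot σ μ)) (b μ) + b σ)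
    (hub : ∀ σ ∈ I, BlockBd LP β A (u σ))
    (hrec : ∀ σ ∈ I, ∀ k x, |block LP k (recenterSum S I g u σ x) x| ≤ A * sc k ^ S.deg σ)
    {σ : ι} (hσ : σ ∈ I) : ∃ B, 0 ≤ B ∧ BlockBd LP (S.deg σ) B (b σ) := by
  have hA := hg.nonneg
  obtain ⟨C, hC, h⟩ := exists_blockBd_bracket_sub S LP hI β hA le_rfl hσ
  refine ⟨C * A, by positivity, ?_⟩
  have := h g g u 0 b 0 A hg hg.bddCont (charDiff_self g hA) hb (fun _ => IsBesov.zero LP) hu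
    (zero_bracket_relation hg.bddCont) (fun ν _ => BlockBd.zero LP _)
    (fun σ hσ => by simpa using hub σ hσ) (fun σ hσ k x => by
      have e : recenterSum S I g (0 : ι → TDist d) σ x = 0 := by simp [recenterSum]
      rw [e, sub_zero]
      exact hrec σ hσ k x)
  simpa using this

end

/-! ### The bracket on `T⁺` -/

section

variable {d : ℕ}

variable {Tp T ιp ι : Type*} [Ring Tp] [HopfAlgebra ℝ Tp] [AddCommGroup T] [Module ℝ T]
  {S : ConcreteRegularityStructure Tp T ιp ι}

/-! ## Brackets of characters -/

theorem exists_uniform_const {κ : Type*} (I : Finset κ) {p : κ → ℝ → Prop}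
    (hmono : ∀ i ∈ I, ∀ C C', C ≤ C' → p i C → p i C') (h : ∀ i ∈ I, ∃ C, 0 ≤ C ∧ p i C) :
    ∃ C, 0 ≤ C ∧ ∀ i ∈ I, p i C := by
  classical
  have h' : ∀ i, ∃ C, 0 ≤ C ∧ (i ∈ I → p i C) := fun i => by
    by_cases hi : i ∈ I
    · obtain ⟨C, hC, hp⟩ := h i hi
      exact ⟨C, hC, fun _ => hp⟩
    · exact ⟨0, le_rfl, fun h => (hi h).elim⟩
  choose C hC hp using h'
  refine ⟨∑ i ∈ I, C i, Finset.sum_nonneg fun i _ => hC i, fun i hi => ?_⟩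
  exact hmono i hi _ _ (Finset.single_le_sum (fun i _ => hC i) hi) (hp i hi)

/-- The map `⟦·⟧^g`. -/
def bracketG (S : ConcreteRegularityStructure Tp T ιp ι) (LP : DyadicPartition d)
    (g : E d → (Tp →ₐ[ℝ] ℝ)) : Tp →ₗ[ℝ] TDist d :=
  S.bp.constr ℝ (bracket S.selfStructure LP g fun τ => distOf fun x => g x (S.bp τ))

theorem bracketG_basis (LP : DyadicPartition d) (g : E d → (Tp →ₐ[ℝ] ℝ)) (τ : ιp) :
    bracketG S LP g (S.bp τ) =
      bracket S.selfStructure LP g (fun τ => distOf fun x => g x (S.bp τ)) τ :=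
  S.bp.constr_basis ℝ _ τ

theorem CharBound.selfStructure {g : E d → (Tp →ₐ[ℝ] ℝ)} {A : ℝ} (h : CharBound S g A) :
    CharBound S.selfStructure g A := ⟨h.nonneg, h.one, h.two⟩

theorem CharDiff.selfStructure {g g' : E d → (Tp →ₐ[ℝ] ℝ)} {δ : ℝ} (h : CharDiff S g g' δ) :
    CharDiff S.selfStructure g g' δ := ⟨h.nonneg, h.one, h.two⟩

theorem CharDiff.charBound {g g' : E d → (Tp →ₐ[ℝ] ℝ)} {A δ : ℝ} (h : CharDiff S g g' δ)
    (h' : CharBound S g' A) : CharBound S g (A + δ) := by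
  refine ⟨add_nonneg h'.nonneg h.nonneg, fun τ x => ?_, fun τ x y => ?_⟩
  · have h1 := h.one τ x
    have h2 := h'.one τ x
    rw [LinearMap.sub_apply] at h1
    have := abs_add_le ((g' x).toLinearMap (S.bp τ))
      ((g x).toLinearMap (S.bp τ) - (g' x).toLinearMap (S.bp τ))
    rw [add_sub_cancel] at this
    linarith
  · have h1 := h.two τ x y
    have h2 := h'.two τ x y
    rw [LinearMap.sub_apply] at h1
    have := abs_add_le (convDiv (g' y) (g' x) (S.bp τ))
      (convDiv (g y) (g x) (S.bp τ) - convDiv (g' y) (g' x) (S.bp τ))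
    rw [add_sub_cancel] at this
    rw [add_mul]
    linarith

theorem isBesov_distOf (LP : DyadicPartition d) {F : E d → ℝ} (hF : BddCont F) :
    IsBesov LP (distOf F) := by
  obtain ⟨C, hC, h⟩ := exists_blockFun_le LP (le_refl (0 : ℝ))
  obtain ⟨A, hA⟩ := hF.bdd
  refine ⟨0, C * A, fun k x => ?_⟩
  rw [block_distOf LP hF]
  simpa using h k F A 0 (BddCont.nonneg_bound hA) (by simpa using hA) x

theorem isBesov_bracketG_basis {LP : DyadicPartition d} {g : E d → (Tp →ₐ[ℝ] ℝ)}
    (hg : ∀ t, BddCont fun x => g x t) (τ : ιp) : IsBesov LP (bracketG S LP g (S.bp τ)) := by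
  rw [bracketG_basis]
  exact isBesov_bracket hg (fun τ => isBesov_distOf LP (hg _)) τ

theorem isBesov_linearMap {κ V : Type*} [AddCommGroup V] [Module ℝ V] (b : Module.Basis κ ℝ V)
    {LP : DyadicPartition d} {L : V →ₗ[ℝ] TDist d} (h : ∀ i, IsBesov LP (L (b i))) (v : V) :
    IsBesov LP (L v) := by
  rw [eq_sum_support b v, map_sum]
  exact IsBesov.sum _ fun i _ => by
    rw [map_smul]
    exact (h i).smul _

theorem isBesov_bracketG {LP : DyadicPartition d} {g : E d → (Tp →ₐ[ℝ] ℝ)}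
    (hg : ∀ t, BddCont fun x => g x t) (t : Tp) : IsBesov LP (bracketG S LP g t) :=
  isBesov_linearMap S.bp (isBesov_bracketG_basis hg) t

theorem bracketG_relation (LP : DyadicPartition d) (g : E d → (Tp →ₐ[ℝ] ℝ)) (τ : ιp) :
    distOf (fun x => g x (S.bp τ)) = ∑ μ ∈ S.selfStructure.below τ,
      paraprod LP (fun x => g x (S.selfStructure.quot τ μ)) (bracketG S LP g (S.bp μ)) +
        bracketG S LP g (S.bp τ) := by
  simp only [bracketG_basis]
  exact bracket_relation (S := S.selfStructure) LP g (fun τ => distOf fun x => g x (S.bp τ)) τ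

theorem ConcreteRegularityStructure.below_one (S : ConcreteRegularityStructure Tp T ιp ι) :
    S.selfStructure.below S.one = ∅ := by
  rw [Finset.eq_empty_iff_forall_notMem]
  intro μ hμ
  have := S.selfStructure.deg_lt_of_mem_below hμ
  change S.degp μ < S.degp S.one at this
  rw [S.degp_one] at this
  exact absurd (S.degp_nonneg μ) (not_le.2 this)

theorem bracketG_one (LP : DyadicPartition d) (g : E d → (Tp →ₐ[ℝ] ℝ)) :
    bracketG S LP g 1 = distOf fun _ => 1 := by
  have h := bracketG_relation (S := S) LP g S.one
  rw [S.below_one, Finset.sum_empty, zero_add, S.bp_one] at h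
  simpa using h.symm

/-- The formula for `⟦·⟧^g` omits `ν = 1`, whereas the general recursion over `selfStructure`
includes it. The extra term is a paraproduct with the constant `⟦1⟧ = 1`, which is zero. -/
theorem sum_betweenp {LP : DyadicPartition d} {g : E d → (Tp →ₐ[ℝ] ℝ)} {b : ιp → TDist d}
    (hb : b S.one = distOf fun _ => 1) (τ : ιp) :
    ∑ ν ∈ S.betweenp τ, paraprod LP (fun x => g x (S.quotp τ ν)) (b ν) =
      ∑ ν ∈ S.selfStructure.below τ,
        paraprod LP (fun x => g x (S.selfStructure.quot τ ν)) (b ν) := by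
  refine Finset.sum_subset (fun ν hν => (S.mem_betweenp_iff.1 hν).1) fun ν hν hν' => ?_
  have : ν = S.one := by
    by_contra hne
    exact hν' (S.mem_betweenp_iff.2 ⟨hν, hne⟩)
  rw [this, hb]
  exact paraprod_distOf_const 1 _

theorem isBracketg_bracketG {LP : DyadicPartition d} {g : E d → (Tp →ₐ[ℝ] ℝ)}
    (hg : ∀ t, BddCont fun x => g x t) : IsBracketg S LP g (bracketG S LP g) := by
  intro τ
  refine ⟨fun ν _ => (isBesov_bracketG hg _).paraprodConverges (hg _), ?_⟩
  rw [sum_betweenp (b := fun ν => bracketG S LP g (S.bp ν))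
    (by rw [S.bp_one]; exact bracketG_one LP g), ← bracketG_relation]
  exact represents_distOf (hg _)

theorem IsBracketg.eq_bracketG {LP : DyadicPartition d} {g : E d → (Tp →ₐ[ℝ] ℝ)}
    (hg : ∀ t, BddCont fun x => g x t) {L : Tp →ₗ[ℝ] TDist d} (h : IsBracketg S LP g L) :
    L = bracketG S LP g := by
  have hrel : ∀ τ, distOf (fun x => g x (S.bp τ)) =
      ∑ ν ∈ S.betweenp τ, paraprod LP (fun x => g x (S.quotp τ ν)) (L (S.bp ν)) + L (S.bp τ) :=
    fun τ => (represents_distOf (hg _)).unique (h τ).2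
  have h1 : L (S.bp S.one) = distOf fun _ => 1 := by
    have h2 := hrel S.one
    have : S.betweenp S.one = ∅ := by
      rw [Finset.eq_empty_iff_forall_notMem]
      intro ν hν
      have := (S.mem_betweenp_iff.1 hν).1
      rw [S.below_one] at this
      simp at this
    rw [this, Finset.sum_empty, zero_add] at h2
    simpa [S.bp_one] using h2.symm
  refine S.bp.ext fun τ => ?_
  rw [bracketG_basis]
  refine congrFun (eq_bracket (S := S.selfStructure) (b := fun τ => L (S.bp τ)) fun τ => ?_) τ
  rw [hrel τ, sum_betweenp (b := fun ν => L (S.bp ν)) h1]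

/-- For `T⁺` over itself the role of `Π_x τ` is played by the function `y ↦ g_{yx}(τ)`: this is
`convDiv_quot` with `ν` the unit, using `τ /⁺ 1 = τ`. -/
theorem recenterSum_distOf {I : Finset ιp} (hI : S.selfStructure.IsLower I) (h1 : S.one ∈ I)
    {g : E d → (Tp →ₐ[ℝ] ℝ)} (hg : ∀ t, BddCont fun x => g x t) {τ : ιp} (hτ : τ ∈ I) (x : E d) :
    BddCont (fun y => convDiv (g y) (g x) (S.bp τ)) ∧
    recenterSum S.selfStructure I g (fun τ => distOf fun x => g x (S.bp τ)) τ x =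
      distOf fun y => convDiv (g y) (g x) (S.bp τ) := by
  have e : (fun y => convDiv (g y) (g x) (S.bp τ)) =
      fun y => ∑ μ ∈ I, charInv (g x) (S.selfStructure.quot τ μ) * g y (S.bp μ) := by
    ext y
    have := hI.convDiv_quot hτ h1 (g y) (g x)
    rw [S.quot_selfStructure, S.quotp_one_right] at this
    rw [this]
    refine Finset.sum_congr rfl fun μ _ => ?_
    rw [S.quot_selfStructure μ, S.quotp_one_right, mul_comm]
  have hb : ∀ μ ∈ I, BddCont fun y => charInv (g x) (S.selfStructure.quot τ μ) * g y (S.bp μ) :=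
    fun μ _ => (hg _).const_mul _
  rw [e]
  refine ⟨BddCont.sum I hb, ?_⟩
  rw [distOf_sum I hb, recenterSum]
  exact Finset.sum_congr rfl fun μ _ => (distOf_const_mul (hg _) _).symm

theorem exists_block_distOf_le (LP : DyadicPartition d) {s : ℝ} (hs : 0 ≤ s) :
    ∃ C, 0 ≤ C ∧ ∀ (F : E d → ℝ), BddCont F → ∀ (A : ℝ) (x : E d), 0 ≤ A →
      (∀ z, |F z| ≤ A * ‖z - x‖ ^ s) → ∀ k, |block LP k (distOf F) x| ≤ C * A * sc k ^ s := by
  obtain ⟨C, hC, h⟩ := exists_blockFun_le LP hs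
  refine ⟨C, hC, fun F hF A x hA hFx k => ?_⟩
  rw [block_distOf LP hF]
  simpa using h k F A x hA hFx x

theorem exists_blockBd_bracketG_basis (LP : DyadicPartition d) {g : E d → (Tp →ₐ[ℝ] ℝ)} {A : ℝ}
    (hg : CharBound S g A) (τ : ιp) :
    ∃ B, 0 ≤ B ∧ BlockBd LP (S.degp τ) B (bracketG S LP g (S.bp τ)) := by
  set I := S.selfStructure.indexLt (S.degp τ + 1)
  have hI : S.selfStructure.IsLower I := S.selfStructure.isLower_indexLt _
  have hτ : τ ∈ I := S.selfStructure.mem_indexLt.2 (lt_add_one _)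
  have h1 : S.one ∈ I := S.selfStructure.mem_indexLt.2
    (by change S.degp S.one < _; rw [S.degp_one]; linarith [S.degp_nonneg τ])
  have hA := hg.nonneg
  obtain ⟨C₀, hC₀, h₀⟩ := exists_block_distOf_le LP (le_refl (0 : ℝ))
  obtain ⟨C₁, hC₁, h₁⟩ := exists_uniform_const I (p := fun σ C => ∀ (F : E d → ℝ), BddCont F →
      ∀ (A : ℝ) (x : E d), 0 ≤ A → (∀ z, |F z| ≤ A * ‖z - x‖ ^ S.degp σ) →
        ∀ k, |block LP k (distOf F) x| ≤ C * A * sc k ^ S.degp σ)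
    (fun σ _ C C' hCC h F hF A x hA hFx k => (h F hF A x hA hFx k).trans (by
      have := (sc_rpow_pos k (S.degp σ)).le
      gcongr))
    (fun σ _ => exists_block_distOf_le LP (S.degp_nonneg σ))
  refine exists_blockBd_bracket (S := S.selfStructure) (LP := LP) hI 0
    (A := (1 + C₀ + C₁) * A) (g := g) (u := fun τ => distOf fun x => g x (S.bp τ))
    (b := fun τ => bracketG S LP g (S.bp τ)) (hg.selfStructure.mono (by nlinarith))
    (fun σ => isBesov_bracketG hg.bddCont _) (bracketG_relation LP g) (fun σ _ k x => ?_)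
    (fun σ hσ k x => ?_) hτ
  · have := h₀ _ (hg.bddCont (S.bp σ)) A x hA (fun z => by simpa using hg.one σ z) k
    refine this.trans ?_
    rw [Real.rpow_zero, mul_one, mul_one]
    gcongr
    linarith
  · obtain ⟨hbc, e⟩ := recenterSum_distOf hI h1 hg.bddCont hσ x
    rw [e]
    refine (h₁ σ hσ _ hbc A x hA (fun z => hg.two σ x z) k).trans ?_
    have := (sc_rpow_pos k (S.degp σ)).le
    change _ ≤ _ * sc k ^ S.degp σ
    gcongr
    linarith

/-- The constant depends on `g'` only. The brackets of `g'` are already known to be regular, and a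
`g` with `δ ≤ 1` satisfies `CharBound` with `A + 1`. -/
theorem exists_blockBd_bracketG_sub (LP : DyadicPartition d) {g' : E d → (Tp →ₐ[ℝ] ℝ)} {A : ℝ}
    (hg' : CharBound S g' A) (τ : ιp) :
    ∃ C, 0 ≤ C ∧ ∀ (g : E d → (Tp →ₐ[ℝ] ℝ)) (δ : ℝ), δ ≤ 1 → CharDiff S g g' δ →
      BlockBd LP (S.degp τ) (C * δ) (bracketG S LP g (S.bp τ) - bracketG S LP g' (S.bp τ)) := by
  set I := S.selfStructure.indexLt (S.degp τ + 1)
  have hI : S.selfStructure.IsLower I := S.selfStructure.isLower_indexLt _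
  have hτ : τ ∈ I := S.selfStructure.mem_indexLt.2 (lt_add_one _)
  have h1 : S.one ∈ I := S.selfStructure.mem_indexLt.2
    (by change S.degp S.one < _; rw [S.degp_one]; linarith [S.degp_nonneg τ])
  have hA := hg'.nonneg
  obtain ⟨C₀, hC₀, h₀⟩ := exists_block_distOf_le LP (le_refl (0 : ℝ))
  obtain ⟨C₁, hC₁, h₁⟩ := exists_uniform_const I (p := fun σ C => ∀ (F : E d → ℝ), BddCont F →
      ∀ (A : ℝ) (x : E d), 0 ≤ A → (∀ z, |F z| ≤ A * ‖z - x‖ ^ S.degp σ) →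
        ∀ k, |block LP k (distOf F) x| ≤ C * A * sc k ^ S.degp σ)
    (fun σ _ C C' hCC h F hF A x hA hFx k => (h F hF A x hA hFx k).trans (by
      have := (sc_rpow_pos k (S.degp σ)).le
      gcongr))
    (fun σ _ => exists_block_distOf_le LP (S.degp_nonneg σ))
  obtain ⟨B, hB, hBb⟩ := exists_uniform_const I
    (p := fun σ B => BlockBd LP (S.degp σ) B (bracketG S LP g' (S.bp σ)))
    (fun σ _ C C' hCC h => h.mono hCC) (fun σ _ => exists_blockBd_bracketG_basis LP hg' σ)
  obtain ⟨C, hC, h⟩ := exists_blockBd_bracket_sub S.selfStructure LP hI 0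
    (A := A + 1) (by positivity) hB hτ
  refine ⟨C * (1 + C₀ + C₁), by positivity, fun g δ hδ1 hd => ?_⟩
  have hδ := hd.nonneg
  have hg : CharBound S g (A + 1) := (hd.charBound hg').mono (by linarith)
  rw [mul_assoc]
  refine h g g' (fun τ => distOf fun x => g x (S.bp τ)) (fun τ => distOf fun x => g' x (S.bp τ))
    (fun τ => bracketG S LP g (S.bp τ)) (fun τ => bracketG S LP g' (S.bp τ))
    ((1 + C₀ + C₁) * δ) hg.selfStructure hg'.bddCont (hd.selfStructure.mono (by nlinarith))
    (fun σ => isBesov_bracketG hg.bddCont _) (fun σ => isBesov_bracketG hg'.bddCont _)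
    (bracketG_relation LP g) (bracketG_relation LP g') hBb (fun σ _ k x => ?_) (fun σ hσ k x => ?_)
  · rw [← distOf_sub (hg.bddCont _) (hg'.bddCont _)]
    have := h₀ _ ((hg.bddCont (S.bp σ)).sub (hg'.bddCont (S.bp σ))) δ x hδ
      (fun z => by simpa using hd.one σ z) k
    refine this.trans ?_
    rw [Real.rpow_zero, mul_one, mul_one]
    gcongr
    linarith
  · obtain ⟨hbc, e⟩ := recenterSum_distOf hI h1 hg.bddCont hσ x
    obtain ⟨hbc', e'⟩ := recenterSum_distOf hI h1 hg'.bddCont hσ x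
    rw [e, e', ← distOf_sub hbc hbc']
    refine (h₁ σ hσ _ (hbc.sub hbc') δ x hδ (fun z => hd.two σ x z) k).trans ?_
    have := (sc_rpow_pos k (S.degp σ)).le
    change _ ≤ _ * sc k ^ S.degp σ
    gcongr
    linarith

/-! ## Linear extension of bounds -/

theorem blockBd_linearMap {κ V : Type*} [AddCommGroup V] [Module ℝ V] (b : Module.Basis κ ℝ V)
    {LP : DyadicPartition d} {α : ℝ} {L : V →ₗ[ℝ] TDist d} {v : V} {B : ℝ}
    (h : ∀ i, b.coord i v ≠ 0 → BlockBd LP α B (L (b i))) :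
    BlockBd LP α (coordSum b v * B) (L v) := by
  rw [eq_sum_support b v, map_sum, ← eq_sum_support b v, coordSum, Finset.sum_mul]
  refine BlockBd.sum _ fun i hi => ?_
  rw [map_smul]
  exact (h i (Finsupp.mem_support_iff.1 hi)).smul _

theorem memHolder_linearMap {κ V : Type*} [AddCommGroup V] [Module ℝ V] (b : Module.Basis κ ℝ V)
    {LP : DyadicPartition d} {α : ℝ} {L : V →ₗ[ℝ] TDist d} {v : V}
    (h : ∀ i, b.coord i v ≠ 0 → ∃ B, 0 ≤ B ∧ BlockBd LP α B (L (b i))) :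
    MemHolder LP α (L v) := by
  obtain ⟨B, hB, hBb⟩ := exists_uniform_const (b.repr v).support
    (p := fun i B => BlockBd LP α B (L (b i))) (fun i _ C C' hCC h => h.mono hCC)
    (fun i hi => h i (Finsupp.mem_support_iff.1 hi))
  rw [memHolder_iff]
  exact ⟨_, mul_nonneg (coordSum_nonneg b v) hB, blockBd_linearMap b fun i hi =>
    hBb i (Finsupp.mem_support_iff.2 hi)⟩

theorem memHolder_bracketG (LP : DyadicPartition d) {g : E d → (Tp →ₐ[ℝ] ℝ)} {A : ℝ}
    (hg : CharBound S g A) {α : ℝ} {t : Tp} (ht : t ∈ S.Tphom α) :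
    MemHolder LP α (bracketG S LP g t) := by
  refine memHolder_linearMap S.bp fun i hi => ?_
  have : S.degp i = α := by
    by_contra hne
    exact hi (coord_eq_zero_of_mem_homogeneous ht hne)
  rw [← this]
  exact exists_blockBd_bracketG_basis LP hg i

theorem memHolder_zero_bracketG (LP : DyadicPartition d) {g : E d → (Tp →ₐ[ℝ] ℝ)} {A : ℝ}
    (hg : CharBound S g A) (t : Tp) : MemHolder LP 0 (bracketG S LP g t) := by
  refine memHolder_linearMap S.bp fun i _ => ?_
  obtain ⟨B, hB, h⟩ := exists_blockBd_bracketG_basis LP hg i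
  exact ⟨_, by positivity, h.of_le hB (S.degp_nonneg i)⟩

theorem exists_blockBd_bracketG_sub_of_mem (LP : DyadicPartition d) {g' : E d → (Tp →ₐ[ℝ] ℝ)}
    {A : ℝ} (hg' : CharBound S g' A) {α : ℝ} {t : Tp} (ht : t ∈ S.Tphom α) :
    ∃ C, 0 ≤ C ∧ ∀ (g : E d → (Tp →ₐ[ℝ] ℝ)) (δ : ℝ), δ ≤ 1 → CharDiff S g g' δ →
      BlockBd LP α (C * δ) (bracketG S LP g t - bracketG S LP g' t) := by
  obtain ⟨C, hC, h⟩ := exists_uniform_const (S.bp.repr t).support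
    (p := fun i C => ∀ (g : E d → (Tp →ₐ[ℝ] ℝ)) (δ : ℝ), δ ≤ 1 → CharDiff S g g' δ →
      BlockBd LP (S.degp i) (C * δ) (bracketG S LP g (S.bp i) - bracketG S LP g' (S.bp i)))
    (fun i _ C C' hCC h g δ h1 h2 => (h g δ h1 h2).mono
      (mul_le_mul_of_nonneg_right hCC h2.nonneg))
    (fun i _ => exists_blockBd_bracketG_sub LP hg' i)
  refine ⟨coordSum S.bp t * C, mul_nonneg (coordSum_nonneg _ _) hC, fun g δ h1 h2 => ?_⟩
  rw [← LinearMap.sub_apply, mul_assoc]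
  refine blockBd_linearMap S.bp fun i hi => ?_
  have : S.degp i = α := by
    by_contra hne
    exact hi (coord_eq_zero_of_mem_homogeneous ht hne)
  rw [← this]
  exact h i (Finsupp.mem_support_iff.2 hi) g δ h1 h2

end

/-! ### The bracket on `T` -/

section

variable {d : ℕ}

variable {Tp T ιp ι : Type*} [Ring Tp] [HopfAlgebra ℝ Tp] [AddCommGroup T] [Module ℝ T]
  {S : ConcreteRegularityStructure Tp T ιp ι}

/-! ## Brackets of models -/

theorem ConcreteRegularityStructure.β₀_le (S : ConcreteRegularityStructure Tp T ιp ι) (σ : ι) :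
    S.β₀ ≤ S.deg σ := S.A_isLeast.2 (S.deg_mem σ)

/-- The crude, scale-free bound required by `exists_apply_rescale_le`: `Π_x σ` is a finite
combination, with coefficients bounded in `x`, of distributions in `𝒞^{β₀}`, and those are
controlled by a translation invariant seminorm. The difference of two models is split bilinearly. -/
theorem exists_recenter_sub_translate_le (S : ConcreteRegularityStructure Tp T ιp ι)
    (LP : DyadicPartition d) {I : Finset ι} (hI : S.IsLower I) {A B : ℝ} (hA : 0 ≤ A)
    (hB : 0 ≤ B) :
    ∃ (N : ℕ) (C : ℝ), 0 ≤ C ∧ ∀ (g g' : E d → (Tp →ₐ[ℝ] ℝ)) (P P' : T →ₗ[ℝ] TDist d) (δ : ℝ),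
      CharBound S g A → CharDiff S g g' δ → (∀ σ, BlockBd LP S.β₀ B (P' (S.b σ))) →
      (∀ σ, BlockBd LP S.β₀ δ ((P - P') (S.b σ))) → ∀ σ ∈ I, ∀ x η,
        |(recenter S g P x - recenter S g' P' x) (S.b σ) (translate η x)| ≤
          C * δ * sn ℝ N η := by
  obtain ⟨N, C, hC, h⟩ := exists_apply_translate_le LP S.β₀
  have hQ := quotSum_nonneg S I
  set Q := quotSum S I
  refine ⟨N, I.card * (Q * (A + B) * C), by positivity,
    fun g g' P P' δ hg hd hP' hPP σ hσ x η => ?_⟩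
  have hδ := hd.nonneg
  have hη := sn_nonneg N η
  have e : (recenter S g P x - recenter S g' P' x) (S.b σ) (translate η x) =
      ∑ μ ∈ I, (charInv (g x) (S.quot σ μ) * ((P - P') (S.b μ)) (translate η x) +
        (charInv (g x) (S.quot σ μ) - charInv (g' x) (S.quot σ μ)) *
          P' (S.b μ) (translate η x)) := by
    rw [LinearMap.sub_apply, hI.recenter_basis hσ, hI.recenter_basis hσ, sub_apply, sum_apply,
      sum_apply, ← Finset.sum_sub_distrib]
    refine Finset.sum_congr rfl fun μ _ => ?_
    rw [LinearMap.sub_apply, sub_apply, smul_apply, smul_apply, smul_eq_mul, smul_eq_mul]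
    ring
  rw [e]
  refine (Finset.abs_sum_le_sum_abs _ _).trans ?_
  calc _ ≤ ∑ μ ∈ I, (Q * (A + B) * C) * δ * sn ℝ N η := by
        refine Finset.sum_le_sum fun μ hμ => ?_
        have h1 := h δ _ (hPP μ) η x
        have h2 := h B _ (hP' μ) η x
        have h3 := hg.abs_charInv_le hσ hμ x
        have h4 := hd.abs_charInv_sub_le hσ hμ x
        refine (abs_add_le _ _).trans ?_
        rw [abs_mul, abs_mul]
        calc _ ≤ (Q * A) * (C * δ * sn ℝ N η) + (Q * δ) * (C * B * sn ℝ N η) := by gcongr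
          _ = _ := by ring
    _ = _ := by rw [Finset.sum_const, nsmul_eq_mul]; ring

theorem exists_block_recenter_sub_le (S : ConcreteRegularityStructure Tp T ιp ι)
    (LP : DyadicPartition d) (r : ℝ) {I : Finset ι} (hI : S.IsLower I) {A B : ℝ} (hA : 0 ≤ A)
    (hB : 0 ≤ B) :
    ∃ C, 0 ≤ C ∧ ∀ (g g' : E d → (Tp →ₐ[ℝ] ℝ)) (P P' : T →ₗ[ℝ] TDist d) (δ : ℝ),
      CharBound S g A → CharDiff S g g' δ → (∀ σ, BlockBd LP S.β₀ B (P' (S.b σ))) →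
      PiBound S LP r (P - P') (fun x => recenter S g P x - recenter S g' P' x) δ →
      ∀ σ ∈ I, ∀ x,
        (∀ k, |block LP k ((recenter S g P x - recenter S g' P' x) (S.b σ)) x| ≤
          C * δ * sc k ^ S.deg σ) ∧
        ∀ k, k ≠ 0 → |∑ j ∈ Finset.range k,
          block LP j ((recenter S g P x - recenter S g' P' x) (S.b σ)) x| ≤
          C * δ * sc k ^ S.deg σ := by
  obtain ⟨N, C, hC, h⟩ := exists_recenter_sub_translate_le S LP hI hA hB
  obtain ⟨D, hD, hDb⟩ := exists_uniform_const I (p := fun σ D => ∀ (v : TDist d) (x : E d) (A : ℝ),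
      0 ≤ A → (∀ φ, IsTest LP r φ → ∀ (l : ℝ) (hl : 0 < l), l ≤ 1 →
        |v (rescale φ l hl x)| ≤ A * l ^ S.deg σ) →
      (∀ η, |v (translate η x)| ≤ A * sn ℝ N η) →
      (∀ k, |block LP k v x| ≤ D * A * sc k ^ S.deg σ) ∧
        ∀ k, k ≠ 0 → |∑ j ∈ Finset.range k, block LP j v x| ≤ D * A * sc k ^ S.deg σ)
    (fun σ _ D D' hDD h v x A hA hv hη => ⟨fun k => ((h v x A hA hv hη).1 k).trans (by
        have := (sc_rpow_pos k (S.deg σ)).le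
        gcongr), fun k hk => ((h v x A hA hv hη).2 k hk).trans (by
        have := (sc_rpow_pos k (S.deg σ)).le
        gcongr)⟩)
    (fun σ _ => by
      obtain ⟨D₁, hD₁, h₁⟩ := exists_block_le_of_isTest LP r (S.deg σ) N
      obtain ⟨D₂, hD₂, h₂⟩ := exists_lowKernel_le_of_isTest LP r (S.deg σ) N
      refine ⟨D₁ + D₂, by positivity, fun v x A hA hv hη => ⟨fun k => ?_, fun k hk => ?_⟩⟩
      · refine (h₁ v x A hA hv hη k).trans ?_
        have := (sc_rpow_pos k (S.deg σ)).le
        gcongr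
        linarith
      · refine (h₂ v x A hA hv hη k hk).trans ?_
        have := (sc_rpow_pos k (S.deg σ)).le
        gcongr
        linarith)
  refine ⟨D * (1 + C), by positivity, fun g g' P P' δ hg hd hP' hPP σ hσ x => ?_⟩
  have hδ := hd.nonneg
  have := hDb σ hσ ((recenter S g P x - recenter S g' P' x) (S.b σ)) x ((1 + C) * δ)
    (by positivity) (fun φ hφ l hl hl1 => (hPP.test σ φ hφ l hl hl1 x).trans (by
      have := Real.rpow_pos_of_pos hl (S.deg σ)
      gcongr
      nlinarith))
    (fun η => (h g g' P P' δ hg hd hP' hPP.blockBd σ hσ x η).trans (by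
      have := sn_nonneg N η
      gcongr
      linarith))
  rw [mul_assoc D]
  exact this

theorem recenter_zero (g : E d → (Tp →ₐ[ℝ] ℝ)) (x : E d) :
    recenter S g (0 : T →ₗ[ℝ] TDist d) x = 0 := by
  have : tensorEval (0 : T →ₗ[ℝ] TDist d) (charInv (g x)) = 0 := by
    rw [tensorEval, TensorProduct.map_zero_left, LinearMap.comp_zero]
  rw [recenter, this, LinearMap.zero_comp]

theorem exists_block_recenter_le (LP : DyadicPartition d) (r : ℝ) {I : Finset ι}
    (hI : S.IsLower I) {A : ℝ} {g : E d → (Tp →ₐ[ℝ] ℝ)} {P : T →ₗ[ℝ] TDist d}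
    (hg : CharBound S g A) (hP : PiBound S LP r P (recenter S g P) A) :
    ∃ C, 0 ≤ C ∧ ∀ σ ∈ I, ∀ x,
        (∀ k, |block LP k (recenter S g P x (S.b σ)) x| ≤ C * sc k ^ S.deg σ) ∧
        ∀ k, k ≠ 0 → |∑ j ∈ Finset.range k, block LP j (recenter S g P x (S.b σ)) x| ≤
          C * sc k ^ S.deg σ := by
  have hA := hg.nonneg
  obtain ⟨C, hC, h⟩ := exists_block_recenter_sub_le S LP r hI hA le_rfl
  refine ⟨C * A, by positivity, fun σ hσ x => ?_⟩
  have h0 : ∀ L : T →ₗ[ℝ] TDist d, L - 0 = L := fun L => by ext; simp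
  have := h g g P 0 A hg (charDiff_self g hA) (fun σ => BlockBd.zero LP _)
    (by simpa only [h0, recenter_zero] using hP) σ hσ x
  simpa only [recenter_zero, h0] using this

theorem RSModel.exists_bound {LP : DyadicPartition d} {r : ℝ} (M : RSModel S LP r) :
    ∃ A, CharBound S M.g A ∧ PiBound S LP r M.Pi (recenter S M.g M.Pi) A := by
  refine ⟨max (gSize S (fun x => (M.g x).toLinearMap) (fun y x => convDiv (M.g y) (M.g x))).toReal
    (piSize S LP r M.Pi (recenter S M.g M.Pi)).toReal, ?_, ?_⟩
  · refine gBound_of_gSize_le (le_max_of_le_left ENNReal.toReal_nonneg) ?_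
    conv_lhs => rw [← ENNReal.ofReal_toReal M.g_bound.ne]
    exact ENNReal.ofReal_le_ofReal (le_max_left _ _)
  · refine piBound_of_piSize_le (le_max_of_le_left ENNReal.toReal_nonneg) ?_
    conv_lhs => rw [← ENNReal.ofReal_toReal M.Pi_bound.ne]
    exact ENNReal.ofReal_le_ofReal (le_max_right _ _)

theorem RSModel.exists_charBound {LP : DyadicPartition d} {r : ℝ} (M : RSModel S LP r) :
    ∃ A, CharBound S M.g A :=
  let ⟨A, h, _⟩ := M.exists_bound
  ⟨A, h⟩

theorem RSModel.bddCont {LP : DyadicPartition d} {r : ℝ} (M : RSModel S LP r) (t : Tp) :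
    BddCont fun x => M.g x t :=
  let ⟨_, h⟩ := M.exists_charBound
  h.bddCont t

theorem RSModel.dist_le {LP : DyadicPartition d} {r : ℝ} {M M' : RSModel S LP r} {δ : ℝ}
    (hδ : 0 ≤ δ) (h : M'.dist M ≤ ENNReal.ofReal δ) : CharDiff S M'.g M.g δ ∧
      PiBound S LP r (M'.Pi - M.Pi)
        (fun x => recenter S M'.g M'.Pi x - recenter S M.g M.Pi x) δ :=
  ⟨gBound_of_gSize_le hδ (le_self_add.trans h), piBound_of_piSize_le hδ (le_add_self.trans h)⟩

/-- The map `⟦·⟧^M`. -/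
def bracketM {LP : DyadicPartition d} {r : ℝ} (M : RSModel S LP r) : T →ₗ[ℝ] TDist d :=
  S.b.constr ℝ (bracket S LP M.g fun σ => M.Pi (S.b σ))

section

variable {LP : DyadicPartition d} {r : ℝ} (M : RSModel S LP r)

theorem bracketM_basis (σ : ι) :
    bracketM M (S.b σ) = bracket S LP M.g (fun σ => M.Pi (S.b σ)) σ :=
  S.b.constr_basis ℝ _ σ

theorem isBesov_bracketM_basis (σ : ι) : IsBesov LP (bracketM M (S.b σ)) := by
  obtain ⟨A, hg, hP⟩ := M.exists_bound
  rw [bracketM_basis]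
  exact isBesov_bracket hg.bddCont (fun τ => (hP.blockBd τ).isBesov) σ

theorem bracketM_relation (σ : ι) :
    M.Pi (S.b σ) = ∑ μ ∈ S.below σ, paraprod LP (fun x => M.g x (S.quot σ μ))
      (bracketM M (S.b μ)) + bracketM M (S.b σ) := by
  simp only [bracketM_basis]
  exact bracket_relation LP M.g (fun σ => M.Pi (S.b σ)) σ

theorem isBracketM_bracketM : IsBracketM S LP M.g M.Pi (bracketM M) := fun σ =>
  ⟨fun _ _ => (isBesov_bracketM_basis M _).paraprodConverges (M.bddCont _), bracketM_relation M σ⟩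

variable {M}

theorem IsBracketM.eq_bracketM {L : T →ₗ[ℝ] TDist d} (h : IsBracketM S LP M.g M.Pi L) :
    L = bracketM M := by
  refine S.b.ext fun σ => ?_
  rw [bracketM_basis]
  exact congrFun (eq_bracket (b := fun σ => L (S.b σ)) fun σ => (h σ).2) σ

variable (M)

theorem exists_blockBd_bracketM_basis (σ : ι) :
    ∃ B, 0 ≤ B ∧ BlockBd LP (S.deg σ) B (bracketM M (S.b σ)) := by
  obtain ⟨A, hg, hP⟩ := M.exists_bound
  set I := S.indexLt (S.deg σ + 1)
  have hI : S.IsLower I := S.isLower_indexLt _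
  have hσ : σ ∈ I := S.mem_indexLt.2 (lt_add_one _)
  obtain ⟨C, hC, h⟩ := exists_block_recenter_le LP r hI hg hP
  refine exists_blockBd_bracket (LP := LP) hI S.β₀ (A := A + C) (g := M.g)
    (u := fun σ => M.Pi (S.b σ)) (b := fun σ => bracketM M (S.b σ)) (hg.mono (by linarith))
    (isBesov_bracketM_basis M) (bracketM_relation M)
    (fun τ _ => (hP.blockBd τ).mono (by linarith)) (fun τ hτ k x => ?_) hσ
  rw [recenterSum, ← hI.recenter_basis hτ]
  refine ((h τ hτ x).1 k).trans ?_
  have := (sc_rpow_pos k (S.deg τ)).le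
  have := hg.nonneg
  gcongr
  linarith

theorem exists_blockBd_bracketM_sub (σ : ι) :
    ∃ C, 0 ≤ C ∧ ∀ (M' : RSModel S LP r) (δ : ℝ), 0 ≤ δ → δ ≤ 1 →
      M'.dist M ≤ ENNReal.ofReal δ →
      BlockBd LP (S.deg σ) (C * δ) (bracketM M' (S.b σ) - bracketM M (S.b σ)) := by
  obtain ⟨A, hg, hP⟩ := M.exists_bound
  have hA := hg.nonneg
  set I := S.indexLt (S.deg σ + 1)
  have hI : S.IsLower I := S.isLower_indexLt _
  have hσ : σ ∈ I := S.mem_indexLt.2 (lt_add_one _)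
  have hA1 : 0 ≤ A + 1 := by linarith
  obtain ⟨C₁, hC₁, h₁⟩ := exists_block_recenter_sub_le S LP r hI hA1 hA
  obtain ⟨B, hB, hBb⟩ := exists_uniform_const I
    (p := fun σ B => BlockBd LP (S.deg σ) B (bracketM M (S.b σ)))
    (fun σ _ C C' hCC h => h.mono hCC) (fun σ _ => exists_blockBd_bracketM_basis M σ)
  obtain ⟨C, hC, h⟩ := exists_blockBd_bracket_sub S LP hI S.β₀ hA1 hB hσ
  refine ⟨C * (1 + C₁), by positivity, fun M' δ hδ hδ1 hdist => ?_⟩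
  obtain ⟨hd, hPP⟩ := RSModel.dist_le hδ hdist
  have hg' : CharBound S M'.g (A + 1) := (hd.charBound hg).mono (by linarith)
  have hle : δ ≤ (1 + C₁) * δ := by nlinarith
  rw [mul_assoc]
  refine h M'.g M.g (fun σ => M'.Pi (S.b σ)) (fun σ => M.Pi (S.b σ))
    (fun σ => bracketM M' (S.b σ)) (fun σ => bracketM M (S.b σ)) ((1 + C₁) * δ) hg' hg.bddCont
    (hd.mono hle) (isBesov_bracketM_basis M') (isBesov_bracketM_basis M) (bracketM_relation M')
    (bracketM_relation M) hBb (fun τ _ => (hPP.blockBd τ).mono hle) (fun τ hτ k x => ?_)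
  rw [recenterSum, recenterSum, ← hI.recenter_basis hτ, ← hI.recenter_basis hτ]
  refine ((h₁ M'.g M.g M'.Pi M.Pi δ hg' hd hP.blockBd hPP τ hτ x).1 k).trans ?_
  have := (sc_rpow_pos k (S.deg τ)).le
  gcongr
  linarith

theorem memHolder_bracketM {α : ℝ} {t : T} (ht : t ∈ S.Thom α) :
    MemHolder LP α (bracketM M t) := by
  refine memHolder_linearMap S.b fun i hi => ?_
  have : S.deg i = α := by
    by_contra hne
    exact hi (coord_eq_zero_of_mem_homogeneous ht hne)
  rw [← this]
  exact exists_blockBd_bracketM_basis M i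

theorem memHolder_β₀_bracketM (t : T) : MemHolder LP S.β₀ (bracketM M t) := by
  refine memHolder_linearMap S.b fun i _ => ?_
  obtain ⟨B, hB, h⟩ := exists_blockBd_bracketM_basis M i
  exact ⟨_, by positivity, h.of_le hB (S.β₀_le i)⟩

theorem exists_blockBd_bracketM_sub_of_mem {α : ℝ} {t : T} (ht : t ∈ S.Thom α) :
    ∃ C, 0 ≤ C ∧ ∀ (M' : RSModel S LP r) (δ : ℝ), 0 ≤ δ → δ ≤ 1 →
      M'.dist M ≤ ENNReal.ofReal δ →
      BlockBd LP α (C * δ) (bracketM M' t - bracketM M t) := by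
  obtain ⟨C, hC, h⟩ := exists_uniform_const (S.b.repr t).support
    (p := fun i C => ∀ (M' : RSModel S LP r) (δ : ℝ), 0 ≤ δ → δ ≤ 1 →
      M'.dist M ≤ ENNReal.ofReal δ →
      BlockBd LP (S.deg i) (C * δ) (bracketM M' (S.b i) - bracketM M (S.b i)))
    (fun i _ C C' hCC h M' δ h0 h1 h2 => (h M' δ h0 h1 h2).mono
      (mul_le_mul_of_nonneg_right hCC h0))
    (fun i _ => exists_blockBd_bracketM_sub M i)
  refine ⟨coordSum S.b t * C, mul_nonneg (coordSum_nonneg _ _) hC, fun M' δ h0 h1 h2 => ?_⟩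
  rw [← LinearMap.sub_apply, mul_assoc]
  refine blockBd_linearMap S.b fun i hi => ?_
  have : S.deg i = α := by
    by_contra hne
    exact hi (coord_eq_zero_of_mem_homogeneous ht hne)
  rw [← this]
  exact h i (Finsupp.mem_support_iff.2 hi) M' δ h0 h1 h2

theorem exists_forall_dist_lt_bracketM {α : ℝ} {t : T} (ht : t ∈ S.Thom α) {ε : ℝ≥0∞}
    (hε : 0 < ε) : ∃ δ : ℝ≥0∞, 0 < δ ∧ ∀ M' : RSModel S LP r, M'.dist M < δ →
      holderNorm LP α (bracketM M' t - bracketM M t) < ε := by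
  obtain ⟨C, hC, h⟩ := exists_blockBd_bracketM_sub_of_mem M ht
  exact exists_pos_of_forall_le_mul hC (fun M' δ h0 h1 h2 =>
    (holderNorm_le_iff LP α (by positivity) _).2 (h M' δ h0 h1 h2)) hε

theorem exists_forall_dist_lt_bracketG {α : ℝ} {t : Tp} (ht : t ∈ S.Tphom α) {ε : ℝ≥0∞}
    (hε : 0 < ε) : ∃ δ : ℝ≥0∞, 0 < δ ∧ ∀ M' : RSModel S LP r, M'.dist M < δ →
      holderNorm LP α (bracketG S LP M'.g t - bracketG S LP M.g t) < ε := by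
  obtain ⟨A, hg⟩ := M.exists_charBound
  obtain ⟨C, hC, h⟩ := exists_blockBd_bracketG_sub_of_mem LP hg ht
  exact exists_pos_of_forall_le_mul hC (fun M' δ h0 h1 h2 =>
    (holderNorm_le_iff LP α (by positivity) _).2
      (h M'.g δ h1 (RSModel.dist_le h0 h2).1)) hε

end

end

/-! ### Coefficients of a modelled distribution and their remainders -/

section

variable {d : ℕ}

variable {Tp T ιp ι : Type*} [Ring Tp] [HopfAlgebra ℝ Tp] [AddCommGroup T] [Module ℝ T]
  {S : ConcreteRegularityStructure Tp T ιp ι}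

/-! ## Modelled distributions -/

/-- The coefficients of `(Id ⊗ g_x⁻¹) Δ f(x)`. -/
def transCoeff (S : ConcreteRegularityStructure Tp T ιp ι) (g : E d → (Tp →ₐ[ℝ] ℝ)) (γ : ℝ)
    (f : E d → T) (x : E d) (μ : ι) : ℝ :=
  ∑ σ ∈ S.indexLt γ, S.b.coord σ (f x) * charInv (g x) (S.quot σ μ)

/-- The coefficients of `f(y) - ĝ_{yx} f(x)`. -/
def modIncr (S : ConcreteRegularityStructure Tp T ιp ι) (g : E d → (Tp →ₐ[ℝ] ℝ)) (γ : ℝ)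
    (f : E d → T) (x : E d) (ν : ι) (y : E d) : ℝ :=
  S.b.coord ν (f y) - ∑ μ ∈ S.indexLt γ, transCoeff S g γ f x μ * g y (S.quot μ ν)

/-- Real bounds for a modelled distribution. -/
structure ModBound (S : ConcreteRegularityStructure Tp T ιp ι) (g : E d → (Tp →ₐ[ℝ] ℝ)) (γ : ℝ)
    (f : E d → T) (A D : ℝ) : Prop where
  sup_nonneg : 0 ≤ A
  incr_nonneg : 0 ≤ D
  coord_eq_zero : ∀ σ, γ ≤ S.deg σ → ∀ x, S.b.coord σ (f x) = 0
  sup_le : ∀ σ x, |S.b.coord σ (f x)| ≤ A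
  incr_le : ∀ σ, S.deg σ < γ → ∀ x y, |modIncr S g γ f x σ y| ≤ D * ‖y - x‖ ^ (γ - S.deg σ)

/-- The factorization of `g_{yx}` separates constants attached to the base point `x` from functions
of `y`, the form in which `IsSystem.sum_smul` applies. -/
theorem coord_hat_convDiv {γ : ℝ} {t : T} (ht : ∀ σ, γ ≤ S.deg σ → S.b.coord σ t = 0)
    (g₁ g₂ : Tp →ₐ[ℝ] ℝ) {ν : ι} (hν : S.deg ν < γ) :
    S.b.coord ν (S.hat (convDiv g₁ g₂) t) = ∑ μ ∈ S.indexLt γ,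
      (∑ σ ∈ S.indexLt γ, S.b.coord σ t * charInv g₂ (S.quot σ μ)) * g₁ (S.quot μ ν) := by
  have hI := S.isLower_indexLt γ
  rw [hI.coord_hat (fun i hi => ht i (not_lt.1 fun h => hi (S.mem_indexLt.2 h))) _
    (S.mem_indexLt.2 hν)]
  simp only [Finset.sum_mul]
  rw [Finset.sum_comm]
  refine Finset.sum_congr rfl fun τ hτ => ?_
  rw [hI.convDiv_quot hτ (S.mem_indexLt.2 hν), Finset.mul_sum]
  exact Finset.sum_congr rfl fun μ _ => by ring

theorem coord_eq_zero_of_mem_Tlt {γ : ℝ} {t : T} (ht : t ∈ S.Tlt γ) {σ : ι} (hσ : γ ≤ S.deg σ) :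
    S.b.coord σ t = 0 := by
  have : S.Tlt γ ≤ LinearMap.ker (S.b.coord σ) := by
    refine iSup₂_le fun β hβ v hv => ?_
    exact LinearMap.mem_ker.2 (coord_eq_zero_of_mem_homogeneous hv
      (((Set.mem_Iio.1 hβ).trans_le hσ).ne'))
  exact LinearMap.mem_ker.1 (this ht)

theorem coord_sub_hat {g : E d → (Tp →ₐ[ℝ] ℝ)} {γ : ℝ} {f : E d → T} (hf : ∀ x, f x ∈ S.Tlt γ)
    {σ : ι} (hσ : S.deg σ < γ) (x y : E d) :
    S.b.coord σ (f y - S.hat (convDiv (g y) (g x)) (f x)) = modIncr S g γ f x σ y := by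
  rw [map_sub, coord_hat_convDiv (fun σ hσ => coord_eq_zero_of_mem_Tlt (hf x) hσ) _ _ hσ]
  rfl

theorem modBound_of_le {g : E d → (Tp →ₐ[ℝ] ℝ)} {γ : ℝ} {f : E d → T} (hf : ∀ x, f x ∈ S.Tlt γ)
    {A D : ℝ} (hA : 0 ≤ A) (hD : 0 ≤ D) (h1 : dSup S γ f ≤ ENNReal.ofReal A)
    (h2 : dIncr S g γ f ≤ ENNReal.ofReal D) : ModBound S g γ f A D := by
  simp only [dSup, iSup_le_iff, enorm_le_ofReal_iff hA] at h1
  simp only [dIncr, iSup_le_iff] at h2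
  refine ⟨hA, hD, fun σ hσ x => coord_eq_zero_of_mem_Tlt (hf x) hσ, fun σ x => ?_,
    fun σ hσ x y => ?_⟩
  · rcases lt_or_ge (S.deg σ) γ with hσ | hσ
    · exact h1 σ hσ x
    · rw [coord_eq_zero_of_mem_Tlt (hf x) hσ, abs_zero]
      exact hA
  · rw [← coord_sub_hat hf hσ]
    exact abs_le_of_enorm_div_le hD (sub_pos.2 hσ).le (h2 σ hσ x y)

theorem ModelledDist.exists_modBound {g : E d → (Tp →ₐ[ℝ] ℝ)} {γ : ℝ} (f : ModelledDist S g γ) :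
    ∃ A, ModBound S g γ f.1 A (dIncr S g γ f.1).toReal := by
  have h1 : dSup S γ f.1 ≠ ⊤ := ((le_self_add).trans_lt f.2.2).ne
  have h2 : dIncr S g γ f.1 ≠ ⊤ := ((le_add_self).trans_lt f.2.2).ne
  exact ⟨(dSup S γ f.1).toReal, modBound_of_le f.2.1 ENNReal.toReal_nonneg ENNReal.toReal_nonneg
    (ENNReal.ofReal_toReal h1).ge (ENNReal.ofReal_toReal h2).ge⟩

section

variable {g : E d → (Tp →ₐ[ℝ] ℝ)} {γ A D : ℝ} {f : E d → T}

/-- Around a point `x` the coefficient is its increment, which tends to zero because `γ - |σ| > 0`,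
plus a finite combination of the continuous functions `y ↦ g_y(μ / σ)`. -/
theorem ModBound.bddCont_coord (hf : ModBound S g γ f A D) (hg : ∀ t, BddCont fun x => g x t)
    (σ : ι) : BddCont fun x => S.b.coord σ (f x) := by
  refine ⟨?_, A, fun x => hf.sup_le σ x⟩
  rcases le_or_gt γ (S.deg σ) with hσ | hσ
  · simp only [hf.coord_eq_zero σ hσ]
    exact continuous_const
  rw [continuous_iff_continuousAt]
  intro x
  set F : E d → ℝ := fun y => ∑ μ ∈ S.indexLt γ, transCoeff S g γ f x μ * g y (S.quot μ σ) with hF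
  have hFc : Continuous F := continuous_finsetSum _ fun μ _ => continuous_const.mul (hg _).cont
  have hs : 0 < γ - S.deg σ := sub_pos.2 hσ
  have h0 : Tendsto (fun y => modIncr S g γ f x σ y) (𝓝 x) (𝓝 0) := by
    refine squeeze_zero_norm (fun y => hf.incr_le σ hσ x y) ?_
    have hc : Continuous fun y : E d => D * ‖y - x‖ ^ (γ - S.deg σ) :=
      continuous_const.mul ((continuous_id.sub continuous_const).norm.rpow_const
        fun _ => Or.inr hs.le)
    simpa [Real.zero_rpow hs.ne'] using hc.tendsto x
  have hx : modIncr S g γ f x σ x = 0 := by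
    have := hf.incr_le σ hσ x x
    rw [sub_self, norm_zero, Real.zero_rpow hs.ne', mul_zero] at this
    exact abs_nonpos_iff.1 this
  have e : ∀ y, S.b.coord σ (f y) = modIncr S g γ f x σ y + F y := fun y => by
    rw [modIncr]; ring
  rw [ContinuousAt, e x, hx]
  simp only [e]
  exact h0.add (hFc.tendsto x)

theorem bddCont_modIncr {ν : ι} (hf : BddCont fun x => S.b.coord ν (f x))
    (hg : ∀ t, BddCont fun x => g x t) (x : E d) : BddCont (modIncr S g γ f x ν) :=
  hf.sub (BddCont.sum _ fun _ _ => (hg _).const_mul _)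

theorem ModBound.bddCont_modIncr (hf : ModBound S g γ f A D) (hg : ∀ t, BddCont fun x => g x t)
    (x : E d) (ν : ι) : BddCont (modIncr S g γ f x ν) :=
  PCRS.bddCont_modIncr (hf.bddCont_coord hg ν) hg x

/-- The paraproducts of the increments of a modelled distribution. -/
theorem ModBound.sum_paraprod {LP : DyadicPartition d} {u b : ι → TDist d}
    (hf : ModBound S g γ f A D) (hg : ∀ t, BddCont fun x => g x t)
    (h : IsSystem LP (S.indexLt γ) (fun σ μ y => g y (S.quot σ μ)) u b) (x : E d) :
    ∑ ν ∈ S.indexLt γ, paraprod LP (modIncr S g γ f x ν) (b ν) =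
      ∑ ν ∈ S.indexLt γ, paraprod LP (fun y => S.b.coord ν (f y)) (b ν) -
        ∑ μ ∈ S.indexLt γ, transCoeff S g γ f x μ • u μ +
          ∑ μ ∈ S.indexLt γ, transCoeff S g γ f x μ • lowPart LP (b μ) := by
  rw [h.sum_smul (transCoeff S g γ f x), sub_add, add_sub_cancel_right, ← Finset.sum_sub_distrib]
  refine Finset.sum_congr rfl fun ν hν => ?_
  exact paraprod_sub_left (h.isBesov ν hν) (hf.bddCont_coord hg ν)
    (bddCont_sum_mul h.bddCont _ hν)

theorem exists_block_paraprod_modIncr_le {LP : DyadicPartition d}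
    (S : ConcreteRegularityStructure Tp T ιp ι) (γ : ℝ) {b : ι → TDist d} {α : ι → ℝ}
    (hb : ∀ ν ∈ S.indexLt γ, ∃ B, 0 ≤ B ∧ BlockBd LP (α ν) B (b ν)) :
    ∃ C, 0 ≤ C ∧ ∀ ν ∈ S.indexLt γ, ∀ (g : E d → (Tp →ₐ[ℝ] ℝ)) (f : E d → T) (A D : ℝ),
      (∀ t, BddCont fun x => g x t) → ModBound S g γ f A D → ∀ x j y,
        |block LP j (paraprod LP (modIncr S g γ f x ν) (b ν)) y| ≤
          C * D * sc j ^ α ν * (sc j + ‖y - x‖) ^ (γ - S.deg ν) := by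
  refine exists_uniform_const _ (fun ν hν C C' hCC h g f A D hg hf x j y => ?_) fun ν hν => ?_
  · refine (h g f A D hg hf x j y).trans ?_
    have := hf.incr_nonneg
    have := (sc_rpow_pos j (α ν)).le
    have := (sc_pos j).le
    gcongr
  · obtain ⟨B, hB, hBb⟩ := hb ν hν
    have hs := (sub_pos.2 (S.mem_indexLt.1 hν)).le
    obtain ⟨C, hC, h⟩ := exists_block_paraprod_le LP (α ν) hs
    refine ⟨C * B, by positivity, fun g f A D hg hf x j y => ?_⟩
    refine (h D B (b ν) _ x hBb (hf.bddCont_modIncr hg x ν) hf.incr_nonneg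
      (hf.incr_le ν (S.mem_indexLt.1 hν) x) j y).trans_eq ?_
    ring

theorem exists_block_paraprod_coord_le {LP : DyadicPartition d}
    (S : ConcreteRegularityStructure Tp T ιp ι) (γ : ℝ) {b : ι → TDist d} {α : ι → ℝ}
    (hb : ∀ ν ∈ S.indexLt γ, ∃ B, 0 ≤ B ∧ BlockBd LP (α ν) B (b ν)) :
    ∃ C, 0 ≤ C ∧ ∀ ν ∈ S.indexLt γ, ∀ (g : E d → (Tp →ₐ[ℝ] ℝ)) (f : E d → T) (A D : ℝ),
      (∀ t, BddCont fun x => g x t) → ModBound S g γ f A D →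
        BlockBd LP (α ν) (C * A) (paraprod LP (fun y => S.b.coord ν (f y)) (b ν)) := by
  refine exists_uniform_const _ (fun ν hν C C' hCC h g f A D hg hf => ?_) fun ν hν => ?_
  · exact (h g f A D hg hf).mono (mul_le_mul_of_nonneg_right hCC hf.sup_nonneg)
  · obtain ⟨B, hB, hBb⟩ := hb ν hν
    obtain ⟨C, hC, h⟩ := exists_block_paraprod_le LP (α ν) (le_refl (0 : ℝ))
    refine ⟨C * B, by positivity, fun g f A D hg hf j y => ?_⟩
    have := h A B (b ν) _ 0 hBb (hf.bddCont_coord hg ν) hf.sup_nonneg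
      (by simpa using hf.sup_le ν) j y
    rw [Real.rpow_zero, mul_one] at this
    refine this.trans_eq ?_
    ring

end

/-! ## The remainders of the coefficients -/

theorem lowPart_eq {LP : DyadicPartition d} {u : TDist d} (hu : IsBesov LP u) :
    lowPart LP u = u - paraprod LP (fun _ => 1) u := by
  rw [paraprod_one hu]
  abel

/-- `(a, c) ↦ P_{g(c)} ⟦a⟧^g`. -/
def paraprodTensor (S : ConcreteRegularityStructure Tp T ιp ι) (LP : DyadicPartition d)
    {g : E d → (Tp →ₐ[ℝ] ℝ)} (hg : ∀ t, BddCont fun x => g x t) :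
    Tp ⊗[ℝ] Tp →ₗ[ℝ] TDist d :=
  TensorProduct.lift (LinearMap.mk₂ ℝ
    (fun a c => paraprod LP (fun x => g x c) (bracketG S LP g a))
    (fun a a' c => by
      rw [map_add, paraprod_add_right (isBesov_bracketG hg a) (isBesov_bracketG hg a') (hg c)])
    (fun r a c => by
      rw [map_smul, paraprod_smul_right (isBesov_bracketG hg a) (hg c)])
    (fun a c c' => by
      simp only [map_add]
      exact paraprod_add_left (isBesov_bracketG hg a) (hg c) (hg c'))
    (fun r a c => by
      simp only [map_smul, smul_eq_mul]
      exact paraprod_const_mul_left (isBesov_bracketG hg a) (hg c) r))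

theorem paraprodTensor_tmul (LP : DyadicPartition d) {g : E d → (Tp →ₐ[ℝ] ℝ)}
    (hg : ∀ t, BddCont fun x => g x t) (a c : Tp) :
    paraprodTensor S LP hg (a ⊗ₜ c) = paraprod LP (fun x => g x c) (bracketG S LP g a) := by
  simp [paraprodTensor]

/-- With the diagonal term inside the sum, and the low part written as `u - P_1 u`, the bracket
relation becomes linear in `t`. It therefore extends from basis elements to all of `T⁺`, in
particular to the quotients `μ / τ`. -/
theorem distOf_char_eq (LP : DyadicPartition d) {g : E d → (Tp →ₐ[ℝ] ℝ)}
    (hg : ∀ t, BddCont fun x => g x t) (t : Tp) :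
    distOf (fun x => g x t) = paraprodTensor S LP hg (Coalgebra.comul t) +
      lowPart LP (bracketG S LP g t) := by
  have hb : ∀ i, distOf (fun x => g x (S.bp i)) =
      paraprodTensor S LP hg (Coalgebra.comul (S.bp i)) +
        lowPart LP (bracketG S LP g (S.bp i)) := by
    intro i
    set I := S.selfStructure.indexLt (S.degp i + 1)
    have hI : S.selfStructure.IsLower I := S.selfStructure.isLower_indexLt _
    have hi : i ∈ I := S.selfStructure.mem_indexLt.2 (lt_add_one _)
    have h := (triangularSystem hI hg (fun σ => isBesov_bracketG (S := S) (LP := LP) hg (S.bp σ))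
      (bracketG_relation LP g)).isSystem.rel i hi
    have e := hI.Δ_eq_sum hi
    change Coalgebra.comul (S.bp i) = ∑ σ ∈ I, S.bp σ ⊗ₜ[ℝ] S.quotp i σ at e
    rw [e, map_sum]
    simp only [paraprodTensor_tmul]
    exact h
  have hmem : t ∈ Submodule.span ℝ (Set.range S.bp) := by rw [S.bp.span_eq]; trivial
  have hB := fun t => isBesov_bracketG (S := S) (LP := LP) hg t
  have h1 := BddCont.const (d := d) 1
  refine Submodule.span_induction ?_ ?_ ?_ ?_ hmem
  · rintro _ ⟨i, rfl⟩
    exact hb i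
  · simp only [map_zero, lowPart_zero, add_zero]
    simpa using distOf_const_mul (BddCont.const (d := d) 0) 0
  · intro s t _ _ hs ht
    simp only [map_add]
    rw [distOf_add (hg s) (hg t), hs, ht, lowPart_eq (hB s), lowPart_eq (hB t),
      lowPart_eq ((hB s).add (hB t)), paraprod_add_right (hB s) (hB t) h1]
    abel
  · intro c t _ ht
    simp only [map_smul, smul_eq_mul]
    rw [distOf_const_mul (hg t), ht, lowPart_eq (hB t), lowPart_eq ((hB t).smul c),
      paraprod_smul_right (hB t) h1, smul_add, smul_sub]

/-- By `comul_quot`, for fixed `τ` the brackets `⟦μ / τ⟧^g` paracontrol the functions `g(μ / τ)`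
with the same coefficients `g(σ / μ)` as the brackets of the model. Both kinds of remainder can then
be treated through `ModBound.sum_paraprod`. -/
theorem isSystem_bracketG (LP : DyadicPartition d) {g : E d → (Tp →ₐ[ℝ] ℝ)}
    (hg : ∀ t, BddCont fun x => g x t) {γ : ℝ} {τ : ι} (hτ : S.deg τ < γ) :
    IsSystem LP (S.indexLt γ) (fun σ μ y => g y (S.quot σ μ))
      (fun μ => distOf fun x => g x (S.quot μ τ)) (fun μ => bracketG S LP g (S.quot μ τ)) := by
  refine ⟨fun _ _ _ _ => hg _, fun _ _ => isBesov_bracketG hg _, fun μ hμ => ?_⟩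
  rw [distOf_char_eq (S := S) LP hg,
    (S.isLower_indexLt γ).comul_quot hμ (S.mem_indexLt.2 hτ), map_sum]
  simp only [paraprodTensor_tmul]

/-- The remainder `⟦f^τ⟧^g`. -/
def remG (S : ConcreteRegularityStructure Tp T ιp ι) (LP : DyadicPartition d)
    (g : E d → (Tp →ₐ[ℝ] ℝ)) (γ : ℝ) (f : E d → T) (τ : ι) : TDist d :=
  distOf (fun x => S.b.coord τ (f x)) - ∑ μ ∈ S.aboveLt γ τ,
    paraprod LP (fun x => S.b.coord μ (f x)) (bracketG S LP g (S.quot μ τ))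

section

variable {LP : DyadicPartition d} {g : E d → (Tp →ₐ[ℝ] ℝ)} {γ A D A' D' : ℝ} {f f' : E d → T}

/-- The index `μ = τ` contributes a paraproduct with `⟦1⟧`, hence nothing, and an index with `μ / τ
= 0` contributes zero as well; so the sum may run over the lower set `indexLt`. -/
theorem ModBound.sum_aboveLt (hf : ModBound S g γ f A D) (hg : ∀ t, BddCont fun x => g x t)
    (τ : ι) :
    ∑ μ ∈ S.aboveLt γ τ, paraprod LP (fun x => S.b.coord μ (f x)) (bracketG S LP g (S.quot μ τ)) =
      ∑ μ ∈ S.indexLt γ,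
        paraprod LP (fun x => S.b.coord μ (f x)) (bracketG S LP g (S.quot μ τ)) := by
  refine Finset.sum_subset (fun μ hμ => S.mem_indexLt.2 (S.mem_aboveLt.1 hμ).2)
    fun μ hμ hμ' => ?_
  by_cases hτ : τ = μ
  · rw [hτ, S.quot_self, bracketG_one]
    exact paraprod_distOf_const 1 _
  · have hq : S.quot μ τ = 0 := by
      by_contra hq
      exact hμ' (S.mem_aboveLt.2 ⟨⟨hq, hτ⟩, S.mem_indexLt.1 hμ⟩)
    rw [hq, map_zero]
    exact paraprod_zero_right (hf.bddCont_coord hg μ)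

theorem ModBound.remG_eq_zero (hf : ModBound S g γ f A D) {τ : ι} (hτ : γ ≤ S.deg τ) :
    remG S LP g γ f τ = 0 := by
  have h : S.aboveLt γ τ = ∅ := by
    rw [Finset.eq_empty_iff_forall_notMem]
    intro μ hμ
    have h1 := S.mem_aboveLt.1 hμ
    exact absurd ((S.deg_lt_of_quot_ne h1.1.2 h1.1.1).trans h1.2) (not_lt.2 hτ)
  have h0 : distOf (fun _ : E d => (0 : ℝ)) = 0 := by
    simpa using distOf_const_mul (BddCont.const (d := d) 0) 0
  rw [remG, h, Finset.sum_empty]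
  simp only [hf.coord_eq_zero τ hτ, h0, sub_zero]

theorem ModBound.remG_sub (hf : ModBound S g γ f A D) (hf' : ModBound S g γ f' A' D')
    (hg : ∀ t, BddCont fun x => g x t) (τ : ι) :
    remG S LP g γ (f' - f) τ = remG S LP g γ f' τ - remG S LP g γ f τ := by
  have h := fun σ => hf.bddCont_coord hg σ
  have h' := fun σ => hf'.bddCont_coord hg σ
  simp only [remG, Pi.sub_apply, map_sub]
  rw [distOf_sub (h' τ) (h τ), Finset.sum_congr rfl fun μ _ =>
    paraprod_sub_left (isBesov_bracketG hg (S.quot μ τ)) (h' μ) (h μ), Finset.sum_sub_distrib]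
  abel

/-- Subtracting the expansion of `ĝ_{yx} f(x)`, whose own remainder is of low frequency, replaces
every coefficient by an increment based at the point of evaluation. -/
theorem ModBound.block_remG (hf : ModBound S g γ f A D) (hg : ∀ t, BddCont fun x => g x t)
    {τ : ι} (hτ : S.deg τ < γ) {k : ℕ} (hk : 3 ≤ k) (x : E d) :
    block LP k (remG S LP g γ f τ) x = block LP k (distOf (modIncr S g γ f x τ)) x -
      ∑ ν ∈ S.indexLt γ, block LP k
        (paraprod LP (modIncr S g γ f x ν) (bracketG S LP g (S.quot ν τ))) x := by
  have h := hf.sum_paraprod hg (isSystem_bracketG LP hg hτ) x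
  have e1 : distOf (modIncr S g γ f x τ) = distOf (fun y => S.b.coord τ (f y)) -
      ∑ μ ∈ S.indexLt γ, transCoeff S g γ f x μ • distOf fun y => g y (S.quot μ τ) := by
    have hs : ∀ μ ∈ S.indexLt γ, BddCont fun y => transCoeff S g γ f x μ * g y (S.quot μ τ) :=
      fun μ _ => (hg _).const_mul _
    have := distOf_sub (hf.bddCont_coord hg τ) (BddCont.sum _ hs)
    rw [distOf_sum _ hs] at this
    rw [Finset.sum_congr rfl fun μ _ => (distOf_const_mul (hg (S.quot μ τ))
      (transCoeff S g γ f x μ)).symm]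
    exact this
  have e2 : block LP k (∑ μ ∈ S.indexLt γ,
      transCoeff S g γ f x μ • lowPart LP (bracketG S LP g (S.quot μ τ))) x = 0 := by
    rw [block_sum]
    refine Finset.sum_eq_zero fun μ _ => ?_
    rw [block_smul, block_lowPart_eq_zero (isBesov_bracketG hg _) hk, mul_zero]
  rw [← block_sum, h, e1, remG, hf.sum_aboveLt hg, block_sub, block_sub, block_add, block_sub, e2]
  ring

/-- In the high blocks the regularity `|ν| - |τ|` of `⟦ν / τ⟧` and the vanishing order `γ - |ν|` of
the increment add up to `γ - |τ|` for every `ν`. The low blocks use only the supremum of `f`, which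
is why the bound involves `A + D`. -/
theorem exists_blockBd_remG (S : ConcreteRegularityStructure Tp T ιp ι) (LP : DyadicPartition d)
    {g : E d → (Tp →ₐ[ℝ] ℝ)} {G : ℝ} (hg : CharBound S g G) (γ : ℝ) :
    ∃ C, 0 ≤ C ∧ ∀ (f : E d → T) (A D : ℝ), ModBound S g γ f A D → ∀ τ,
      BlockBd LP (γ - S.deg τ) (C * (A + D)) (remG S LP g γ f τ) := by
  suffices h : ∃ C, 0 ≤ C ∧ ∀ τ ∈ S.indexLt γ, ∀ (f : E d → T) (A D : ℝ), ModBound S g γ f A D →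
      BlockBd LP (γ - S.deg τ) (C * (A + D)) (remG S LP g γ f τ) by
    obtain ⟨C, hC, h⟩ := h
    refine ⟨C, hC, fun f A D hf τ => ?_⟩
    rcases lt_or_ge (S.deg τ) γ with hτ | hτ
    · exact h τ (S.mem_indexLt.2 hτ) f A D hf
    · rw [hf.remG_eq_zero hτ]
      exact (BlockBd.zero LP _).mono
        (mul_nonneg hC (add_nonneg hf.sup_nonneg hf.incr_nonneg))
  refine exists_uniform_const _ (fun τ _ C C' hCC h f A D hf => (h f A D hf).mono
    (mul_le_mul_of_nonneg_right hCC (add_nonneg hf.sup_nonneg hf.incr_nonneg))) fun τ hτI => ?_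
  have hτ := S.mem_indexLt.1 hτI
  have hb : ∀ ν ∈ S.indexLt γ, ∃ B, 0 ≤ B ∧
      BlockBd LP (S.deg ν - S.deg τ) B (bracketG S LP g (S.quot ν τ)) := fun ν _ =>
    (memHolder_iff LP _ _).1 (memHolder_bracketG LP hg (S.quot_mem ν τ))
  obtain ⟨C₁, hC₁, h₁⟩ := exists_block_paraprod_modIncr_le S γ hb
  obtain ⟨C₂, hC₂, h₂⟩ := exists_block_paraprod_coord_le S γ hb
  obtain ⟨C₃, hC₃, h₃⟩ := exists_block_distOf_le LP (sub_pos.2 hτ).le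
  obtain ⟨C₄, hC₄, h₄⟩ := exists_block_distOf_le LP (le_refl (0 : ℝ))
  set X : ℝ := C₃ + ∑ _ν ∈ S.indexLt γ, C₁ with hX
  set Y : ℝ := C₄ * 2 ^ |0 - (γ - S.deg τ)| +
    ∑ ν ∈ S.indexLt γ, C₂ * 2 ^ |S.deg ν - S.deg τ - (γ - S.deg τ)| with hY
  have hX0 : 0 ≤ X := add_nonneg hC₃ (Finset.sum_nonneg fun _ _ => hC₁)
  have hY0 : 0 ≤ Y := add_nonneg (by positivity) (Finset.sum_nonneg fun _ _ => by positivity)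
  refine ⟨X + Y, by positivity, fun f A D hf k x => ?_⟩
  have hA := hf.sup_nonneg
  have hD := hf.incr_nonneg
  have hsc := (sc_rpow_pos k (γ - S.deg τ)).le
  rcases le_or_gt 3 k with hk | hk
  · rw [hf.block_remG hg.bddCont hτ hk]
    have e1 := h₃ _ (hf.bddCont_modIncr hg.bddCont x τ) D x hD (hf.incr_le τ hτ x) k
    have e2 : ∀ ν ∈ S.indexLt γ, |block LP k
        (paraprod LP (modIncr S g γ f x ν) (bracketG S LP g (S.quot ν τ))) x| ≤
        C₁ * (D * sc k ^ (γ - S.deg τ)) := by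
      intro ν hν
      refine (h₁ ν hν g f A D hg.bddCont hf x k x).trans_eq ?_
      rw [sub_self, norm_zero, add_zero, mul_assoc, ← Real.rpow_add (sc_pos k), mul_assoc]
      congr 3
      ring
    calc _ ≤ C₃ * D * sc k ^ (γ - S.deg τ) +
          ∑ ν ∈ S.indexLt γ, C₁ * (D * sc k ^ (γ - S.deg τ)) :=
          (abs_sub _ _).trans (add_le_add e1 ((Finset.abs_sum_le_sum_abs _ _).trans
            (Finset.sum_le_sum e2)))
      _ = X * D * sc k ^ (γ - S.deg τ) := by rw [← Finset.sum_mul, hX]; ring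
      _ ≤ _ := by
        gcongr
        · linarith
        · linarith
  · rw [remG, hf.sum_aboveLt hg.bddCont, block_sub, block_sum]
    have e1 := h₄ _ (hf.bddCont_coord hg.bddCont τ) A x hA (by simpa using hf.sup_le τ) k
    have e1' := sc_rpow_le_of_lt_three hk 0 (γ - S.deg τ)
    have e2 : ∀ ν ∈ S.indexLt γ, |block LP k
        (paraprod LP (fun y => S.b.coord ν (f y)) (bracketG S LP g (S.quot ν τ))) x| ≤
        C₂ * 2 ^ |S.deg ν - S.deg τ - (γ - S.deg τ)| * (A * sc k ^ (γ - S.deg τ)) := by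
      intro ν hν
      refine (h₂ ν hν g f A D hg.bddCont hf k x).trans ?_
      have := sc_rpow_le_of_lt_three hk (S.deg ν - S.deg τ) (γ - S.deg τ)
      calc _ ≤ C₂ * A * (2 ^ |S.deg ν - S.deg τ - (γ - S.deg τ)| * sc k ^ (γ - S.deg τ)) := by
            gcongr
        _ = _ := by ring
    calc _ ≤ C₄ * A * (2 ^ |0 - (γ - S.deg τ)| * sc k ^ (γ - S.deg τ)) + ∑ ν ∈ S.indexLt γ,
          C₂ * 2 ^ |S.deg ν - S.deg τ - (γ - S.deg τ)| * (A * sc k ^ (γ - S.deg τ)) :=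
          (abs_sub _ _).trans (add_le_add (e1.trans (by gcongr))
            ((Finset.abs_sum_le_sum_abs _ _).trans (Finset.sum_le_sum e2)))
      _ = Y * A * sc k ^ (γ - S.deg τ) := by rw [← Finset.sum_mul, hY]; ring
      _ ≤ _ := by
        gcongr
        · linarith
        · linarith

end

end

/-! ### Reconstruction: the remainder function and its key estimate -/

section

variable {d : ℕ}

variable {Tp T ιp ι : Type*} [Ring Tp] [HopfAlgebra ℝ Tp] [AddCommGroup T] [Module ℝ T]
  {S : ConcreteRegularityStructure Tp T ιp ι}

/-! ## Reconstruction -/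

/-- Trades regularity for vanishing order, using `q ≤ q + z`: all terms of degree `|ν|` are brought
under the single weight with exponent `β₀`. -/
theorem rpow_mul_add_rpow_le {q z β α γ : ℝ} (hq : 0 < q) (hz : 0 ≤ z) (h1 : β ≤ α) :
    q ^ α * (q + z) ^ (γ - α) ≤ q ^ β * (q + z) ^ (γ - β) := by
  have e1 : q ^ α = q ^ β * q ^ (α - β) := by rw [← Real.rpow_add hq, add_sub_cancel]
  have e2 : (q + z) ^ (γ - β) = (q + z) ^ (α - β) * (q + z) ^ (γ - α) := by
    rw [← Real.rpow_add (by positivity)]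
    congr 1
    ring
  rw [e1, e2, mul_assoc]
  have : q ^ (α - β) ≤ (q + z) ^ (α - β) :=
    Real.rpow_le_rpow hq.le (by linarith) (sub_nonneg.2 h1)
  gcongr

theorem rpow_le_weight {q z β γ : ℝ} (hq : 0 < q) (hz : 0 ≤ z) (h1 : β ≤ γ) :
    q ^ γ ≤ q ^ β * (q + z) ^ (γ - β) := by
  have := rpow_mul_add_rpow_le (γ := γ) hq hz h1
  simpa using this

section

variable {g : E d → (Tp →ₐ[ℝ] ℝ)} {γ A D : ℝ} {f f' : E d → T}

theorem transCoeff_sub (x : E d) (μ : ι) : transCoeff S g γ (f' - f) x μ =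
    transCoeff S g γ f' x μ - transCoeff S g γ f x μ := by
  simp only [transCoeff, Pi.sub_apply, map_sub, sub_mul, Finset.sum_sub_distrib]

theorem modIncr_sub (x : E d) (ν : ι) (y : E d) : modIncr S g γ (f' - f) x ν y =
    modIncr S g γ f' x ν y - modIncr S g γ f x ν y := by
  simp only [modIncr, transCoeff_sub, Pi.sub_apply, map_sub, sub_mul, Finset.sum_sub_distrib]
  ring

theorem ModBound.bddCont_transCoeff (hf : ModBound S g γ f A D)
    (hg : ∀ t, BddCont fun x => g x t) (μ : ι) : BddCont fun x => transCoeff S g γ f x μ :=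
  BddCont.sum _ fun σ _ => (hf.bddCont_coord hg σ).mul (hg (HopfAlgebra.antipode ℝ (S.quot σ μ)))

/-- Change of base point: `g_y⁻¹ f(y) - g_x⁻¹ f(x)` is `g_y⁻¹` applied to the increment `f(y) -
ĝ_{yx} f(x)`, since the matrices of `g_y` and `g_y⁻¹` cancel. -/
theorem transCoeff_sub_transCoeff (g : E d → (Tp →ₐ[ℝ] ℝ)) (γ : ℝ) (f : E d → T) (x y : E d)
    {μ : ι} (hμ : μ ∈ S.indexLt γ) :
    transCoeff S g γ f y μ - transCoeff S g γ f x μ =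
      ∑ ν ∈ S.indexLt γ, modIncr S g γ f x ν y * charInv (g y) (S.quot ν μ) := by
  classical
  simp only [modIncr, sub_mul, Finset.sum_sub_distrib]
  congr 1
  simp only [Finset.sum_mul]
  rw [Finset.sum_comm]
  have e : ∀ κ ∈ S.indexLt γ, ∑ ν ∈ S.indexLt γ,
      transCoeff S g γ f x κ * g y (S.quot κ ν) * charInv (g y) (S.quot ν μ) =
      if κ = μ then transCoeff S g γ f x κ else 0 := by
    intro κ hκ
    have := (S.isLower_indexLt γ).sum_charInv_mul hκ hμ (g y)
    calc _ = transCoeff S g γ f x κ *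
          ∑ ν ∈ S.indexLt γ, charInv (g y) (S.quot ν μ) * g y (S.quot κ ν) := by
          rw [Finset.mul_sum]
          exact Finset.sum_congr rfl fun ν _ => by ring
      _ = _ := by
          rw [this]
          split_ifs <;> simp
  rw [Finset.sum_congr rfl e, Finset.sum_ite_eq' _ μ, if_pos hμ]

theorem ModBound.recenter_eq (hf : ModBound S g γ f A D) (P : T →ₗ[ℝ] TDist d) (x : E d) :
    recenter S g P x (f x) = ∑ μ ∈ S.indexLt γ, transCoeff S g γ f x μ • P (S.b μ) := by
  conv_lhs => rw [basis_eq_sum S.b (f x) (I := S.indexLt γ)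
    fun i hi => hf.coord_eq_zero i (not_lt.1 fun h => hi (S.mem_indexLt.2 h)) x, map_sum]
  have e : ∀ σ ∈ S.indexLt γ, recenter S g P x (S.b.coord σ (f x) • S.b σ) =
      ∑ μ ∈ S.indexLt γ, (S.b.coord σ (f x) * charInv (g x) (S.quot σ μ)) • P (S.b μ) := by
    intro σ hσ
    rw [map_smul, (S.isLower_indexLt γ).recenter_basis hσ, Finset.smul_sum]
    simp only [smul_smul]
  rw [Finset.sum_congr rfl e, Finset.sum_comm]
  simp only [transCoeff, Finset.sum_smul]

/-- In other words `Π_y f(y) - Π_x f(x) = Π_y (f(y) - ĝ_{yx} f(x))`. -/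
theorem sum_transCoeff_sub_smul (g : E d → (Tp →ₐ[ℝ] ℝ)) (γ : ℝ) (f : E d → T)
    (P : T →ₗ[ℝ] TDist d) (x y : E d) :
    ∑ μ ∈ S.indexLt γ, (transCoeff S g γ f y μ - transCoeff S g γ f x μ) • P (S.b μ) =
      ∑ ν ∈ S.indexLt γ, modIncr S g γ f x ν y • recenter S g P y (S.b ν) := by
  have e1 : ∀ μ ∈ S.indexLt γ,
      (transCoeff S g γ f y μ - transCoeff S g γ f x μ) • P (S.b μ) =
      ∑ ν ∈ S.indexLt γ, (modIncr S g γ f x ν y * charInv (g y) (S.quot ν μ)) • P (S.b μ) :=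
    fun μ hμ => by rw [transCoeff_sub_transCoeff g γ f x y hμ, Finset.sum_smul]
  have e2 : ∀ ν ∈ S.indexLt γ, modIncr S g γ f x ν y • recenter S g P y (S.b ν) =
      ∑ μ ∈ S.indexLt γ, (modIncr S g γ f x ν y * charInv (g y) (S.quot ν μ)) • P (S.b μ) :=
    fun ν hν => by
      rw [(S.isLower_indexLt γ).recenter_basis hν, Finset.smul_sum]
      simp only [smul_smul]
  rw [Finset.sum_congr rfl e1, Finset.sum_congr rfl e2, Finset.sum_comm]

end

section

variable {LP : DyadicPartition d} {r : ℝ} (M : RSModel S LP r) (γ : ℝ)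

theorem isSystem_bracketM : IsSystem LP (S.indexLt γ) (fun σ μ y => M.g y (S.quot σ μ))
    (fun σ => M.Pi (S.b σ)) (fun σ => bracketM M (S.b σ)) :=
  (triangularSystem (S.isLower_indexLt γ) M.bddCont (isBesov_bracketM_basis M)
    (bracketM_relation M)).isSystem

/-- `∑_ν P_{(f - ĝ_{·x} f(x))^ν} ⟦ν⟧^M`. -/
def paraIncr (f : E d → T) (x : E d) : TDist d :=
  ∑ ν ∈ S.indexLt γ, paraprod LP (modIncr S M.g γ f x ν) (bracketM M (S.b ν))

/-- The low frequencies of the brackets, transported from `x`. -/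
def lowTerm (f : E d → T) (x y : E d) : ℝ :=
  ∑ μ ∈ S.indexLt γ, transCoeff S M.g γ f x μ *
    (block LP 0 (bracketM M (S.b μ)) y + block LP 1 (bracketM M (S.b μ)) y)

open Classical in
/-- The remainder `⟦f⟧^M`, as a function. -/
def remFun (f : E d → T) (y : E d) : ℝ :=
  -- The subtracted series turns the low blocks of `paraIncr y` at `y` into minus a tail, of order
  -- `2^{-kγ}`. It is needed, and converges, for `γ > 0`; for `γ < 0` the low blocks already have
  -- that order.
  lowTerm M γ f y y - if 0 < γ then ∑' j, block LP j (paraIncr M γ f y) y else 0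

variable {M γ} {A D A' D' : ℝ} {f f' : E d → T}

theorem ModBound.isBesov_paraIncr (hf : ModBound S M.g γ f A D) (x : E d) :
    IsBesov LP (paraIncr M γ f x) :=
  IsBesov.sum _ fun ν _ => (isBesov_bracketM_basis M ν).paraprod_isBesov
    (hf.bddCont_modIncr M.bddCont x ν)

theorem bddCont_lowTerm (f : E d → T) (x : E d) : BddCont (lowTerm M γ f x) :=
  BddCont.sum _ fun μ _ => (isBesov_bracketM_basis M μ).bddCont_low.const_mul _

theorem distOf_lowTerm (f : E d → T) (x : E d) : distOf (lowTerm M γ f x) =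
    ∑ μ ∈ S.indexLt γ, transCoeff S M.g γ f x μ • lowPart LP (bracketM M (S.b μ)) := by
  unfold lowTerm
  rw [distOf_sum _ fun μ _ => (isBesov_bracketM_basis M μ).bddCont_low.const_mul _]
  exact Finset.sum_congr rfl fun μ _ =>
    distOf_const_mul (isBesov_bracketM_basis M μ).bddCont_low _

theorem ModBound.paraIncr_eq (hf : ModBound S M.g γ f A D) (x : E d) :
    paraIncr M γ f x = ∑ ν ∈ S.indexLt γ,
      paraprod LP (fun y => S.b.coord ν (f y)) (bracketM M (S.b ν)) -
        recenter S M.g M.Pi x (f x) + distOf (lowTerm M γ f x) := by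
  rw [hf.recenter_eq, distOf_lowTerm]
  exact hf.sum_paraprod M.bddCont (isSystem_bracketM M γ) x

theorem sum_block_lowPart {u : TDist d} (hu : IsBesov LP u) {k : ℕ} (hk : 3 ≤ k) (y : E d) :
    ∑ j ∈ Finset.range k, block LP j (lowPart LP u) y = block LP 0 u y + block LP 1 u y := by
  rw [← lowFun_low hu hk, lowFun]
  exact Finset.sum_congr rfl fun j _ => block_distOf LP hu.bddCont_low j y

/-- Changing the base point in the low frequencies of `paraIncr`. -/
theorem ModBound.sum_block_paraIncr (hf : ModBound S M.g γ f A D) {k : ℕ} (hk : 3 ≤ k)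
    (x y : E d) :
    ∑ j ∈ Finset.range k, block LP j (paraIncr M γ f x) y + lowTerm M γ f y y -
        lowTerm M γ f x y =
      ∑ j ∈ Finset.range k, block LP j (paraIncr M γ f y) y +
        ∑ ν ∈ S.indexLt γ, modIncr S M.g γ f x ν y *
          ∑ j ∈ Finset.range k, block LP j (recenter S M.g M.Pi y (S.b ν)) y := by
  -- In the difference of `paraIncr` at the two base points the paraproducts `P_{f^ν} ⟦ν⟧` cancel.
  -- Only the recentered distributions and the low parts change.
  have h1 : ∀ j, block LP j (paraIncr M γ f x) y = block LP j (paraIncr M γ f y) y +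
      ∑ ν ∈ S.indexLt γ, modIncr S M.g γ f x ν y *
        block LP j (recenter S M.g M.Pi y (S.b ν)) y -
      ∑ μ ∈ S.indexLt γ, (transCoeff S M.g γ f y μ - transCoeff S M.g γ f x μ) *
        block LP j (lowPart LP (bracketM M (S.b μ))) y := by
    intro j
    have e := congrArg (fun v => block LP j v y) (sum_transCoeff_sub_smul (S := S) M.g γ f M.Pi x y)
    simp only [block_sum, block_smul] at e
    rw [← e, hf.paraIncr_eq, hf.paraIncr_eq, hf.recenter_eq, hf.recenter_eq, distOf_lowTerm,
      distOf_lowTerm]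
    simp only [block_add, block_sub, block_sum, block_smul, sub_mul, Finset.sum_sub_distrib]
    ring
  have h2 : lowTerm M γ f y y - lowTerm M γ f x y =
      ∑ j ∈ Finset.range k, ∑ μ ∈ S.indexLt γ,
        (transCoeff S M.g γ f y μ - transCoeff S M.g γ f x μ) *
        block LP j (lowPart LP (bracketM M (S.b μ))) y := by
    rw [Finset.sum_comm, lowTerm, lowTerm, ← Finset.sum_sub_distrib]
    refine Finset.sum_congr rfl fun μ _ => ?_
    rw [← Finset.mul_sum, sum_block_lowPart (isBesov_bracketM_basis M μ) hk]
    ring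
  have h3 : ∑ ν ∈ S.indexLt γ, modIncr S M.g γ f x ν y *
          ∑ j ∈ Finset.range k, block LP j (recenter S M.g M.Pi y (S.b ν)) y =
      ∑ j ∈ Finset.range k, ∑ ν ∈ S.indexLt γ, modIncr S M.g γ f x ν y *
        block LP j (recenter S M.g M.Pi y (S.b ν)) y := by
    rw [Finset.sum_comm]
    exact Finset.sum_congr rfl fun ν _ => Finset.mul_sum _ _ _
  rw [add_sub_assoc, h2, h3, ← Finset.sum_add_distrib, ← Finset.sum_add_distrib]
  refine Finset.sum_congr rfl fun j _ => ?_
  rw [h1 j]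
  ring

variable (M γ)

/-- Term `ν` is of order `sc j ^ |ν| (sc j + ‖y - x‖) ^ (γ - |ν|)`; all are put under the common
weight with `β₀`, the worst regularity and the largest vanishing order. -/
theorem exists_block_paraIncr_le : ∃ C, 0 ≤ C ∧ ∀ (f : E d → T) (A D : ℝ),
    ModBound S M.g γ f A D → ∀ x j y, |block LP j (paraIncr M γ f x) y| ≤
      C * D * (sc j ^ S.β₀ * (sc j + ‖y - x‖) ^ (γ - S.β₀)) := by
  obtain ⟨C, hC, h⟩ := exists_block_paraprod_modIncr_le S γ
    (b := fun ν => bracketM M (S.b ν)) (α := S.deg)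
    (fun ν _ => exists_blockBd_bracketM_basis M ν)
  refine ⟨∑ _ν ∈ S.indexLt γ, C, Finset.sum_nonneg fun _ _ => hC, fun f A D hf x j y => ?_⟩
  have hD := hf.incr_nonneg
  rw [paraIncr, block_sum, Finset.sum_mul, Finset.sum_mul]
  refine (Finset.abs_sum_le_sum_abs _ _).trans (Finset.sum_le_sum fun ν hν => ?_)
  refine (h ν hν M.g f A D M.bddCont hf x j y).trans ?_
  rw [mul_assoc]
  exact mul_le_mul_of_nonneg_left
    (rpow_mul_add_rpow_le (sc_pos j) (norm_nonneg _) (S.β₀_le ν)) (by positivity)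

theorem exists_block_paraIncr_self_le : ∃ C, 0 ≤ C ∧ ∀ (f : E d → T) (A D : ℝ),
    ModBound S M.g γ f A D → ∀ x j, |block LP j (paraIncr M γ f x) x| ≤ C * D * sc j ^ γ := by
  obtain ⟨C, hC, h⟩ := exists_block_paraIncr_le M γ
  refine ⟨C, hC, fun f A D hf x j => (h f A D hf x j x).trans_eq ?_⟩
  rw [sub_self, norm_zero, add_zero, ← Real.rpow_add (sc_pos j), add_sub_cancel]

variable {M γ}

theorem ModBound.summable_block_paraIncr (hγ : 0 < γ) (hf : ModBound S M.g γ f A D) (y : E d) :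
    Summable fun j => block LP j (paraIncr M γ f y) y := by
  obtain ⟨C, hC, h⟩ := exists_block_paraIncr_self_le M γ
  exact (abs_tsum_le_sc hγ 0 fun m => by simpa using h f A D hf y m).1

theorem ModBound.paraIncr_sub (hf : ModBound S M.g γ f A D) (hf' : ModBound S M.g γ f' A' D')
    (x : E d) : paraIncr M γ (f' - f) x = paraIncr M γ f' x - paraIncr M γ f x := by
  rw [paraIncr, paraIncr, paraIncr, ← Finset.sum_sub_distrib]
  refine Finset.sum_congr rfl fun ν _ => ?_
  rw [← paraprod_sub_left (isBesov_bracketM_basis M ν) (hf'.bddCont_modIncr M.bddCont x ν)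
    (hf.bddCont_modIncr M.bddCont x ν)]
  congr 1
  ext y
  exact modIncr_sub x ν y

theorem ModBound.remFun_sub (hf : ModBound S M.g γ f A D) (hf' : ModBound S M.g γ f' A' D')
    (y : E d) : remFun M γ (f' - f) y = remFun M γ f' y - remFun M γ f y := by
  have h1 : lowTerm M γ (f' - f) y y = lowTerm M γ f' y y - lowTerm M γ f y y := by
    simp only [lowTerm, transCoeff_sub, sub_mul, Finset.sum_sub_distrib]
  rw [remFun, remFun, remFun, h1]
  split_ifs with hγ
  · simp only [hf.paraIncr_sub hf', block_sub]
    rw [(hf'.summable_block_paraIncr hγ y).tsum_sub (hf.summable_block_paraIncr hγ y)]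
    ring
  · ring

theorem ModBound.continuous_block_paraIncr (hf : ModBound S M.g γ f A D) (j : ℕ) :
    Continuous fun y => block LP j (paraIncr M γ f y) y := by
  have hc := fun μ => (hf.bddCont_transCoeff M.bddCont μ).cont
  simp only [hf.paraIncr_eq, hf.recenter_eq, distOf_lowTerm, block_add, block_sub, block_sum,
    block_smul]
  refine ((continuous_finsetSum _ fun ν _ => continuous_block LP j _).sub
    (continuous_finsetSum _ fun μ _ => (hc μ).mul (continuous_block LP j _))).add
    (continuous_finsetSum _ fun μ _ => (hc μ).mul (continuous_block LP j _))

theorem ModBound.continuous_remFun (hf : ModBound S M.g γ f A D) :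
    Continuous (remFun M γ f) := by
  have h1 : Continuous fun y => lowTerm M γ f y y :=
    continuous_finsetSum _ fun μ _ => (hf.bddCont_transCoeff M.bddCont μ).cont.mul
      (isBesov_bracketM_basis M μ).bddCont_low.cont
  refine h1.sub ?_
  split_ifs with hγ
  · obtain ⟨C, hC, h⟩ := exists_block_paraIncr_self_le M γ
    have hs : Summable fun j => C * D * sc j ^ γ := by
      simpa using (hasSum_sc_rpow hγ 0).summable.mul_left (C * D)
    exact continuous_tsum hf.continuous_block_paraIncr hs fun j y => h f A D hf y j
  · exact continuous_const

variable (M γ)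

theorem exists_remFun_le : ∃ C, 0 ≤ C ∧ ∀ (f : E d → T) (A D : ℝ),
    ModBound S M.g γ f A D → ∀ y, |remFun M γ f y| ≤ C * (A + D) := by
  obtain ⟨C₁, hC₁, h₁⟩ := exists_block_paraIncr_self_le M γ
  obtain ⟨G, hG⟩ := M.exists_charBound
  choose B hB using fun μ => (isBesov_bracketM_basis M μ).bddCont_low.bdd
  have hB0 : ∀ μ, 0 ≤ B μ := fun μ => BddCont.nonneg_bound (hB μ)
  have hQ := quotSum_nonneg S (S.indexLt γ)
  have hG0 := hG.nonneg
  set X := ∑ μ ∈ S.indexLt γ, (∑ _σ ∈ S.indexLt γ, quotSum S (S.indexLt γ) * G) * B μ with hX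
  have hX0 : 0 ≤ X := Finset.sum_nonneg fun μ _ =>
    mul_nonneg (Finset.sum_nonneg fun _ _ => by positivity) (hB0 μ)
  set Y := C₁ * |(1 - (1 / 2 : ℝ) ^ γ)⁻¹| * sc 0 ^ γ with hY
  have hY0 : 0 ≤ Y := by
    have := (sc_rpow_pos 0 γ).le
    positivity
  refine ⟨X + Y, by positivity, fun f A D hf y => ?_⟩
  have hA := hf.sup_nonneg
  have hD := hf.incr_nonneg
  have h1 : |lowTerm M γ f y y| ≤ X * A := by
    rw [lowTerm, hX, Finset.sum_mul]
    refine (Finset.abs_sum_le_sum_abs _ _).trans (Finset.sum_le_sum fun μ hμ => ?_)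
    rw [abs_mul, mul_right_comm]
    refine mul_le_mul ?_ (hB μ y) (abs_nonneg _)
      (mul_nonneg (Finset.sum_nonneg fun _ _ => by positivity) hA)
    rw [transCoeff, Finset.sum_mul]
    refine (Finset.abs_sum_le_sum_abs _ _).trans (Finset.sum_le_sum fun σ hσ => ?_)
    rw [abs_mul, mul_comm]
    exact mul_le_mul (hG.abs_charInv_le hσ hμ y) (hf.sup_le σ y) (abs_nonneg _) (by positivity)
  have h2 : |if 0 < γ then ∑' j, block LP j (paraIncr M γ f y) y else 0| ≤ Y * D := by
    split_ifs with hγ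
    · refine (abs_tsum_le_sc hγ 0 (A := C₁ * D)
        fun m => by simpa using h₁ f A D hf y m).2.trans ?_
      rw [hY, abs_of_nonneg (geom_const_nonneg hγ)]
      exact le_of_eq (by ring)
    · rw [abs_zero]
      positivity
  refine (abs_sub _ _).trans ((add_le_add h1 h2).trans ?_)
  nlinarith [mul_nonneg hX0 hD, mul_nonneg hY0 hA]

variable {M γ} in
theorem ModBound.bddCont_remFun (hf : ModBound S M.g γ f A D) : BddCont (remFun M γ f) := by
  obtain ⟨C, hC, h⟩ := exists_remFun_le M γ
  exact ⟨hf.continuous_remFun, _, h f A D hf⟩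

/-- The key estimate: the low frequencies of `paraIncr` and the remainder compensate. -/
theorem exists_sum_block_add_remFun_le (hγ : γ ≠ 0) (hβ : S.β₀ ≤ γ) :
    ∃ C, 0 ≤ C ∧ ∀ (f : E d → T) (A D : ℝ), ModBound S M.g γ f A D → ∀ k, 3 ≤ k → ∀ x y,
      |∑ j ∈ Finset.range k, block LP j (paraIncr M γ f x) y + remFun M γ f y -
        lowTerm M γ f x y| ≤ C * D * (sc k ^ S.β₀ * (sc k + ‖y - x‖) ^ (γ - S.β₀)) := by
  obtain ⟨G, hG, hP⟩ := M.exists_bound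
  obtain ⟨C₁, hC₁, h₁⟩ := exists_block_paraIncr_self_le M γ
  obtain ⟨C₂, hC₂, h₂⟩ := exists_block_recenter_le LP r (S.isLower_indexLt γ) hG hP
  set Q := (1 - (1 / 2 : ℝ) ^ |γ|)⁻¹ with hQ
  have hQ0 : 0 ≤ Q := geom_const_nonneg (abs_pos.2 hγ)
  set X := ∑ _ν ∈ S.indexLt γ, C₂ with hX
  have hX0 : 0 ≤ X := Finset.sum_nonneg fun _ _ => hC₂
  refine ⟨C₁ * Q + X, by positivity, fun f A D hf k hk x y => ?_⟩
  have hD := hf.incr_nonneg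
  set w := sc k ^ S.β₀ * (sc k + ‖y - x‖) ^ (γ - S.β₀) with hw
  have hk0 := sc_pos k
  have hγw : sc k ^ γ ≤ w := rpow_le_weight hk0 (norm_nonneg _) hβ
  have hw0 : 0 ≤ w := (sc_rpow_pos k γ).le.trans hγw
  set Θ := ∑ j ∈ Finset.range k, block LP j (paraIncr M γ f y) y -
    if 0 < γ then ∑' j, block LP j (paraIncr M γ f y) y else 0 with hΘ
  have e : ∑ j ∈ Finset.range k, block LP j (paraIncr M γ f x) y + remFun M γ f y -
        lowTerm M γ f x y = Θ + ∑ ν ∈ S.indexLt γ, modIncr S M.g γ f x ν y *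
          ∑ j ∈ Finset.range k, block LP j (recenter S M.g M.Pi y (S.b ν)) y := by
    have := hf.sum_block_paraIncr hk x y
    rw [remFun, hΘ]
    linarith
  have hΘle : |Θ| ≤ C₁ * D * Q * sc k ^ γ := by
    rw [hΘ]
    -- For `γ < 0` the sum of the low blocks is dominated by its last scale; for `γ > 0` it cancels
    -- against the full series up to a tail. At `γ = 0` neither sum is geometric, hence the
    -- exclusion.
    rcases lt_or_gt_of_ne hγ with hneg | hpos
    · rw [if_neg (not_lt.2 hneg.le), sub_zero, hQ, abs_of_neg hneg]
      refine (Finset.abs_sum_le_sum_abs _ _).trans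
        ((Finset.sum_le_sum fun j _ => h₁ f A D hf y j).trans ?_)
      rw [← Finset.mul_sum, mul_assoc (C₁ * D) _ (sc k ^ γ)]
      exact mul_le_mul_of_nonneg_left (sum_sc_rpow_le hneg k) (by positivity)
    · rw [if_pos hpos, ← (hf.summable_block_paraIncr hpos y).sum_add_tsum_nat_add k,
        sub_add_cancel_left, abs_neg, hQ, abs_of_pos hpos]
      exact (abs_tsum_le_sc hpos k fun m => by
        rw [add_comm k m]
        exact h₁ f A D hf y (m + k)).2
  have hsum : |∑ ν ∈ S.indexLt γ, modIncr S M.g γ f x ν y *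
      ∑ j ∈ Finset.range k, block LP j (recenter S M.g M.Pi y (S.b ν)) y| ≤ X * (D * w) := by
    rw [hX, Finset.sum_mul]
    refine (Finset.abs_sum_le_sum_abs _ _).trans (Finset.sum_le_sum fun ν hν => ?_)
    have hνγ := S.mem_indexLt.1 hν
    rw [abs_mul]
    calc _ ≤ D * ‖y - x‖ ^ (γ - S.deg ν) * (C₂ * sc k ^ S.deg ν) :=
          mul_le_mul (hf.incr_le ν hνγ x y) ((h₂ ν hν y).2 k (by omega)) (abs_nonneg _)
            (by positivity)
      _ ≤ D * (sc k + ‖y - x‖) ^ (γ - S.deg ν) * (C₂ * sc k ^ S.deg ν) := by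
          have := (sc_rpow_pos k (S.deg ν)).le
          have := Real.rpow_le_rpow (norm_nonneg (y - x))
            (show ‖y - x‖ ≤ sc k + ‖y - x‖ by linarith) (sub_pos.2 hνγ).le
          gcongr
      _ = C₂ * (D * (sc k ^ S.deg ν * (sc k + ‖y - x‖) ^ (γ - S.deg ν))) := by ring
      _ ≤ _ := by
          have := rpow_mul_add_rpow_le (γ := γ) hk0 (norm_nonneg (y - x)) (S.β₀_le ν)
          gcongr
  rw [e]
  calc _ ≤ C₁ * D * Q * w + X * (D * w) :=
        (abs_add_le _ _).trans (add_le_add (hΘle.trans (by gcongr)) hsum)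
    _ = _ := by ring

end

end

/-! ### The reconstruction bound and the regularity of the remainder -/

section

variable {d : ℕ}

variable {Tp T ιp ι : Type*} [Ring Tp] [HopfAlgebra ℝ Tp] [AddCommGroup T] [Module ℝ T]
  {S : ConcreteRegularityStructure Tp T ιp ι}

section

variable {LP : DyadicPartition d} {r : ℝ} {M : RSModel S LP r} {γ A D A' D' : ℝ} {f f' : E d → T}

variable (M γ) in
/-- The reconstruction of a modelled distribution. -/
def reconstruct (f : E d → T) : TDist d :=
  ∑ τ ∈ S.indexLt γ, paraprod LP (fun x => S.b.coord τ (f x)) (bracketM M (S.b τ)) +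
    distOf (remFun M γ f)

theorem paraIncr_eq_zero (h : ∀ ν ∈ S.indexLt γ, bracketM M (S.b ν) = 0)
    (hf : ModBound S M.g γ f A D) (x : E d) : paraIncr M γ f x = 0 :=
  Finset.sum_eq_zero fun ν hν => by
    rw [h ν hν, paraprod_zero_right (hf.bddCont_modIncr M.bddCont x ν)]

theorem lowTerm_eq_zero (h : ∀ ν ∈ S.indexLt γ, bracketM M (S.b ν) = 0) (f : E d → T)
    (x : E d) : lowTerm M γ f x = fun _ => 0 := by
  ext y
  exact Finset.sum_eq_zero fun ν hν => by rw [h ν hν, block_zero, block_zero, add_zero, mul_zero]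

theorem remFun_eq_zero (h : ∀ ν ∈ S.indexLt γ, bracketM M (S.b ν) = 0)
    (hf : ModBound S M.g γ f A D) : remFun M γ f = fun _ => 0 := by
  ext y
  simp [remFun, lowTerm_eq_zero h, paraIncr_eq_zero h hf, block_zero]

theorem distOf_zero : distOf (fun _ : E d => (0 : ℝ)) = 0 := by
  simpa using distOf_const_mul (BddCont.const (d := d) 0) 0

theorem ModBound.reconstruct_sub_recenter (hf : ModBound S M.g γ f A D) (x : E d) :
    reconstruct M γ f - recenter S M.g M.Pi x (f x) =
      paraIncr M γ f x + distOf fun y => remFun M γ f y - lowTerm M γ f x y := by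
  rw [hf.paraIncr_eq, distOf_sub hf.bddCont_remFun (bddCont_lowTerm f x), reconstruct]
  abel

theorem ModBound.reconstruct_eq_recenter (h : ∀ ν ∈ S.indexLt γ, bracketM M (S.b ν) = 0)
    (hf : ModBound S M.g γ f A D) (x : E d) :
    reconstruct M γ f - recenter S M.g M.Pi x (f x) = 0 := by
  rw [hf.reconstruct_sub_recenter, paraIncr_eq_zero h hf, remFun_eq_zero h hf,
    lowTerm_eq_zero h]
  simp only [sub_zero, distOf_zero, add_zero]

/-- Splitting at scale `k`: the coarse blocks of `paraIncr x` are grouped with the remainder, as in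
`exists_sum_block_add_remFun_le`, and the fine ones stay as a series. -/
theorem ModBound.hasSum_reconstruct (hf : ModBound S M.g γ f A D) (k : ℕ) (x : E d)
    (φ : 𝓢(E d, ℝ)) :
    HasSum (fun m => ∫ y, φ y * block LP (k + m) (paraIncr M γ f x) y)
      ((reconstruct M γ f - recenter S M.g M.Pi x (f x)) φ -
        ∫ y, φ y * (∑ j ∈ Finset.range k, block LP j (paraIncr M γ f x) y + remFun M γ f y -
          lowTerm M γ f x y)) := by
  have hb := fun j => (hf.isBesov_paraIncr x).bddCont_block j
  have hr := hf.bddCont_remFun.sub (bddCont_lowTerm (M := M) (γ := γ) f x)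
  have h := hasSum_integral_block LP (paraIncr M γ f x) φ
  have h1 := (hasSum_nat_add_iff' k).2 h
  have e : (reconstruct M γ f - recenter S M.g M.Pi x (f x)) φ -
        ∫ y, φ y * (∑ j ∈ Finset.range k, block LP j (paraIncr M γ f x) y + remFun M γ f y -
          lowTerm M γ f x y) = paraIncr M γ f x φ -
      ∑ j ∈ Finset.range k, ∫ y, φ y * block LP j (paraIncr M γ f x) y := by
    rw [hf.reconstruct_sub_recenter, add_apply, distOf_apply hr,
      ← integral_finsetSum _ fun j _ => (hb j).integrable_mul φ.integrable]
    have e2 : ∀ y, φ y * (∑ j ∈ Finset.range k, block LP j (paraIncr M γ f x) y +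
        remFun M γ f y - lowTerm M γ f x y) =
        ∑ j ∈ Finset.range k, φ y * block LP j (paraIncr M γ f x) y +
          φ y * (remFun M γ f y - lowTerm M γ f x y) := fun y => by
      rw [← Finset.mul_sum]; ring
    simp only [e2]
    rw [integral_add (integrable_finsetSum _ fun j _ => (hb j).integrable_mul φ.integrable)
      (hr.integrable_mul φ.integrable)]
    ring
  rw [e]
  simpa only [add_comm k] using h1

theorem sc_rpow_le_of_between {k : ℕ} {l : ℝ} (hl : 0 < l) (h1 : sc k ≤ l) (h2 : l ≤ 8 * sc k)
    (p : ℝ) : sc k ^ p ≤ 8 ^ |p| * l ^ p := by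
  have hk := sc_pos k
  rcases le_total 0 p with hp | hp
  · calc sc k ^ p ≤ 1 * l ^ p := by
          rw [one_mul]
          exact Real.rpow_le_rpow hk.le h1 hp
      _ ≤ _ := by
          gcongr
          exact Real.one_le_rpow (by norm_num) (abs_nonneg p)
  · rw [abs_of_nonpos hp, Real.rpow_neg (by norm_num), ← Real.inv_rpow (by norm_num),
      ← Real.mul_rpow (by norm_num) hl.le]
    refine Real.rpow_le_rpow_of_nonpos (by positivity) ?_ hp
    linarith

-- The coarse part is a function of controlled growth around `x`, integrated against the decay of
-- the test function. The fine blocks gain `(sc j / l) ^ r`, and their sum converges because `β₀ + r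
-- > 0`; this is the only role of the hypothesis on `r` besides `r > 0`.
variable (M γ) in
theorem exists_reconstruct_le (hr : |min S.β₀ 0| < r) (hγ : γ ≠ 0) (hβ : S.β₀ ≤ γ) :
    ∃ C, 0 ≤ C ∧ ∀ (f : E d → T) (A D : ℝ), ModBound S M.g γ f A D → ∀ φ, IsTest LP r φ →
      ∀ (l : ℝ) (hl : 0 < l), l ≤ 1 → ∀ x,
        |(reconstruct M γ f - recenter S M.g M.Pi x (f x)) (rescale φ l hl x)| ≤
          C * D * l ^ γ := by
  have hr0 : 0 < r := (abs_nonneg _).trans_lt hr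
  have hβr : 0 < S.β₀ + r := by
    have := (abs_lt.1 hr).1
    have := min_le_left S.β₀ 0
    linarith
  set s := γ - S.β₀ with hs
  have hs0 : 0 ≤ s := sub_nonneg.2 hβ
  obtain ⟨C₁, hC₁, h₁⟩ := exists_block_paraIncr_le M γ
  obtain ⟨C₂, hC₂, h₂⟩ := exists_sum_block_add_remFun_le M γ hγ hβ
  obtain ⟨C₃, hC₃, h₃⟩ := exists_isTest_integral_le LP hr0 hs0
  obtain ⟨C₄, hC₄, h₄⟩ := exists_isTest_integral_block_le LP hr0 hs0
  set Q := (1 - (1 / 2 : ℝ) ^ (S.β₀ + r))⁻¹ with hQ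
  have hQ0 : 0 ≤ Q := geom_const_nonneg hβr
  refine ⟨C₃ * C₂ * 8 ^ |S.β₀| * 2 ^ s + C₄ * C₁ * Q, by positivity,
    fun f A D hf φ hφ l hl hl1 x => ?_⟩
  have hD := hf.incr_nonneg
  -- `l / 8 ≤ sc k < l / 4`: comparable to `l`, and below `sc 2 = 1 / 2` since `l ≤ 1`, which forces
  -- `k ≥ 3`.
  obtain ⟨k, hk1, hk2⟩ := exists_sc_between (t := l / 8) (by positivity) (by linarith)
  have hkl : sc k ≤ l := by linarith
  have hk3 : 3 ≤ k := by
    by_contra hcon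
    have h5 := sc_antitone (show k ≤ 2 by omega)
    have h6 : sc 2 = 1 / 2 := by norm_num [sc]
    linarith
  have hk0 := sc_pos k
  have hlγ : l ^ S.β₀ * l ^ s = l ^ γ := by rw [← Real.rpow_add hl, hs, add_sub_cancel]
  have hbeta := (sc_rpow_pos k S.β₀).le
  have hlow : |∫ y, rescale φ l hl x y * (∑ j ∈ Finset.range k,
      block LP j (paraIncr M γ f x) y + remFun M γ f y - lowTerm M γ f x y)| ≤
      C₃ * C₂ * 8 ^ |S.β₀| * 2 ^ s * D * l ^ γ := by
    have := h₃ φ hφ l hl x _ (C₂ * D * sc k ^ S.β₀) (sc k) (by positivity) hk0.le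
      (fun y => by
        rw [mul_assoc]
        exact h₂ f A D hf k hk3 x y)
    refine this.trans ?_
    have e1 := sc_rpow_le_of_between hl hkl (by linarith) S.β₀
    have e2 : (sc k + l) ^ s ≤ 2 ^ s * l ^ s := by
      rw [← Real.mul_rpow (by norm_num) hl.le]
      exact Real.rpow_le_rpow (by positivity) (by linarith) hs0
    calc _ ≤ C₃ * (C₂ * D * (8 ^ |S.β₀| * l ^ S.β₀)) * (2 ^ s * l ^ s) := by gcongr
      _ = C₃ * C₂ * 8 ^ |S.β₀| * 2 ^ s * D * (l ^ S.β₀ * l ^ s) := by ring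
      _ = _ := by rw [hlγ]
  have hsum := hf.hasSum_reconstruct k x (rescale φ l hl x)
  have hfine : ∀ m, |∫ y, rescale φ l hl x y * block LP (k + m) (paraIncr M γ f x) y| ≤
      C₄ * C₁ * D * l ^ s * l ^ (-r) * sc (k + m) ^ (S.β₀ + r) := by
    intro m
    have hkm := sc_pos (k + m)
    have := (sc_rpow_pos (k + m) S.β₀).le
    refine (h₄ φ hφ l hl x (k + m) (by omega)
      ((sc_antitone (Nat.le_add_right k m)).trans hkl) (paraIncr M γ f x)
      (C₁ * D * sc (k + m) ^ S.β₀) (by positivity) (fun y => by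
        rw [mul_assoc]
        exact h₁ f A D hf x (k + m) y)).trans_eq ?_
    rw [Real.div_rpow hkm.le hl.le, Real.rpow_neg hl.le, Real.rpow_add hkm]
    ring
  have htail := (abs_tsum_le_sc hβr k hfine).2
  rw [hsum.tsum_eq] at htail
  have htail' : C₄ * C₁ * D * l ^ s * l ^ (-r) * Q * sc k ^ (S.β₀ + r) ≤
      C₄ * C₁ * Q * D * l ^ γ := by
    have e1 : sc k ^ (S.β₀ + r) ≤ l ^ (S.β₀ + r) := Real.rpow_le_rpow hk0.le hkl hβr.le
    calc _ ≤ C₄ * C₁ * D * l ^ s * l ^ (-r) * Q * l ^ (S.β₀ + r) := by gcongr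
      _ = C₄ * C₁ * Q * D * (l ^ s * l ^ (-r) * l ^ (S.β₀ + r)) := by ring
      _ = _ := by
        rw [← Real.rpow_add hl, ← Real.rpow_add hl]
        congr 2
        rw [hs]
        ring
  have hfin := abs_add_le
    ((reconstruct M γ f - recenter S M.g M.Pi x (f x)) (rescale φ l hl x) -
      ∫ y, rescale φ l hl x y * (∑ j ∈ Finset.range k,
        block LP j (paraIncr M γ f x) y + remFun M γ f y - lowTerm M γ f x y))
    (∫ y, rescale φ l hl x y * (∑ j ∈ Finset.range k,
        block LP j (paraIncr M γ f x) y + remFun M γ f y - lowTerm M γ f x y))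
  rw [sub_add_cancel] at hfin
  calc _ ≤ _ := hfin
    _ ≤ C₄ * C₁ * Q * D * l ^ γ + C₃ * C₂ * 8 ^ |S.β₀| * 2 ^ s * D * l ^ γ :=
      add_le_add (htail.trans htail') hlow
    _ = _ := by ring

/-- The inserted terms have frequencies too low to be seen by block `k + 1`. They convert the
remainder into the combination controlled by `exists_sum_block_add_remFun_le`, with base point `x`.
-/
theorem ModBound.block_distOf_remFun (hf : ModBound S M.g γ f A D) {k : ℕ} (hk : 2 ≤ k)
    (x : E d) :
    block LP (k + 1) (distOf (remFun M γ f)) x = ∫ y, LP.kernel (k + 1) (x - y) *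
      (∑ j ∈ Finset.range k, block LP j (paraIncr M γ f x) y + remFun M γ f y -
        lowTerm M γ f x y) := by
  have hb := fun j => (hf.isBesov_paraIncr x).bddCont_block j
  have hL := bddCont_lowTerm (M := M) (γ := γ) f x
  have e1 : ∀ j ∈ Finset.range k,
      ∫ y, LP.kernel (k + 1) (x - y) * block LP j (paraIncr M γ f x) y = 0 := by
    intro j hj
    have h := (apply_convS_kernel LP j (paraIncr M γ f x) (reflectAt (LP.kernel (k + 1)) x)).2
    rw [LP.convS_kernel_reflectAt_kernel_eq_zero
      (by have := Finset.mem_range.1 hj; omega) x, map_zero] at h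
    simp only [reflectAt_apply] at h
    exact h.symm
  have e2 : ∫ y, LP.kernel (k + 1) (x - y) * lowTerm M γ f x y = 0 := by
    have h : block LP (k + 1) (distOf (lowTerm M γ f x)) x = 0 := by
      rw [distOf_lowTerm, block_sum]
      refine Finset.sum_eq_zero fun μ _ => ?_
      rw [block_smul, block_lowPart_eq_zero (isBesov_bracketM_basis M μ) (by omega), mul_zero]
    rwa [block_distOf LP hL] at h
  have e3 : ∀ y, LP.kernel (k + 1) (x - y) *
      (∑ j ∈ Finset.range k, block LP j (paraIncr M γ f x) y + remFun M γ f y -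
        lowTerm M γ f x y) =
      ∑ j ∈ Finset.range k, LP.kernel (k + 1) (x - y) * block LP j (paraIncr M γ f x) y +
        LP.kernel (k + 1) (x - y) * remFun M γ f y -
          LP.kernel (k + 1) (x - y) * lowTerm M γ f x y := fun y => by
    rw [← Finset.mul_sum]; ring
  have i1 : Integrable fun y => ∑ j ∈ Finset.range k,
      LP.kernel (k + 1) (x - y) * block LP j (paraIncr M γ f x) y :=
    integrable_finsetSum _ fun j _ => (hb j).integrable_conv _ x
  have i2 := hf.bddCont_remFun.integrable_conv (LP.kernel (k + 1)) x
  simp only [e3]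
  have i3 : Integrable fun y => ∑ j ∈ Finset.range k,
      LP.kernel (k + 1) (x - y) * block LP j (paraIncr M γ f x) y +
        LP.kernel (k + 1) (x - y) * remFun M γ f y := i1.add i2
  rw [integral_sub i3 (hL.integrable_conv _ x), integral_add i1 i2,
    integral_finsetSum _ fun j _ => (hb j).integrable_conv _ x, Finset.sum_eq_zero e1, e2,
    block_distOf LP hf.bddCont_remFun, blockFun]
  ring

variable (M γ) in
theorem exists_blockBd_remFun : ∃ C, 0 ≤ C ∧ ∀ (f : E d → T) (A D : ℝ),
    ModBound S M.g γ f A D → BlockBd LP γ (C * (A + D)) (distOf (remFun M γ f)) := by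
  obtain ⟨C₀, hC₀, h₀⟩ := exists_remFun_le M γ
  obtain ⟨C₁, hC₁, h₁⟩ := exists_block_distOf_le LP (le_refl (0 : ℝ))
  have hsup : ∀ (f : E d → T) (A D : ℝ), ModBound S M.g γ f A D → ∀ k x,
      |block LP k (distOf (remFun M γ f)) x| ≤ C₁ * C₀ * (A + D) := by
    intro f A D hf k x
    have hAD := add_nonneg hf.sup_nonneg hf.incr_nonneg
    have := h₁ _ hf.bddCont_remFun (C₀ * (A + D)) x (by positivity)
      (by simpa using h₀ f A D hf) k
    rw [Real.rpow_zero, mul_one, ← mul_assoc] at this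
    exact this
  -- For `γ ≤ 0` a bounded function already belongs to `𝒞^γ`; this includes `γ = 0`, where the key
  -- estimate is not available.
  rcases le_or_gt γ 0 with hγ | hγ
  · refine ⟨2 ^ (0 - γ) * (C₁ * C₀), by positivity, fun f A D hf => ?_⟩
    have hAD := add_nonneg hf.sup_nonneg hf.incr_nonneg
    have h : BlockBd LP 0 (C₁ * C₀ * (A + D)) (distOf (remFun M γ f)) := fun k x => by
      rw [Real.rpow_zero, mul_one]
      exact hsup f A D hf k x
    rw [mul_assoc]
    exact h.of_le (by positivity) hγ
  rcases lt_or_ge γ S.β₀ with hβ | hβ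
  · refine ⟨0, le_rfl, fun f A D hf => ?_⟩
    have h0 := remFun_eq_zero (M := M) (γ := γ) (fun ν hν =>
      absurd ((S.β₀_le ν).trans_lt (S.mem_indexLt.1 hν)) (not_lt.2 hβ.le)) hf
    rw [h0, distOf_zero, zero_mul]
    exact BlockBd.zero LP γ
  have hs0 : 0 ≤ γ - S.β₀ := sub_nonneg.2 hβ
  obtain ⟨C₂, hC₂, h₂⟩ := exists_sum_block_add_remFun_le M γ hγ.ne' hβ
  obtain ⟨C₃, hC₃, h₃⟩ := exists_kernel_weight LP hs0
  set m := ∑ k ∈ Finset.range 4, (sc k ^ γ)⁻¹ with hm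
  have hm0 : ∀ k ∈ Finset.range 4, 0 ≤ (sc k ^ γ)⁻¹ := fun k _ => inv_nonneg.2 (sc_rpow_pos _ _).le
  have hm1 : 0 ≤ m := Finset.sum_nonneg hm0
  refine ⟨C₁ * C₀ * m + C₂ * C₃ * 2 ^ γ, by positivity, fun f A D hf k x => ?_⟩
  have hA := hf.sup_nonneg
  have hD := hf.incr_nonneg
  have hsk := sc_rpow_pos k γ
  -- The key estimate is applied at `n = k - 1` and needs `n ≥ 3`. The four remaining blocks are
  -- bounded by the supremum of the remainder.
  rcases lt_or_ge k 4 with hk | hk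
  · have h2 : 1 ≤ m * sc k ^ γ := by
      have := Finset.single_le_sum hm0 (Finset.mem_range.2 hk)
      calc (1 : ℝ) = (sc k ^ γ)⁻¹ * sc k ^ γ := (inv_mul_cancel₀ hsk.ne').symm
        _ ≤ _ := by gcongr
    calc _ ≤ C₁ * C₀ * (A + D) * 1 := by
          rw [mul_one]
          exact hsup f A D hf k x
      _ ≤ C₁ * C₀ * (A + D) * (m * sc k ^ γ) := by gcongr
      _ = C₁ * C₀ * m * (A + D) * sc k ^ γ := by ring
      _ ≤ _ := by
          gcongr
          exact le_add_of_nonneg_right (by positivity)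
  · obtain ⟨n, rfl⟩ : ∃ n, k = n + 1 := ⟨k - 1, by omega⟩
    rw [hf.block_distOf_remFun (by omega)]
    have hn := sc_pos n
    have hnβ := (sc_rpow_pos n S.β₀).le
    obtain ⟨hi, hw⟩ := h₃ (n + 1) (sc n) (sc_antitone (Nat.le_succ n)) x x
    have hdbl : sc n = 2 * sc (n + 1) := by
      rw [sc_add]
      ring
    calc _ ≤ ∫ y, C₂ * D * sc n ^ S.β₀ *
          (|LP.kernel (n + 1) (x - y)| * (sc n + ‖y - x‖) ^ (γ - S.β₀)) := by
          rw [← Real.norm_eq_abs]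
          refine norm_integral_le_of_norm_le (hi.const_mul _) (Eventually.of_forall fun y => ?_)
          rw [norm_mul, Real.norm_eq_abs, Real.norm_eq_abs]
          refine (mul_le_mul_of_nonneg_left (h₂ f A D hf n (by omega) x y)
            (abs_nonneg _)).trans_eq ?_
          ring
      _ ≤ C₂ * D * sc n ^ S.β₀ * (C₃ * (sc n + ‖x - x‖) ^ (γ - S.β₀)) := by
          rw [integral_const_mul]
          gcongr
      _ = C₂ * C₃ * 2 ^ γ * D * sc (n + 1) ^ γ := by
          have e : sc n ^ S.β₀ * sc n ^ (γ - S.β₀) = 2 ^ γ * sc (n + 1) ^ γ := by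
            rw [← Real.rpow_add hn, add_sub_cancel, ← Real.mul_rpow (by norm_num) (sc_pos _).le,
              ← hdbl]
          rw [sub_self, norm_zero, add_zero]
          linear_combination C₂ * D * C₃ * e
      _ ≤ _ := by
          gcongr
          · exact le_add_of_nonneg_left (by positivity)
          · linarith

end

end

/-! ### Normalization of the constant and continuity in the modelled distribution -/

section

variable {d : ℕ}

variable {Tp T ιp ι : Type*} [Ring Tp] [HopfAlgebra ℝ Tp] [AddCommGroup T] [Module ℝ T]
  {S : ConcreteRegularityStructure Tp T ιp ι}

section

variable {LP : DyadicPartition d} {r : ℝ} (M : RSModel S LP r) (γ : ℝ)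

theorem bracketM_eq_zero (h : M.piNorm = 0) : bracketM M = 0 := by
  have hP : PiBound S LP r M.Pi (recenter S M.g M.Pi) 0 :=
    piBound_of_piSize_le le_rfl (by rw [ENNReal.ofReal_zero]; exact h.le)
  have hPi : ∀ σ, M.Pi (S.b σ) = 0 := fun σ => eq_zero_of_block_eq_zero LP fun n x => by
    simpa using hP.blockBd σ n x
  refine (IsBracketM.eq_bracketM fun σ => ⟨fun μ _ => ?_, ?_⟩).symm
  · exact (IsBesov.zero LP).paraprodConverges (M.bddCont _)
  · rw [hPi σ]
    exact zero_bracket_relation M.bddCont σ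

/-- The constant may depend on the model, so the factor `‖Π‖^g` is introduced by dividing by it. If
all brackets of degree below `γ` vanish, then `R f = Π_x f(x)` and any constant works; otherwise
`‖Π‖^g` is nonzero and `β₀ ≤ γ`. -/
theorem isReconstruction_reconstruct (hr : |min S.β₀ 0| < r) (hγ : γ ≠ 0) :
    IsReconstruction M γ fun f => reconstruct M γ f.1 := by
  by_cases h : ∀ ν ∈ S.indexLt γ, bracketM M (S.b ν) = 0
  · refine ⟨0, fun f φ _ l hl _ x => ?_⟩
    obtain ⟨A, hf⟩ := f.exists_modBound
    rw [hf.reconstruct_eq_recenter h]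
    simp
  have hβ : S.β₀ ≤ γ := by
    by_contra hβ
    exact h fun ν hν => absurd ((S.β₀_le ν).trans_lt (S.mem_indexLt.1 hν))
      (not_lt.2 (not_le.1 hβ).le)
  have hp0 : M.piNorm ≠ 0 := fun h0 => h fun ν _ => by rw [bracketM_eq_zero M h0]; rfl
  have hpt : M.piNorm ≠ ⊤ := M.Pi_bound.ne
  obtain ⟨C, hC, hCb⟩ := exists_reconstruct_le M γ hr hγ hβ
  have hp := ENNReal.toReal_pos hp0 hpt
  refine ⟨(C / M.piNorm.toReal).toNNReal, fun f φ hφ l hl hl1 x => ?_⟩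
  obtain ⟨A, hf⟩ := f.exists_modBound
  have hD : dIncr S M.g γ f.1 ≠ ⊤ := ((le_add_self).trans_lt f.2.2).ne
  have hmain := hCb f.1 A _ hf φ hφ l hl hl1 x
  rw [← enorm_le_ofReal_iff (by positivity), ENNReal.ofReal_mul (by positivity),
    ENNReal.ofReal_mul hC, ENNReal.ofReal_toReal hD] at hmain
  have e : (((C / M.piNorm.toReal).toNNReal : ℝ≥0) : ℝ≥0∞) * M.piNorm = ENNReal.ofReal C := by
    have e' : (((C / M.piNorm.toReal).toNNReal : ℝ≥0) : ℝ≥0∞) * M.piNorm =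
        ENNReal.ofReal (C / M.piNorm.toReal) * ENNReal.ofReal M.piNorm.toReal := by
      rw [ENNReal.ofReal_toReal hpt]
      rfl
    rw [e', ← ENNReal.ofReal_mul (by positivity), div_mul_cancel₀ _ hp.ne']
  rw [e]
  exact hmain

variable {γ} in
theorem ModelledDist.modBound_sub {g : E d → (Tp →ₐ[ℝ] ℝ)} {f f' : ModelledDist S g γ} {t : ℝ}
    (ht : 0 ≤ t) (h : dNorm S g γ (f'.1 - f.1) ≤ ENNReal.ofReal t) :
    ModBound S g γ (f'.1 - f.1) t t :=
  modBound_of_le (fun x => Submodule.sub_mem _ (f'.2.1 x) (f.2.1 x)) ht ht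
    (le_self_add.trans h) (le_add_self.trans h)

variable {γ} in
/-- The remainders depend continuously on the modelled distribution. -/
theorem exists_forall_dNorm_lt (f : ModelledDist S M.g γ) {ε : ℝ≥0∞} (hε : 0 < ε) :
    ∃ δ : ℝ≥0∞, 0 < δ ∧ ∀ f' : ModelledDist S M.g γ, dNorm S M.g γ (f'.1 - f.1) < δ →
      holderNorm LP γ (distOf (remFun M γ f'.1) - distOf (remFun M γ f.1)) < ε ∧
      ∀ τ, holderNorm LP (γ - S.deg τ)
        (remG S LP M.g γ f'.1 τ - remG S LP M.g γ f.1 τ) < ε := by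
  obtain ⟨G, hG⟩ := M.exists_charBound
  obtain ⟨C₁, hC₁, h₁⟩ := exists_blockBd_remFun M γ
  obtain ⟨C₂, hC₂, h₂⟩ := exists_blockBd_remG S LP hG γ
  obtain ⟨A, hf⟩ := f.exists_modBound
  have hle : ∀ (f' : ModelledDist S M.g γ) (t : ℝ), 0 ≤ t → t ≤ 1 →
      dNorm S M.g γ (f'.1 - f.1) ≤ ENNReal.ofReal t →
      max (holderNorm LP γ (distOf (remFun M γ f'.1) - distOf (remFun M γ f.1)))
        (⨆ τ, holderNorm LP (γ - S.deg τ) (remG S LP M.g γ f'.1 τ - remG S LP M.g γ f.1 τ)) ≤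
        ENNReal.ofReal (2 * (C₁ + C₂) * t) := by
    intro f' t ht _ hft
    -- Both remainders are linear in the modelled distribution, so their bounds, applied to `f' -
    -- f`, give Lipschitz continuity.
    obtain ⟨A', hf'⟩ := f'.exists_modBound
    have hsub := ModelledDist.modBound_sub ht hft
    refine max_le ?_ (iSup_le fun τ => ?_)
    · rw [← distOf_sub hf'.bddCont_remFun hf.bddCont_remFun,
        holderNorm_le_iff LP _ (by positivity)]
      have := h₁ _ t t hsub
      rw [funext (hf.remFun_sub hf')] at this
      exact this.mono (by nlinarith [mul_nonneg hC₂ ht])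
    · rw [← hf.remG_sub hf' hG.bddCont, holderNorm_le_iff LP _ (by positivity)]
      exact (h₂ _ t t hsub τ).mono (by nlinarith [mul_nonneg hC₁ ht])
  obtain ⟨δ, hδ, h⟩ := exists_pos_of_forall_le_mul (by positivity) hle hε
  refine ⟨δ, hδ, fun f' hf' => ⟨(le_max_left _ _).trans_lt (h f' hf'), fun τ => ?_⟩⟩
  exact ((le_iSup (fun τ => holderNorm LP (γ - S.deg τ)
    (remG S LP M.g γ f'.1 τ - remG S LP M.g γ f.1 τ)) τ).trans (le_max_right _ _)).trans_lt
    (h f' hf')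

end

end

end PCRS

end

/-! ### The theorem -/

theorem theorem1 {d : ℕ} (hd : 0 < d) (LP : DyadicPartition d)
    {Tp T ιp ι : Type*} [Ring Tp] [HopfAlgebra ℝ Tp] [AddCommGroup T] [Module ℝ T]
    (S : ConcreteRegularityStructure Tp T ιp ι) (r : ℝ) (hr : |min S.β₀ 0| < r) :
    ∃ (bg : (E d → (Tp →ₐ[ℝ] ℝ)) → (Tp →ₗ[ℝ] TDist d))
      (bM : RSModel S LP r → (T →ₗ[ℝ] TDist d)),
      -- the brackets satisfy the recursive formulas and are determined by them
      (∀ M : RSModel S LP r, IsBracketg S LP M.g (bg M.g) ∧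
        ∀ bg' : Tp →ₗ[ℝ] TDist d, IsBracketg S LP M.g bg' → bg' = bg M.g) ∧
      (∀ M : RSModel S LP r, IsBracketM S LP M.g M.Pi (bM M) ∧
        ∀ bM' : T →ₗ[ℝ] TDist d, IsBracketM S LP M.g M.Pi bM' → bM' = bM M) ∧
      -- regularity of the brackets
      (∀ M : RSModel S LP r, (∀ τ : Tp, MemHolder LP 0 (bg M.g τ)) ∧
        ∀ α : ℝ, ∀ τ ∈ S.Tphom α, MemHolder LP α (bg M.g τ)) ∧
      (∀ M : RSModel S LP r, (∀ σ : T, MemHolder LP S.β₀ (bM M σ)) ∧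
        ∀ α : ℝ, ∀ σ ∈ S.Thom α, MemHolder LP α (bM M σ)) ∧
      -- continuity of the brackets with respect to the model
      (∀ α : ℝ, ∀ τ ∈ S.Tphom α, ∀ M : RSModel S LP r, ∀ ε : ℝ≥0∞, 0 < ε →
        ∃ δ : ℝ≥0∞, 0 < δ ∧ ∀ M' : RSModel S LP r, M'.dist M < δ →
          holderNorm LP α (bg M'.g τ - bg M.g τ) < ε) ∧
      (∀ α : ℝ, ∀ σ ∈ S.Thom α, ∀ M : RSModel S LP r, ∀ ε : ℝ≥0∞, 0 < ε →
        ∃ δ : ℝ≥0∞, 0 < δ ∧ ∀ M' : RSModel S LP r, M'.dist M < δ →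
          holderNorm LP α (bM M' σ - bM M σ) < ε) ∧
      -- paracontrolled representation of modelled distributions and of their reconstructions
      ∀ (M : RSModel S LP r) (γ : ℝ),
        ∃ (remM : ModelledDist S M.g γ → TDist d) (remg : ModelledDist S M.g γ → ι → TDist d),
          (∀ f, MemHolder LP γ (remM f)) ∧
          (∀ f τ, MemHolder LP (γ - S.deg τ) (remg f τ)) ∧
          (∀ f : ModelledDist S M.g γ, ∀ τ ∈ S.indexLt γ,
            ParaprodConverges LP (f.coeff τ) (bM M (S.b τ))) ∧
          (γ ≠ 0 → IsReconstruction M γ (fun f =>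
            ∑ τ ∈ S.indexLt γ, paraprod LP (f.coeff τ) (bM M (S.b τ)) + remM f)) ∧
          (∀ (f : ModelledDist S M.g γ) (τ : ι),
            (∀ μ ∈ S.aboveLt γ τ,
              ParaprodConverges LP (f.coeff μ) (bg M.g (S.quot μ τ))) ∧
            Represents
              (∑ μ ∈ S.aboveLt γ τ, paraprod LP (f.coeff μ) (bg M.g (S.quot μ τ)) + remg f τ)
              (f.coeff τ)) ∧
          -- continuity of the remainders with respect to the modelled distribution
          (∀ f : ModelledDist S M.g γ, ∀ ε : ℝ≥0∞, 0 < ε → ∃ δ : ℝ≥0∞, 0 < δ ∧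
            ∀ f' : ModelledDist S M.g γ, dNorm S M.g γ (f'.1 - f.1) < δ →
              holderNorm LP γ (remM f' - remM f) < ε ∧
              ∀ τ, holderNorm LP (γ - S.deg τ) (remg f' τ - remg f τ) < ε) := by
  refine ⟨bracketG S LP, bracketM, fun M => ⟨isBracketg_bracketG M.bddCont,
      fun L hL => hL.eq_bracketG M.bddCont⟩, fun M => ⟨isBracketM_bracketM M,
      fun L hL => hL.eq_bracketM⟩, fun M => ?_, fun M => ⟨memHolder_β₀_bracketM M,
      fun α σ hσ => memHolder_bracketM M hσ⟩,
    fun α τ hτ M ε hε => exists_forall_dist_lt_bracketG M hτ hε,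
    fun α σ hσ M ε hε => exists_forall_dist_lt_bracketM M hσ hε, fun M γ => ?_⟩
  · obtain ⟨A, hg⟩ := M.exists_charBound
    exact ⟨memHolder_zero_bracketG LP hg, fun α τ hτ => memHolder_bracketG LP hg hτ⟩
  · obtain ⟨G, hG⟩ := M.exists_charBound
    refine ⟨fun f => distOf (remFun M γ f.1), fun f τ => remG S LP M.g γ f.1 τ, fun f => ?_,
      fun f τ => ?_, fun f τ _ => ?_, isReconstruction_reconstruct M γ hr,
      fun f τ => ⟨fun μ _ => ?_, ?_⟩, fun f ε hε => exists_forall_dNorm_lt M f hε⟩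
    all_goals obtain ⟨A, hf⟩ := f.exists_modBound
    · obtain ⟨C, hC, h⟩ := exists_blockBd_remFun M γ
      exact (memHolder_iff LP _ _).2 ⟨_, (h _ _ _ hf).nonneg, h _ _ _ hf⟩
    · obtain ⟨C, hC, h⟩ := exists_blockBd_remG S LP hG γ
      exact (memHolder_iff LP _ _).2 ⟨_, (h _ _ _ hf τ).nonneg, h _ _ _ hf τ⟩
    · exact (isBesov_bracketM_basis M τ).paraprodConverges (hf.bddCont_coord M.bddCont τ)
    · exact (isBesov_bracketG M.bddCont _).paraprodConverges (hf.bddCont_coord M.bddCont μ)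
    · have e : ∑ μ ∈ S.aboveLt γ τ, paraprod LP (f.coeff μ) (bracketG S LP M.g (S.quot μ τ)) +
          remG S LP M.g γ f.1 τ = distOf (f.coeff τ) := add_sub_cancel _ _
      rw [e]
      exact represents_distOf (hf.bddCont_coord M.bddCont τ)
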